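/- **Setting.** Let $K$ be a two-dimensional local field with finite last residue field $\mathbb F_q$: $K$ is complete with respect to a discrete valuation with valuation ring $\mathcal O_K$ and residue field $\bar K$, and $\bar K$ is complete with respect to a discrete valuation with valuation ring $\mathcal O_{\bar K}$ and finite residue field $\mathbb F_q$. Let $\mathcal O'_K\subset\mathcal O_K$ be the preimage of $\mathcal O_{\bar K}$, $\Gamma_K=K^*/(\mathcal O'_K)^*$ (written additively), $\nu:K^*\to\Gamma_K$ the quotient map. The valuation of $K$ induces $\pi:\Gamma_K\to\mathbb Z$, and there is an exact sequence $0\to\mathbb Z\to\Gamma_K\xrightarrow{\pi}\mathbb Z\to0$, in which $1$ goes to the class of a lift of a uniformizer of $\bar K$; thus each $\pi^{-1}(k)$ is an ordered $\mathbb Z$-torsor. Let $\breve\Gamma_K=\Gamma_K\sqcup\mathbb Z$, with $n\in\mathbb Z$ also written $(n,-\infty)$; it is ordered by comparing first the images in $\mathbb Z$ (under $\pi$ on $\Gamma_K$, the identity on $\mathbb Z$), then within $\pi^{-1}(n)$ as in the torsor, with $(n,-\infty)$ below all of $\pi^{-1}(n)$. The group $\Gamma_K$ acts on $\breve\Gamma_K$,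 preserving the order, by translation on $\Gamma_K$ and through $\pi$ on $\mathbb Z$; write $\beta\circ\alpha$. For $\alpha\in\breve\Gamma_K$ let $\mathcal O'(\alpha)=\{0\}\cup\{x\in K^*:\nu(x)\ge\alpha\}$, and $\mathcal O(n)=\mathcal O'((n,-\infty))$. A *partial topology* on $K$ consists of a topology on each group $\mathcal O(n)/\mathcal O(m)$, $n\le m$, that makes it a totally disconnected locally compact group, such that: for $m=n+1$ it is the topology coming from $\bar K$ (by multiplication by any element of valuation $n$); for $n\le m\le k$ the topology of $\mathcal O(m)/\mathcal O(k)$ is induced from $\mathcal O(n)/\mathcal O(k)$, and that of $\mathcal O(n)/\mathcal O(m)$ is the quotient topology from $\mathcal O(n)/\mathcal O(k)$; and multiplication by $a\in K^*$ is a homeomorphism $\mathcal O(n)/\mathcal O(m)\to a\mathcal O(n)/a\mathcal O(m)$. We fix one. All the groups $\mathcal O'(\beta)/\mathcal O'(\gamma)$, $\beta\le\gamma$, then carry the induced and quotient topologies. **Spaces on $K$.** $\mathcal D(H)$ is the space of locally constant compactly supported functions $H\to\mathbb C$, and $\mathcal D'(H)=\mathrm{Hom}_{\mathbb C}(\mathcal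 D(H),\mathbb C)$. For $\beta\ge\gamma$ in $\breve\Gamma_K$ let $\mu(\beta,\gamma)$ be the line of invariant complex measures on $\mathcal O'(\gamma)/\mathcal O'(\beta)$, and $\mu(\gamma,\beta)=\mu(\beta,\gamma)^*$; there are canonical associative isomorphisms $\mu(\beta,\gamma)\otimes\mu(\gamma,\delta)\to\mu(\beta,\delta)$. Fix $\alpha\in\breve\Gamma_K$ and put $$\mathcal D_\alpha(K)=\varprojlim_{n}\varprojlim_{m\ge n}\mathcal D(\mathcal O(n)/\mathcal O(m))\otimes\mu(m,\alpha),\qquad \mathcal D'_\alpha(K)=\varinjlim_{n}\varinjlim_{m\ge n}\mathcal D'(\mathcal O(n)/\mathcal O(m))\otimes\mu(\alpha,m).$$ For $n'\le n\le m\le m'$ the transition map of the first system takes $f\otimes(s\otimes\mu)$, with $s\in\mu(m',m)$ and $\mu\in\mu(m,\alpha)$, to $f'\otimes\mu$, where $f'(x)=\int_{\mathcal O(m)/\mathcal O(m')}f(x+y)\,ds(y)$ for $x\in\mathcal O(n)$; those of the second system are defined dually. The group $(\mathcal O'_K)^*$ acts on these spaces by multiplication on $K$; consider the coinvariants $\mathcal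 D_\alpha(K)_{(\mathcal O'_K)^*}$ and the invariants $\mathcal D'_\alpha(K)^{(\mathcal O'_K)^*}$. **Spaces on $\Gamma_K$.** Call $A\subset\Gamma_K$ admissible if for every $x\in\Gamma_K$ the set $A\cap\pi^{-1}(\pi(x))$ differs from the ray $x+\mathbb Z_{\ge0}$ by a finite set. For $\beta\ge\gamma$ let $R_{\beta,\gamma}=\{x\in\Gamma_K:\beta>x\ge\gamma\}$ and let $[\beta,\gamma]$ be the $\mathbb Z$-torsor of the integer-valued maps $d$ on the set of all $A\cap R_{\beta,\gamma}$, $A$ admissible, with $d(A_2)=d(A_1)+|A_2\setminus A_1|$ for $A_1\subset A_2$; let $[\gamma,\beta]=[\beta,\gamma]^*$ be the dual torsor. There are canonical isomorphisms $[\beta,\gamma]\otimes[\gamma,\delta]\to[\beta,\delta]$ and $[\beta,\beta]=\mathbb Z$, and $h^{-1}\in[\gamma,\beta]$ denotes the inverse of $h\in[\beta,\gamma]$. Let $\mu_q(\beta,\gamma)=([\beta,\gamma]\times^{\mathbb Z}\mathbb C^*)\cup\{0\}$, formed with $\mathbb Z\to\mathbb C^*$, $n\mapsto q^n$; it is a line,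 it contains the image $\vartheta_q(h)=h\times1$ of each $h\in[\beta,\gamma]$, and these lines have canonical products. For a $\mathbb Z$-torsor $T$ let $\mathcal D_+(T)$ be the space of the functions $c:T\to\mathbb C$ that vanish far to the left and are constant far to the right, $\mathcal D'_+(T)$ its dual space, $\delta_{+\infty}\in\mathcal D_+'(T)$ the functional of the value far to the right, and $\delta_{\ge x}\in\mathcal D_+(T)$ the indicator function of $\{y\ge x\}$. The line $\mu_q(k+1,k)$ is embedded in $\mathcal D'_+(\pi^{-1}(k))$: for $d\in[k+1,k]$ the functional $\vartheta_q(d)$ takes $\delta_{\ge x}$ to $q^{d(x+\mathbb Z_{\ge0})}$. Then $$\mathcal D_{+,\alpha,q}(\Gamma_K)\subset\prod_{k\in\mathbb Z}\mathcal D_+(\pi^{-1}(k))\otimes\mu_q(k+1,\alpha)$$ is the subspace of the elements $\prod_kf_k\otimes\mu_k$ (written with $\mu_k\neq0$) such that $\delta_{+\infty}(f_k)=\eta_{k+1}(f_{k+1})$ for all $k$, where $\eta_{k+1}\in\mu_q(k+2,k+1)$ is given by $\mu_{k+1}=\eta_{k+1}\otimes\mu_k$, and $$\mathcal D'_{+,\alpha,q}(\Gamma_K)=\Bigl(\bigoplus_{k\in\mathbb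 Z}\mathcal D'_+(\pi^{-1}(k))\otimes\mu_q(\alpha,k+1)\Bigr)/Y,$$ where $Y$ is spanned by the elements $\delta_{+\infty}\otimes(\lambda\otimes\eta)-\eta\otimes\lambda$ (first term in degree $k$, second term in degree $k+1$) for $k\in\mathbb Z$, $\lambda\in\mu_q(\alpha,k+2)$, $\eta\in\mu_q(k+2,k+1)$. **The group and its actions.** Let $\tilde\Gamma_{K,\alpha}=\{(\beta,h):\beta\in\Gamma_K,\ h\in[\alpha,\beta\circ\alpha]\}$ with $(\beta_1,h_1)(\beta_2,h_2)=(\beta_1+\beta_2,\ h_1\otimes\beta_1(h_2))$ (the discrete Heisenberg group). It acts on $\mathcal D_{+,\alpha,q}(\Gamma_K)$ by $f\otimes\mu\mapsto\beta(f)\otimes(\beta(\mu)\otimes\vartheta_q(h^{-1}))$ and on $\mathcal D'_{+,\alpha,q}(\Gamma_K)$ by $g\otimes\lambda\mapsto\beta(g)\otimes(\vartheta_q(h)\otimes\beta(\lambda))$. There are unique linear maps $\Theta:\mu_q(\beta,\gamma)\to\mu(\beta,\gamma)$, for all $\beta,\gamma\in\breve\Gamma_K$, that are compatible with products and such that, for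 $x\in\pi^{-1}(k)$ and $(k+1,-\infty)\ge\beta\ge x\ge\gamma\ge(k,-\infty)$, the map $\Theta$ takes $\vartheta_q(d)$, $d\in[\beta,\gamma]$, to the invariant measure on $\mathcal O'(\gamma)/\mathcal O'(\beta)$ for which $\mathcal O'(x)/\mathcal O'(\beta)$ has measure $q^{d((x+\mathbb Z_{\ge0})\cap R_{\beta,\gamma})}$. Using these canonical identifications, $(\beta,h)\in\tilde\Gamma_{K,\alpha}$ acts on $\mathcal D_\alpha(K)_{(\mathcal O'_K)^*}$ by $$f\otimes\mu\longmapsto\beta'(f)\otimes\bigl(\beta'(\mu)\otimes\vartheta_q(h^{-1})\bigr),\qquad f\in\mathcal D(\mathcal O(n)/\mathcal O(m)),\ \mu\in\mu(m,\alpha),$$ and on $\mathcal D'_\alpha(K)^{(\mathcal O'_K)^*}$ by $$v\otimes\lambda\longmapsto\beta'(v)\otimes\bigl(\vartheta_q(h)\otimes\beta'(\lambda)\bigr),\qquad v\in\mathcal D'(\mathcal O(n)/\mathcal O(m)),\ \lambda\in\mu(\alpha,m),$$ where $\beta'\in K^*$ is any element with $\nu(\beta')=\beta$; these are well-defined representations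 of $\tilde\Gamma_{K,\alpha}$, independent of the choice of $\beta'$. **The natural maps.** For $f\in\mathcal D(\mathcal O(k)/\mathcal O(k+1))$ let $c_f\in\mathcal D_+(\pi^{-1}(k))$ be the function whose value at $x$ is the mean value of $f$, with respect to a nonzero invariant measure, on the image of $\{y\in K^*:\nu(y)=x\}$ in $\mathcal O(k)/\mathcal O(k+1)$. Let $$\Phi:\mathcal D_\alpha(K)_{(\mathcal O'_K)^*}\longrightarrow\mathcal D_{+,\alpha,q}(\Gamma_K)$$ be the linear map whose component in degree $k$ is induced by the projection to $\mathcal D(\mathcal O(k)/\mathcal O(k+1))\otimes\mu(k+1,\alpha)$ and by $f\otimes\mu\mapsto c_f\otimes\mu$, and let $$\Phi':\mathcal D'_{+,\alpha,q}(\Gamma_K)\longrightarrow\mathcal D'_\alpha(K)^{(\mathcal O'_K)^*}$$ be the linear map that takes the class of $h\otimes\lambda$ ($h\in\mathcal D'_+(\pi^{-1}(k))$, $\lambda\in\mu_q(\alpha,k+1)$) to the class of $(f\mapsto h(c_f))\otimes\lambda\in\mathcal D'(\mathcal O(k)/\mathcal O(k+1))\otimes\mu(\alpha,k+1)$. **Claim.**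 For every $\alpha\in\breve\Gamma_K$ the objects $\Theta$, the two actions of $\tilde\Gamma_{K,\alpha}$ on $\mathcal D_\alpha(K)_{(\mathcal O'_K)^*}$ and $\mathcal D'_\alpha(K)^{(\mathcal O'_K)^*}$, and the maps $\Phi$ and $\Phi'$ described above exist, $\Phi$ is surjective, $\Phi'$ is injective, and both $\Phi$ and $\Phi'$ are $\tilde\Gamma_{K,\alpha}$-equivariant. -/

import Mathlib

open scoped TensorProduct

noncomputable section

namespace TwoDim

section Extensions

/-! ### Free abelian groups of rank two, given as extensions of `ℤ` by `ℤ` -/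

/-- An extension `0 → ℤ → Γ → ℤ → 0`, with maps `emb` and `lev` (the latter is `π`). -/
class Ext2 (Γ : Type*) [AddCommGroup Γ] where
  emb : ℤ →+ Γ
  lev : Γ →+ ℤ
  emb_injective : Function.Injective emb
  lev_surjective : Function.Surjective lev
  exact : ∀ γ : Γ, lev γ = 0 ↔ ∃ n : ℤ, emb n = γ

open Ext2 (emb lev)

/-- The set `Γ ∪ π(Γ)`; `bot n` is the element `(n, -∞)`. -/
inductive Breve (Γ : Type*) where
  | pt (γ : Γ) : Breve Γ
  | bot (n : ℤ) : Breve Γ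

section Gamma

variable {Γ : Type*} [AddCommGroup Γ] [Ext2 Γ]

theorem lev_emb (n : ℤ) : lev (emb n : Γ) = 0 := (Ext2.exact _).2 ⟨n, rfl⟩

namespace Breve

/-- The map to `ℤ` that extends `π`. -/
def floor : Breve Γ → ℤ
  | pt γ => lev γ
  | bot n => n

/-- The least `n` with `α ≤ (n, -∞)`. -/
def ceil : Breve Γ → ℤ
  | pt γ => lev γ + 1
  | bot n => n

/-- The order: first compare the images in `ℤ`; inside the fibre of `π` over `n` the order is that of
a `ℤ`-torsor, and `(n, -∞)` is below it. -/
def le : Breve Γ → Breve Γ → Prop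
  | pt γ, pt δ => lev γ < lev δ ∨ ∃ n : ℕ, δ = γ + emb (n : ℤ)
  | pt γ, bot m => lev γ < m
  | bot n, pt δ => n ≤ lev δ
  | bot n, bot m => n ≤ m

theorem le_pt_pt {γ δ : Γ} (h : ∃ n : ℕ, δ = γ + emb (n : ℤ)) : lev δ = lev γ := by
  obtain ⟨n, rfl⟩ := h
  rw [map_add, lev_emb, add_zero]

instance : LinearOrder (Breve Γ) where
  le := le
  le_refl a := by
    cases a
    · exact Or.inr ⟨0, by simp⟩
    · exact le_refl (_ : ℤ)
  le_trans a b c hab hbc := by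
    rcases a with γ | n <;> rcases b with δ | m <;> rcases c with ε | k <;>
      simp only [le] at hab hbc ⊢
    · rcases hab with h | h <;> rcases hbc with h' | h'
      · exact Or.inl (h.trans h')
      · exact Or.inl (by rw [le_pt_pt h']; exact h)
      · exact Or.inl (by rw [← le_pt_pt h]; exact h')
      · obtain ⟨n, rfl⟩ := h
        obtain ⟨m, rfl⟩ := h'
        exact Or.inr ⟨n + m, by push_cast; rw [map_add, add_assoc]⟩
    · rcases hab with h | h
      · omega
      · have := le_pt_pt h; omega
    · exact Or.inl (by omega)
    · omega
    · rcases hbc with h | h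
      · omega
      · have := le_pt_pt h; omega
    · omega
    · omega
    · omega
  le_antisymm a b hab hba := by
    rcases a with γ | n <;> rcases b with δ | m <;> simp only [le] at hab hba
    · rcases hab with h | h <;> rcases hba with h' | h'
      · omega
      · have := le_pt_pt h'; omega
      · have := le_pt_pt h; omega
      · obtain ⟨n, rfl⟩ := h
        obtain ⟨m, hm⟩ := h'
        rw [add_assoc, ← map_add, left_eq_add] at hm
        have : (n : ℤ) + m = 0 := Ext2.emb_injective (hm.trans (map_zero _).symm)
        have : n = 0 := by omega
        subst this
        simp
    · omega
    · omega
    · rw [le_antisymm hab hba]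
  le_total a b := by
    rcases a with γ | n <;> rcases b with δ | m <;> simp only [le]
    · rcases lt_trichotomy (lev γ) (lev δ) with h | h | h
      · exact Or.inl (Or.inl h)
      · obtain ⟨n, hn⟩ := (Ext2.exact (δ - γ)).1 (by rw [map_sub, h, sub_self])
        rcases le_total 0 n with h0 | h0
        · exact Or.inl (Or.inr ⟨n.toNat, by rw [Int.toNat_of_nonneg h0, hn]; abel⟩)
        · refine Or.inr (Or.inr ⟨(-n).toNat, ?_⟩)
          rw [Int.toNat_of_nonneg (by omega), map_neg, hn]; abel
      · exact Or.inr (Or.inl h)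
    · omega
    · omega
    · omega
  toDecidableLE := Classical.decRel _

theorem pt_le_pt {γ δ : Γ} :
    pt γ ≤ pt δ ↔ lev γ < lev δ ∨ ∃ n : ℕ, δ = γ + emb (n : ℤ) := Iff.rfl
theorem pt_le_bot {γ : Γ} {m : ℤ} : (pt γ : Breve Γ) ≤ bot m ↔ lev γ < m := Iff.rfl
theorem bot_le_pt {γ : Γ} {m : ℤ} : (bot m : Breve Γ) ≤ pt γ ↔ m ≤ lev γ := Iff.rfl
theorem bot_le_bot {n m : ℤ} : (bot n : Breve Γ) ≤ bot m ↔ n ≤ m := Iff.rfl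

/-- `Γ` acts on `Γ ∪ π(Γ)`. -/
instance : AddAction Γ (Breve Γ) where
  vadd γ a := match a with
    | pt δ => pt (γ + δ)
    | bot n => bot (lev γ + n)
  zero_vadd a := by
    cases a
    · exact congrArg pt (zero_add _)
    · exact congrArg bot (by rw [map_zero, zero_add])
  add_vadd γ δ a := by
    cases a
    · exact congrArg pt (add_assoc _ _ _)
    · exact congrArg bot (by rw [map_add, add_assoc])

theorem vadd_pt (γ δ : Γ) : γ +ᵥ (pt δ : Breve Γ) = pt (γ + δ) := rfl
theorem vadd_bot (γ : Γ) (n : ℤ) : γ +ᵥ (bot n : Breve Γ) = bot (lev γ + n) := rfl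

theorem vadd_mono (γ : Γ) {a b : Breve Γ} (h : a ≤ b) : γ +ᵥ a ≤ γ +ᵥ b := by
  rcases a with δ | n <;> rcases b with ε | m <;>
    simp only [vadd_pt, vadd_bot, pt_le_pt, pt_le_bot, bot_le_pt, bot_le_bot, map_add] at h ⊢
  · rcases h with h | ⟨n, rfl⟩
    · exact Or.inl (by omega)
    · exact Or.inr ⟨n, by abel⟩
  all_goals omega

theorem vadd_le_vadd (γ : Γ) {a b : Breve Γ} : γ +ᵥ a ≤ γ +ᵥ b ↔ a ≤ b :=
  ⟨fun h => by simpa using vadd_mono (-γ) h, vadd_mono γ⟩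

theorem vadd_min (γ : Γ) (a b : Breve Γ) : γ +ᵥ min a b = min (γ +ᵥ a) (γ +ᵥ b) := by
  rcases le_total a b with h | h
  · rw [min_eq_left h, min_eq_left (vadd_mono γ h)]
  · rw [min_eq_right h, min_eq_right (vadd_mono γ h)]

theorem floor_le_ceil {a b : Breve Γ} (h : a ≤ b) : a.floor ≤ b.ceil := by
  rcases a with γ | n <;> rcases b with δ | m <;> simp only [floor, ceil]
  · rcases h with h | h
    · omega
    · have := le_pt_pt h; omega
  · exact le_of_lt h
  · have : n ≤ lev δ := h
    omega
  · exact h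

theorem bot_floor_le (a : Breve Γ) : bot a.floor ≤ a := by
  cases a <;> exact le_refl (_ : ℤ)

theorem le_bot_ceil (a : Breve Γ) : a ≤ bot a.ceil := by
  rcases a with γ | n
  · exact lt_add_one (lev γ)
  · exact le_refl _

theorem floor_mono {a b : Breve Γ} (h : a ≤ b) : a.floor ≤ b.floor := by
  rcases a with γ | n <;> rcases b with δ | m <;> simp only [floor]
  · rcases h with h | h
    · omega
    · have := le_pt_pt h; omega
  · exact le_of_lt h
  · exact h
  · exact h

theorem ceil_mono {a b : Breve Γ} (h : a ≤ b) : a.ceil ≤ b.ceil := by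
  rcases a with γ | n <;> rcases b with δ | m <;> simp only [ceil]
  · rcases h with h | h
    · omega
    · have := le_pt_pt h; omega
  · exact h
  · have : n ≤ lev δ := h
    omega
  · exact h

theorem floor_vadd (γ : Γ) (a : Breve Γ) : (γ +ᵥ a).floor = lev γ + a.floor := by
  rcases a with δ | n
  · exact map_add _ _ _
  · rfl

theorem ceil_vadd (γ : Γ) (a : Breve Γ) : (γ +ᵥ a).ceil = lev γ + a.ceil := by
  rcases a with δ | n
  · change lev (γ + δ) + 1 = lev γ + (lev δ + 1)
    rw [map_add, add_assoc]
  · rfl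

end Breve

open Breve

/-! ### The torsors `[α, β]` and the lines `μ_r(α, β)` -/

/-- `{x, x + 1, x + 2, …}` in the fibre of `π` through `x`. -/
def ray (x : Γ) : Set Γ := {γ | ∃ n : ℕ, γ = x + emb (n : ℤ)}

/-- The sets `A ⊆ Γ` that are commensurable with a ray in every fibre of `π`. -/
def IsGood (A : Set Γ) : Prop :=
  ∀ x : Γ, (symmDiff (A ∩ {γ | lev γ = lev x}) (ray x)).Finite

variable (Γ) in
/-- The type of the sets that are commensurable with a ray in every fibre. -/
structure Good where
  val : Set Γ
  prop : IsGood val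

theorem Good.ext {A B : Good Γ} (h : A.1 = B.1) : A = B := by
  obtain ⟨a, _⟩ := A
  obtain ⟨b, _⟩ := B
  obtain rfl : a = b := h
  rfl

/-- The integer-valued indicator of a set. -/
def ind (S : Set Γ) (γ : Γ) : ℤ := Set.indicator S 1 γ

/-- `{γ ∈ Γ : γ ≥ α}`. -/
def up (α : Breve Γ) : Set Γ := {γ | α ≤ pt γ}

/-- The change of "dimension" from `A` to `B` in the region between `β` and `α`: if `α ≥ β` and `A ⊆ B`
this is the number of elements of `B \ A` in `R_{α, β} = {γ : α > γ ≥ β}`, and `jump β α = - jump α β`. -/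
def jump (α β : Breve Γ) (A B : Good Γ) : ℤ :=
  ∑ᶠ γ : Γ, (ind B.1 γ - ind A.1 γ) * (ind (up β) γ - ind (up α) γ)

theorem ind_mem {S : Set Γ} {γ : Γ} (h : γ ∈ S) : ind S γ = 1 := by simp [ind, h]
theorem ind_not_mem {S : Set Γ} {γ : Γ} (h : γ ∉ S) : ind S γ = 0 := by simp [ind, h]

theorem Good.finite_diff (A B : Good Γ) (k : ℤ) :
    {γ : Γ | lev γ = k ∧ ind B.1 γ - ind A.1 γ ≠ 0}.Finite := by
  obtain ⟨x, rfl⟩ := Ext2.lev_surjective (Γ := Γ) k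
  refine ((A.2 x).union (B.2 x)).subset ?_
  rintro γ ⟨h, hne⟩
  by_cases hA : γ ∈ A.1 <;> by_cases hB : γ ∈ B.1 <;> by_cases hR : γ ∈ ray x <;>
    simp_all [Set.mem_symmDiff, ind_mem, ind_not_mem]

theorem up_between {α β : Breve Γ} {γ : Γ} (h : ind (up β) γ - ind (up α) γ ≠ 0) :
    min α.floor β.floor ≤ lev γ ∧ lev γ ≤ max α.floor β.floor := by
  have key : ∀ {a b : Breve Γ}, a ≤ pt γ → ¬ b ≤ pt γ → a.floor ≤ lev γ ∧ lev γ ≤ b.floor :=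
    fun ha hb => ⟨floor_mono ha, floor_mono (not_le.1 hb).le⟩
  by_cases ha : γ ∈ up α <;> by_cases hb : γ ∈ up β
  · simp [ind_mem, ha, hb] at h
  · have := key ha hb; omega
  · have := key hb ha; omega
  · simp [ind_not_mem, ha, hb] at h

theorem jump_finite (α β : Breve Γ) (A B : Good Γ) :
    (Function.support fun γ : Γ =>
      (ind B.1 γ - ind A.1 γ) * (ind (up β) γ - ind (up α) γ)).Finite := by
  refine (Set.Finite.biUnion
    (Set.finite_Icc (min α.floor β.floor) (max α.floor β.floor))
    fun k _ => Good.finite_diff A B k).subset ?_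
  intro γ hγ
  rw [Function.mem_support] at hγ
  simp only [Set.mem_iUnion]
  exact ⟨lev γ, up_between (right_ne_zero_of_mul hγ), rfl, left_ne_zero_of_mul hγ⟩

theorem jump_add (α β γ : Breve Γ) (A B : Good Γ) :
    jump α γ A B = jump α β A B + jump β γ A B := by
  rw [jump, jump, jump, ← finsum_add_distrib (jump_finite _ _ _ _) (jump_finite _ _ _ _)]
  exact finsum_congr fun x => by ring

theorem jump_trans (α β : Breve Γ) (A B C : Good Γ) :
    jump α β A C = jump α β A B + jump α β B C := by
  rw [jump, jump, jump, ← finsum_add_distrib (jump_finite _ _ _ _) (jump_finite _ _ _ _)]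
  exact finsum_congr fun x => by ring

theorem jump_self (α : Breve Γ) (A B : Good Γ) : jump α α A B = 0 := by
  simp [jump]

theorem jump_same (α β : Breve Γ) (A : Good Γ) : jump α β A A = 0 := by
  simp [jump]

theorem jump_symm (α β : Breve Γ) (A B : Good Γ) : jump β α A B = - jump α β A B := by
  have := jump_add α β α A B
  rw [jump_self] at this
  omega

/-- The translate `β + A`. -/
def Good.shift (β : Γ) (A : Good Γ) : Good Γ :=
  ⟨{γ | γ - β ∈ A.1}, fun x => by
    refine ((A.2 (x - β)).image (fun γ => γ + β)).subset ?_
    intro γ hγ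
    refine ⟨γ - β, ?_, by simp⟩
    have h1 : lev (γ - β) = lev (x - β) ↔ lev γ = lev x := by
      rw [map_sub, map_sub]; omega
    have h2 : γ - β ∈ ray (x - β) ↔ γ ∈ ray x := by
      refine exists_congr fun n => ?_
      rw [sub_add_eq_add_sub, sub_left_inj]
    have e1 : γ ∈ {δ | lev δ = lev x} ↔ lev γ = lev x := Iff.rfl
    have e2 : γ - β ∈ {δ | lev δ = lev (x - β)} ↔ lev (γ - β) = lev (x - β) := Iff.rfl
    rw [Set.mem_symmDiff, Set.mem_inter_iff, e1] at hγ
    rw [Set.mem_symmDiff, Set.mem_inter_iff, e2, h1, h2]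
    exact hγ⟩

theorem Good.shift_add (β γ : Γ) (A : Good Γ) : A.shift (β + γ) = (A.shift γ).shift β :=
  Good.ext <| Set.ext fun x => by
    change x - (β + γ) ∈ A.1 ↔ x - β - γ ∈ A.1
    rw [sub_sub]

theorem Good.shift_zero (A : Good Γ) : A.shift 0 = A :=
  Good.ext <| Set.ext fun x => by
    change x - 0 ∈ A.1 ↔ x ∈ A.1
    rw [sub_zero]

theorem jump_shift (γ : Γ) (α β : Breve Γ) (A B : Good Γ) :
    jump (γ +ᵥ α) (γ +ᵥ β) (A.shift γ) (B.shift γ) = jump α β A B := by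
  rw [jump, jump, ← finsum_comp_equiv (Equiv.addRight γ)]
  refine finsum_congr fun x => ?_
  have h1 : ∀ C : Good Γ, ind (C.shift γ).1 (x + γ) = ind C.1 x := fun C => by
    have : x + γ ∈ (C.shift γ).1 ↔ x ∈ C.1 := by
      change x + γ - γ ∈ C.1 ↔ x ∈ C.1
      rw [add_sub_cancel_right]
    by_cases h : x ∈ C.1
    · rw [ind_mem h, ind_mem (this.2 h)]
    · rw [ind_not_mem h, ind_not_mem (fun h' => h (this.1 h'))]
  have h2 : ∀ a : Breve Γ, ind (up (γ +ᵥ a)) (x + γ) = ind (up a) x := fun a => by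
    have : x + γ ∈ up (γ +ᵥ a) ↔ x ∈ up a := by
      change γ +ᵥ a ≤ pt (x + γ) ↔ a ≤ pt x
      rw [add_comm, ← vadd_pt, vadd_le_vadd]
    by_cases h : x ∈ up a
    · rw [ind_mem h, ind_mem (this.2 h)]
    · rw [ind_not_mem h, ind_not_mem (fun h' => h (this.1 h'))]
  simp only [Equiv.coe_addRight, h1, h2]

/-- The `ℤ`-torsor `[α, β]`, with `ℤ` acting by addition of constants. For `α ≥ β` an element of it is
the same as a map `d` on the subsets of `R_{α, β}` commensurable with rays (evaluate on `A ∩ R_{α, β}`)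
such that `d(A₂) = d(A₁) + |A₂ \ A₁|` when `A₁ ⊆ A₂`; for `α ≤ β` the map `d ↦ -d` identifies it
with the set `[β, α]`, on which `ℤ` then acts in the opposite way. -/
structure Torsor (α β : Breve Γ) where
  val : Good Γ → ℤ
  prop : ∀ A B, val B = val A + jump α β A B

namespace Torsor

@[ext] theorem ext {α β : Breve Γ} {d e : Torsor α β} (h : ∀ A, d.1 A = e.1 A) : d = e := by
  obtain ⟨a, _⟩ := d
  obtain ⟨b, _⟩ := e
  obtain rfl : a = b := funext h
  rfl

/-- The action of `n ∈ ℤ`. -/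
def translate {α β : Breve Γ} (n : ℤ) (d : Torsor α β) : Torsor α β :=
  ⟨fun A => n + d.1 A, fun A B => by rw [d.2 A B]; ring⟩

/-- The unit of `[α, α] = ℤ`. -/
def one (α : Breve Γ) : Torsor α α := ⟨fun _ => 0, fun A B => by rw [jump_self, add_zero]⟩

/-- The composition `[α, β] ⊗ [β, γ] → [α, γ]`. -/
def mul {α β γ : Breve Γ} (d : Torsor α β) (e : Torsor β γ) : Torsor α γ :=
  ⟨fun A => d.1 A + e.1 A, fun A B => by rw [d.2 A B, e.2 A B, jump_add α β γ]; ring⟩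

/-- The inverse `[α, β] → [β, α]`. -/
def inv {α β : Breve Γ} (d : Torsor α β) : Torsor β α :=
  ⟨fun A => - d.1 A, fun A B => by rw [d.2 A B, jump_symm α β]; ring⟩

/-- The isomorphism `[α, β] → [γ + α, γ + β]` given by the action of `γ` (with the targets given up
to equality). -/
def shift (γ : Γ) {α β α' β' : Breve Γ} (hα : α' = γ +ᵥ α) (hβ : β' = γ +ᵥ β)
    (d : Torsor α β) : Torsor α' β' :=
  ⟨fun A => d.1 (A.shift (-γ)), fun A B => by
    subst hα hβ
    rw [d.2 (A.shift (-γ)), ← jump_shift γ α β, ← Good.shift_add, ← Good.shift_add,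
      add_neg_cancel, Good.shift_zero, Good.shift_zero]⟩

end Torsor

/-! ### The discrete Heisenberg group -/

/-- The group of the pairs `(β, h)` with `β ∈ Γ` and `h ∈ [α, β ∘ α]`. -/
@[ext] structure Heis (α : Breve Γ) where
  pt : Γ
  tor : Torsor α (pt +ᵥ α)

namespace Heis

variable {α : Breve Γ}

theorem ext' {x y : Heis α} (h : x.pt = y.pt) (h' : ∀ A, x.tor.1 A = y.tor.1 A) : x = y := by
  obtain ⟨b, h1⟩ := x
  obtain ⟨c, h2⟩ := y
  obtain rfl : b = c := h
  obtain rfl : h1 = h2 := Torsor.ext h'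
  rfl

/-- `(β₁, h₁)(β₂, h₂) = (β₁ + β₂, h₁ ⊗ β₁(h₂))`. -/
instance : Mul (Heis α) :=
  ⟨fun x y => ⟨x.pt + y.pt, x.tor.mul (y.tor.shift x.pt rfl (add_vadd _ _ _))⟩⟩

instance : One (Heis α) := ⟨⟨0, ⟨fun _ => 0, fun A B => by rw [zero_vadd, jump_self, add_zero]⟩⟩⟩

instance : Inv (Heis α) :=
  ⟨fun x => ⟨-x.pt, x.tor.inv.shift (-x.pt) (by rw [← add_vadd, neg_add_cancel, zero_vadd]) rfl⟩⟩

instance : Group (Heis α) where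
  mul_assoc x y z := ext' (add_assoc _ _ _) fun A => by
    change (x.tor.1 A + y.tor.1 (A.shift (-x.pt))) + z.tor.1 (A.shift (-(x.pt + y.pt))) =
      x.tor.1 A + (y.tor.1 (A.shift (-x.pt)) + z.tor.1 ((A.shift (-x.pt)).shift (-y.pt)))
    rw [← Good.shift_add, neg_add_rev, add_assoc]
  one_mul x := ext' (zero_add _) fun A => by
    change 0 + x.tor.1 (A.shift (-0)) = x.tor.1 A
    rw [neg_zero, Good.shift_zero, zero_add]
  mul_one x := ext' (add_zero _) fun A => by
    change x.tor.1 A + 0 = x.tor.1 A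
    rw [add_zero]
  inv_mul_cancel x := ext' (neg_add_cancel _) fun A => by
    change - x.tor.1 (A.shift (- -x.pt)) + x.tor.1 (A.shift (- -x.pt)) = 0
    rw [neg_add_cancel]

end Heis

end Gamma

end Extensions

section Lines

open Ext2 (emb lev)

/-! ### Lines -/

theorem lift_bijective {L₁ L₂ L₃ : Type*} [AddCommGroup L₁] [Module ℂ L₁] [AddCommGroup L₂]
    [Module ℂ L₂] [AddCommGroup L₃] [Module ℂ L₃] (h₁ : Module.finrank ℂ L₁ = 1)
    (h₂ : Module.finrank ℂ L₂ = 1) (h₃ : Module.finrank ℂ L₃ = 1) (B : L₁ →ₗ[ℂ] L₂ →ₗ[ℂ] L₃)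
    (hB : ∀ x y, x ≠ 0 → y ≠ 0 → B x y ≠ 0) : Function.Bijective (TensorProduct.lift B) := by
  have f₁ : FiniteDimensional ℂ L₁ := .of_finrank_pos (by omega)
  have f₂ : FiniteDimensional ℂ L₂ := .of_finrank_pos (by omega)
  have f₃ : FiniteDimensional ℂ L₃ := .of_finrank_pos (by omega)
  have n₁ : Nontrivial L₁ := Module.nontrivial_of_finrank_pos (R := ℂ) (by omega)
  have n₂ : Nontrivial L₂ := Module.nontrivial_of_finrank_pos (R := ℂ) (by omega)
  obtain ⟨x, hx⟩ := exists_ne (0 : L₁)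
  obtain ⟨y, hy⟩ := exists_ne (0 : L₂)
  have hs : Function.Surjective (TensorProduct.lift B) := fun z => by
    obtain ⟨c, hc⟩ := (finrank_eq_one_iff_of_nonzero' (B x y) (hB x y hx hy)).1 h₃ z
    exact ⟨c • (x ⊗ₜ y), by rw [map_smul, TensorProduct.lift.tmul, hc]⟩
  refine ⟨?_, hs⟩
  rw [LinearMap.injective_iff_surjective_of_finrank_eq_finrank]
  · exact hs
  · rw [Module.finrank_tensorProduct, h₁, h₂, h₃]

section Gamma

variable {Γ : Type*} [AddCommGroup Γ] [Ext2 Γ]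

open Breve

/-- An element `z` of `Γ` with `π(z) = 1`. -/
def stdLift (Γ : Type*) [AddCommGroup Γ] [Ext2 Γ] : Γ := (Ext2.lev_surjective (Γ := Γ) 1).choose

theorem lev_stdLift : lev (stdLift Γ) = 1 := (Ext2.lev_surjective (Γ := Γ) 1).choose_spec

theorem ray_symmDiff {a b : Γ} (h : lev a = lev b) : (symmDiff (ray a) (ray b)).Finite := by
  obtain ⟨m, hm⟩ := (Ext2.exact (b - a)).1 (by rw [map_sub, h, sub_self])
  obtain rfl : b = a + emb m := by rw [hm]; abel
  refine ((Set.finite_Icc (min 0 m) (max 0 m)).image fun n => a + emb n).subset ?_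
  rintro γ (⟨⟨n, rfl⟩, h'⟩ | ⟨⟨n, rfl⟩, h'⟩)
  · refine ⟨n, ⟨by omega, ?_⟩, rfl⟩
    by_contra hn
    refine h' ⟨(n - m).toNat, ?_⟩
    rw [Int.toNat_of_nonneg (by omega), map_sub]; abel
  · refine ⟨m + n, ⟨by omega, ?_⟩, by simp only [map_add]; abel⟩
    by_contra hn
    refine h' ⟨(m + n).toNat, ?_⟩
    rw [Int.toNat_of_nonneg (by omega), map_add]; abel

/-- The union of the rays that start at `x + j z`, `j ∈ ℤ`. -/
def stdGood (x : Γ) : Good Γ :=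
  ⟨{γ | ∃ j : ℤ, γ ∈ ray (x + j • stdLift Γ)}, fun y => by
    have hl : lev (x + (lev y - lev x) • stdLift Γ) = lev y := by
      rw [map_add, map_zsmul, lev_stdLift]; simp
    have : {γ : Γ | ∃ j : ℤ, γ ∈ ray (x + j • stdLift Γ)} ∩ {γ | lev γ = lev y} =
        ray (x + (lev y - lev x) • stdLift Γ) := by
      ext γ
      constructor
      · rintro ⟨⟨j, n, rfl⟩, h⟩
        have h : lev (x + j • stdLift Γ + emb (n : ℤ)) = lev y := h
        rw [map_add, map_add, map_zsmul, lev_stdLift, lev_emb] at h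
        obtain rfl : j = lev y - lev x := by simp at h; omega
        exact ⟨n, rfl⟩
      · rintro ⟨n, rfl⟩
        refine ⟨⟨_, n, rfl⟩, ?_⟩
        change lev (_ + emb (n : ℤ)) = _
        rw [map_add, lev_emb, hl, add_zero]
    rw [this]
    exact ray_symmDiff hl⟩

theorem stdGood_shift (β x : Γ) : (stdGood x).shift β = stdGood (β + x) :=
  Good.ext <| Set.ext fun γ => by
    refine exists_congr fun j => exists_congr fun n => ?_
    rw [sub_eq_iff_eq_add]
    have : x + j • stdLift Γ + emb (n : ℤ) + β = β + x + j • stdLift Γ + emb (n : ℤ) := by abel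
    rw [this]

/-- The line `μ_r(α, β)`, which is `([α, β] ×^ℤ ℂˣ) ∪ {0}` for `ℤ → ℂˣ`, `n ↦ rⁿ`:
the class of `(d, c)` is the function `A ↦ c r^{d(A)}`. -/
def muR (r : ℂˣ) (α β : Breve Γ) : Submodule ℂ (Good Γ → ℂ) where
  carrier := {m | ∀ A B, m B = (r : ℂ) ^ jump α β A B * m A}
  add_mem' {m m'} h h' A B := by
    change m B + m' B = _ * (m A + m' A)
    rw [h A B, h' A B, mul_add]
  zero_mem' A B := by simp
  smul_mem' c m h A B := by
    change c * m B = _ * (c * m A)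
    rw [h A B]; ring

/-- The embedding `[α, β] → μ_r(α, β)`. -/
def theta (r : ℂˣ) {α β : Breve Γ} (d : Torsor α β) : muR r α β :=
  ⟨fun A => (r : ℂ) ^ d.1 A, fun A B => by
    change (r : ℂ) ^ d.1 B = _ * (r : ℂ) ^ d.1 A
    rw [d.2 A B, zpow_add₀ r.ne_zero, mul_comm]⟩

variable {r : ℂˣ}

theorem muR_prop {α β : Breve Γ} (m : muR r α β) (A B : Good Γ) :
    m.1 B = (r : ℂ) ^ jump α β A B * m.1 A := m.2 A B

/-- The product `μ_r(α, β) ⊗ μ_r(β, γ) → μ_r(α, γ)`. -/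
def mulR (r : ℂˣ) (α β γ : Breve Γ) : muR r α β →ₗ[ℂ] muR r β γ →ₗ[ℂ] muR r α γ :=
  LinearMap.mk₂ ℂ (fun m n => ⟨fun A => m.1 A * n.1 A, fun A B => by
      change m.1 B * n.1 B = _ * (m.1 A * n.1 A)
      rw [muR_prop m A B, muR_prop n A B, jump_add α β γ, zpow_add₀ r.ne_zero]; ring⟩)
    (fun _ _ _ => Subtype.ext <| funext fun _ => add_mul _ _ _)
    (fun _ _ _ => Subtype.ext <| funext fun _ => mul_assoc _ _ _)
    (fun _ _ _ => Subtype.ext <| funext fun _ => mul_add _ _ _)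
    (fun _ _ _ => Subtype.ext <| funext fun _ => mul_left_comm _ _ _)

theorem mulR_apply {α β γ : Breve Γ} (m : muR r α β) (n : muR r β γ) (A : Good Γ) :
    (mulR r α β γ m n).1 A = m.1 A * n.1 A := rfl

/-- Evaluation at a set. -/
def evalR (r : ℂˣ) (α β : Breve Γ) (A : Good Γ) : muR r α β ≃ₗ[ℂ] ℂ where
  toFun m := m.1 A
  map_add' _ _ := rfl
  map_smul' _ _ := rfl
  invFun c := ⟨fun B => (r : ℂ) ^ jump α β A B * c, fun B C => by
    change (r : ℂ) ^ jump α β A C * c = _ * ((r : ℂ) ^ jump α β A B * c)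
    rw [jump_trans α β A B C, zpow_add₀ r.ne_zero]; ring⟩
  left_inv m := Subtype.ext <| funext fun B => (muR_prop m A B).symm
  right_inv c := by
    change (r : ℂ) ^ jump α β A A * c = c
    rw [jump_same, zpow_zero, one_mul]

theorem finrank_muR (α β : Breve Γ) : Module.finrank ℂ (muR r α β) = 1 := by
  rw [(evalR r α β (stdGood 0)).finrank_eq, Module.finrank_self]

theorem muR_ne {α β : Breve Γ} {m : muR r α β} (h : m ≠ 0) (A : Good Γ) : m.1 A ≠ 0 := fun h0 =>
  h ((evalR r α β A).injective (h0.trans (map_zero _).symm))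

/-- The isomorphism `μ_r(α, β) ⊗ μ_r(β, γ) → μ_r(α, γ)`. -/
def mulREquiv (r : ℂˣ) (α β γ : Breve Γ) : muR r α β ⊗[ℂ] muR r β γ ≃ₗ[ℂ] muR r α γ :=
  LinearEquiv.ofBijective (TensorProduct.lift (mulR r α β γ)) <|
    lift_bijective (finrank_muR _ _) (finrank_muR _ _) (finrank_muR _ _) _ fun _ _ hx hy h =>
      mul_ne_zero (muR_ne hx (stdGood 0)) (muR_ne hy (stdGood 0))
        (congrFun (congrArg Subtype.val h) (stdGood 0))

theorem mulREquiv_tmul {α β γ : Breve Γ} (m : muR r α β) (n : muR r β γ) :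
    mulREquiv r α β γ (m ⊗ₜ n) = mulR r α β γ m n := rfl

/-- The isomorphism `μ_r(α, β) → μ_r(γ + α, γ + β)` given by the action of `γ` (with the targets
given up to equality). -/
def shiftR (r : ℂˣ) (γ : Γ) {α β α' β' : Breve Γ} (hα : α' = γ +ᵥ α) (hβ : β' = γ +ᵥ β) :
    muR r α β →ₗ[ℂ] muR r α' β' where
  toFun m := ⟨fun A => m.1 (A.shift (-γ)), fun A B => by
    subst hα hβ
    change m.1 (B.shift (-γ)) = _ * m.1 (A.shift (-γ))
    rw [muR_prop m (A.shift (-γ)), ← jump_shift γ α β, ← Good.shift_add, ← Good.shift_add,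
      add_neg_cancel, Good.shift_zero, Good.shift_zero]⟩
  map_add' _ _ := rfl
  map_smul' _ _ := rfl

/-! ### Functions and distributions on the fibres of `π` -/

/-- The space `𝒟₊(T)` of the torsor `T = π⁻¹(k)`, whose elements are extended by zero to `Γ`. -/
def DPlusT (Γ : Type*) [AddCommGroup Γ] [Ext2 Γ] (k : ℤ) : Submodule ℂ (Γ → ℂ) where
  carrier := {c | (∀ x, lev x ≠ k → c x = 0) ∧
    (∃ x₀, lev x₀ = k ∧ ∀ y, lev y = k → pt y ≤ pt x₀ → c y = 0) ∧
    (∃ x₁, lev x₁ = k ∧ ∀ x, lev x = k → pt x₁ ≤ pt x → c x = c (x + emb 1))}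
  add_mem' := by
    rintro c d ⟨h1, ⟨a, ha, h2⟩, ⟨b, hb, h3⟩⟩ ⟨h1', ⟨a', ha', h2'⟩, ⟨b', hb', h3'⟩⟩
    refine ⟨fun x hx => ?_, ?_, ?_⟩
    · rw [Pi.add_apply, h1 x hx, h1' x hx, add_zero]
    · rcases le_total (pt a) (pt a') with h | h
      · exact ⟨a, ha, fun y hy hya => by
          rw [Pi.add_apply, h2 y hy hya, h2' y hy (hya.trans h), add_zero]⟩
      · exact ⟨a', ha', fun y hy hya => by
          rw [Pi.add_apply, h2' y hy hya, h2 y hy (hya.trans h), add_zero]⟩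
    · rcases le_total (pt b) (pt b') with h | h
      · exact ⟨b', hb', fun y hy hya => by
          rw [Pi.add_apply, Pi.add_apply, h3' y hy hya, h3 y hy (h.trans hya)]⟩
      · exact ⟨b, hb, fun y hy hya => by
          rw [Pi.add_apply, Pi.add_apply, h3 y hy hya, h3' y hy (h.trans hya)]⟩
  zero_mem' := by
    obtain ⟨x, hx⟩ := Ext2.lev_surjective (Γ := Γ) k
    exact ⟨fun _ _ => rfl, ⟨x, hx, fun _ _ _ => rfl⟩, ⟨x, hx, fun _ _ _ => rfl⟩⟩
  smul_mem' := by
    rintro s c ⟨h1, ⟨a, ha, h2⟩, ⟨b, hb, h3⟩⟩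
    refine ⟨fun x hx => ?_, ⟨a, ha, fun y hy hya => ?_⟩, ⟨b, hb, fun y hy hya => ?_⟩⟩
    · rw [Pi.smul_apply, h1 x hx, smul_zero]
    · rw [Pi.smul_apply, h2 y hy hya, smul_zero]
    · rw [Pi.smul_apply, Pi.smul_apply, h3 y hy hya]

theorem DPlusT_finite {k : ℤ} (c : DPlusT Γ k) :
    {x : Γ | c.1 x - c.1 (x - emb 1) ≠ 0}.Finite := by
  obtain ⟨c, h1, ⟨a, ha, h2⟩, ⟨b, hb, h3⟩⟩ := c
  obtain ⟨m, hm⟩ := (Ext2.exact (b - a)).1 (by rw [map_sub, ha, hb, sub_self])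
  obtain rfl : b = a + emb m := by rw [hm]; abel
  refine ((Set.finite_Icc 0 (max 0 m)).image fun n => a + emb n).subset ?_
  intro x hx
  have hx : c x - c (x - emb 1) ≠ 0 := hx
  have hlev : lev (x - emb 1) = lev x := by rw [map_sub, lev_emb, sub_zero]
  have hxk : lev x = k := by
    by_contra h
    rw [h1 x h, h1 _ (by rwa [hlev])] at hx
    exact hx (sub_self 0)
  obtain ⟨n, hn⟩ := (Ext2.exact (x - a)).1 (by rw [map_sub, ha, hxk, sub_self])
  obtain rfl : x = a + emb n := by rw [hn]; abel
  refine ⟨n, ⟨?_, ?_⟩, rfl⟩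
  · by_contra hn0
    refine hx ?_
    rw [h2 _ hxk (pt_le_pt.2 (Or.inr ⟨(-n).toNat, ?_⟩)),
      h2 _ (hlev.trans hxk) (pt_le_pt.2 (Or.inr ⟨(1 - n).toNat, ?_⟩)), sub_zero]
    · rw [Int.toNat_of_nonneg (by omega), map_sub]; abel
    · rw [Int.toNat_of_nonneg (by omega), map_neg]; abel
  · by_contra hnm
    refine hx ?_
    rw [h3 (a + emb n - emb 1) (hlev.trans hxk) (pt_le_pt.2 (Or.inr ⟨(n - 1 - m).toNat, ?_⟩)),
      sub_add_cancel, sub_self]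
    rw [Int.toNat_of_nonneg (by omega), map_sub, map_sub]; abel

/-- The element of the dual `𝒟'₊(T)` of `𝒟₊(T)` with the given values `a_{x, x}` on the functions
`δ_{≥ x}`; here `f = ∑ₓ (f(x) - f(x - 1)) δ_{≥ x}`. -/
def ofVals (k : ℤ) (a : Γ → ℂ) : Module.Dual ℂ (DPlusT Γ k) where
  toFun f := ∑ᶠ x, (f.1 x - f.1 (x - emb 1)) * a x
  map_add' f g := by
    have hs : ∀ f : DPlusT Γ k,
        (Function.support fun x => (f.1 x - f.1 (x - emb 1)) * a x).Finite := fun f =>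
      (DPlusT_finite f).subset fun x hx => left_ne_zero_of_mul hx
    rw [← finsum_add_distrib (hs f) (hs g)]
    refine finsum_congr fun x => ?_
    change (f.1 x + g.1 x - (f.1 _ + g.1 _)) * _ = _
    ring
  map_smul' s f := by
    change (∑ᶠ x : Γ, (s * f.1 x - s * f.1 (x - emb 1)) * a x) =
      s * ∑ᶠ x : Γ, (f.1 x - f.1 (x - emb 1)) * a x
    rw [mul_finsum]
    exact finsum_congr fun x => by ring

/-- `δ_{+∞}`, which takes `f` to its value far to the right. -/
def deltaInf (Γ : Type*) [AddCommGroup Γ] [Ext2 Γ] (k : ℤ) : Module.Dual ℂ (DPlusT Γ k) :=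
  ofVals k fun _ => 1

/-- The embedding `μ_r(k + 1, k) → 𝒟'₊(π⁻¹(k))`: the value on `δ_{≥ x}` is the value on a set whose
intersection with `π⁻¹(k)` is the ray from `x`. -/
def embR (r : ℂˣ) (k : ℤ) : muR (Γ := Γ) r (bot (k + 1)) (bot k) →ₗ[ℂ] Module.Dual ℂ (DPlusT Γ k) where
  toFun η := ofVals k fun x => η.1 (stdGood x)
  map_add' η η' := LinearMap.ext fun f => by
    have hs : ∀ a : Γ → ℂ,
        (Function.support fun x => (f.1 x - f.1 (x - emb 1)) * a x).Finite := fun a =>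
      (DPlusT_finite f).subset fun x hx => left_ne_zero_of_mul hx
    change (∑ᶠ x : Γ, (f.1 x - f.1 (x - emb 1)) * (η.1 (stdGood x) + η'.1 (stdGood x))) =
      (∑ᶠ x : Γ, (f.1 x - f.1 (x - emb 1)) * η.1 (stdGood x)) +
        ∑ᶠ x : Γ, (f.1 x - f.1 (x - emb 1)) * η'.1 (stdGood x)
    rw [← finsum_add_distrib (hs _) (hs _)]
    exact finsum_congr fun x => mul_add _ _ _
  map_smul' s η := LinearMap.ext fun f => by
    change (∑ᶠ x : Γ, (f.1 x - f.1 (x - emb 1)) * (s * η.1 (stdGood x))) =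
      s * ∑ᶠ x : Γ, (f.1 x - f.1 (x - emb 1)) * η.1 (stdGood x)
    rw [mul_finsum]
    exact finsum_congr fun x => mul_left_comm _ _ _

theorem ofVals_apply (k : ℤ) (a : Γ → ℂ) (f : DPlusT Γ k) :
    ofVals k a f = ∑ᶠ x, (f.1 x - f.1 (x - emb 1)) * a x := rfl

theorem embR_apply (k : ℤ) (η : muR (Γ := Γ) r (bot (k + 1)) (bot k)) (f : DPlusT Γ k) :
    embR r k η f = ∑ᶠ x, (f.1 x - f.1 (x - emb 1)) * η.1 (stdGood x) := rfl

/-- The map `𝒟₊(π⁻¹(k)) → 𝒟₊(π⁻¹(π(β) + k))` induced by `x ↦ β + x` (with the target given up to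
equality). -/
def shiftT (β : Γ) {k k' : ℤ} (hk : k' = lev β + k) : DPlusT Γ k →ₗ[ℂ] DPlusT Γ k' where
  toFun f := ⟨fun x => f.1 (x - β), by
    obtain ⟨f, h1, ⟨a, ha, h2⟩, ⟨b, hb, h3⟩⟩ := f
    refine ⟨fun x hx => h1 _ ?_, ⟨β + a, ?_, fun y hy hya => h2 _ ?_ ?_⟩,
      ⟨β + b, ?_, fun y hy hya => ?_⟩⟩
    · rw [map_sub]; omega
    · rw [map_add]; omega
    · rw [map_sub]; omega
    · rw [← vadd_le_vadd β, vadd_pt, vadd_pt, add_sub_cancel]; exact hya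
    · rw [map_add]; omega
    · have := h3 (y - β) (by rw [map_sub]; omega)
        (by rw [← vadd_le_vadd β, vadd_pt, vadd_pt, add_sub_cancel]; exact hya)
      change f (y - β) = f (y + emb 1 - β)
      rw [this, sub_add_eq_add_sub]⟩
  map_add' _ _ := rfl
  map_smul' _ _ := rfl

/-- The inverse of `shiftT`. -/
def shiftT' (β : Γ) {k k' : ℤ} (hk : k' = lev β + k) : DPlusT Γ k' →ₗ[ℂ] DPlusT Γ k :=
  shiftT (-β) (by rw [map_neg]; omega)

/-! ### The spaces on `Γ` -/

variable (r) (α : Breve Γ)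

/-- `f ⊗ μ ↦ δ_{+∞}(f) μ`. -/
def istar (k : ℤ) :
    DPlusT Γ k ⊗[ℂ] muR r (bot (k + 1)) α →ₗ[ℂ] muR r (bot (k + 1)) α :=
  (TensorProduct.lid ℂ _).toLinearMap ∘ₗ (deltaInf Γ k).rTensor _

/-- `f ⊗ (η ⊗ μ) ↦ η(f) μ` for `η ∈ μ_r(k + 1, k)` and `μ ∈ μ_r(k, α)`. -/
def pistar (k : ℤ) : DPlusT Γ k ⊗[ℂ] muR r (bot (k + 1)) α →ₗ[ℂ] muR r (bot k) α :=
  (TensorProduct.lid ℂ _).toLinearMap ∘ₗ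
    (TensorProduct.lift (embR r k).flip).rTensor _ ∘ₗ
    (TensorProduct.assoc ℂ _ _ _).symm.toLinearMap ∘ₗ
    (mulREquiv r (bot (k + 1)) (bot k) α).symm.toLinearMap.lTensor _

variable {r α}

theorem istar_tmul (k : ℤ) (f : DPlusT Γ k) (m : muR r (bot (k + 1)) α) :
    istar r α k (f ⊗ₜ m) = deltaInf Γ k f • m := rfl

theorem pistar_tmul (k : ℤ) (f : DPlusT Γ k) (η : muR r (bot (k + 1)) (bot k))
    (m : muR r (bot k) α) : pistar r α k (f ⊗ₜ mulR r _ _ _ η m) = embR r k η f • m := by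
  rw [← mulREquiv_tmul]
  simp [pistar]

variable (r α)

/-- The space `∏ₖ 𝒟₊(π⁻¹(k)) ⊗ μ_r(k + 1, α)`. -/
abbrev PreD : Type _ := ∀ k : ℤ, DPlusT Γ k ⊗[ℂ] muR r (bot (k + 1)) α

/-- The space `𝒟_{+, α, r}(Γ)`. On an element with components `f_k ⊗ μ_k`, `μ_k ≠ 0`,
`μ_{k + 1} = η_{k + 1} ⊗ μ_k`, the condition says `δ_{+∞}(f_k) = η_{k + 1}(f_{k + 1})`. -/
def DPlus : Submodule ℂ (PreD r α) where
  carrier := {F | ∀ k, istar r α k (F k) = pistar r α (k + 1) (F (k + 1))}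
  add_mem' {F G} hF hG k := by
    rw [Pi.add_apply, Pi.add_apply, map_add, map_add, hF k, hG k]
  zero_mem' k := by simp
  smul_mem' c F hF k := by
    rw [Pi.smul_apply, Pi.smul_apply, map_smul, map_smul, hF k]

open scoped DirectSum

/-- The space `⨁ₖ 𝒟'₊(π⁻¹(k)) ⊗ μ_r(α, k + 1)`. -/
abbrev PreD' : Type _ := ⨁ k : ℤ, Module.Dual ℂ (DPlusT Γ k) ⊗[ℂ] muR r α (bot (k + 1))

instance : AddCommGroup (PreD' r α) := Module.addCommMonoidToAddCommGroup ℂ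

/-- The subspace generated by `δ_{+∞} ⊗ (λ ⊗ η) - η ⊗ λ`, where the first summand is in degree `k`, the
second one in degree `k + 1`, and `λ ∈ μ_r(α, k + 2)`, `η ∈ μ_r(k + 2, k + 1)`. -/
def relD' : Submodule ℂ (PreD' r α) :=
  Submodule.span ℂ {z | ∃ (k : ℤ) (l : muR r α (bot (k + 1 + 1)))
    (η : muR r (bot (k + 1 + 1)) (bot (k + 1))),
    z = DirectSum.lof ℂ ℤ (fun k => Module.Dual ℂ (DPlusT Γ k) ⊗[ℂ] muR r α (bot (k + 1))) k
        (deltaInf Γ k ⊗ₜ mulR r _ _ _ l η) -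
      DirectSum.lof ℂ ℤ (fun k => Module.Dual ℂ (DPlusT Γ k) ⊗[ℂ] muR r α (bot (k + 1))) (k + 1)
        (embR r (k + 1) η ⊗ₜ l)}

/-- The space `𝒟'_{+, α, r}(Γ)`. -/
abbrev DPlus' : Type _ := PreD' r α ⧸ relD' r α

/-! ### The action of the discrete Heisenberg group on these spaces -/

variable {α}

/-- `f ⊗ μ ↦ β(f) ⊗ (β(μ) ⊗ h⁻¹)`. -/
def actAt (x : Heis α) {k k' : ℤ} (hk : k' = lev x.pt + k) :
    DPlusT Γ k ⊗[ℂ] muR r (bot (k + 1)) α →ₗ[ℂ] DPlusT Γ k' ⊗[ℂ] muR r (bot (k' + 1)) α :=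
  TensorProduct.map (shiftT x.pt hk)
    ((mulR r (bot (k' + 1)) (x.pt +ᵥ α) α).flip (theta r x.tor.inv) ∘ₗ
      shiftR r x.pt (by rw [vadd_bot, hk, add_assoc]) rfl)

/-- `g ⊗ λ ↦ β(g) ⊗ (h ⊗ β(λ))`. -/
def actAt' (x : Heis α) {k k' : ℤ} (hk : k' = lev x.pt + k) :
    Module.Dual ℂ (DPlusT Γ k) ⊗[ℂ] muR r α (bot (k + 1)) →ₗ[ℂ]
      Module.Dual ℂ (DPlusT Γ k') ⊗[ℂ] muR r α (bot (k' + 1)) :=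
  TensorProduct.map (shiftT' x.pt hk).dualMap
    (mulR r α (x.pt +ᵥ α) (bot (k' + 1)) (theta r x.tor) ∘ₗ
      shiftR r x.pt rfl (by rw [vadd_bot, hk, add_assoc]))

theorem actAt_one {k k' : ℤ} (h : k' = k) (F : PreD r α) :
    actAt r (1 : Heis α) (k := k) (k' := k')
      (by change k' = lev (0 : Γ) + k; rw [map_zero, zero_add, h]) (F k) = F k' := by
  subst h
  generalize F k' = z
  induction z with
  | zero => exact map_zero _
  | add x y hx hy => rw [map_add, hx, hy]
  | tmul f m =>
    refine (TensorProduct.map_tmul _ _ _ _).trans ?_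
    congr 1
    · refine Subtype.ext <| funext fun x => ?_
      change f.1 (x - 0) = f.1 x
      rw [sub_zero]
    · refine Subtype.ext <| funext fun A => ?_
      change m.1 (A.shift (-0)) * (r : ℂ) ^ (-0 : ℤ) = m.1 A
      rw [neg_zero, Good.shift_zero, neg_zero, zpow_zero, mul_one]

theorem actAt_mul (x y : Heis α) {k k' k'' : ℤ} (hk : k' = lev y.pt + k)
    (hk' : k'' = lev x.pt + k') (h : k'' = lev (x * y).pt + k) (z) :
    actAt r (x * y) h z = actAt r x hk' (actAt r y hk z) := by
  induction z with
  | zero => simp only [map_zero]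
  | add a b ha hb => rw [map_add, ha, hb, map_add, map_add]
  | tmul f m =>
    refine (TensorProduct.map_tmul _ _ _ _).trans ?_
    symm
    refine (congrArg _ (TensorProduct.map_tmul _ _ _ _)).trans
      ((TensorProduct.map_tmul _ _ _ _).trans ?_)
    congr 1
    · refine Subtype.ext <| funext fun u => ?_
      change f.1 (u - x.pt - y.pt) = f.1 (u - (x.pt + y.pt))
      rw [sub_sub]
    · refine Subtype.ext <| funext fun A => ?_
      change m.1 ((A.shift (-x.pt)).shift (-y.pt)) *
          (r : ℂ) ^ (- y.tor.1 (A.shift (-x.pt))) * (r : ℂ) ^ (- x.tor.1 A) =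
        m.1 (A.shift (-(x.pt + y.pt))) * (r : ℂ) ^ (- (x.tor.1 A + y.tor.1 (A.shift (-x.pt))))
      rw [← Good.shift_add, neg_add_rev, neg_add_rev, zpow_add₀ r.ne_zero, mul_assoc]

end Gamma

end Lines

section HeisenbergAction

open Ext2 (emb lev)
open Breve
open scoped DirectSum

section Gamma

variable {Γ : Type*} [AddCommGroup Γ] [Ext2 Γ] {r : ℂˣ}

theorem embR_shift (β : Γ) {k k' : ℤ} (hk : k' = lev β + k) (h₁ h₂)
    (η : muR (Γ := Γ) r (bot (k + 1)) (bot k)) (f : DPlusT Γ k) :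
    embR r k' (shiftR r β h₁ h₂ η) (shiftT β hk f) = embR r k η f := by
  rw [embR_apply, embR_apply, ← finsum_comp_equiv (Equiv.addRight β)]
  refine finsum_congr fun x => ?_
  change (f.1 (x + β - β) - f.1 (x + β - emb 1 - β)) * η.1 ((stdGood (x + β)).shift (-β)) = _
  rw [stdGood_shift, add_sub_cancel_right, sub_right_comm, add_sub_cancel_right, add_comm x β,
    neg_add_cancel_left]

theorem deltaInf_shift (β : Γ) {k k' : ℤ} (hk : k' = lev β + k) (f : DPlusT Γ k) :
    deltaInf Γ k' (shiftT β hk f) = deltaInf Γ k f := by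
  rw [deltaInf, deltaInf, ofVals_apply, ofVals_apply, ← finsum_comp_equiv (Equiv.addRight β)]
  refine finsum_congr fun x => ?_
  change (f.1 (x + β - β) - f.1 (x + β - emb 1 - β)) * 1 = _
  rw [add_sub_cancel_right, sub_right_comm, add_sub_cancel_right]

theorem shiftT_shiftT' (β : Γ) {k k' : ℤ} (hk : k' = lev β + k) (f : DPlusT Γ k') :
    shiftT β hk (shiftT' β hk f) = f := Subtype.ext <| funext fun x => by
  change f.1 (x - β - -β) = f.1 x
  rw [sub_neg_eq_add, sub_add_cancel]

theorem deltaInf_shift' (β : Γ) {k k' : ℤ} (hk : k' = lev β + k) :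
    (shiftT' β hk).dualMap (deltaInf Γ k) = deltaInf Γ k' := LinearMap.ext fun f => by
  change deltaInf Γ k (shiftT' β hk f) = _
  rw [← deltaInf_shift β hk, shiftT_shiftT']

theorem embR_shift' (β : Γ) {k k' : ℤ} (hk : k' = lev β + k) (h₁ h₂)
    (η : muR (Γ := Γ) r (bot (k + 1)) (bot k)) :
    (shiftT' β hk).dualMap (embR r k η) = embR r k' (shiftR r β h₁ h₂ η) :=
  LinearMap.ext fun f => by
    change embR r k η (shiftT' β hk f) = _
    rw [← embR_shift β hk h₁ h₂, shiftT_shiftT']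

variable (r) {α : Breve Γ}

theorem actAt_tmul (w : Heis α) {k k' : ℤ} (hk : k' = lev w.pt + k) (f : DPlusT Γ k)
    (m : muR r (bot (k + 1)) α) :
    actAt r w hk (f ⊗ₜ m) = shiftT w.pt hk f ⊗ₜ mulR r (bot (k' + 1)) (w.pt +ᵥ α) α
      (shiftR r w.pt (by rw [vadd_bot, hk, add_assoc]) rfl m) (theta r w.tor.inv) := rfl

theorem actAt'_tmul (w : Heis α) {k k' : ℤ} (hk : k' = lev w.pt + k)
    (g : Module.Dual ℂ (DPlusT Γ k)) (l : muR r α (bot (k + 1))) :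
    actAt' r w hk (g ⊗ₜ l) = (shiftT' w.pt hk).dualMap g ⊗ₜ mulR r α (w.pt +ᵥ α) (bot (k' + 1))
      (theta r w.tor) (shiftR r w.pt rfl (by rw [vadd_bot, hk, add_assoc]) l) := rfl

theorem istar_actAt (w : Heis α) {k k' : ℤ} (hk : k' = lev w.pt + k) (z) :
    istar r α k' (actAt r w hk z) = mulR r (bot (k' + 1)) (w.pt +ᵥ α) α
      (shiftR r w.pt (by rw [vadd_bot, hk, add_assoc]) rfl (istar r α k z))
      (theta r w.tor.inv) := by
  induction z with
  | zero => simp only [map_zero, LinearMap.zero_apply]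
  | add x y hx hy => rw [map_add, map_add, hx, hy, map_add, map_add, map_add, LinearMap.add_apply]
  | tmul f m =>
    rw [actAt_tmul, istar_tmul, istar_tmul, deltaInf_shift, map_smul, map_smul,
      LinearMap.smul_apply]

theorem pistar_actAt (w : Heis α) {k k' : ℤ} (hk : k' = lev w.pt + k) (z) :
    pistar r α k' (actAt r w hk z) = mulR r (bot k') (w.pt +ᵥ α) α
      (shiftR r w.pt (by rw [vadd_bot, hk]) rfl (pistar r α k z)) (theta r w.tor.inv) := by
  induction z with
  | zero => simp only [map_zero, LinearMap.zero_apply]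
  | add x y hx hy => rw [map_add, map_add, hx, hy, map_add, map_add, map_add, LinearMap.add_apply]
  | tmul f m =>
    obtain ⟨t, rfl⟩ := (mulREquiv r (bot (k + 1)) (bot k) α).surjective m
    induction t with
    | zero =>
      rw [LinearEquiv.map_zero, TensorProduct.tmul_zero]
      simp only [map_zero, LinearMap.zero_apply]
    | add x y hx hy =>
      rw [LinearEquiv.map_add, TensorProduct.tmul_add, map_add, map_add, hx, hy, map_add, map_add, map_add,
        LinearMap.add_apply]
    | tmul η l =>
      rw [mulREquiv_tmul, actAt_tmul, pistar_tmul]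
      have e : mulR r (bot (k' + 1)) (w.pt +ᵥ α) α
          (shiftR r w.pt (by rw [vadd_bot, hk, add_assoc]) rfl (mulR r _ (bot k) α η l))
          (theta r w.tor.inv) =
        mulR r (bot (k' + 1)) (bot k') α
          (shiftR r w.pt (by rw [vadd_bot, hk, add_assoc]) (by rw [vadd_bot, hk]) η)
          (mulR r (bot k') (w.pt +ᵥ α) α (shiftR r w.pt (by rw [vadd_bot, hk]) rfl l)
            (theta r w.tor.inv)) := Subtype.ext <| funext fun A => mul_assoc _ _ _
      rw [e, pistar_tmul, embR_shift, map_smul, map_smul, LinearMap.smul_apply]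

theorem actAt_congr (w : Heis α) (F : PreD r α) {j k k' : ℤ} (h : j = k) (hj : k' = lev w.pt + j)
    (hk : k' = lev w.pt + k) : actAt r w hj (F j) = actAt r w hk (F k) := by
  subst h; rfl

/-- The action of an element of the group on `∏ₖ 𝒟₊(π⁻¹(k)) ⊗ μ_r(k + 1, α)`. -/
def actPre (w : Heis α) : PreD r α →ₗ[ℂ] PreD r α :=
  LinearMap.pi fun k => actAt r w (k := k - lev w.pt) (by ring) ∘ₗ LinearMap.proj _

theorem actPre_apply (w : Heis α) (F : PreD r α) {k k' : ℤ} (hk : k' = lev w.pt + k) :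
    actPre r w F k' = actAt r w hk (F k) :=
  actAt_congr r w F (by omega) _ _

theorem actPre_mem (w : Heis α) {F : PreD r α} (hF : F ∈ DPlus r α) : actPre r w F ∈ DPlus r α := by
  intro k
  rw [actPre_apply r w F (k := k - lev w.pt) (by ring),
    actPre_apply r w F (k := k - lev w.pt + 1) (k' := k + 1) (by ring), istar_actAt, pistar_actAt,
    hF]

/-- The action of the discrete Heisenberg group on `𝒟_{+, α, r}(Γ)`. -/
def repPlus (α : Breve Γ) : Representation ℂ (Heis α) (DPlus r α) where
  toFun w := (actPre r w).restrict fun _ => actPre_mem r w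
  map_one' := LinearMap.ext fun F => Subtype.ext <| funext fun k => by
    change actPre r 1 F.1 k = F.1 k
    exact (actPre_apply r 1 F.1 _).trans (actAt_one r (α := α) (k := k) (k' := k) rfl F.1)
  map_mul' x y := LinearMap.ext fun F => Subtype.ext <| funext fun k => by
    change actPre r (x * y) F.1 k = actPre r x (actPre r y F.1) k
    have hxy : lev (x * y).pt = lev x.pt + lev y.pt := map_add _ _ _
    rw [actPre_apply r x _ (k := k - lev x.pt) (by ring),
      actPre_apply r y _ (k := k - lev x.pt - lev y.pt) (by ring),
      actPre_apply r (x * y) _ (k := k - lev x.pt - lev y.pt) (by rw [hxy]; ring), ← actAt_mul]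

/-- The inclusion of the summand of degree `k`. -/
def ofDeg (α : Breve Γ) (k : ℤ) :
    Module.Dual ℂ (DPlusT Γ k) ⊗[ℂ] muR r α (bot (k + 1)) →ₗ[ℂ] PreD' r α :=
  DirectSum.lof ℂ ℤ (fun k => Module.Dual ℂ (DPlusT Γ k) ⊗[ℂ] muR r α (bot (k + 1))) k

/-- The action of an element of the group on `⨁ₖ 𝒟'₊(π⁻¹(k)) ⊗ μ_r(α, k + 1)`. -/
def actPre' (w : Heis α) : PreD' r α →ₗ[ℂ] PreD' r α :=
  DirectSum.toModule ℂ ℤ _ fun k => ofDeg r α (lev w.pt + k) ∘ₗ actAt' r w rfl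

theorem actPre'_ofDeg (w : Heis α) {k k' : ℤ} (hk : k' = lev w.pt + k) (z) :
    actPre' r w (ofDeg r α k z) = ofDeg r α k' (actAt' r w hk z) := by
  subst hk
  exact DirectSum.toModule_lof ..

theorem actPre'_le (w : Heis α) : relD' r α ≤ (relD' r α).comap (actPre' r w) := by
  refine Submodule.span_le.2 ?_
  rintro _ ⟨k, l, η, rfl⟩
  have e : mulR r α (w.pt +ᵥ α) (bot (lev w.pt + k + 1)) (theta r w.tor) (shiftR r w.pt rfl
        (by rw [vadd_bot, add_assoc]) (mulR r α (bot (k + 1 + 1)) (bot (k + 1)) l η)) =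
      mulR r α (bot (lev w.pt + k + 1 + 1)) (bot (lev w.pt + k + 1))
        (mulR r α (w.pt +ᵥ α) (bot (lev w.pt + k + 1 + 1)) (theta r w.tor)
          (shiftR r w.pt rfl (by rw [vadd_bot]; congr 1; ring) l))
        (shiftR r w.pt (by rw [vadd_bot]; congr 1; ring) (by rw [vadd_bot, add_assoc]) η) :=
    Subtype.ext <| funext fun A => (mul_assoc _ _ _).symm
  refine Submodule.subset_span ⟨lev w.pt + k,
    mulR r α (w.pt +ᵥ α) (bot (lev w.pt + k + 1 + 1)) (theta r w.tor)
          (shiftR r w.pt rfl (by rw [vadd_bot]; congr 1; ring) l),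
    shiftR r w.pt (by rw [vadd_bot]; congr 1; ring) (by rw [vadd_bot, add_assoc]) η, ?_⟩
  rw [map_sub]
  refine congrArg₂ (· - ·) ?_ ?_
  · refine (actPre'_ofDeg r w (k' := lev w.pt + k) rfl _).trans (congrArg (ofDeg r α _) ?_)
    rw [actAt'_tmul, deltaInf_shift', e]
  · refine (actPre'_ofDeg r w (k' := lev w.pt + k + 1) (by ring) _).trans
      (congrArg (ofDeg r α _) ?_)
    rw [actAt'_tmul, embR_shift' _ _ (by rw [vadd_bot]; congr 1; ring)
      (by rw [vadd_bot, add_assoc])]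

theorem actAt'_one {k : ℤ} (z) :
    actAt' r (1 : Heis α) (k := k) (k' := k)
      (by change k = lev (0 : Γ) + k; rw [map_zero, zero_add]) z = z := by
  induction z with
  | zero => exact map_zero _
  | add x y hx hy => rw [map_add, hx, hy]
  | tmul g m =>
    rw [actAt'_tmul]
    congr 1
    · refine LinearMap.ext fun f => congrArg g (Subtype.ext <| funext fun x => ?_)
      change f.1 (x - -0) = f.1 x
      rw [neg_zero, sub_zero]
    · refine Subtype.ext <| funext fun A => ?_
      change (r : ℂ) ^ (0 : ℤ) * m.1 (A.shift (-0)) = m.1 A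
      rw [neg_zero, Good.shift_zero, zpow_zero, one_mul]

theorem actAt'_mul (x y : Heis α) {k k' k'' : ℤ} (hk : k' = lev y.pt + k)
    (hk' : k'' = lev x.pt + k') (h : k'' = lev (x * y).pt + k) (z) :
    actAt' r (x * y) h z = actAt' r x hk' (actAt' r y hk z) := by
  induction z with
  | zero => simp only [map_zero]
  | add a b ha hb => rw [map_add, ha, hb, map_add, map_add]
  | tmul g m =>
    rw [actAt'_tmul, actAt'_tmul, actAt'_tmul]
    congr 1
    · refine LinearMap.ext fun f => congrArg g (Subtype.ext <| funext fun u => ?_)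
      change f.1 (u - -(x.pt + y.pt)) = f.1 (u - -y.pt - -x.pt)
      rw [neg_add_rev, sub_add_eq_sub_sub]
    · refine Subtype.ext <| funext fun A => ?_
      change (r : ℂ) ^ (x.tor.1 A + y.tor.1 (A.shift (-x.pt))) * m.1 (A.shift (-(x.pt + y.pt))) =
        (r : ℂ) ^ x.tor.1 A * ((r : ℂ) ^ y.tor.1 (A.shift (-x.pt)) *
          m.1 ((A.shift (-x.pt)).shift (-y.pt)))
      rw [← Good.shift_add, neg_add_rev, zpow_add₀ r.ne_zero, mul_assoc]

/-- The action of the discrete Heisenberg group on `𝒟'_{+, α, r}(Γ)`. -/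
def repPlus' (α : Breve Γ) : Representation ℂ (Heis α) (DPlus' r α) where
  toFun w := (relD' r α).mapQ _ (actPre' r w) (actPre'_le r w)
  map_one' := Submodule.linearMap_qext _ <| DirectSum.linearMap_ext _ fun k =>
    LinearMap.ext fun z => by
      refine congrArg (relD' r α).mkQ ?_
      refine (actPre'_ofDeg r 1 (k' := k) ?_ z).trans (congrArg (ofDeg r α k) (actAt'_one r z))
      change k = lev (0 : Γ) + k
      rw [map_zero, zero_add]
  map_mul' x y := Submodule.linearMap_qext _ <| DirectSum.linearMap_ext _ fun k =>
    LinearMap.ext fun z => by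
      have hxy : lev (x * y).pt = lev x.pt + lev y.pt := map_add _ _ _
      refine congrArg (relD' r α).mkQ ?_
      refine (actPre'_ofDeg r (x * y) (k' := lev x.pt + (lev y.pt + k))
        (by rw [hxy, add_assoc]) z).trans ?_
      rw [actAt'_mul r x y rfl rfl, ← actPre'_ofDeg, ← actPre'_ofDeg]
      rfl

end Gamma

end HeisenbergAction

section Fields

open Ext2 (emb lev)
open Breve
open scoped WithZero

/-! ### Two-dimensional local fields -/

/-- A two-dimensional local field with finite last residue field: `K` is complete with respect to the
discrete valuation `v`, its residue field is complete with respect to the discrete valuation `w`, and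
the residue field of the latter is finite. -/
class TwoDimLocalField (K : Type*) [Field K] where
  v : Valuation K ℤᵐ⁰
  v_surjective : Function.Surjective v
  v_complete : IsAdicComplete (IsLocalRing.maximalIdeal v.valuationSubring) v.valuationSubring
  w : Valuation (IsLocalRing.ResidueField v.valuationSubring) ℤᵐ⁰
  w_surjective : Function.Surjective w
  w_complete : IsAdicComplete (IsLocalRing.maximalIdeal w.valuationSubring) w.valuationSubring
  finite_residue : Finite (IsLocalRing.ResidueField w.valuationSubring)

variable (K : Type*) [Field K] [TwoDimLocalField K]

/-- The ring of integers of `K`. -/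
abbrev OK : ValuationSubring K := (TwoDimLocalField.v (K := K)).valuationSubring

/-- The residue field of `K`. -/
abbrev KBar : Type _ := IsLocalRing.ResidueField (OK K)

/-- The ring of integers of the residue field. -/
abbrev OKBar : ValuationSubring (KBar K) := (TwoDimLocalField.w (K := K)).valuationSubring

/-- The last residue field. -/
abbrev LastRes : Type _ := IsLocalRing.ResidueField (OKBar K)

instance : Finite (LastRes K) := TwoDimLocalField.finite_residue

/-- The number `q` of the elements of the last residue field. -/
def qK : ℂˣ := Units.mk0 (Nat.card (LastRes K) : ℂ) (Nat.cast_ne_zero.2 Nat.card_pos.ne')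

/-- The ring `𝒪'_K`, as a subring of `K`. -/
def OPrime : Subring K :=
  ((OKBar K).toSubring.comap (IsLocalRing.residue (OK K))).map (OK K).subtype

/-- The group `(𝒪'_K)^*`. -/
def OUnits : Subgroup Kˣ := (OPrime K).toSubmonoid.units

/-- The group `Γ_K`, written additively. -/
def ΓK : Type _ := Additive (Kˣ ⧸ OUnits K)

instance : AddCommGroup (ΓK K) := inferInstanceAs (AddCommGroup (Additive (Kˣ ⧸ OUnits K)))

variable {K}

/-- The rank-two valuation. -/
def ν (a : Kˣ) : ΓK K := Additive.ofMul (QuotientGroup.mk a)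

theorem ν_mul (a b : Kˣ) : ν (a * b) = ν a + ν b := rfl
theorem ν_one : ν (1 : Kˣ) = 0 := rfl
theorem ν_inv (a : Kˣ) : ν a⁻¹ = -ν a := rfl
theorem ν_surjective : Function.Surjective (ν : Kˣ → ΓK K) := fun γ =>
  QuotientGroup.mk_surjective (Additive.toMul γ)
theorem ν_eq_zero {a : Kˣ} : ν a = 0 ↔ a ∈ OUnits K := QuotientGroup.eq_one_iff a

open TwoDimLocalField (v w)

theorem mem_OPrime {x : K} :
    x ∈ OPrime K ↔ ∃ h : x ∈ OK K, IsLocalRing.residue (OK K) ⟨x, h⟩ ∈ OKBar K := by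
  constructor
  · rintro ⟨y, hy, rfl⟩
    exact ⟨y.2, hy⟩
  · rintro ⟨h, hx⟩
    exact ⟨⟨x, h⟩, hx, rfl⟩

/-- The discrete valuation of `K`. -/
def ord (a : Kˣ) : ℤ := -WithZero.log (v (a : K))

theorem v_ne (a : Kˣ) : v (a : K) ≠ 0 := (Valuation.ne_zero_iff _).2 a.ne_zero

theorem ord_mul (a b : Kˣ) : ord (a * b) = ord a + ord b := by
  rw [ord, Units.val_mul, map_mul, WithZero.log_mul (v_ne a) (v_ne b), neg_add]; rfl

theorem v_eq (a : Kˣ) : v (a : K) = WithZero.exp (-ord a) := by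
  rw [ord, neg_neg, WithZero.exp_log (v_ne a)]

theorem mem_OK_iff (a : Kˣ) : (a : K) ∈ OK K ↔ 0 ≤ ord a := by
  rw [Valuation.mem_valuationSubring_iff, v_eq, ← WithZero.exp_zero, WithZero.exp_le_exp]
  omega

theorem ord_of_mem {a : Kˣ} (h : a ∈ OUnits K) : ord a = 0 := by
  have h1 := (mem_OK_iff a).1 (mem_OPrime.1 h.1).1
  have h2 := (mem_OK_iff a⁻¹).1 (mem_OPrime.1 h.2).1
  have h3 := ord_mul a a⁻¹
  rw [mul_inv_cancel, ord, Units.val_one, map_one, WithZero.log_one] at h3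
  omega

/-- The homomorphism `π : Γ_K → ℤ`. -/
def levK : ΓK K →+ ℤ :=
  MonoidHom.toAdditive (β := Multiplicative ℤ) (QuotientGroup.lift (OUnits K)
    { toFun := fun a => Multiplicative.ofAdd (ord a)
      map_one' := by
        change Multiplicative.ofAdd (ord (1 : Kˣ)) = Multiplicative.ofAdd 0
        rw [ord_of_mem (one_mem _)]
      map_mul' := fun a b => congrArg Multiplicative.ofAdd (ord_mul a b) }
    fun _ ha => congrArg Multiplicative.ofAdd (ord_of_mem ha))

theorem levK_ν (a : Kˣ) : levK (ν a) = ord a := rfl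

/-- The image in the residue field of an element of valuation zero. -/
def res (a : Kˣ) (h : ord a = 0) : KBar K :=
  IsLocalRing.residue (OK K) ⟨a, (mem_OK_iff a).2 h.ge⟩

theorem ord_inv (a : Kˣ) : ord a⁻¹ = -ord a := by
  have h3 := ord_mul a a⁻¹
  rw [mul_inv_cancel, ord_of_mem (one_mem _)] at h3
  omega

theorem res_mul (a b : Kˣ) (ha : ord a = 0) (hb : ord b = 0) (h : ord (a * b) = 0) :
    res (a * b) h = res a ha * res b hb := by
  rw [res, res, res, ← map_mul]; rfl

theorem res_ne (a : Kˣ) (h : ord a = 0) : res a h ≠ 0 := by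
  intro h0
  have := res_mul a a⁻¹ h (by rw [ord_inv, h, neg_zero]) (by rw [mul_inv_cancel, ord_of_mem (one_mem _)])
  rw [h0, zero_mul, res, IsLocalRing.residue_eq_zero_iff, IsLocalRing.mem_maximalIdeal] at this
  exact this (by convert isUnit_one; exact Units.mul_inv a)

/-- The second valuation of an element of valuation zero. -/
def ord' (a : Kˣ) (h : ord a = 0) : ℤ := -WithZero.log (w (res a h))

theorem w_res (a : Kˣ) (h : ord a = 0) : w (res a h) = WithZero.exp (-ord' a h) := by
  rw [ord', neg_neg, WithZero.exp_log ((Valuation.ne_zero_iff _).2 (res_ne a h))]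

theorem ord'_mul (a b : Kˣ) (ha : ord a = 0) (hb : ord b = 0) (h : ord (a * b) = 0) :
    ord' (a * b) h = ord' a ha + ord' b hb := by
  rw [ord', res_mul a b ha hb h, map_mul, WithZero.log_mul
    ((Valuation.ne_zero_iff _).2 (res_ne a ha)) ((Valuation.ne_zero_iff _).2 (res_ne b hb)), neg_add]
  rfl

theorem mem_OPrime_of_ord_eq (a : Kˣ) (h : ord a = 0) : (a : K) ∈ OPrime K ↔ 0 ≤ ord' a h := by
  have : (a : K) ∈ OPrime K ↔ res a h ∈ OKBar K := by
    rw [mem_OPrime]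
    exact ⟨fun ⟨_, h2⟩ => h2, fun h2 => ⟨(mem_OK_iff a).2 h.ge, h2⟩⟩
  rw [this, Valuation.mem_valuationSubring_iff, w_res, ← WithZero.exp_zero, WithZero.exp_le_exp]
  omega

theorem ord'_inv (a : Kˣ) (h : ord a = 0) (h' : ord a⁻¹ = 0) : ord' a⁻¹ h' = -ord' a h := by
  have h1 : ord (1 * 1 : Kˣ) = 0 := ord_of_mem (by rw [one_mul]; exact one_mem _)
  have h0 : ord (1 : Kˣ) = 0 := ord_of_mem (one_mem _)
  have e := ord'_mul 1 1 h0 h0 h1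
  have e2 := ord'_mul a a⁻¹ h h' (by rw [mul_inv_cancel]; exact h0)
  have e3 : ord' (1 * 1 : Kˣ) h1 = ord' (1 : Kˣ) h0 := by congr 1; exact one_mul _
  have e4 : ord' (a * a⁻¹) (by rw [mul_inv_cancel]; exact h0) = ord' (1 : Kˣ) h0 := by
    congr 1; exact mul_inv_cancel a
  omega

theorem mem_OUnits_iff (a : Kˣ) (h : ord a = 0) : a ∈ OUnits K ↔ ord' a h = 0 := by
  have h' : ord a⁻¹ = 0 := by rw [ord_inv, h, neg_zero]
  have : a ∈ OUnits K ↔ (a : K) ∈ OPrime K ∧ ((a⁻¹ : Kˣ) : K) ∈ OPrime K := Iff.rfl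
  rw [this, mem_OPrime_of_ord_eq a h, mem_OPrime_of_ord_eq a⁻¹ h', ord'_inv a h h']
  omega

theorem exists_uniformizer (K : Type*) [Field K] [TwoDimLocalField K] :
    ∃ (u : Kˣ) (h : ord u = 0), ord' u h = 1 := by
  obtain ⟨y, hy⟩ := TwoDimLocalField.w_surjective (K := K) (WithZero.exp (-1))
  obtain ⟨x, rfl⟩ := IsLocalRing.residue_surjective y
  have hx : IsUnit x := by
    by_contra hx
    rw [← mem_nonunits_iff, ← IsLocalRing.mem_maximalIdeal, ← IsLocalRing.residue_eq_zero_iff] at hx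
    rw [hx, map_zero] at hy
    exact WithZero.exp_ne_zero hy.symm
  obtain ⟨y, hxy⟩ := hx.exists_right_inv
  have hxy' : (x : K) * y = 1 := congrArg Subtype.val hxy
  have h : ord (Units.mk (x : K) y hxy' (by rw [mul_comm, hxy'])) = 0 := by
    have h1 := (mem_OK_iff (Units.mk (x : K) y hxy' (by rw [mul_comm, hxy']))).1 x.2
    have h2 := (mem_OK_iff (Units.mk (x : K) y hxy' (by rw [mul_comm, hxy']))⁻¹).1 y.2
    rw [ord_inv] at h2
    omega
  refine ⟨_, h, ?_⟩
  have : res _ h = IsLocalRing.residue (OK K) x := rfl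
  rw [ord', this]
  rw [hy, WithZero.log_exp]; rfl

variable (K) in
/-- An element of `K` whose residue is a uniformizer of the residue field. -/
def unif : Kˣ := (exists_uniformizer K).choose

theorem ord_unif : ord (unif K) = 0 := (exists_uniformizer K).choose_spec.choose
theorem ord'_unif : ord' (unif K) ord_unif = 1 := (exists_uniformizer K).choose_spec.choose_spec

theorem ord_zpow (a : Kˣ) (n : ℤ) : ord (a ^ n) = n * ord a := by
  exact (map_zsmul levK n (ν a)).trans (smul_eq_mul _ _)

theorem ord'_zpow (a : Kˣ) (h : ord a = 0) (n : ℤ) (hn : ord (a ^ n) = 0) :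
    ord' (a ^ n) hn = n * ord' a h := by
  induction n with
  | zero =>
    rw [zero_mul, ← mem_OUnits_iff, zpow_zero]
    exact one_mem _
  | succ n ih =>
    have h' : ord (a ^ (n : ℤ)) = 0 := by rw [ord_zpow, h, mul_zero]
    have := ord'_mul (a ^ (n : ℤ)) a h' h (by rw [ord_mul, h', h, add_zero])
    rw [ih h'] at this
    rw [add_mul, one_mul, ← this]
    congr 1
    exact zpow_add_one _ _
  | pred n ih =>
    have h' : ord (a ^ (-n : ℤ)) = 0 := by rw [ord_zpow, h, mul_zero]
    have := ord'_mul (a ^ (-(n : ℤ) - 1)) a hn h (by rw [ord_mul, hn, h, add_zero])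
    have e : ord' (a ^ (-(n : ℤ) - 1) * a) (by rw [ord_mul, hn, h, add_zero]) =
        ord' (a ^ (-n : ℤ)) h' := by
      congr 1
      rw [← zpow_add_one, sub_add_cancel]
    rw [e, ih h'] at this
    rw [sub_mul, one_mul]
    omega

/-- The extension `0 → ℤ → Γ_K → ℤ → 0`; the first map takes `1` to the class of a lift of a
uniformizer of the residue field. -/
instance : Ext2 (ΓK K) where
  emb := zmultiplesHom _ (ν (unif K))
  lev := levK
  emb_injective := by
    rw [injective_iff_map_eq_zero]
    intro n hn
    have hn : ν (unif K ^ n) = 0 := hn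
    have h0 : ord (unif K ^ n) = 0 := by rw [ord_zpow, ord_unif, mul_zero]
    rw [ν_eq_zero, mem_OUnits_iff _ h0, ord'_zpow _ ord_unif, ord'_unif, mul_one] at hn
    exact hn
  lev_surjective n := by
    obtain ⟨x, hx⟩ := TwoDimLocalField.v_surjective (K := K) (WithZero.exp (-n))
    have hx0 : x ≠ 0 := by
      rintro rfl
      rw [map_zero] at hx
      exact WithZero.exp_ne_zero hx.symm
    refine ⟨ν (Units.mk0 x hx0), ?_⟩
    rw [levK_ν, ord, Units.val_mk0, hx, WithZero.log_exp, neg_neg]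
  exact γ := by
    obtain ⟨a, rfl⟩ := ν_surjective γ
    rw [levK_ν]
    constructor
    · intro h
      refine ⟨ord' a h, ?_⟩
      have hu : ord (unif K ^ ord' a h) = 0 := by rw [ord_zpow, ord_unif, mul_zero]
      have hu' : ord (unif K ^ ord' a h)⁻¹ = 0 := by rw [ord_inv, hu, neg_zero]
      have h0 : ord (a * (unif K ^ ord' a h)⁻¹) = 0 := by rw [ord_mul, h, hu', add_zero]
      have : ν (a * (unif K ^ ord' a h)⁻¹) = 0 := by
        rw [ν_eq_zero, mem_OUnits_iff _ h0, ord'_mul a _ h hu', ord'_inv _ hu,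
          ord'_zpow _ ord_unif, ord'_unif]
        ring
      rw [ν_mul, ν_inv] at this
      exact (add_neg_eq_zero.1 this).symm
    · rintro ⟨n, hn⟩
      rw [← levK_ν, ← hn]
      refine (map_zsmul levK n (ν (unif K))).trans ?_
      rw [levK_ν, ord_unif, smul_zero]

theorem lev_ν (a : Kˣ) : (lev : ΓK K →+ ℤ) (ν a) = ord a := rfl

/-! ### The modules `𝒪'(α)` -/

theorem zero_le_iff (a : Kˣ) : (pt (0 : ΓK K) : Breve (ΓK K)) ≤ pt (ν a) ↔ (a : K) ∈ OPrime K := by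
  rw [pt_le_pt, map_zero, lev_ν]
  rcases lt_trichotomy (ord a) 0 with h | h | h
  · refine iff_of_false ?_ fun h' => ?_
    · rintro (h' | ⟨n, hn⟩)
      · omega
      · have := congrArg lev hn
        rw [zero_add, lev_emb, lev_ν] at this
        omega
    · have := (mem_OK_iff a).1 (mem_OPrime.1 h').1
      omega
  · rw [mem_OPrime_of_ord_eq a h]
    have key : ∀ n : ℤ, ν a = 0 + emb n ↔ ord' a h = n := fun n => by
      have hu : ord (unif K ^ n) = 0 := by rw [ord_zpow, ord_unif, mul_zero]
      have hu' : ord (unif K ^ n)⁻¹ = 0 := by rw [ord_inv, hu, neg_zero]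
      have h0 : ord (a * (unif K ^ n)⁻¹) = 0 := by rw [ord_mul, h, hu', add_zero]
      have e : ν a = 0 + emb n ↔ ν (a * (unif K ^ n)⁻¹) = 0 := by
        rw [ν_mul, ν_inv, zero_add]
        exact add_neg_eq_zero.symm
      rw [e, ν_eq_zero, mem_OUnits_iff _ h0, ord'_mul a _ h hu', ord'_inv _ hu,
        ord'_zpow _ ord_unif, ord'_unif, mul_one]
      omega
    constructor
    · rintro (h' | ⟨n, hn⟩)
      · omega
      · have := (key n).1 hn
        omega
    · intro h'
      exact Or.inr ⟨(ord' a h).toNat, (key _).2 (by omega)⟩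
  · refine iff_of_true (Or.inl h) (mem_OPrime.2 ⟨(mem_OK_iff a).2 h.le, ?_⟩)
    have : IsLocalRing.residue (OK K) ⟨a, (mem_OK_iff a).2 h.le⟩ = 0 := by
      rw [IsLocalRing.residue_eq_zero_iff, IsLocalRing.mem_maximalIdeal, mem_nonunits_iff]
      intro hu
      obtain ⟨y, hy⟩ := hu.exists_right_inv
      have hy : (a : K) * y = 1 := congrArg Subtype.val hy
      have hy' : ((a⁻¹ : Kˣ) : K) = y := by
        rw [← one_mul (y : K), ← Units.inv_mul a, mul_assoc, hy, mul_one]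
      have := (mem_OK_iff a⁻¹).1 (hy' ▸ y.2)
      rw [ord_inv] at this
      omega
    rw [this]
    exact zero_mem _

theorem ν_le_iff (a b : Kˣ) : (pt (ν a) : Breve (ΓK K)) ≤ pt (ν b) ↔ ((a⁻¹ * b : Kˣ) : K) ∈ OPrime K := by
  rw [← zero_le_iff, ← vadd_le_vadd (ν a) (a := pt 0), vadd_pt, vadd_pt, add_zero, ← ν_mul,
    mul_inv_cancel_left]

/-- The subgroup `𝒪'(α) = {0} ∪ {x : ν(x) ≥ α}` of `K`. -/
def O (α : Breve (ΓK K)) : AddSubgroup K where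
  carrier := {x | ∀ a : Kˣ, (a : K) = x → α ≤ pt (ν a)}
  zero_mem' a ha := (a.ne_zero ha).elim
  add_mem' {x y} hx hy c hc := by
    by_cases hx0 : x = 0
    · exact hy c (by rw [hc, hx0, zero_add])
    by_cases hy0 : y = 0
    · exact hx c (by rw [hc, hy0, add_zero])
    have key : ∀ a b : Kˣ, (c : K) = a + b → α ≤ pt (ν a) → pt (ν a) ≤ pt (ν b) → α ≤ pt (ν c) := by
      intro a b hab ha h
      refine ha.trans ((ν_le_iff a c).2 ?_)
      rw [Units.val_mul, hab, mul_add, Units.inv_mul]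
      exact add_mem (one_mem _) (by rw [← Units.val_mul]; exact (ν_le_iff a b).1 h)
    rcases le_total (pt (ν (Units.mk0 x hx0))) (pt (ν (Units.mk0 y hy0))) with h | h
    · exact key _ _ hc (hx _ rfl) h
    · exact key _ _ (hc.trans (add_comm _ _)) (hy _ rfl) h
  neg_mem' {x} hx c hc := by
    have h := hx (-c) (by rw [Units.val_neg, hc, neg_neg])
    refine h.trans ((ν_le_iff _ _).2 ?_)
    have : ((-c)⁻¹ * c : Kˣ) = -1 := by rw [inv_neg, neg_mul, inv_mul_cancel]
    rw [this, Units.val_neg, Units.val_one]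
    exact neg_mem (one_mem _)

theorem mem_O {α : Breve (ΓK K)} {x : K} : x ∈ O α ↔ ∀ a : Kˣ, (a : K) = x → α ≤ pt (ν a) := Iff.rfl

theorem O_anti {α β : Breve (ΓK K)} (h : α ≤ β) : O β ≤ O α := fun _ hx a ha => h.trans (hx a ha)

theorem mul_mem_O (g : Kˣ) {α α' : Breve (ΓK K)} (h : α' = ν g +ᵥ α) {x : K} (hx : x ∈ O α) :
    (g : K) * x ∈ O α' := by
  subst h
  intro a ha
  have := hx (g⁻¹ * a) (by rw [Units.val_mul, ha, Units.inv_mul_cancel_left])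
  rw [← vadd_le_vadd (ν g), vadd_pt, ← ν_mul, mul_inv_cancel_left] at this
  exact this

end Fields

section Measures

open Ext2 (emb lev)
open Breve

variable {K : Type*} [Field K] [TwoDimLocalField K]

/-! ### Partial topologies -/

/-- The quotient `𝒪'(a) / 𝒪'(b)`, for `a ≤ b`. -/
def Q (a b : Breve (ΓK K)) : Type _ := ↥(O a) ⧸ (O b).addSubgroupOf (O a)

instance (a b : Breve (ΓK K)) : AddCommGroup (Q a b) :=
  inferInstanceAs (AddCommGroup (↥(O a) ⧸ (O b).addSubgroupOf (O a)))

namespace Q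

/-- The projection `𝒪'(a) → 𝒪'(a) / 𝒪'(b)`. -/
def mk (a b : Breve (ΓK K)) : ↥(O a) →+ Q a b := QuotientAddGroup.mk' _

theorem mk_surjective (a b : Breve (ΓK K)) : Function.Surjective (mk a b) :=
  QuotientAddGroup.mk'_surjective _

/-- The map between such quotients that is induced by an additive map. -/
def map (s : K →+ K) {a b c d : Breve (ΓK K)} (h₁ : ∀ x ∈ O a, s x ∈ O c)
    (h₂ : ∀ x ∈ O b, s x ∈ O d) : Q a b →+ Q c d :=
  QuotientAddGroup.map _ _ ((s.comp (O a).subtype).codRestrict (O c) fun x => h₁ x x.2)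
    fun x hx => h₂ x hx

theorem map_mk (s : K →+ K) {a b c d : Breve (ΓK K)} (h₁ : ∀ x ∈ O a, s x ∈ O c)
    (h₂ : ∀ x ∈ O b, s x ∈ O d) (x : O a) : map s h₁ h₂ (mk a b x) = mk c d ⟨s x, h₁ x x.2⟩ := rfl

/-- The natural map `𝒪'(a) / 𝒪'(b) → 𝒪'(c) / 𝒪'(d)` for `c ≤ a` and `d ≤ b`. -/
def nat {a b c d : Breve (ΓK K)} (h₁ : c ≤ a) (h₂ : d ≤ b) : Q a b →+ Q c d :=
  map (AddMonoidHom.id K) (fun _ hx => O_anti h₁ hx) fun _ hx => O_anti h₂ hx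

/-- Multiplication by `g`, from `𝒪'(a) / 𝒪'(b)` to `g 𝒪'(a) / g 𝒪'(b)`. -/
def mul (g : Kˣ) {a b a' b' : Breve (ΓK K)} (ha : a' = ν g +ᵥ a) (hb : b' = ν g +ᵥ b) :
    Q a b →+ Q a' b' :=
  map (AddMonoidHom.mulLeft (g : K)) (fun _ hx => mul_mem_O g ha hx) fun _ hx => mul_mem_O g hb hx

end Q

theorem eq_vadd_inv {g : Kˣ} {a a' : Breve (ΓK K)} (h : a' = ν g +ᵥ a) : a = ν g⁻¹ +ᵥ a' := by
  rw [h, ν_inv, neg_vadd_vadd]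

theorem vadd_le_of_eq {γ : ΓK K} {a b a' b' : Breve (ΓK K)} (hab : a ≤ b) (ha : a' = γ +ᵥ a)
    (hb : b' = γ +ᵥ b) : a' ≤ b' := by
  rw [ha, hb]
  exact vadd_mono _ hab

theorem mem_O_zero {x : K} (h : x ∈ O (bot 0 : Breve (ΓK K))) : x ∈ OK K := by
  by_cases hx : x = 0
  · rw [hx]
    exact zero_mem _
  · exact (mem_OK_iff (Units.mk0 x hx)).2 (h (Units.mk0 x hx) rfl)

variable (K) in
/-- A partial topology on `K`. -/
class PartialTopology where
  /-- The topology on `𝒪(n) / 𝒪(m)` for `n ≤ m`. -/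
  top : ∀ n m : ℤ, TopologicalSpace (Q (bot n : Breve (ΓK K)) (bot m))
  isTopologicalAddGroup : ∀ {n m : ℤ}, n ≤ m →
    @IsTopologicalAddGroup (Q (bot n : Breve (ΓK K)) (bot m)) (top n m) _
  locallyCompact : ∀ {n m : ℤ}, n ≤ m →
    @LocallyCompactSpace (Q (bot n : Breve (ΓK K)) (bot m)) (top n m)
  totallyDisconnected : ∀ {n m : ℤ}, n ≤ m →
    @TotallyDisconnectedSpace (Q (bot n : Breve (ΓK K)) (bot m)) (top n m)
  /-- For `t` of valuation `n` the bijection `x ↦ t x` from the residue field of `K` to `𝒪(n) / 𝒪(n + 1)`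
  is a homeomorphism. -/
  residue : ∀ (n : ℤ) (t : Kˣ) (h₀ : (bot n : Breve (ΓK K)) = ν t +ᵥ bot 0)
    (h₁ : (bot (n + 1) : Breve (ΓK K)) = ν t +ᵥ bot 1),
    (top n (n + 1)).induced (fun x => Q.mul t h₀ h₁ (Q.mk (bot 0) (bot 1) x)) =
      (TwoDimLocalField.w (K := K)).subgroups_basis.topology.induced
        (fun x : ↥(O (bot 0 : Breve (ΓK K))) => IsLocalRing.residue (OK K) ⟨x, mem_O_zero x.2⟩)
  sub : ∀ {n m k : ℤ} (h : n ≤ m), m ≤ k →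
    top m k = (top n k).induced (Q.nat (bot_le_bot.2 h) le_rfl)
  quot : ∀ {n m k : ℤ}, n ≤ m → ∀ h : m ≤ k,
    top n m = (top n k).coinduced (Q.nat le_rfl (bot_le_bot.2 h))
  mul : ∀ {n m : ℤ}, n ≤ m → ∀ (g : Kˣ) {n' m' : ℤ} (hn : (bot n' : Breve (ΓK K)) = ν g +ᵥ bot n)
    (hm : (bot m' : Breve (ΓK K)) = ν g +ᵥ bot m),
    @IsHomeomorph _ _ (top n m) (top n' m') (Q.mul g hn hm)

variable [PartialTopology K]

/-- The topology of `𝒪'(a)` as a subspace of `𝒪(n) / 𝒪(m)`, that is pulled back from this quotient, where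
`n` is the greatest integer with `𝒪'(a) ⊆ 𝒪(n)` and `m` the least one with `𝒪(m) ⊆ 𝒪'(b)`. -/
@[reducible] def topO (a b : Breve (ΓK K)) : TopologicalSpace (O a) :=
  (PartialTopology.top (K := K) a.floor b.ceil).induced
    fun x : O a => Q.mk (K := K) (bot a.floor) (bot b.ceil) ⟨(x : K), O_anti (bot_floor_le a) x.2⟩

/-- The topology of `𝒪'(a) / 𝒪'(b)`: the quotient topology of the subspace topology. -/
instance topQ (a b : Breve (ΓK K)) : TopologicalSpace (Q a b) := (topO a b).coinduced (Q.mk a b)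

theorem Q.continuous_mul (g : Kˣ) {a b a' b' : Breve (ΓK K)} (hab : a ≤ b) (ha : a' = ν g +ᵥ a)
    (hb : b' = ν g +ᵥ b) : Continuous (Q.mul g ha hb) := by
  refine continuous_coinduced_dom.2 ?_
  have h1 : (bot a'.floor : Breve (ΓK K)) = ν g +ᵥ bot a.floor := by
    rw [ha, floor_vadd, vadd_bot]
  have h2 : (bot b'.ceil : Breve (ΓK K)) = ν g +ᵥ bot b.ceil := by
    rw [hb, ceil_vadd, vadd_bot]
  have hc := @IsHomeomorph.continuous _ _ (PartialTopology.top _ _) (PartialTopology.top _ _) _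
    (PartialTopology.mul (floor_le_ceil hab) g h1 h2)
  have hs : @Continuous _ _ (topO a b) (topO a' b')
      fun x : O a => (⟨(g : K) * x, mul_mem_O g ha x.2⟩ : O a') :=
    continuous_induced_rng.2 (@Continuous.comp _ _ _ (topO a b) (PartialTopology.top _ _)
      (PartialTopology.top _ _) _ _ hc continuous_induced_dom)
  exact @Continuous.comp _ _ _ (topO a b) (topO a' b') _ _ (Q.mk a' b') continuous_coinduced_rng hs

theorem Q.mul_inv_mul (g : Kˣ) {a b a' b' : Breve (ΓK K)} (ha : a' = ν g +ᵥ a)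
    (hb : b' = ν g +ᵥ b) (x : Q a b) :
    Q.mul g⁻¹ (eq_vadd_inv ha) (eq_vadd_inv hb) (Q.mul g ha hb x) = x := by
  obtain ⟨x, rfl⟩ := Q.mk_surjective a b x
  refine congrArg (Q.mk a b) (Subtype.ext ?_)
  exact Units.inv_mul_cancel_left g (x : K)

theorem Q.mul_mul_inv (g : Kˣ) {a b a' b' : Breve (ΓK K)} (ha : a' = ν g +ᵥ a)
    (hb : b' = ν g +ᵥ b) (x : Q a' b') :
    Q.mul g ha hb (Q.mul g⁻¹ (eq_vadd_inv ha) (eq_vadd_inv hb) x) = x := by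
  obtain ⟨x, rfl⟩ := Q.mk_surjective a' b' x
  refine congrArg (Q.mk a' b') (Subtype.ext ?_)
  exact Units.mul_inv_cancel_left g (x : K)

/-- Multiplication by `g` as a homeomorphism. -/
def Q.mulHomeo (g : Kˣ) {a b a' b' : Breve (ΓK K)} (hab : a ≤ b) (ha : a' = ν g +ᵥ a)
    (hb : b' = ν g +ᵥ b) : Q a b ≃ₜ Q a' b' where
  toFun := Q.mul g ha hb
  invFun := Q.mul g⁻¹ (eq_vadd_inv ha) (eq_vadd_inv hb)
  left_inv := Q.mul_inv_mul g ha hb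
  right_inv := Q.mul_mul_inv g ha hb
  continuous_toFun := Q.continuous_mul g hab ha hb
  continuous_invFun := Q.continuous_mul g⁻¹ (vadd_le_of_eq hab ha hb) _ _

/-! ### Functions and invariant measures on `𝒪'(a) / 𝒪'(b)` -/

/-- The space `𝒟(𝒪'(a) / 𝒪'(b))` of locally constant functions with compact support. Its elements are
regarded as functions on `𝒪'(a)`, extended by zero to `K`. -/
def Test (a b : Breve (ΓK K)) : Submodule ℂ (K → ℂ) where
  carrier := {f | (∀ x, x ∉ O a → f x = 0) ∧ ∃ g : Q a b → ℂ, IsLocallyConstant g ∧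
    HasCompactSupport g ∧ ∀ x : O a, f x = g (Q.mk a b x)}
  add_mem' := by
    rintro f f' ⟨h1, g, h2, h3, h4⟩ ⟨h1', g', h2', h3', h4'⟩
    refine ⟨fun x hx => ?_, g + g', h2.add h2', h3.add h3', fun x => ?_⟩
    · rw [Pi.add_apply, h1 x hx, h1' x hx, add_zero]
    · rw [Pi.add_apply, Pi.add_apply, h4, h4']
  zero_mem' := ⟨fun _ _ => rfl, 0, IsLocallyConstant.const 0, HasCompactSupport.zero, fun _ => rfl⟩
  smul_mem' := by
    rintro c f ⟨h1, g, h2, h3, h4⟩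
    refine ⟨fun x hx => ?_, c • g, h2.comp (c • ·), ?_, fun x => ?_⟩
    · rw [Pi.smul_apply, h1 x hx, smul_zero]
    · exact h3.comp_left (g := fun z : ℂ => c • z) (smul_zero c)
    · rw [Pi.smul_apply, Pi.smul_apply, h4]

/-- The action of `g`, which takes `f` to `x ↦ f(g⁻¹ x)`. -/
def Test.mul (g : Kˣ) {a b a' b' : Breve (ΓK K)} (hab : a ≤ b) (ha : a' = ν g +ᵥ a)
    (hb : b' = ν g +ᵥ b) : Test a b →ₗ[ℂ] Test a' b' where
  toFun f := ⟨fun x => f.1 (((g⁻¹ : Kˣ) : K) * x), by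
    obtain ⟨f, h1, F, h2, h3, h4⟩ := f
    refine ⟨fun x hx => h1 _ fun h => hx ?_, F ∘ (Q.mulHomeo g hab ha hb).symm,
      h2.comp_continuous (Q.mulHomeo g hab ha hb).symm.continuous,
      h3.comp_homeomorph (Q.mulHomeo g hab ha hb).symm, fun x => ?_⟩
    · have := mul_mem_O g ha h
      rwa [Units.mul_inv_cancel_left] at this
    · exact h4 ⟨((g⁻¹ : Kˣ) : K) * x, mul_mem_O g⁻¹ (eq_vadd_inv ha) x.2⟩⟩
  map_add' _ _ := rfl
  map_smul' _ _ := rfl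

theorem Test.mul_apply (g : Kˣ) {a b a' b' : Breve (ΓK K)} (hab : a ≤ b) (ha : a' = ν g +ᵥ a)
    (hb : b' = ν g +ᵥ b) (f : Test a b) (x : K) :
    (Test.mul g hab ha hb f).1 x = f.1 (((g⁻¹ : Kˣ) : K) * x) := rfl

theorem Test.mul_mul_inv (g : Kˣ) {a b a' b' : Breve (ΓK K)} (hab : a ≤ b) (hab' : a' ≤ b')
    (ha : a' = ν g +ᵥ a) (hb : b' = ν g +ᵥ b) (ha' : a = ν g⁻¹ +ᵥ a') (hb' : b = ν g⁻¹ +ᵥ b')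
    (f : Test a' b') : Test.mul g hab ha hb (Test.mul g⁻¹ hab' ha' hb' f) = f :=
  Subtype.ext <| funext fun x => congrArg f.1 (Units.mul_inv_cancel_left g⁻¹ x |>.symm ▸ by
    rw [inv_inv, Units.mul_inv_cancel_left])

theorem Test.inv_mul_mul (g : Kˣ) {a b a' b' : Breve (ΓK K)} (hab : a ≤ b) (hab' : a' ≤ b')
    (ha : a' = ν g +ᵥ a) (hb : b' = ν g +ᵥ b) (ha' : a = ν g⁻¹ +ᵥ a') (hb' : b = ν g⁻¹ +ᵥ b')
    (f : Test a b) : Test.mul g⁻¹ hab' ha' hb' (Test.mul g hab ha hb f) = f :=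
  Subtype.ext <| funext fun x => congrArg f.1 (by rw [inv_inv, Units.inv_mul_cancel_left])

/-- The space of the invariant complex-valued measures on `𝒪'(a) / 𝒪'(b)`, which is `μ(b, a)` for
`a ≤ b`; a measure is given by the integrals of the functions from `𝒟(𝒪'(a) / 𝒪'(b))`. -/
def Meas (a b : Breve (ΓK K)) : Submodule ℂ (Module.Dual ℂ (Test a b)) where
  carrier := {m | ∀ c ∈ O a, ∀ f f' : Test a b, (∀ x, f'.1 x = f.1 (x + c)) → m f' = m f}
  add_mem' {m m'} h h' c hc f f' hf := by
    rw [LinearMap.add_apply, LinearMap.add_apply, h c hc f f' hf, h' c hc f f' hf]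
  zero_mem' _ _ _ _ _ := rfl
  smul_mem' s m h c hc f f' hf := by
    rw [LinearMap.smul_apply, LinearMap.smul_apply, h c hc f f' hf]

/-- The action of `g` on invariant measures. -/
def Meas.mul (g : Kˣ) {a b a' b' : Breve (ΓK K)} (hab : a ≤ b) (ha : a' = ν g +ᵥ a)
    (hb : b' = ν g +ᵥ b) : Meas a b →ₗ[ℂ] Meas a' b' where
  toFun m := ⟨m.1 ∘ₗ Test.mul g⁻¹ (vadd_le_of_eq hab ha hb) (eq_vadd_inv ha) (eq_vadd_inv hb),
    fun c hc f f' hf => m.2 _ (mul_mem_O g⁻¹ (eq_vadd_inv ha) hc) _ _ fun x => by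
      rw [Test.mul_apply, Test.mul_apply, hf, inv_inv, mul_add, Units.mul_inv_cancel_left]⟩
  map_add' _ _ := rfl
  map_smul' _ _ := rfl

theorem Meas.mul_apply (g : Kˣ) {a b a' b' : Breve (ΓK K)} (hab : a ≤ b) (ha : a' = ν g +ᵥ a)
    (hb : b' = ν g +ᵥ b) (m : Meas a b) (f : Test a b) :
    (Meas.mul g hab ha hb m).1 (Test.mul g hab ha hb f) = m.1 f :=
  congrArg m.1 (Test.inv_mul_mul g hab _ ha hb _ _ f)

theorem Meas.mul_mul_inv (g : Kˣ) {a b a' b' : Breve (ΓK K)} (hab : a ≤ b) (hab' : a' ≤ b')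
    (ha : a' = ν g +ᵥ a) (hb : b' = ν g +ᵥ b) (ha' : a = ν g⁻¹ +ᵥ a') (hb' : b = ν g⁻¹ +ᵥ b')
    (m : Meas a' b') : Meas.mul g hab ha hb (Meas.mul g⁻¹ hab' ha' hb' m) = m :=
  Subtype.ext <| LinearMap.ext fun f => congrArg m.1 <| Subtype.ext <| funext fun x => by
    rw [Test.mul_apply, Test.mul_apply, inv_inv, Units.mul_inv_cancel_left]

theorem Meas.inv_mul_mul (g : Kˣ) {a b a' b' : Breve (ΓK K)} (hab : a ≤ b) (hab' : a' ≤ b')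
    (ha : a' = ν g +ᵥ a) (hb : b' = ν g +ᵥ b) (ha' : a = ν g⁻¹ +ᵥ a') (hb' : b = ν g⁻¹ +ᵥ b')
    (m : Meas a b) : Meas.mul g⁻¹ hab' ha' hb' (Meas.mul g hab ha hb m) = m :=
  Subtype.ext <| LinearMap.ext fun f => congrArg m.1 <| Subtype.ext <| funext fun x => by
    rw [Test.mul_apply, Test.mul_apply, inv_inv, inv_inv, Units.inv_mul_cancel_left]

/-- The function `f'` on `𝒪'(a) / 𝒪'(b)` is the direct image of the restriction to `𝒪'(a) / 𝒪'(c)` of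
the function `f` on `𝒪'(a') / 𝒪'(c)`, where `a' ≤ a ≤ b ≤ c`, along the measure `m` on
`𝒪'(b) / 𝒪'(c)`: `f'(x) = ∫ f(x + y) dm(y)` for `x ∈ 𝒪'(a)`. -/
def IsDirectImage {a' a b c : Breve (ΓK K)} (f : Test a' c) (m : Meas b c) (f' : Test a b) : Prop :=
  ∀ x ∈ O a, ∃ φ : Test b c, (∀ y ∈ O b, φ.1 y = f.1 (x + y)) ∧ f'.1 x = m.1 φ

/-- For `a ≤ b ≤ c` the measure `n` on `𝒪'(a) / 𝒪'(c)` is the product of the measures `l` on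
`𝒪'(a) / 𝒪'(b)` and `m` on `𝒪'(b) / 𝒪'(c)`. -/
def IsProd {a b c : Breve (ΓK K)} (l : Meas a b) (m : Meas b c) (n : Meas a c) : Prop :=
  ∀ f : Test a c, ∃ f' : Test a b, IsDirectImage f m f' ∧ n.1 f = l.1 f'

theorem IsDirectImage.mul (g : Kˣ) {a₁ a b c a₁' a' b' c' : Breve (ΓK K)} (h₁ : a₁ ≤ c)
    (hbc : b ≤ c) (hab : a ≤ b) (e₁ : a₁' = ν g +ᵥ a₁) (ea : a' = ν g +ᵥ a) (eb : b' = ν g +ᵥ b)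
    (ec : c' = ν g +ᵥ c) {f : Test a₁ c} {m : Meas b c} {f' : Test a b}
    (h : IsDirectImage f m f') :
    IsDirectImage (Test.mul g h₁ e₁ ec f) (Meas.mul g hbc eb ec m) (Test.mul g hab ea eb f') := by
  intro x hx
  obtain ⟨φ, h1, h2⟩ := h _ (mul_mem_O g⁻¹ (eq_vadd_inv ea) hx)
  refine ⟨Test.mul g hbc eb ec φ, fun y hy => ?_, ?_⟩
  · rw [Test.mul_apply, Test.mul_apply, h1 _ (mul_mem_O g⁻¹ (eq_vadd_inv eb) hy), mul_add]
  · rw [Meas.mul_apply, Test.mul_apply, h2]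

theorem IsProd.mul (g : Kˣ) {a b c a' b' c' : Breve (ΓK K)} (hac : a ≤ c) (hbc : b ≤ c)
    (hab : a ≤ b) (ea : a' = ν g +ᵥ a) (eb : b' = ν g +ᵥ b) (ec : c' = ν g +ᵥ c) {l : Meas a b}
    {m : Meas b c} {n : Meas a c} (h : IsProd l m n) :
    IsProd (Meas.mul g hab ea eb l) (Meas.mul g hbc eb ec m) (Meas.mul g hac ea ec n) := by
  intro f
  obtain ⟨f', h1, h2⟩ := h (Test.mul g⁻¹ (vadd_le_of_eq hac ea ec) (eq_vadd_inv ea)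
    (eq_vadd_inv ec) f)
  refine ⟨Test.mul g hab ea eb f', ?_, ?_⟩
  · have := h1.mul g hac hbc hab ea ea eb ec
    rwa [Test.mul_mul_inv] at this
  · rw [Meas.mul_apply, ← h2]
    rfl

/-- The graph of the linear map that takes a measure on `𝒪'(b) / 𝒪'(c)` to its product with `l`. -/
def prodGraph {a b : Breve (ΓK K)} (c : Breve (ΓK K)) (l : Meas a b) :
    Submodule ℂ (Meas b c × Meas a c) := Submodule.span ℂ {p | IsProd l p.1 p.2}

theorem prodGraph_mul (g : Kˣ) {a b c a' b' c' : Breve (ΓK K)} (hac : a ≤ c) (hbc : b ≤ c)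
    (hab : a ≤ b) (ea : a' = ν g +ᵥ a) (eb : b' = ν g +ᵥ b) (ec : c' = ν g +ᵥ c) {l : Meas a b}
    {m : Meas b c} {n : Meas a c} (h : (m, n) ∈ prodGraph c l) :
    (Meas.mul g hbc eb ec m, Meas.mul g hac ea ec n) ∈
      prodGraph c' (Meas.mul g hab ea eb l) := by
  have key : prodGraph c l ≤ (prodGraph c' (Meas.mul g hab ea eb l)).comap
      ((Meas.mul g hbc eb ec).prodMap (Meas.mul g hac ea ec)) :=
    Submodule.span_le.2 fun p hp =>
      Submodule.subset_span (IsProd.mul g hac hbc hab ea eb ec hp)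
  exact key h

/-! ### The lines `μ(α, β)` -/

/-- The line `μ(α, β)`. Since `μ(δ, δ) = ℂ` and `μ(β, δ) ≅ μ(β, α) ⊗ μ(α, δ)`, an element of `μ(α, β)` is
the same as a compatible family of linear maps `μ(β, δ) → μ(α, δ)` for all `δ ≤ α, β`. The map with
`δ = β` identifies this space with the space of measures on `𝒪'(β) / 𝒪'(α)` if `α ≥ β`, and the
map with `δ = α` identifies it with the dual of the space of measures on `𝒪'(α) / 𝒪'(β)` if
`α ≤ β`. -/
def Mu (α β : Breve (ΓK K)) :
    Submodule ℂ (∀ δ : {δ : Breve (ΓK K) // δ ≤ α ∧ δ ≤ β}, Meas δ.1 β →ₗ[ℂ] Meas δ.1 α) where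
  carrier := {φ | ∀ ε δ : {δ : Breve (ΓK K) // δ ≤ α ∧ δ ≤ β}, ε.1 ≤ δ.1 →
    ∀ (l : Meas ε.1 δ.1) (m : Meas δ.1 β) (n : Meas ε.1 β), (m, n) ∈ prodGraph β l →
      (φ δ m, φ ε n) ∈ prodGraph α l}
  add_mem' h h' ε δ hεδ l m n hp := add_mem (h ε δ hεδ l m n hp) (h' ε δ hεδ l m n hp)
  zero_mem' _ _ _ _ _ _ _ := zero_mem _
  smul_mem' c _ h ε δ hεδ l m n hp := Submodule.smul_mem _ c (h ε δ hεδ l m n hp)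

end Measures

section Spaces

open Ext2 (emb lev)
open Breve

variable {K : Type*} [Field K] [TwoDimLocalField K] [PartialTopology K]

theorem Mu.aux (g : Kˣ) {α β α' β' : Breve (ΓK K)} (hα : α' = ν g +ᵥ α) (hβ : β' = ν g +ᵥ β)
    {δ : Breve (ΓK K)} (h : δ ≤ α' ∧ δ ≤ β') : ν g⁻¹ +ᵥ δ ≤ α ∧ ν g⁻¹ +ᵥ δ ≤ β :=
  ⟨vadd_le_of_eq h.1 rfl (eq_vadd_inv hα), vadd_le_of_eq h.2 rfl (eq_vadd_inv hβ)⟩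

theorem vadd_vadd_inv (g : Kˣ) (δ : Breve (ΓK K)) : δ = ν g +ᵥ (ν g⁻¹ +ᵥ δ) := by
  rw [ν_inv, vadd_neg_vadd]

/-- The action of `g` on these lines. -/
def Mu.mul (g : Kˣ) {α β α' β' : Breve (ΓK K)} (hα : α' = ν g +ᵥ α) (hβ : β' = ν g +ᵥ β) :
    Mu α β →ₗ[ℂ] Mu α' β' where
  toFun φ := ⟨fun δ => Meas.mul g (Mu.aux g hα hβ δ.2).1 (vadd_vadd_inv g δ.1) hα ∘ₗ
      φ.1 ⟨ν g⁻¹ +ᵥ δ.1, Mu.aux g hα hβ δ.2⟩ ∘ₗ Meas.mul g⁻¹ δ.2.2 rfl (eq_vadd_inv hβ), by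
    intro ε δ hεδ l m n hp
    have h1 := prodGraph_mul g⁻¹ ε.2.2 δ.2.2 hεδ rfl rfl (eq_vadd_inv hβ) hp
    have h2 := φ.2 ⟨ν g⁻¹ +ᵥ ε.1, Mu.aux g hα hβ ε.2⟩ ⟨ν g⁻¹ +ᵥ δ.1, Mu.aux g hα hβ δ.2⟩
      (vadd_mono _ hεδ) _ _ _ h1
    have h3 := prodGraph_mul g (Mu.aux g hα hβ ε.2).1 (Mu.aux g hα hβ δ.2).1 (vadd_mono _ hεδ)
      (vadd_vadd_inv g ε.1) (vadd_vadd_inv g δ.1) hα h2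
    rw [Meas.mul_mul_inv] at h3
    exact h3⟩
  map_add' φ ψ := Subtype.ext <| funext fun δ => LinearMap.ext fun m =>
    (Meas.mul g (Mu.aux g hα hβ δ.2).1 (vadd_vadd_inv g δ.1) hα).map_add _ _
  map_smul' c φ := Subtype.ext <| funext fun δ => LinearMap.ext fun m =>
    (Meas.mul g (Mu.aux g hα hβ δ.2).1 (vadd_vadd_inv g δ.1) hα).map_smul c _

theorem Mu.mul_apply (g : Kˣ) {α β α' β' : Breve (ΓK K)} (hα : α' = ν g +ᵥ α)
    (hβ : β' = ν g +ᵥ β) (φ : Mu α β) {δ δ₀ : Breve (ΓK K)} (h : δ ≤ α' ∧ δ ≤ β')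
    (h₀ : δ₀ ≤ α ∧ δ₀ ≤ β) (hδ : δ = ν g +ᵥ δ₀) (m : Meas δ β') :
    (Mu.mul g hα hβ φ).1 ⟨δ, h⟩ m = Meas.mul g h₀.1 hδ hα
      (φ.1 ⟨δ₀, h₀⟩ (Meas.mul g⁻¹ h.2 (eq_vadd_inv hδ) (eq_vadd_inv hβ) m)) := by
  obtain rfl : δ₀ = ν g⁻¹ +ᵥ δ := eq_vadd_inv hδ
  rfl

/-- The element `z` of `μ(α, γ)` is the product of `x ∈ μ(α, β)` and `y ∈ μ(β, γ)`. -/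
def IsMul {α β γ : Breve (ΓK K)} (x : Mu α β) (y : Mu β γ) (z : Mu α γ) : Prop :=
  ∀ (δ : Breve (ΓK K)) (hα : δ ≤ α) (hβ : δ ≤ β) (hγ : δ ≤ γ) (m : Meas δ γ),
    z.1 ⟨δ, hα, hγ⟩ m = x.1 ⟨δ, hα, hβ⟩ (y.1 ⟨δ, hβ, hγ⟩ m)

/-- The element `x` of `μ(b, a)`, where `a ≤ b`, is the measure `l` on `𝒪'(a) / 𝒪'(b)`. -/
def IsMeas {a b : Breve (ΓK K)} (l : Meas a b) (x : Mu b a) : Prop :=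
  ∀ (δ : Breve (ΓK K)) (h : δ ≤ b ∧ δ ≤ a) (u : Meas δ a), IsProd u l (x.1 ⟨δ, h⟩ u)

theorem IsMul.mul (g : Kˣ) {α β γ α' β' γ' : Breve (ΓK K)} (hα : α' = ν g +ᵥ α)
    (hβ : β' = ν g +ᵥ β) (hγ : γ' = ν g +ᵥ γ) {x : Mu α β} {y : Mu β γ} {z : Mu α γ}
    (h : IsMul x y z) : IsMul (Mu.mul g hα hβ x) (Mu.mul g hβ hγ y) (Mu.mul g hα hγ z) := by
  intro δ h1 h2 h3 m
  have k1 : ν g⁻¹ +ᵥ δ ≤ α := vadd_le_of_eq h1 rfl (eq_vadd_inv hα)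
  have k2 : ν g⁻¹ +ᵥ δ ≤ β := vadd_le_of_eq h2 rfl (eq_vadd_inv hβ)
  have k3 : ν g⁻¹ +ᵥ δ ≤ γ := vadd_le_of_eq h3 rfl (eq_vadd_inv hγ)
  have e1 := Mu.mul_apply g hα hγ z ⟨h1, h3⟩ ⟨k1, k3⟩ (vadd_vadd_inv g δ) m
  have e2 := Mu.mul_apply g hβ hγ y ⟨h2, h3⟩ ⟨k2, k3⟩ (vadd_vadd_inv g δ) m
  have e3 := Mu.mul_apply g hα hβ x ⟨h1, h2⟩ ⟨k1, k2⟩ (vadd_vadd_inv g δ)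
    ((Mu.mul g hβ hγ y).1 ⟨δ, h2, h3⟩ m)
  refine e1.trans (Eq.trans ?_ e3.symm)
  rw [e2, Meas.inv_mul_mul]
  exact congrArg _ (h _ k1 k2 k3 _)

theorem IsMeas.mul (g : Kˣ) {a b a' b' : Breve (ΓK K)} (hab : a ≤ b) (ha : a' = ν g +ᵥ a)
    (hb : b' = ν g +ᵥ b) {l : Meas a b} {x : Mu b a} (h : IsMeas l x) :
    IsMeas (Meas.mul g hab ha hb l) (Mu.mul g hb ha x) := by
  intro δ hδ u
  have k : ν g⁻¹ +ᵥ δ ≤ b ∧ ν g⁻¹ +ᵥ δ ≤ a := Mu.aux g hb ha hδ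
  rw [Mu.mul_apply g hb ha x _ k (vadd_vadd_inv g δ)]
  have := IsProd.mul g k.1 hab k.2 (vadd_vadd_inv g δ) ha hb
    (h _ k (Meas.mul g⁻¹ hδ.2 rfl (eq_vadd_inv ha) u))
  rwa [Meas.mul_mul_inv] at this

/-! ### The spaces `𝒟_α(K)` and `𝒟'_α(K)` -/

/-- The set of the pairs `n ≤ m` of integers. -/
abbrev Idx : Type := {p : ℤ × ℤ // p.1 ≤ p.2}

variable (K) in
/-- The space `𝒟(𝒪(n) / 𝒪(m))`. -/
abbrev TestI (p : Idx) : Submodule ℂ (K → ℂ) := Test (bot p.1.1 : Breve (ΓK K)) (bot p.1.2)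

/-- The space `𝒟(𝒪(n) / 𝒪(m)) ⊗ μ(m, α)`. -/
def XK (α : Breve (ΓK K)) (p : Idx) : Type _ := TestI K p ⊗[ℂ] Mu (bot p.1.2) α

instance (α : Breve (ΓK K)) (p : Idx) : AddCommGroup (XK α p) :=
  inferInstanceAs (AddCommGroup (TestI K p ⊗[ℂ] Mu (bot p.1.2) α))

instance (α : Breve (ΓK K)) (p : Idx) : Module ℂ (XK α p) :=
  inferInstanceAs (Module ℂ (TestI K p ⊗[ℂ] Mu (bot p.1.2) α))

/-- The tensor `f ⊗ m`. -/
def XK.tmul {α : Breve (ΓK K)} {p : Idx} (f : TestI K p) (m : Mu (bot p.1.2) α) : XK α p := f ⊗ₜ m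

/-- The graph of the transition map
`𝒟(𝒪(n') / 𝒪(m')) ⊗ μ(m', α) → 𝒟(𝒪(n) / 𝒪(m)) ⊗ μ(m, α)` for `n' ≤ n ≤ m ≤ m'`: if `s` is a measure on
`𝒪(m) / 𝒪(m')`, an element of `μ(m', m)`, then `f ⊗ (s ⊗ μ)` is taken to `f' ⊗ μ`, where `f'` is the
direct image along `s` of the restriction of `f`. -/
def transGraph (α : Breve (ΓK K)) (p' p : Idx) : Submodule ℂ (XK α p' × XK α p) :=
  Submodule.span ℂ {z | ∃ (f : TestI K p') (f' : TestI K p)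
    (s : Meas (bot p.1.2 : Breve (ΓK K)) (bot p'.1.2)) (x : Mu (bot p'.1.2) (bot p.1.2))
    (m : Mu (bot p.1.2) α) (m' : Mu (bot p'.1.2) α),
    IsDirectImage f s f' ∧ IsMeas s x ∧ IsMul x m m' ∧ z = (XK.tmul f m', XK.tmul f' m)}

/-- The space `𝒟_α(K)`: the projective limit of the spaces `𝒟(𝒪(n) / 𝒪(m)) ⊗ μ(m, α)`. -/
def DK (α : Breve (ΓK K)) : Submodule ℂ (∀ p, XK α p) where
  carrier := {F | ∀ p' p : Idx, p'.1.1 ≤ p.1.1 → p.1.2 ≤ p'.1.2 → (F p', F p) ∈ transGraph α p' p}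
  add_mem' h h' p' p h₁ h₂ := add_mem (h p' p h₁ h₂) (h' p' p h₁ h₂)
  zero_mem' _ _ _ _ := zero_mem _
  smul_mem' c _ h p' p h₁ h₂ := Submodule.smul_mem _ c (h p' p h₁ h₂)

theorem eq_unit_vadd (g : OUnits K) (a : Breve (ΓK K)) : a = ν (g : Kˣ) +ᵥ a := by
  rw [ν_eq_zero.2 g.2, zero_vadd]

/-- The action of `g ∈ (𝒪'_K)^*` on `𝒟(𝒪(n) / 𝒪(m)) ⊗ μ(m, α)`. -/
def actX (α : Breve (ΓK K)) (g : OUnits K) (p : Idx) : XK α p →ₗ[ℂ] XK α p :=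
  TensorProduct.map
    (Test.mul (g : Kˣ) (bot_le_bot.2 p.2) (eq_unit_vadd g _) (eq_unit_vadd g _))
    (Mu.mul (g : Kˣ) (eq_unit_vadd g _) (eq_unit_vadd g _))

theorem bot_mono {n m : ℤ} (h : n ≤ m) : (bot n : Breve (ΓK K)) ≤ bot m := h

theorem actX_transGraph (α : Breve (ΓK K)) (g : OUnits K) {p' p : Idx} (h₁ : p'.1.1 ≤ p.1.1)
    (h₂ : p.1.2 ≤ p'.1.2) {x y} (h : (x, y) ∈ transGraph α p' p) :
    (actX α g p' x, actX α g p y) ∈ transGraph α p' p := by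
  have key : transGraph α p' p ≤ (transGraph α p' p).comap
      ((actX α g p').prodMap (actX α g p)) := by
    refine Submodule.span_le.2 ?_
    rintro _ ⟨f, f', s, x, m, m', hf, hs, hm, rfl⟩
    refine Submodule.subset_span ⟨_, _, _, _, _, _,
      hf.mul (g : Kˣ) (bot_mono p'.2) (bot_mono h₂) (bot_mono p.2) (eq_unit_vadd g _)
        (eq_unit_vadd g _) (eq_unit_vadd g _) (eq_unit_vadd g _),
      hs.mul (g : Kˣ) (bot_mono h₂) (eq_unit_vadd g _) (eq_unit_vadd g _),
      hm.mul (g : Kˣ) (eq_unit_vadd g _) (eq_unit_vadd g _) (eq_unit_vadd g _), ?_⟩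
    rfl
  exact key h

theorem Test.mul_one' {a b : Breve (ΓK K)} (hab : a ≤ b) (ha : a = ν (1 : Kˣ) +ᵥ a)
    (hb : b = ν (1 : Kˣ) +ᵥ b) : Test.mul 1 hab ha hb = LinearMap.id :=
  LinearMap.ext fun f => Subtype.ext <| funext fun x => by
    rw [Test.mul_apply, inv_one, Units.val_one, one_mul]; rfl

theorem Test.mul_mul' (g h : Kˣ) {a b a' b' a'' b'' : Breve (ΓK K)} (hab : a ≤ b) (hab' : a' ≤ b')
    (ha : a' = ν h +ᵥ a) (hb : b' = ν h +ᵥ b) (ha' : a'' = ν g +ᵥ a') (hb' : b'' = ν g +ᵥ b')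
    (ha'' : a'' = ν (g * h) +ᵥ a) (hb'' : b'' = ν (g * h) +ᵥ b) :
    Test.mul (g * h) hab ha'' hb'' = Test.mul g hab' ha' hb' ∘ₗ Test.mul h hab ha hb :=
  LinearMap.ext fun f => Subtype.ext <| funext fun x => by
    rw [LinearMap.comp_apply, Test.mul_apply, Test.mul_apply, Test.mul_apply, mul_inv_rev,
      Units.val_mul, mul_assoc]

theorem Meas.mul_one' {a b : Breve (ΓK K)} (hab : a ≤ b) (ha : a = ν (1 : Kˣ) +ᵥ a)
    (hb : b = ν (1 : Kˣ) +ᵥ b) (m : Meas a b) : Meas.mul 1 hab ha hb m = m :=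
  Subtype.ext <| LinearMap.ext fun f => congrArg m.1 <| Subtype.ext <| funext fun x => by
    rw [Test.mul_apply, inv_one, inv_one, Units.val_one, one_mul]

theorem Meas.mul_mul' (g h : Kˣ) {a b a' b' a'' b'' : Breve (ΓK K)} (hab : a ≤ b) (hab' : a' ≤ b')
    (ha : a' = ν h +ᵥ a) (hb : b' = ν h +ᵥ b) (ha' : a'' = ν g +ᵥ a') (hb' : b'' = ν g +ᵥ b')
    (ha'' : a'' = ν (g * h) +ᵥ a) (hb'' : b'' = ν (g * h) +ᵥ b) (m : Meas a b) :
    Meas.mul (g * h) hab ha'' hb'' m = Meas.mul g hab' ha' hb' (Meas.mul h hab ha hb m) :=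
  Subtype.ext <| LinearMap.ext fun f => congrArg m.1 <| Subtype.ext <| funext fun x => by
    rw [Test.mul_apply, Test.mul_apply, Test.mul_apply, inv_inv, inv_inv, inv_inv, Units.val_mul,
      mul_assoc]

theorem Mu.mul_one' {α β : Breve (ΓK K)} (hα : α = ν (1 : Kˣ) +ᵥ α) (hβ : β = ν (1 : Kˣ) +ᵥ β) :
    Mu.mul 1 hα hβ = LinearMap.id :=
  LinearMap.ext fun φ => Subtype.ext <| funext fun δ => LinearMap.ext fun m => by
    rw [Mu.mul_apply 1 hα hβ φ δ.2 δ.2 (by rw [ν_one, zero_vadd]), Meas.mul_one']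
    refine congrArg (φ.1 δ) ?_
    exact Subtype.ext <| LinearMap.ext fun f => congrArg m.1 <| Subtype.ext <| funext fun x => by
      rw [Test.mul_apply, inv_inv, inv_one, Units.val_one, one_mul]

theorem Mu.mul_mul' (g h : Kˣ) {α β α' β' α'' β'' : Breve (ΓK K)}
    (hα : α' = ν h +ᵥ α) (hβ : β' = ν h +ᵥ β) (hα' : α'' = ν g +ᵥ α') (hβ' : β'' = ν g +ᵥ β')
    (hα'' : α'' = ν (g * h) +ᵥ α) (hβ'' : β'' = ν (g * h) +ᵥ β) :
    Mu.mul (g * h) hα'' hβ'' = Mu.mul g hα' hβ' ∘ₗ Mu.mul h hα hβ :=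
  LinearMap.ext fun φ => Subtype.ext <| funext fun ⟨δ, hδ⟩ => LinearMap.ext fun m => by
    have k1 := Mu.aux g hα' hβ' hδ
    have k2 := Mu.aux h hα hβ k1
    have e1 := Mu.mul_apply (g * h) hα'' hβ'' φ hδ k2
      (by rw [ν_mul, add_vadd, ← vadd_vadd_inv, ← vadd_vadd_inv]) m
    have e2 := Mu.mul_apply g hα' hβ' (Mu.mul h hα hβ φ) hδ k1 (vadd_vadd_inv g _) m
    have e3 := Mu.mul_apply h hα hβ φ k1 k2 (vadd_vadd_inv h _)
      (Meas.mul g⁻¹ hδ.2 rfl (eq_vadd_inv hβ') m)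
    refine e1.trans (Eq.trans ?_ e2.symm)
    rw [e3]
    have e4 : Meas.mul (g * h)⁻¹ hδ.2
        (by rw [mul_inv_rev, ν_mul, add_vadd]) (eq_vadd_inv hβ'') m =
        Meas.mul h⁻¹ k1.2 rfl (eq_vadd_inv hβ) (Meas.mul g⁻¹ hδ.2 rfl (eq_vadd_inv hβ') m) :=
      Subtype.ext <| LinearMap.ext fun f => congrArg m.1 <| Subtype.ext <| funext fun x => by
        rw [Test.mul_apply, Test.mul_apply, Test.mul_apply, inv_inv, inv_inv, inv_inv,
          mul_inv_rev, Units.val_mul, mul_assoc]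
    rw [e4]
    exact Meas.mul_mul' g h k2.1 k1.1 (vadd_vadd_inv h _) hα (vadd_vadd_inv g _) hα' _ _ _

theorem XK.hom_ext {α : Breve (ΓK K)} {p : Idx} {V : Type*} [AddCommGroup V] [Module ℂ V]
    {A B : XK α p →ₗ[ℂ] V} (h : ∀ f m, A (XK.tmul f m) = B (XK.tmul f m)) : A = B :=
  TensorProduct.ext' h

theorem actX_tmul (α : Breve (ΓK K)) (g : OUnits K) (p : Idx) (f : TestI K p)
    (m : Mu (bot p.1.2) α) : actX α g p (XK.tmul f m) = XK.tmul
      (Test.mul (g : Kˣ) (bot_le_bot.2 p.2) (eq_unit_vadd g _) (eq_unit_vadd g _) f)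
      (Mu.mul (g : Kˣ) (eq_unit_vadd g _) (eq_unit_vadd g _) m) := rfl

theorem actX_one (α : Breve (ΓK K)) (p : Idx) : actX α 1 p = LinearMap.id :=
  XK.hom_ext fun f m => by
    rw [actX_tmul]
    exact congrArg₂ XK.tmul
      (LinearMap.congr_fun (Test.mul_one' (bot_mono p.2) (eq_unit_vadd 1 _) (eq_unit_vadd 1 _)) f)
      (LinearMap.congr_fun (Mu.mul_one' (eq_unit_vadd 1 _) (eq_unit_vadd 1 _)) m)

theorem actX_mul (α : Breve (ΓK K)) (g h : OUnits K) (p : Idx) :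
    actX α (g * h) p = actX α g p ∘ₗ actX α h p :=
  XK.hom_ext fun f m => by
    rw [LinearMap.comp_apply, actX_tmul, actX_tmul, actX_tmul]
    exact congrArg₂ XK.tmul
      (LinearMap.congr_fun (Test.mul_mul' (g : Kˣ) (h : Kˣ) (bot_mono p.2) (bot_mono p.2)
        (eq_unit_vadd h _) (eq_unit_vadd h _) (eq_unit_vadd g _) (eq_unit_vadd g _) _ _) f)
      (LinearMap.congr_fun (Mu.mul_mul' (g : Kˣ) (h : Kˣ) (eq_unit_vadd h _) (eq_unit_vadd h _)
        (eq_unit_vadd g _) (eq_unit_vadd g _) _ _) m)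

/-- The action of the group `(𝒪'_K)^*` on `𝒟_α(K)`. -/
def repD (α : Breve (ΓK K)) : Representation ℂ (OUnits K) (DK α) where
  toFun g := (LinearMap.pi fun p => actX α g p ∘ₗ LinearMap.proj p).restrict
    fun _ hF p' p h₁ h₂ => actX_transGraph α g h₁ h₂ (hF p' p h₁ h₂)
  map_one' := LinearMap.ext fun F => Subtype.ext <| funext fun p =>
    LinearMap.congr_fun (actX_one α p) (F.1 p)
  map_mul' g h := LinearMap.ext fun F => Subtype.ext <| funext fun p =>
    LinearMap.congr_fun (actX_mul α g h p) (F.1 p)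

/-- The space `𝒟'(𝒪(n) / 𝒪(m)) ⊗ μ(α, m)`. -/
def XK' (α : Breve (ΓK K)) (p : Idx) : Type _ :=
  Module.Dual ℂ (TestI K p) ⊗[ℂ] Mu α (bot p.1.2)

instance (α : Breve (ΓK K)) (p : Idx) : AddCommGroup (XK' α p) :=
  inferInstanceAs (AddCommGroup (Module.Dual ℂ (TestI K p) ⊗[ℂ] Mu α (bot p.1.2)))

instance (α : Breve (ΓK K)) (p : Idx) : Module ℂ (XK' α p) :=
  inferInstanceAs (Module ℂ (Module.Dual ℂ (TestI K p) ⊗[ℂ] Mu α (bot p.1.2)))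

/-- The tensor `v ⊗ l`. -/
def XK'.tmul {α : Breve (ΓK K)} {p : Idx} (v : Module.Dual ℂ (TestI K p)) (l : Mu α (bot p.1.2)) :
    XK' α p := v ⊗ₜ l

/-- The distribution `v'` on `𝒪(n') / 𝒪(m')` is the image of the distribution `v` on `𝒪(n) / 𝒪(m)`, where
`n' ≤ n ≤ m ≤ m'`, under the map that is dual to `f ↦ f'`, where `f'` is the direct image along `s` of
the restriction of `f`. -/
def IsDualImage {p' p : Idx} (s : Meas (bot p.1.2 : Breve (ΓK K)) (bot p'.1.2))
    (v : Module.Dual ℂ (TestI K p)) (v' : Module.Dual ℂ (TestI K p')) : Prop :=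
  ∀ f, ∃ f', IsDirectImage f s f' ∧ v' f = v f'

open scoped DirectSum

/-- The direct sum of the spaces `𝒟'(𝒪(n) / 𝒪(m)) ⊗ μ(α, m)`. -/
abbrev PreDK' (α : Breve (ΓK K)) : Type _ := ⨁ p : Idx, XK' α p

/-- The inclusion of a summand. -/
def ofIdx (α : Breve (ΓK K)) (p : Idx) : XK' α p →ₗ[ℂ] PreDK' α := DirectSum.lof ℂ Idx (XK' α) p

/-- The subspace that is generated by the differences of the elements of
`𝒟'(𝒪(n) / 𝒪(m)) ⊗ μ(α, m)` and their images under the transition maps to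
`𝒟'(𝒪(n') / 𝒪(m')) ⊗ μ(α, m')`, where `n' ≤ n ≤ m ≤ m'`: if `s` is a measure on `𝒪(m) / 𝒪(m')`, an
element of `μ(m', m)`, then `v ⊗ (λ ⊗ s)` is taken to `v' ⊗ λ`. -/
def relDK' (α : Breve (ΓK K)) : Submodule ℂ (PreDK' α) :=
  Submodule.span ℂ {z | ∃ (p' p : Idx) (_ : p'.1.1 ≤ p.1.1) (_ : p.1.2 ≤ p'.1.2)
    (v : Module.Dual ℂ (TestI K p)) (v' : Module.Dual ℂ (TestI K p'))
    (s : Meas (bot p.1.2 : Breve (ΓK K)) (bot p'.1.2)) (x : Mu (bot p'.1.2) (bot p.1.2))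
    (l : Mu α (bot p.1.2)) (l' : Mu α (bot p'.1.2)),
    IsDualImage s v v' ∧ IsMeas s x ∧ IsMul l' x l ∧
      z = ofIdx α p (XK'.tmul v l) - ofIdx α p' (XK'.tmul v' l')}

/-- The space `𝒟'_α(K)`: the inductive limit of the spaces `𝒟'(𝒪(n) / 𝒪(m)) ⊗ μ(α, m)`. -/
abbrev DK' (α : Breve (ΓK K)) : Type _ := PreDK' α ⧸ relDK' α

/-- The map from a member of the inductive system to the limit. -/
def toDK' (α : Breve (ΓK K)) (p : Idx) : XK' α p →ₗ[ℂ] DK' α := (relDK' α).mkQ ∘ₗ ofIdx α p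

/-- The action of `g` on distributions. -/
def dualMul (g : Kˣ) {a b a' b' : Breve (ΓK K)} (hab : a ≤ b) (ha : a' = ν g +ᵥ a)
    (hb : b' = ν g +ᵥ b) : Module.Dual ℂ (Test a b) →ₗ[ℂ] Module.Dual ℂ (Test a' b') :=
  (Test.mul g⁻¹ (vadd_le_of_eq hab ha hb) (eq_vadd_inv ha) (eq_vadd_inv hb)).dualMap

/-- The action of `g ∈ (𝒪'_K)^*` on `𝒟'(𝒪(n) / 𝒪(m)) ⊗ μ(α, m)`. -/
def actX' (α : Breve (ΓK K)) (g : OUnits K) (p : Idx) : XK' α p →ₗ[ℂ] XK' α p :=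
  TensorProduct.map
    (dualMul (g : Kˣ) (bot_le_bot.2 p.2) (eq_unit_vadd g _) (eq_unit_vadd g _))
    (Mu.mul (g : Kˣ) (eq_unit_vadd g _) (eq_unit_vadd g _))

theorem XK'.hom_ext {α : Breve (ΓK K)} {p : Idx} {V : Type*} [AddCommGroup V] [Module ℂ V]
    {A B : XK' α p →ₗ[ℂ] V} (h : ∀ v l, A (XK'.tmul v l) = B (XK'.tmul v l)) : A = B :=
  TensorProduct.ext' h

theorem actX'_tmul (α : Breve (ΓK K)) (g : OUnits K) (p : Idx) (v : Module.Dual ℂ (TestI K p))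
    (l : Mu α (bot p.1.2)) : actX' α g p (XK'.tmul v l) = XK'.tmul
      (dualMul (g : Kˣ) (bot_le_bot.2 p.2) (eq_unit_vadd g _) (eq_unit_vadd g _) v)
      (Mu.mul (g : Kˣ) (eq_unit_vadd g _) (eq_unit_vadd g _) l) := rfl

theorem IsDualImage.mul (g : OUnits K) {p' p : Idx} (h₂ : p.1.2 ≤ p'.1.2)
    {s : Meas (bot p.1.2 : Breve (ΓK K)) (bot p'.1.2)} {v : Module.Dual ℂ (TestI K p)}
    {v' : Module.Dual ℂ (TestI K p')} (h : IsDualImage s v v') :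
    IsDualImage (p' := p') (p := p)
      (Meas.mul (g : Kˣ) (bot_mono h₂) (eq_unit_vadd g _) (eq_unit_vadd g _) s)
      (dualMul (g : Kˣ) (bot_mono p.2) (eq_unit_vadd g _) (eq_unit_vadd g _) v)
      (dualMul (g : Kˣ) (bot_mono p'.2) (eq_unit_vadd g _) (eq_unit_vadd g _) v') := by
  intro f
  obtain ⟨f', hf, e⟩ := h (Test.mul (g : Kˣ)⁻¹ (bot_mono p'.2) (eq_vadd_inv (eq_unit_vadd g _))
    (eq_vadd_inv (eq_unit_vadd g _)) f)
  refine ⟨Test.mul (g : Kˣ) (bot_mono p.2) (eq_unit_vadd g _) (eq_unit_vadd g _) f', ?_, ?_⟩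
  · have := hf.mul (g : Kˣ) (bot_mono p'.2) (bot_mono h₂) (bot_mono p.2) (eq_unit_vadd g _)
      (eq_unit_vadd g _) (eq_unit_vadd g _) (eq_unit_vadd g _)
    rwa [Test.mul_mul_inv] at this
  · refine e.trans (congrArg v ?_)
    exact (Test.inv_mul_mul (g : Kˣ) (bot_mono p.2) (bot_mono p.2) _ _ _ _ f').symm

/-- The action of an element of `(𝒪'_K)^*` on the direct sum. -/
def actPreDK' (α : Breve (ΓK K)) (g : OUnits K) : PreDK' α →ₗ[ℂ] PreDK' α :=
  DirectSum.toModule ℂ Idx _ fun p => ofIdx α p ∘ₗ actX' α g p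

theorem actPreDK'_of (α : Breve (ΓK K)) (g : OUnits K) (p : Idx) (z : XK' α p) :
    actPreDK' α g (ofIdx α p z) = ofIdx α p (actX' α g p z) := DirectSum.toModule_lof ..

theorem relDK'_mem {α : Breve (ΓK K)} {p' p : Idx} (h₁ : p'.1.1 ≤ p.1.1) (h₂ : p.1.2 ≤ p'.1.2)
    {v : Module.Dual ℂ (TestI K p)} {v' : Module.Dual ℂ (TestI K p')}
    {s : Meas (bot p.1.2 : Breve (ΓK K)) (bot p'.1.2)} {x : Mu (bot p'.1.2) (bot p.1.2)}
    {l : Mu α (bot p.1.2)} {l' : Mu α (bot p'.1.2)} (hv : IsDualImage s v v') (hs : IsMeas s x)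
    (hl : IsMul l' x l) :
    ofIdx α p (XK'.tmul v l) - ofIdx α p' (XK'.tmul v' l') ∈ relDK' α :=
  Submodule.subset_span ⟨p', p, h₁, h₂, v, v', s, x, l, l', hv, hs, hl, rfl⟩

theorem actPreDK'_le (α : Breve (ΓK K)) (g : OUnits K) :
    relDK' α ≤ (relDK' α).comap (actPreDK' α g) := by
  refine Submodule.span_le.2 ?_
  rintro _ ⟨p', p, h₁, h₂, v, v', s, x, l, l', hv, hs, hl, rfl⟩
  have h := relDK'_mem (α := α) h₁ h₂ (hv.mul g h₂)
    (hs.mul (g : Kˣ) (bot_mono h₂) (eq_unit_vadd g _) (eq_unit_vadd g _))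
    (hl.mul (g : Kˣ) (eq_unit_vadd g _) (eq_unit_vadd g _) (eq_unit_vadd g _))
  have e : actPreDK' α g (ofIdx α p (XK'.tmul v l) - ofIdx α p' (XK'.tmul v' l')) =
      ofIdx α p (actX' α g p (XK'.tmul v l)) - ofIdx α p' (actX' α g p' (XK'.tmul v' l')) := by
    rw [map_sub, actPreDK'_of, actPreDK'_of]
  rw [actX'_tmul, actX'_tmul] at e
  exact Submodule.mem_comap.2 (e.symm ▸ h)

theorem actX'_one (α : Breve (ΓK K)) (p : Idx) : actX' α 1 p = LinearMap.id :=
  XK'.hom_ext fun v l => by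
    rw [actX'_tmul]
    refine congrArg₂ XK'.tmul ?_
      (LinearMap.congr_fun (Mu.mul_one' (eq_unit_vadd 1 _) (eq_unit_vadd 1 _)) l)
    refine LinearMap.ext fun f => congrArg v <| Subtype.ext <| funext fun x => ?_
    rw [Test.mul_apply, inv_inv]
    change f.1 (((1 : Kˣ) : K) * x) = _
    rw [Units.val_one, one_mul]

theorem actX'_mul (α : Breve (ΓK K)) (g h : OUnits K) (p : Idx) :
    actX' α (g * h) p = actX' α g p ∘ₗ actX' α h p :=
  XK'.hom_ext fun v l => by
    rw [LinearMap.comp_apply, actX'_tmul, actX'_tmul, actX'_tmul]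
    refine congrArg₂ XK'.tmul ?_
      (LinearMap.congr_fun (Mu.mul_mul' (g : Kˣ) (h : Kˣ) (eq_unit_vadd h _) (eq_unit_vadd h _)
        (eq_unit_vadd g _) (eq_unit_vadd g _) _ _) l)
    refine LinearMap.ext fun f => congrArg v <| Subtype.ext <| funext fun x => ?_
    rw [Test.mul_apply, Test.mul_apply, Test.mul_apply, inv_inv, inv_inv, inv_inv, ← mul_assoc]
    rfl

/-- The action of the group `(𝒪'_K)^*` on `𝒟'_α(K)`. -/
def repD' (α : Breve (ΓK K)) : Representation ℂ (OUnits K) (DK' α) where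
  toFun g := (relDK' α).mapQ _ (actPreDK' α g) (actPreDK'_le α g)
  map_one' := Submodule.linearMap_qext _ <| DirectSum.linearMap_ext _ fun p =>
    LinearMap.ext fun z => by
      refine congrArg (relDK' α).mkQ ?_
      refine (actPreDK'_of α 1 p z).trans ?_
      rw [actX'_one]
      rfl
  map_mul' g h := Submodule.linearMap_qext _ <| DirectSum.linearMap_ext _ fun p =>
    LinearMap.ext fun z => by
      refine congrArg (relDK' α).mkQ ?_
      refine (actPreDK'_of α (g * h) p z).trans ?_
      rw [actX'_mul, LinearMap.comp_apply, ← actPreDK'_of, ← actPreDK'_of]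
      rfl

end Spaces

section NaturalMaps

open Ext2 (emb lev)
open Breve

variable {K : Type*} [Field K] [TwoDimLocalField K] [PartialTopology K]

/-! ### The canonical isomorphisms `μ_q(α, β) ≅ μ(α, β)` -/

/-- The maps `Θ` are the canonical isomorphisms `μ_q(α, β) → μ(α, β)`: they are compatible with products
and, if `α` and `β` are in one fibre, `α ≥ x ≥ β`, they take `m` to the invariant measure on
`𝒪'(β) / 𝒪'(α)` for which the measure of `𝒪'(x) / 𝒪'(α)` is the value of `m` on the ray from `x`.
(These conditions determine `Θ`, since the map `m ↦ m(A)` is bijective for every `A`.) -/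
structure IsTheta (Θ : ∀ α β : Breve (ΓK K), muR (qK K) α β →ₗ[ℂ] Mu α β) : Prop where
  mul : ∀ (α β γ : Breve (ΓK K)) (x : muR (qK K) α β) (y : muR (qK K) β γ),
    IsMul (Θ α β x) (Θ β γ y) (Θ α γ (mulR (qK K) α β γ x y))
  norm : ∀ (α β : Breve (ΓK K)) (x : ΓK K), bot (lev x) ≤ β → β ≤ pt x → pt x ≤ α →
    α ≤ bot (lev x + 1) → ∀ m : muR (qK K) α β, ∃ (l : Meas β α) (u : Test β α),
      (∀ y, u.1 y = (O (pt x) : Set K).indicator 1 y) ∧ IsMeas l (Θ α β m) ∧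
        l.1 u = m.1 (stdGood x)

/-! ### The action of the discrete Heisenberg group on the (co)invariants -/

/-- The operator on `𝒟_α(K)` that is given on `𝒟(𝒪(n) / 𝒪(m)) ⊗ μ(m, α)` by
`f ⊗ μ ↦ g(f) ⊗ (g(μ) ⊗ h⁻¹)`. -/
def IsHeisAct {α : Breve (ΓK K)} (Θ : ∀ α β : Breve (ΓK K), muR (qK K) α β →ₗ[ℂ] Mu α β) (g : Kˣ)
    (h : Torsor α (ν g +ᵥ α)) (T : DK α →ₗ[ℂ] DK α) : Prop :=
  ∀ (F : DK α) (p p' : Idx) (hn : (bot p'.1.1 : Breve (ΓK K)) = ν g +ᵥ bot p.1.1)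
    (hm : (bot p'.1.2 : Breve (ΓK K)) = ν g +ᵥ bot p.1.2),
    (F.1 p, (T F).1 p') ∈ Submodule.span ℂ {z : XK α p × XK α p' |
      ∃ (f : TestI K p) (μ : Mu (bot p.1.2) α) (τ : Mu (bot p'.1.2) α),
        IsMul (Mu.mul g hm rfl μ) (Θ (ν g +ᵥ α) α (theta (qK K) h.inv)) τ ∧
          z = (XK.tmul f μ, XK.tmul (Test.mul g (bot_mono p.2) hn hm f) τ)}

/-- The operator on `𝒟'_α(K)` that is given on `𝒟'(𝒪(n) / 𝒪(m)) ⊗ μ(α, m)` by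
`v ⊗ λ ↦ g(v) ⊗ (h ⊗ g(λ))`. -/
def IsHeisAct' {α : Breve (ΓK K)} (Θ : ∀ α β : Breve (ΓK K), muR (qK K) α β →ₗ[ℂ] Mu α β) (g : Kˣ)
    (h : Torsor α (ν g +ᵥ α)) (T : DK' α →ₗ[ℂ] DK' α) : Prop :=
  ∀ (p p' : Idx) (hn : (bot p'.1.1 : Breve (ΓK K)) = ν g +ᵥ bot p.1.1)
    (hm : (bot p'.1.2 : Breve (ΓK K)) = ν g +ᵥ bot p.1.2) (v : Module.Dual ℂ (TestI K p))
    (l : Mu α (bot p.1.2)), ∃ τ : Mu α (bot p'.1.2),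
      IsMul (Θ α (ν g +ᵥ α) (theta (qK K) h)) (Mu.mul g rfl hm l) τ ∧
        T (toDK' α p (XK'.tmul v l)) =
          toDK' α p' (XK'.tmul (dualMul g (bot_mono p.2) hn hm v) τ)

/-- `ρ` is the action of the group on the coinvariants `𝒟_α(K)_{(𝒪'_K)^*}`. -/
def IsHeisRep {α : Breve (ΓK K)} (Θ : ∀ α β : Breve (ΓK K), muR (qK K) α β →ₗ[ℂ] Mu α β)
    (ρ : Representation ℂ (Heis α) (repD α).Coinvariants) : Prop :=
  ∀ (g : Kˣ) (h : Torsor α (ν g +ᵥ α)), ∃ T : DK α →ₗ[ℂ] DK α, IsHeisAct Θ g h T ∧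
    ∀ F : DK α, ρ ⟨ν g, h⟩ (Representation.Coinvariants.mk (repD α) F) =
      Representation.Coinvariants.mk (repD α) (T F)

/-- `ρ'` is the action of the group on the invariants `𝒟'_α(K)^{(𝒪'_K)^*}`. -/
def IsHeisRep' {α : Breve (ΓK K)} (Θ : ∀ α β : Breve (ΓK K), muR (qK K) α β →ₗ[ℂ] Mu α β)
    (ρ' : Representation ℂ (Heis α) (repD' α).invariants) : Prop :=
  ∀ (g : Kˣ) (h : Torsor α (ν g +ᵥ α)), ∃ T : DK' α →ₗ[ℂ] DK' α, IsHeisAct' Θ g h T ∧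
    ∀ S : (repD' α).invariants, (ρ' ⟨ν g, h⟩ S : DK' α) = T S

/-! ### The natural maps -/

/-- The set `{y : ν(y) = x}`, which is the set `𝒪'(x) \ m' 𝒪'(x)` for the maximal ideal `m'` of `𝒪'`. -/
def OStar (x : ΓK K) : Set K := {y | ∃ a : Kˣ, (a : K) = y ∧ ν a = x}

/-- The value of `c ∈ 𝒟₊(π⁻¹(k))` at each `x ∈ π⁻¹(k)` is the mean value of `f ∈ 𝒟(𝒪(k) / 𝒪(k + 1))` on the
open compact subset `{y : ν(y) = x}` of `𝒪(k) / 𝒪(k + 1)`, for an invariant measure `m`. -/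
def IsAvg {k : ℤ} (f : Test (bot k : Breve (ΓK K)) (bot (k + 1))) (c : DPlusT (ΓK K) k) : Prop :=
  ∀ x : ΓK K, lev x = k → ∀ m : Meas (bot k : Breve (ΓK K)) (bot (k + 1)),
    ∃ u φ : Test (bot k : Breve (ΓK K)) (bot (k + 1)),
      (∀ y, u.1 y = (OStar x).indicator 1 y) ∧ (∀ y, φ.1 y = (OStar x).indicator f.1 y) ∧
        m.1 φ = c.1 x * m.1 u

/-- The pair `(k, k + 1)`. -/
def succIdx (k : ℤ) : Idx := ⟨(k, k + 1), (lt_add_one k).le⟩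

/-- `Φ` is the natural map `𝒟_α(K)_{(𝒪'_K)^*} → 𝒟_{+, α, q}(Γ_K)`: its component in degree `k` is the
composition of the map to `𝒟(𝒪(k) / 𝒪(k + 1)) ⊗ μ(k + 1, α)` and of the map `f ⊗ μ ↦ c ⊗ μ`, where
`c` is the function of the mean values of `f`. -/
def IsSur {α : Breve (ΓK K)} (Θ : ∀ α β : Breve (ΓK K), muR (qK K) α β →ₗ[ℂ] Mu α β)
    (Φ : (repD α).Coinvariants →ₗ[ℂ] DPlus (qK K) α) : Prop :=
  ∀ (F : DK α) (k : ℤ),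
    (F.1 (succIdx k), (Φ (Representation.Coinvariants.mk (repD α) F)).1 k) ∈ Submodule.span ℂ
      {z : XK α (succIdx k) × (DPlusT (ΓK K) k ⊗[ℂ] muR (qK K) (bot (k + 1)) α) |
        ∃ (f : Test (bot k : Breve (ΓK K)) (bot (k + 1))) (c : DPlusT (ΓK K) k)
          (μ : muR (qK K) (bot (k + 1)) α), IsAvg f c ∧
            z = (XK.tmul (p := succIdx k) f (Θ (bot (k + 1)) α μ), c ⊗ₜ μ)}

/-- `Φ'` is the natural map `𝒟'_{+, α, q}(Γ_K) → 𝒟'_α(K)^{(𝒪'_K)^*}`: it takes the class of `h ⊗ λ`, where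
`h ∈ 𝒟'₊(π⁻¹(k))` and `λ ∈ μ_q(α, k + 1)`, to the class of `v ⊗ λ`, where `v` is the distribution on
`𝒪(k) / 𝒪(k + 1)` that takes `f` to `h(c)`, where `c` is the function of the mean values of `f`. -/
def IsInj {α : Breve (ΓK K)} (Θ : ∀ α β : Breve (ΓK K), muR (qK K) α β →ₗ[ℂ] Mu α β)
    (Φ' : DPlus' (qK K) α →ₗ[ℂ] (repD' α).invariants) : Prop :=
  ∀ (k : ℤ) (h : Module.Dual ℂ (DPlusT (ΓK K) k)) (l : muR (qK K) α (bot (k + 1))),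
    ∃ v : Module.Dual ℂ (Test (bot k : Breve (ΓK K)) (bot (k + 1))),
      (∀ f, ∃ c, IsAvg f c ∧ v f = h c) ∧
        (Φ' ((relD' (qK K) α).mkQ (ofDeg (qK K) α k (h ⊗ₜ l))) : DK' α) =
          toDK' α (succIdx k) (XK'.tmul (p := succIdx k) v (Θ α (bot (k + 1)) l))

end NaturalMaps

end TwoDim

end

open TwoDim

/-! Topology is replaced by subgroups of `K`. In a totally disconnected locally compact group the
compact open subgroups form a basis at zero. In terms of `K` these are the subgroups in `Lat a b`,
and test functions are the linear combinations of indicators of their cosets (`Test.induction`). An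
invariant functional is therefore determined by its value on one such subgroup, and Haar measure
gives a nonzero one, so each space `Meas a b` is a line.

All these lines are given bases at once. `frameMeas` is a family of nonzero measures which is
multiplicative (`frameMeas_prod`) and in which the measures of the balls `𝒪'(x)` inside one fibre
are the powers of `q` prescribed by `jump` (`frameMeas_isNorm`). In the resulting coordinates the
products of the `μ(α, β)` are products of numbers (`isMul_iff`), `Θ` is evaluation at the set
`stdGood 0` (`thetaK`), and an element `g` of `Kˣ` acts on `μ(α, β)` by `modulus (ν g) α β`, a power
of `q` that depends on `Γ` only (`Mu.coord_mul`). So `𝒟_α(K)` becomes the space `Lim` of families of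
test functions compatible with the maps `tr`, and an element of the Heisenberg group acts by a
translation and a scalar `scal`. The same scalar describes its action on the spaces on `Γ`
(`trivR_actAt`). The scalars satisfy the cocycle identity `scal_mul`, and two lifts of an element of
`Γ` differ by a unit, which acts trivially on coinvariants and on invariants. Hence the two
representations.

The mean value map `avg` from functions on `𝒪(k) / 𝒪(k + 1)` to `𝒟₊(π⁻¹(k))` is onto, turns the
value at zero into `δ_{+∞}` and the integral into the standard element of `μ_q(k + 1, k)`
(`deltaInf_avg`, `stdE_avg`). In a compatible family the value at zero of component `k` is the
integral of component `k + 1` (`succ_apply_zero`), which is the condition that defines `𝒟₊`. This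
gives `Φ` and, dually, `Φ'`. Equivariance comes down to `avg_mul`.

For surjectivity, the components of a target element are lifted one by one to `f k`. The condition
then reads `f k (0) = ∫ f (k + 1)`, and the gluing lemma `exists_extension` allows neighbouring
functions to be combined into one on a longer quotient. Alternating steps to the right and to the
left yield a compatible family (`exists_lim`).

For injectivity, `𝒟'₊` is paired with the families in `Fam`. If an element supported in finitely
many degrees pairs to zero with all of them, its top component is a multiple of the functional that
the defining relations move one degree down, so descent shows that it vanishes (`evFam_eq_zero`).
Each such family lifts to `Lim` by the surjectivity argument, and the pairing factors through `Φ'`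
(`evLim_injD`). -/

namespace TwoDim

noncomputable section

open _root_.TwoDim.Ext2 (emb lev)
open Breve

/-! ### Topological groups -/

section VanDantzig

open Topology Pointwise

/-- In a totally disconnected locally compact group every neighbourhood of zero contains a compact open
subgroup. -/
theorem exists_compact_open_addSubgroup {G : Type*} [AddCommGroup G] [TopologicalSpace G]
    [IsTopologicalAddGroup G] [LocallyCompactSpace G] [TotallyDisconnectedSpace G] {S : Set G}
    (hS : S ∈ 𝓝 (0 : G)) :
    ∃ H : AddSubgroup G, IsOpen (H : Set G) ∧ IsCompact (H : Set G) ∧ (H : Set G) ⊆ S := by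
  obtain ⟨C, hC, h0⟩ := exists_compact_mem_nhds (0 : G)
  obtain ⟨W, hW, h0W, hWS⟩ := (loc_compact_Haus_tot_disc_of_zero_dim (H := G)).mem_nhds_iff.1
    (Filter.inter_mem hS h0)
  have hWc : IsCompact W := hC.of_isClosed_subset hW.1 (hWS.trans Set.inter_subset_right)
  -- `V` is a neighbourhood of zero with `W + V ⊆ W`. The subgroup is the stabilizer of `W` under
  -- translation: it contains `V ∩ -V`, so it is open, and it lies in `W` because `0 ∈ W`.
  obtain ⟨V, hV, hVW⟩ := compact_open_separated_add_right hWc hW.2 subset_rfl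
  let H : AddSubgroup G :=
    { carrier := {g | ∀ w, w ∈ W ↔ w + g ∈ W}
      zero_mem' := fun w => by rw [add_zero]
      add_mem' := fun {a b} ha hb w => by rw [ha w, hb (w + a), add_assoc]
      neg_mem' := fun {a} ha w => by rw [ha (w + -a), neg_add_cancel_right] }
  have hHo : IsOpen (H : Set G) := by
    refine AddSubgroup.isOpen_of_mem_nhds H (g := 0)
      (Filter.mem_of_superset (Filter.inter_mem hV (neg_mem_nhds_zero G hV)) ?_)
    rintro g ⟨hg, hg'⟩ w
    refine ⟨fun hw => hVW (Set.add_mem_add hw hg), fun hw => ?_⟩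
    have := hVW (Set.add_mem_add hw hg')
    rwa [add_neg_cancel_right] at this
  have hHW : (H : Set G) ⊆ W := fun g hg => by
    have := (hg 0).1 h0W
    rwa [zero_add] at this
  exact ⟨H, hHo, hWc.of_isClosed_subset (AddSubgroup.isClosed_of_isOpen H hHo) hHW,
    hHW.trans (hWS.trans Set.inter_subset_left)⟩

end VanDantzig

/-! ### Open subgroups of the quotients `𝒪'(a) / 𝒪'(b)`. -/

section Open

variable {K : Type*} [Field K] [TwoDimLocalField K]

theorem Q.mk_eq_mk {a b : Breve (ΓK K)} {x y : O a} :
    Q.mk a b x = Q.mk a b y ↔ (x : K) - y ∈ O b := by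
  rw [← sub_eq_zero, ← map_sub]
  exact (QuotientAddGroup.eq_zero_iff _).trans AddSubgroup.mem_addSubgroupOf

variable [PartialTopology K]

open PartialTopology Topology

/-- Pulling a topology back along a surjection and pushing it forward again changes nothing. So the
derived topology agrees with the given one where both are defined. -/
theorem topQ_bot (n m : ℤ) : topQ (bot n : Breve (ΓK K)) (bot m) = top n m := by
  refine TopologicalSpace.ext_iff.2 fun s => ?_
  refine isOpen_coinduced.trans
    ((@isOpen_induced_iff _ _ (top n m) _ _).trans ⟨?_, fun h => ⟨s, h, rfl⟩⟩)
  rintro ⟨t, ht, hts⟩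
  rwa [← (Q.mk_surjective (bot n : Breve (ΓK K)) (bot m)).preimage_injective hts]

theorem isTopologicalAddGroup_bot {n m : ℤ} (h : n ≤ m) :
    IsTopologicalAddGroup (Q (bot n : Breve (ΓK K)) (bot m)) := by
  have := isTopologicalAddGroup (K := K) h
  rwa [← topQ_bot] at this

theorem locallyCompact_bot {n m : ℤ} (h : n ≤ m) :
    LocallyCompactSpace (Q (bot n : Breve (ΓK K)) (bot m)) := by
  have := locallyCompact (K := K) h
  rwa [← topQ_bot] at this

theorem totallyDisconnected_bot {n m : ℤ} (h : n ≤ m) :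
    TotallyDisconnectedSpace (Q (bot n : Breve (ΓK K)) (bot m)) := by
  have := totallyDisconnected (K := K) h
  rwa [← topQ_bot] at this

theorem isInducing_nat {n m k : ℤ} (h : n ≤ m) (h' : m ≤ k) :
    IsInducing (Q.nat (K := K) (bot_mono h) (le_refl (bot k))) := by
  refine ⟨?_⟩
  have := sub (K := K) h h'
  rwa [← topQ_bot, ← topQ_bot] at this

theorem continuous_nat {n m k : ℤ} (h : n ≤ m) (h' : m ≤ k) :
    Continuous (Q.nat (K := K) (le_refl (bot n)) (bot_mono h')) := by
  have := quot (K := K) h h'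
  rw [← topQ_bot, ← topQ_bot] at this
  rw [this]
  exact continuous_coinduced_rng

/-- In the quotient topology it suffices to look at the preimage of the image. It is a subgroup that
contains the open subgroup `W`. -/
theorem isOpen_nat_image {n m k : ℤ} (h : n ≤ m) (h' : m ≤ k)
    {W : AddSubgroup (Q (bot n : Breve (ΓK K)) (bot k))} (hW : IsOpen (W : Set (Q (bot n : Breve (ΓK K)) (bot k)))) :
    IsOpen (W.map (Q.nat (K := K) (le_refl (bot n)) (bot_mono h')) :
      Set (Q (bot n : Breve (ΓK K)) (bot m))) := by
  have := quot (K := K) h h'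
  rw [← topQ_bot, ← topQ_bot] at this
  rw [this, isOpen_coinduced]
  have := isTopologicalAddGroup_bot (K := K) (h.trans h')
  have e : (Q.nat (K := K) (le_refl (bot n)) (bot_mono h')) ⁻¹'
      (W.map (Q.nat (K := K) (le_refl (bot n)) (bot_mono h')) : Set _) =
      ((W.map (Q.nat (K := K) (le_refl (bot n)) (bot_mono h'))).comap
        (Q.nat (K := K) (le_refl (bot n)) (bot_mono h')) : Set _) := rfl
  rw [e]
  exact AddSubgroup.isOpen_mono (AddSubgroup.le_comap_map _ _) hW

/-- The inclusion of `𝒪'(a)` in `𝒪(n)`, followed by the projection to `𝒪(n) / 𝒪(m)`. -/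
def toBot {a : Breve (ΓK K)} {n : ℤ} (m : ℤ) (h : bot n ≤ a) : O a →+ Q (bot n : Breve (ΓK K)) (bot m) :=
  (Q.mk _ _).comp (AddSubgroup.inclusion (O_anti h))

theorem bot_le_of_le_floor {a : Breve (ΓK K)} {n : ℤ} (h : n ≤ a.floor) : bot n ≤ a :=
  (bot_mono h).trans (bot_floor_le a)

/-- The ambient `𝒪(n)` may be taken larger than the minimal one, because the inclusions of the
quotients are topological embeddings. This is what allows subgroups with different `a` to be
compared. -/
theorem topO_eq_induced {a b : Breve (ΓK K)} (hab : a ≤ b) {n : ℤ} (h : n ≤ a.floor) :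
    topO a b = (topQ (bot n) (bot b.ceil)).induced (toBot b.ceil (bot_le_of_le_floor h)) := by
  have := (isInducing_nat (K := K) h (floor_le_ceil hab)).eq_induced
  rw [topO, ← topQ_bot, this, induced_compose]
  rfl

/-- `U` is a subgroup of `K` that contains `𝒪'(b)` and whose intersection with `𝒪'(a)` has an open image
in `𝒪'(a) / 𝒪'(b)`. -/
def IsOp (a b : Breve (ΓK K)) (U : AddSubgroup K) : Prop :=
  O b ≤ U ∧ IsOpen (Q.mk a b '' {x | (x : K) ∈ U})

/-- As `U` contains `𝒪'(b)`, its trace on `𝒪'(a)` is saturated for the projection. -/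
theorem isOp_iff_topO {a b : Breve (ΓK K)} {U : AddSubgroup K} :
    IsOp a b U ↔ O b ≤ U ∧ IsOpen[topO a b] {x : O a | (x : K) ∈ U} := by
  refine and_congr_right fun hb => ?_
  have : Q.mk a b ⁻¹' (Q.mk a b '' {x | (x : K) ∈ U}) = {x : O a | (x : K) ∈ U} := by
    refine Set.Subset.antisymm ?_ (Set.subset_preimage_image _ _)
    rintro x ⟨y, hy, hyx⟩
    have := U.sub_mem hy (hb (Q.mk_eq_mk.1 hyx))
    rwa [sub_sub_cancel] at this
  nth_rewrite 2 [← this]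
  exact isOpen_coinduced

theorem isTopologicalAddGroup_topO {a b : Breve (ΓK K)} (hab : a ≤ b) :
    @IsTopologicalAddGroup (O a) (topO a b) _ := by
  rw [topO_eq_induced hab le_rfl]
  have := isTopologicalAddGroup_bot (K := K) (floor_le_ceil hab)
  exact topologicalAddGroup_induced _

theorem isTopologicalAddGroup_Q {a b : Breve (ΓK K)} (hab : a ≤ b) :
    IsTopologicalAddGroup (Q a b) := by
  have := isTopologicalAddGroup_topO hab
  exact @QuotientAddGroup.instIsTopologicalAddGroup (O a) (topO a b) _ this
    ((O b).addSubgroupOf (O a)) _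

/-- The working criterion for openness: it speaks of open subgroups `W` of the quotients that carry
the given topologies and no longer of open sets. The existence of `W` uses that open subgroups form
a basis at zero. -/
theorem isOp_iff {a b : Breve (ΓK K)} (hab : a ≤ b) {n : ℤ} (h : n ≤ a.floor) {U : AddSubgroup K} :
    IsOp a b U ↔ O b ≤ U ∧ ∃ W : AddSubgroup (Q (bot n : Breve (ΓK K)) (bot b.ceil)),
      IsOpen (W : Set (Q (bot n : Breve (ΓK K)) (bot b.ceil))) ∧
        ∀ x : O a, toBot b.ceil (bot_le_of_le_floor h) x ∈ W → (x : K) ∈ U := by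
  rw [isOp_iff_topO]
  refine and_congr_right fun hb => ?_
  have hn : n ≤ b.ceil := h.trans (floor_le_ceil hab)
  have i1 := isTopologicalAddGroup_bot (K := K) hn
  have i2 := locallyCompact_bot (K := K) hn
  have i3 := totallyDisconnected_bot (K := K) hn
  have i4 := isTopologicalAddGroup_topO hab
  constructor
  · intro hU
    rw [topO_eq_induced hab h, isOpen_induced_iff] at hU
    obtain ⟨S, hS, hSU⟩ := hU
    have h0 : (0 : Q (bot n : Breve (ΓK K)) (bot b.ceil)) ∈ S := by
      have : (0 : O a) ∈ {x : O a | (x : K) ∈ U} := U.zero_mem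
      rw [← hSU, Set.mem_preimage, map_zero] at this
      exact this
    obtain ⟨W, hW, -, hWS⟩ := exists_compact_open_addSubgroup (hS.mem_nhds h0)
    refine ⟨W, hW, fun x hx => ?_⟩
    have : x ∈ {x : O a | (x : K) ∈ U} := hSU ▸ hWS hx
    exact this
  · rintro ⟨W, hW, hWU⟩
    have hc : @Continuous _ _ (topO a b) _ (toBot b.ceil (bot_le_of_le_floor h) : O a → _) := by
      rw [topO_eq_induced hab h]
      exact continuous_induced_dom
    have := @IsOpen.preimage _ _ (topO a b) _ _ hc _ hW
    exact @AddSubgroup.isOpen_mono _ _ (topO a b) _ (W.comap (toBot b.ceil (bot_le_of_le_floor h)))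
      (U.addSubgroupOf (O a)) hWU this

theorem IsOp.le {a b : Breve (ΓK K)} {U : AddSubgroup K} (h : IsOp a b U) : O b ≤ U := h.1

theorem IsOp.inf {a b : Breve (ΓK K)} {U V : AddSubgroup K} (hU : IsOp a b U)
    (hV : IsOp a b V) : IsOp a b (U ⊓ V) := by
  rw [isOp_iff_topO] at *
  exact ⟨le_inf hU.1 hV.1, @IsOpen.inter _ (topO a b) _ _ hU.2 hV.2⟩

theorem IsOp.mono {a b : Breve (ΓK K)} (hab : a ≤ b) {U V : AddSubgroup K} (hU : IsOp a b U)
    (h : U ≤ V) : IsOp a b V := by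
  rw [isOp_iff hab le_rfl] at *
  exact ⟨hU.1.trans h, hU.2.imp fun W hW => ⟨hW.1, fun x hx => h (hW.2 x hx)⟩⟩

theorem isOp_O {a b : Breve (ΓK K)} (hab : a ≤ b) : IsOp a b (O a) := by
  rw [isOp_iff hab le_rfl]
  exact ⟨O_anti hab, ⊤, isOpen_univ, fun x _ => x.2⟩

theorem IsOp.of_quotient {a b c : Breve (ΓK K)} (hab : a ≤ b) (hbc : b ≤ c) {U : AddSubgroup K}
    (hU : IsOp a b U) : IsOp a c U := by
  rw [isOp_iff hab le_rfl] at hU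
  rw [isOp_iff (hab.trans hbc) le_rfl]
  obtain ⟨h1, W, hW, h2⟩ := hU
  exact ⟨(O_anti hbc).trans h1, W.comap (Q.nat le_rfl (bot_mono (ceil_mono hbc))),
    hW.preimage (continuous_nat (floor_le_ceil hab) (ceil_mono hbc)), h2⟩

theorem IsOp.to_quotient {a b c : Breve (ΓK K)} (hab : a ≤ b) (hbc : b ≤ c) {U : AddSubgroup K}
    (hU : IsOp a c U) (h : O b ≤ U) : IsOp a b U := by
  rw [isOp_iff (hab.trans hbc) le_rfl] at hU
  rw [isOp_iff hab le_rfl]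
  obtain ⟨h1, W, hW, h2⟩ := hU
  refine ⟨h, _, isOpen_nat_image (floor_le_ceil hab) (ceil_mono hbc) hW, ?_⟩
  rintro x ⟨w, hw, hwx⟩
  obtain ⟨y, rfl⟩ := Q.mk_surjective _ _ w
  -- The lift `y` of `w` is only known to lie in `𝒪(n)`, but it differs from `x` by an element of
  -- `𝒪'(b)`, so it lies in `𝒪'(a)` and the hypothesis on `W` applies to it.
  have hd : (y : K) - x ∈ O b := O_anti (le_bot_ceil b) (Q.mk_eq_mk.1 hwx)
  have hy : (y : K) ∈ O a := by
    have := add_mem (O_anti hab hd) x.2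
    rwa [sub_add_cancel] at this
  have := U.sub_mem (h2 ⟨y, hy⟩ hw) (h hd)
  rwa [sub_sub_cancel] at this

theorem IsOp.restrict {a b c : Breve (ΓK K)} (hab : a ≤ b) (hbc : b ≤ c) {U : AddSubgroup K}
    (hU : IsOp a c U) : IsOp b c U := by
  rw [isOp_iff (hab.trans hbc) le_rfl] at hU
  rw [isOp_iff hbc (floor_mono hab)]
  obtain ⟨h1, W, hW, h2⟩ := hU
  exact ⟨h1, W, hW, fun x hx => h2 ⟨x, O_anti hab x.2⟩ hx⟩

/-- The topology of `𝒪'(b) / 𝒪'(c)` is that of a subspace of `𝒪'(a) / 𝒪'(c)`: the same `W` that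
witnesses the openness of `V` cuts out an open subgroup there. -/
theorem IsOp.extend {a b c : Breve (ΓK K)} (hab : a ≤ b) (hbc : b ≤ c) {V : AddSubgroup K}
    (hV : IsOp b c V) : ∃ U, IsOp a c U ∧ U ⊓ O b ≤ V := by
  rw [isOp_iff hbc (floor_mono hab)] at hV
  obtain ⟨h1, W, hW, h2⟩ := hV
  refine ⟨(W.comap (toBot c.ceil (bot_floor_le a))).map (O a).subtype ⊔ O c, ?_, ?_⟩
  · rw [isOp_iff (hab.trans hbc) le_rfl]
    exact ⟨le_sup_right, W, hW, fun x hx => AddSubgroup.mem_sup_left ⟨x, hx, rfl⟩⟩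
  · rintro x ⟨hx, hxb⟩
    obtain ⟨_, ⟨y, hy, rfl⟩, z, hz, rfl⟩ := AddSubgroup.mem_sup.1 hx
    have hyb : (y : K) ∈ O b := by
      have := (O b).sub_mem hxb (O_anti hbc hz)
      rwa [add_sub_cancel_right] at this
    exact V.add_mem (h2 ⟨y, hyb⟩ hy) (h1 hz)

/-! ### Lattices -/

/-- `U` is a subgroup between `𝒪'(b)` and `𝒪'(a)` that is open and totally bounded in `𝒪'(a) / 𝒪'(b)`. -/
structure Lat (a b : Breve (ΓK K)) (U : AddSubgroup K) : Prop where
  le : U ≤ O a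
  isOp : IsOp a b U
  relIndex_ne : ∀ V, IsOp a b V → V.relIndex U ≠ 0

theorem Lat.inf {a b : Breve (ΓK K)} {U V : AddSubgroup K} (hU : Lat a b U) (hV : IsOp a b V) :
    Lat a b (U ⊓ V) :=
  ⟨inf_le_left.trans hU.le, hU.isOp.inf hV, fun V' hV' h =>
    hU.relIndex_ne _ (hV.inf hV') (by
      rw [inf_comm V V', ← AddSubgroup.relIndex_inf_mul_relIndex, inf_comm V U, h, zero_mul])⟩

/-- An open subgroup of the subspace contains the trace of an open subgroup of the whole, and
intersecting with `𝒪'(b)` keeps a finite index finite. -/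
theorem Lat.restrict {a b c : Breve (ΓK K)} (hab : a ≤ b) (hbc : b ≤ c) {U : AddSubgroup K}
    (hU : Lat a c U) : Lat b c (U ⊓ O b) where
  le := inf_le_right
  isOp := (hU.isOp.restrict hab hbc).inf (isOp_O hbc)
  relIndex_ne V hV h := by
    obtain ⟨V', hV', hle⟩ := hV.extend hab hbc
    refine AddSubgroup.relIndex_inter_ne_zero (hU.relIndex_ne V' hV') (O b) ?_
    exact AddSubgroup.relIndex_eq_zero_of_le_left hle h

/-- An open `V` contains `𝒪'(b)`, so its index in `U + 𝒪'(b)` is controlled by its index in `U + V`,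
which is its index in `U`. -/
theorem Lat.sup {a b c : Breve (ΓK K)} (hab : a ≤ b) (hbc : b ≤ c) {U : AddSubgroup K}
    (hU : Lat a c U) : Lat a b (U ⊔ O b) where
  le := sup_le hU.le (O_anti hab)
  isOp := (hU.isOp.mono (hab.trans hbc) le_sup_left).to_quotient hab hbc le_sup_right
  relIndex_ne V hV h := by
    refine hU.relIndex_ne V (hV.of_quotient hab hbc) ?_
    rw [← AddSubgroup.relIndex_sup_right]
    exact AddSubgroup.relIndex_eq_zero_of_le_right (sup_le_sup_left hV.le U) h

end Open

end

end TwoDim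

namespace TwoDim

noncomputable section

open _root_.TwoDim.Ext2 (emb lev)
open Breve

/-! ### The balls `𝒪'(x)`, their indices and the topology of `𝒪(k) / 𝒪(k + 1)`. -/

section Balls

variable {K : Type*} [Field K] [TwoDimLocalField K]

theorem mem_O_zero_iff {x : K} : x ∈ O (pt (0 : ΓK K)) ↔ x ∈ OPrime K := by
  by_cases hx : x = 0
  · rw [hx]
    exact iff_of_true (zero_mem _) (zero_mem _)
  · exact ⟨fun h => (zero_le_iff (Units.mk0 x hx)).1 (h _ rfl), fun h a ha =>
      (zero_le_iff a).2 (ha ▸ h)⟩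

theorem mul_mem_O_iff (g : Kˣ) {a a' : Breve (ΓK K)} (h : a' = ν g +ᵥ a) {x : K} :
    (g : K) * x ∈ O a' ↔ x ∈ O a := by
  refine ⟨fun hx => ?_, mul_mem_O g h⟩
  have := mul_mem_O g⁻¹ (eq_vadd_inv h) hx
  rwa [Units.inv_mul_cancel_left] at this

theorem inv_mul_mem_O_iff (g : Kˣ) {a a' : Breve (ΓK K)} (h : a' = ν g +ᵥ a) {x : K} :
    ((g⁻¹ : Kˣ) : K) * x ∈ O a ↔ x ∈ O a' := mul_mem_O_iff g⁻¹ (eq_vadd_inv h)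

theorem pt_ν_eq (g : Kˣ) : (pt (ν g) : Breve (ΓK K)) = ν g +ᵥ (pt 0 : Breve (ΓK K)) := by rw [vadd_pt, add_zero]

theorem units_mem_O_iff {a : Breve (ΓK K)} (g : Kˣ) : (g : K) ∈ O a ↔ a ≤ pt (ν g) :=
  ⟨fun h => h g rfl, fun h a ha => by rwa [Units.ext ha]⟩

theorem ord_unif_zpow (j : ℤ) : ord (unif K ^ j) = 0 := by rw [ord_zpow, ord_unif, mul_zero]

theorem ν_unif_zpow (j : ℤ) : ν (unif K ^ j) = emb j := rfl

theorem bot_zero_le_pt_emb (j : ℤ) : (bot 0 : Breve (ΓK K)) ≤ pt (emb j) :=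
  bot_le_pt.2 (lev_emb _).ge

/-- Division by the `j`-th power of the lifted uniformizer reduces the claim to `j = 0`, that is to
the definition of `𝒪'`. Elements with zero residue need no separate treatment. -/
theorem mem_O_emb_iff {j : ℤ} {x : K} (hx : x ∈ OK K) :
    x ∈ O (pt (emb j : ΓK K)) ↔
      TwoDimLocalField.w (IsLocalRing.residue (OK K) ⟨x, hx⟩) ≤ WithZero.exp (-j) := by
  by_cases h0 : x = 0
  · subst h0
    refine iff_of_true (zero_mem _) ?_
    have : (⟨0, hx⟩ : OK K) = 0 := rfl
    rw [this, map_zero, map_zero]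
    exact zero_le
  obtain ⟨g, rfl⟩ : ∃ g : Kˣ, (g : K) = x := ⟨Units.mk0 x h0, rfl⟩
  rw [units_mem_O_iff, ← ν_unif_zpow, ν_le_iff, mem_OPrime]
  have hg := (mem_OK_iff g).1 hx
  have hord : ord ((unif K ^ j)⁻¹ * g) = ord g := by rw [ord_mul, ord_inv, ord_unif_zpow]; simp
  have hm : (((unif K ^ j)⁻¹ * g : Kˣ) : K) ∈ OK K := by rw [mem_OK_iff, hord]; exact hg
  have hu : ((unif K ^ j : Kˣ) : K) ∈ OK K := by rw [mem_OK_iff, ord_unif_zpow]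
  have e : (⟨g, hx⟩ : OK K) = ⟨_, hu⟩ * ⟨_, hm⟩ := Subtype.ext (by
    change (g : K) = ((unif K ^ j : Kˣ) : K) * (((unif K ^ j)⁻¹ * g : Kˣ) : K)
    rw [← Units.val_mul, mul_inv_cancel_left])
  have hw : TwoDimLocalField.w (IsLocalRing.residue (OK K) ⟨_, hu⟩) = WithZero.exp (-j) := by
    have := w_res (unif K ^ j) (ord_unif_zpow j)
    rwa [ord'_zpow _ ord_unif, ord'_unif, mul_one] at this
  rw [e, map_mul, map_mul, hw]
  have hpos : (0 : WithZero (Multiplicative ℤ)) < WithZero.exp (-j) := by simp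
  have hiff : ∀ y : WithZero (Multiplicative ℤ), WithZero.exp (-j) * y ≤ WithZero.exp (-j) ↔ y ≤ 1 :=
    fun y => by
      conv_lhs => rw [← mul_one (WithZero.exp (-j)), mul_assoc, one_mul]
      exact mul_le_mul_iff_right₀ hpos
  rw [hiff]
  exact ⟨fun ⟨_, h⟩ => h, fun h => ⟨hm, h⟩⟩

/-- The index of `𝒪'(x + 1)` in `𝒪'(x)`. -/
theorem relIndex_O_succ (x : ΓK K) :
    (O (pt (x + emb 1))).relIndex (O (pt x)) = Nat.card (LastRes K) := by
  obtain ⟨g, rfl⟩ := ν_surjective x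
  have hmem : ∀ y : O (pt (ν g) : Breve (ΓK K)), ((g⁻¹ : Kˣ) : K) * y ∈ OPrime K := fun y => by
    rw [← mem_O_zero_iff, inv_mul_mem_O_iff g (pt_ν_eq g)]
    exact y.2
  -- The index is the cardinality of the image of `y ↦ r (g⁻¹ y)`, where `r` takes the residue
  -- twice. This map is onto the last residue field and its kernel is the next smaller ball.
  let r : OPrime K →+* LastRes K := (IsLocalRing.residue (OKBar K)).comp
    { toFun := fun y => ⟨IsLocalRing.residue (OK K) ⟨y, (mem_OPrime.1 y.2).1⟩, (mem_OPrime.1 y.2).2⟩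
      map_one' := rfl
      map_mul' := fun _ _ => rfl
      map_zero' := rfl
      map_add' := fun _ _ => rfl }
  let φ : O (pt (ν g) : Breve (ΓK K)) →+ LastRes K := r.toAddMonoidHom.comp
    { toFun := fun y => ⟨((g⁻¹ : Kˣ) : K) * y, hmem y⟩
      map_zero' := Subtype.ext (mul_zero _)
      map_add' := fun _ _ => Subtype.ext (mul_add _ _ _) }
  have hφ : Function.Surjective φ := fun z => by
    obtain ⟨z, rfl⟩ := IsLocalRing.residue_surjective z
    obtain ⟨z, hz⟩ := z
    obtain ⟨z, rfl⟩ := IsLocalRing.residue_surjective z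
    have hz' : (z : K) ∈ OPrime K := mem_OPrime.2 ⟨z.2, hz⟩
    refine ⟨⟨(g : K) * z, mul_mem_O g (pt_ν_eq g) (mem_O_zero_iff.2 hz')⟩, ?_⟩
    have : (⟨((g⁻¹ : Kˣ) : K) * ((g : K) * z), hmem ⟨(g : K) * z, mul_mem_O g (pt_ν_eq g)
        (mem_O_zero_iff.2 hz')⟩⟩ : OPrime K) = ⟨z, hz'⟩ :=
      Subtype.ext (Units.inv_mul_cancel_left g z)
    exact congrArg r this
  have hker : φ.ker = (O (pt (ν g + emb 1))).addSubgroupOf (O (pt (ν g))) := by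
    ext y
    have hy := (mem_OPrime.1 (hmem y)).1
    have e : (pt (ν g + emb 1) : Breve (ΓK K)) = ν g +ᵥ pt (emb 1) := rfl
    rw [AddMonoidHom.mem_ker, AddSubgroup.mem_addSubgroupOf, ← inv_mul_mem_O_iff g e,
      mem_O_emb_iff hy]
    change IsLocalRing.residue (OKBar K) ⟨IsLocalRing.residue (OK K) ⟨_, hy⟩, _⟩ = 0 ↔ _
    rw [IsLocalRing.residue_eq_zero_iff, Valuation.mem_maximalIdeal_iff]
    change TwoDimLocalField.w (IsLocalRing.residue (OK K) ⟨_, hy⟩) < 1 ↔ _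
    generalize TwoDimLocalField.w (IsLocalRing.residue (OK K) ⟨_, hy⟩) = v
    cases v using WithZero.expRecOn with
    | zero => simp
    | exp v => rw [← WithZero.exp_zero, WithZero.exp_lt_exp, WithZero.exp_le_exp]; omega
  rw [AddSubgroup.relIndex, ← hker, AddSubgroup.index_ker, AddMonoidHom.range_eq_top.2 hφ]
  exact Nat.card_congr (AddSubgroup.topEquiv (G := LastRes K)).toEquiv

theorem O_succ_le (x : ΓK K) : O (pt (x + emb 1)) ≤ O (pt x) :=
  O_anti (pt_le_pt.2 (Or.inr ⟨1, rfl⟩))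

theorem relIndex_O_add (x : ΓK K) (n : ℕ) :
    (O (pt (x + emb (n : ℤ)))).relIndex (O (pt x)) = Nat.card (LastRes K) ^ n := by
  induction n with
  | zero => simp
  | succ n ih =>
    have e : x + emb ((n + 1 : ℕ) : ℤ) = x + emb (n : ℤ) + emb 1 := by
      rw [Nat.cast_succ, map_add, add_assoc]
    rw [e, ← AddSubgroup.relIndex_mul_relIndex _ _ _ (O_succ_le _) (O_anti (pt_le_pt.2 (Or.inr ⟨n, rfl⟩))),
      relIndex_O_succ, ih, pow_succ']

theorem le_or_eq_add {x y : ΓK K} (h : lev x = lev y) :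
    (pt y : Breve (ΓK K)) ≤ pt x ∨ ∃ n : ℕ, y = x + emb (n : ℤ) := by
  rcases le_total (pt x) (pt y) with h' | h'
  · rcases h' with h' | h'
    · omega
    · exact Or.inr h'
  · exact Or.inl h'

theorem relIndex_O_ne {x y : ΓK K} (h : lev x = lev y) : (O (pt y)).relIndex (O (pt x)) ≠ 0 := by
  rcases le_or_eq_add h with h | ⟨n, rfl⟩
  · rw [AddSubgroup.relIndex_eq_one.2 (O_anti h)]
    exact one_ne_zero
  · rw [relIndex_O_add]
    exact pow_ne_zero _ Nat.card_pos.ne'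

variable [PartialTopology K]

open Topology PartialTopology

/-- Multiplication by `t` identifies the residue field with `𝒪(k) / 𝒪(k + 1)`, and the axiom on
residues says that this is a homeomorphism. Openness can therefore be tested for the valuation `w`.
-/
theorem isOpen_image_iff {k : ℤ} (t : Kˣ) (ht : ord t = k) {U : AddSubgroup K} (hU : O (bot (k + 1)) ≤ U) :
    IsOp (bot k) (bot (k + 1)) U ↔
      ∃ S, IsOpen[(TwoDimLocalField.w (K := K)).subgroups_basis.topology] S ∧
        ∀ x : O (bot 0 : Breve (ΓK K)), IsLocalRing.residue (OK K) ⟨x, mem_O_zero x.2⟩ ∈ S ↔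
          (t : K) * x ∈ U := by
  have h₀ : (bot k : Breve (ΓK K)) = ν t +ᵥ bot 0 := by rw [vadd_bot, lev_ν, ht, add_zero]
  have h₁ : (bot (k + 1) : Breve (ΓK K)) = ν t +ᵥ bot 1 := by rw [vadd_bot, lev_ν, ht]
  have hr := residue k t h₀ h₁
  rw [isOp_iff_topO, and_iff_right hU]
  have key : IsOpen[topO (bot k) (bot (k + 1))] {x : O (bot k : Breve (ΓK K)) | (x : K) ∈ U} ↔
      IsOpen[(top k (k + 1)).induced (fun x => Q.mul t h₀ h₁ (Q.mk (bot 0) (bot 1) x))]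
        {x : O (bot 0 : Breve (ΓK K)) | (t : K) * x ∈ U} := by
    refine (@isOpen_induced_iff _ _ (top k (k + 1)) _ _).trans
      (Iff.trans ?_ (@isOpen_induced_iff _ _ (top k (k + 1)) _ _).symm)
    refine exists_congr fun s => and_congr_right fun _ => ?_
    constructor
    · intro hs
      ext x
      exact Set.ext_iff.1 hs ⟨(t : K) * x, mul_mem_O t h₀ x.2⟩
    · intro hs
      ext x
      obtain ⟨x, hx⟩ := x
      have hx' := mul_mem_O t⁻¹ (eq_vadd_inv h₀) hx
      have := (Set.ext_iff.1 hs ⟨_, hx'⟩).symm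
      have e : (⟨(t : K) * (((t⁻¹ : Kˣ) : K) * x), mul_mem_O t h₀ hx'⟩ : O (bot k : Breve (ΓK K))) =
        ⟨x, hx⟩ := Subtype.ext (Units.mul_inv_cancel_left t x)
      have e' : Q.mul t h₀ h₁ (Q.mk (bot 0) (bot 1) ⟨_, hx'⟩) = Q.mk (bot k) (bot (k + 1)) ⟨x, hx⟩ :=
        congrArg (Q.mk (bot k) (bot (k + 1))) e
      have e2 : (⟨((t⁻¹ : Kˣ) : K) * x, hx'⟩ : O (bot 0 : Breve (ΓK K))) ∈
          (fun x => Q.mul t h₀ h₁ (Q.mk (bot 0) (bot 1) x)) ⁻¹' s ↔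
          Q.mk (bot k) (bot (k + 1)) ⟨x, hx⟩ ∈ s := by
        rw [← e']
        rfl
      refine e2.symm.trans (this.symm.trans ?_)
      change (t : K) * (((t⁻¹ : Kˣ) : K) * x) ∈ U ↔ x ∈ U
      rw [Units.mul_inv_cancel_left]
  rw [key, hr, @isOpen_induced_iff _ _ (TwoDimLocalField.w (K := K)).subgroups_basis.topology]
  exact exists_congr fun s => and_congr_right fun _ =>
    ⟨fun h x => Set.ext_iff.1 h x, fun h => Set.ext h⟩

theorem isOp_O_pt {x : ΓK K} {k : ℤ} (hx : lev x = k) : IsOp (bot k) (bot (k + 1)) (O (pt x)) := by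
  obtain ⟨t, rfl⟩ := ν_surjective x
  rw [lev_ν] at hx
  rw [isOpen_image_iff t hx (O_anti (pt_le_bot.2 (by rw [lev_ν]; omega)))]
  let _ : Valued (KBar K) (WithZero (Multiplicative ℤ)) := Valued.mk' TwoDimLocalField.w
  refine ⟨(OKBar K : Set (KBar K)), Valued.isOpen_integer (KBar K), fun y => ?_⟩
  rw [mul_mem_O_iff t (pt_ν_eq t), mem_O_zero_iff, mem_OPrime]
  exact ⟨fun h => ⟨_, h⟩, fun ⟨_, h⟩ => h⟩

/-- The balls of a valuation are a basis at zero in the residue field, so the balls of level `k` are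
cofinal among the open subgroups. -/
theorem IsOp.exists_O_pt {k : ℤ} {U : AddSubgroup K} (hU : IsOp (bot k : Breve (ΓK K)) (bot (k + 1)) U) :
    ∃ x : ΓK K, lev x = k ∧ O (pt x) ≤ U := by
  obtain ⟨x, hx⟩ := Ext2.lev_surjective (Γ := ΓK K) k
  obtain ⟨t, rfl⟩ := ν_surjective x
  rw [lev_ν] at hx
  rw [isOpen_image_iff t hx hU.1] at hU
  obtain ⟨S, hS, hSU⟩ := hU
  have h0 : (0 : KBar K) ∈ S := by
    rw [← map_zero (IsLocalRing.residue (OK K))]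
    refine (hSU 0).2 ?_
    rw [AddSubgroup.coe_zero, mul_zero]
    exact zero_mem _
  let _ : Valued (KBar K) (WithZero (Multiplicative ℤ)) := Valued.mk' TwoDimLocalField.w
  obtain ⟨γ, hγ⟩ := (Valued.mem_nhds_zero (R := KBar K)).1 (IsOpen.mem_nhds hS h0)
  have hδ : MonoidWithZeroHom.ValueGroup₀.embedding γ.1 ≠ 0 :=
    (Units.map (MonoidWithZeroHom.ValueGroup₀.embedding :
      MonoidWithZeroHom.ValueGroup₀ (.ofClass (TwoDimLocalField.w (K := K))) →*₀ _).toMonoidHom γ).ne_zero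
  set δ := MonoidWithZeroHom.ValueGroup₀.embedding γ.1 with hδ'
  -- The neighbourhood is given by a strict inequality `w < δ`, the ball by a weak one. The exponent
  -- is shifted by one to pass between them.
  have hlt : WithZero.exp (-(1 - WithZero.log δ)) < δ := by
    conv_rhs => rw [← WithZero.exp_log hδ]
    rw [WithZero.exp_lt_exp]
    omega
  refine ⟨ν t + emb (1 - WithZero.log δ), ?_, fun y hy => ?_⟩
  · rw [map_add, lev_ν, lev_emb, hx, add_zero]
  · have hz := (inv_mul_mem_O_iff t (vadd_pt (ν t) (emb (1 - WithZero.log δ))).symm).2 hy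
    have hz0 := O_anti (bot_zero_le_pt_emb _) hz
    have := (hSU ⟨_, hz0⟩).1 (hγ ?_)
    · rwa [Units.mul_inv_cancel_left] at this
    · refine (Valuation.restrict_lt_iff_lt_embedding _).2 (lt_of_le_of_lt ?_ hlt)
      exact (mem_O_emb_iff (mem_O_zero hz0)).1 hz

end Balls

end

end TwoDim

namespace TwoDim

noncomputable section

open _root_.TwoDim.Ext2 (emb lev)
open Breve

/-! ### Invariance under an open subgroup. -/

section Groups

open Topology

theorem isLocallyConstant_of_invariant {G X : Type*} [AddCommGroup G] [TopologicalSpace G]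
    [IsTopologicalAddGroup G] {g : G → X} (H : AddSubgroup G) (hH : IsOpen (H : Set G))
    (h : ∀ x, ∀ u ∈ H, g (x + u) = g x) : IsLocallyConstant g := by
  refine (IsLocallyConstant.iff_exists_open g).2 fun x => ⟨(fun y => y - x) ⁻¹' H,
    hH.preimage (continuous_id.sub continuous_const), ?_, fun y hy => ?_⟩
  · change x - x ∈ H
    rw [sub_self]
    exact zero_mem _
  · rw [← h x _ hy, add_sub_cancel]

theorem coset_mem_nhds {G : Type*} [AddCommGroup G] [TopologicalSpace G]
    [IsTopologicalAddGroup G] {H : AddSubgroup G} (hH : IsOpen (H : Set G)) (q : G) :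
    {y | y - q ∈ H} ∈ 𝓝 q := by
  refine (hH.preimage (continuous_id.sub continuous_const)).mem_nhds ?_
  change q - q ∈ H
  rw [sub_self]
  exact zero_mem _

end Groups

/-! ### Existence and compactness of lattices. -/

section Lattices

variable {K : Type*} [Field K]

/-- The indicator function of `c + U`. -/
def cosetFun (c : K) (U : AddSubgroup K) : K → ℂ := Set.indicator {x | x - c ∈ U} 1

theorem cosetFun_of_mem {c x : K} {U : AddSubgroup K} (h : x - c ∈ U) : cosetFun c U x = 1 :=
  Set.indicator_of_mem (s := {x | x - c ∈ U}) h 1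

theorem cosetFun_of_not_mem {c x : K} {U : AddSubgroup K} (h : x - c ∉ U) : cosetFun c U x = 0 :=
  Set.indicator_of_notMem (s := {x | x - c ∈ U}) h 1

theorem exists_finset_cover {V U : AddSubgroup K} (h : V.relIndex U ≠ 0) :
    ∃ s : Finset K, (∀ c ∈ s, c ∈ U) ∧ ∀ x ∈ U, ∃ c ∈ s, x - c ∈ V := by
  classical
  have : Finite (U ⧸ V.addSubgroupOf U) := by
    have : (V.addSubgroupOf U).FiniteIndex := ⟨h⟩
    infer_instance
  have := Fintype.ofFinite (U ⧸ V.addSubgroupOf U)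
  refine ⟨Finset.univ.image fun c : U ⧸ V.addSubgroupOf U => (c.out : K), ?_, fun x hx => ?_⟩
  · intro c hc
    obtain ⟨c, -, rfl⟩ := Finset.mem_image.1 hc
    exact c.out.2
  · refine ⟨_, Finset.mem_image_of_mem _ (Finset.mem_univ (QuotientAddGroup.mk ⟨x, hx⟩)), ?_⟩
    have := QuotientAddGroup.eq.1 (QuotientAddGroup.out_eq'
      (QuotientAddGroup.mk ⟨x, hx⟩ : U ⧸ V.addSubgroupOf U))
    rw [AddSubgroup.mem_addSubgroupOf] at this
    rw [sub_eq_neg_add]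
    exact this

variable [TwoDimLocalField K] [PartialTopology K]

open Topology PartialTopology

/-- An open subgroup contains a ball of the same level, and the index of one ball in another is
finite since the last residue field is finite. -/
theorem lat_O_pt {x : ΓK K} {k : ℤ} (hx : lev x = k) : Lat (bot k) (bot (k + 1)) (O (pt x)) where
  le := O_anti (bot_le_pt.2 hx.ge)
  isOp := isOp_O_pt hx
  relIndex_ne V hV := by
    obtain ⟨y, hy, h⟩ := hV.exists_O_pt
    exact fun h0 => relIndex_O_ne (hx.trans hy.symm) (AddSubgroup.relIndex_eq_zero_of_le_left h h0)

/-- When `a` is a point, `𝒪'(a)` is the preimage of a ball in the first quotient `𝒪(k) / 𝒪(k + 1)`.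
-/
theorem isOp_floor_O {a b : Breve (ΓK K)} (hab : a ≤ b) : IsOp (bot a.floor) (bot b.ceil) (O a) := by
  cases a with
  | bot n => exact isOp_O (bot_mono (floor_le_ceil hab))
  | pt x => exact (isOp_O_pt rfl).of_quotient (bot_mono (lt_add_one _).le) (bot_mono (ceil_mono hab))

theorem continuous_mk {a b : Breve (ΓK K)} : @Continuous _ _ (topO a b) _ (Q.mk a b) :=
  continuous_coinduced_rng

theorem isOpen_map_iff {a b : Breve (ΓK K)} {U : AddSubgroup K} (hU : O b ≤ U) :
    IsOpen ((U.addSubgroupOf (O a)).map (Q.mk a b) : Set (Q a b)) ↔ IsOp a b U :=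
  (and_iff_right hU).symm

theorem mem_map_mk_iff {a b : Breve (ΓK K)} {U : AddSubgroup K} (hU : O b ≤ U) (x : O a) :
    Q.mk a b x ∈ (U.addSubgroupOf (O a)).map (Q.mk a b) ↔ (x : K) ∈ U := by
  refine ⟨?_, fun h => ⟨x, h, rfl⟩⟩
  rintro ⟨y, hy, hyx⟩
  have hy : (y : K) ∈ U := hy
  have := U.sub_mem hy (hU (Q.mk_eq_mk.1 hyx))
  rwa [sub_sub_cancel] at this

theorem relIndex_map_mk {a b : Breve (ΓK K)} {U V : AddSubgroup K} (hU : U ≤ O a) (hV : O b ≤ V) :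
    ((V.addSubgroupOf (O a)).map (Q.mk a b)).relIndex ((U.addSubgroupOf (O a)).map (Q.mk a b)) =
      V.relIndex U := by
  rw [← AddSubgroup.relIndex_comap]
  have : ((V.addSubgroupOf (O a)).map (Q.mk a b)).comap (Q.mk a b) = V.addSubgroupOf (O a) :=
    AddSubgroup.ext fun x => mem_map_mk_iff hV x
  rw [this, AddSubgroup.relIndex_addSubgroupOf hU]

/-- Every neighbourhood of zero contains a compact open subgroup. -/
theorem exists_lat_of_mem_nhds {a b : Breve (ΓK K)} (hab : a ≤ b) {S : Set (Q a b)}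
    (hS : S ∈ 𝓝 (0 : Q a b)) : ∃ U, Lat a b U ∧
      ((U.addSubgroupOf (O a)).map (Q.mk a b) : Set (Q a b)) ⊆ S ∧
      IsCompact ((U.addSubgroupOf (O a)).map (Q.mk a b) : Set (Q a b)) := by
  have hn := floor_le_ceil hab
  have i1 := isTopologicalAddGroup_bot (K := K) hn
  have i2 := locallyCompact_bot (K := K) hn
  have i3 := totallyDisconnected_bot (K := K) hn
  have i4 := isTopologicalAddGroup_Q hab
  obtain ⟨S', hS', hoS, h0S⟩ := mem_nhds_iff.1 hS
  have hpre : IsOpen[topO a b] (Q.mk a b ⁻¹' S') := isOpen_coinduced.1 hoS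
  rw [topO_eq_induced hab le_rfl, isOpen_induced_iff] at hpre
  obtain ⟨R, hR, hRS⟩ := hpre
  -- `𝒪'(a)` is itself open in the ambient quotient, so the compact open subgroup `W` can be chosen
  -- inside its image. This makes the preimage of `W` in `𝒪'(a)` compact.
  have hA := (isOp_floor_O hab).2
  have h0 : (0 : Q (bot a.floor : Breve (ΓK K)) (bot b.ceil)) ∈
      R ∩ (Q.mk _ _ '' {x : O (bot a.floor : Breve (ΓK K)) | (x : K) ∈ O a}) := by
    refine ⟨?_, ⟨0, (O a).zero_mem, map_zero _⟩⟩
    have : (0 : O a) ∈ Q.mk a b ⁻¹' S' := by rw [Set.mem_preimage, map_zero]; exact h0S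
    rw [← hRS, Set.mem_preimage, map_zero] at this
    exact this
  obtain ⟨W, hW, hWc, hWR⟩ := exists_compact_open_addSubgroup ((hR.inter hA).mem_nhds h0)
  set f := toBot b.ceil (bot_floor_le a) with hf
  have hWf : (W : Set _) ⊆ Set.range f := fun w hw => by
    obtain ⟨x, hx, rfl⟩ := (hWR hw).2
    exact ⟨⟨x, hx⟩, rfl⟩
  have hcomp : @IsCompact _ (topO a b) (f ⁻¹' W) :=
    @Topology.IsInducing.isCompact_preimage' _ _ (topO a b) _ f
      (@Topology.IsInducing.mk _ _ (topO a b) _ _ (topO_eq_induced hab le_rfl)) _ hWc hWf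
  have himg := @IsCompact.image _ _ (topO a b) _ _ _ hcomp continuous_mk
  -- Adding `𝒪'(b)` makes the subgroup saturated and does not change its image in `𝒪'(a) / 𝒪'(b)`.
  let U := (W.comap f).map (O a).subtype ⊔ O b
  have hUO : U ≤ O a := sup_le (by rintro _ ⟨x, -, rfl⟩; exact x.2) (O_anti hab)
  have hbU : O b ≤ U := le_sup_right
  have hWU : ∀ x : O a, f x ∈ W → (x : K) ∈ U := fun x hx => AddSubgroup.mem_sup_left ⟨x, hx, rfl⟩
  have hUop : IsOp a b U := (isOp_iff hab le_rfl).2 ⟨hbU, W, hW, hWU⟩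
  have hUW : ((U.addSubgroupOf (O a)).map (Q.mk a b) : Set (Q a b)) = Q.mk a b '' (f ⁻¹' W) := by
    ext q
    constructor
    · rintro ⟨x, hx, rfl⟩
      obtain ⟨_, ⟨y, hy, rfl⟩, z, hz, hyz⟩ := AddSubgroup.mem_sup.1 hx
      refine ⟨y, hy, Q.mk_eq_mk.2 ?_⟩
      have : (y : K) - x = -z := by
        have : (y : K) + z = x := hyz
        rw [← this]; ring
      rw [this]
      exact neg_mem hz
    · rintro ⟨x, hx, rfl⟩
      exact ⟨x, hWU x hx, rfl⟩
  have hUc : IsCompact ((U.addSubgroupOf (O a)).map (Q.mk a b) : Set (Q a b)) := hUW ▸ himg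
  refine ⟨U, ⟨hUO, hUop, fun V hV => ?_⟩, ?_, hUc⟩
  -- An open subgroup of a compact group has finite index.
  · rw [← relIndex_map_mk hUO hV.1]
    have hVo := (isOpen_map_iff hV.1).2 hV
    have : CompactSpace ((U.addSubgroupOf (O a)).map (Q.mk a b)) := isCompact_iff_compactSpace.1 hUc
    have hfin := AddSubgroup.quotient_finite_of_isOpen
      (((V.addSubgroupOf (O a)).map (Q.mk a b)).addSubgroupOf ((U.addSubgroupOf (O a)).map (Q.mk a b)))
      (hVo.preimage continuous_subtype_val)
    exact AddSubgroup.index_ne_zero_of_finite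
  · rw [hUW]
    rintro _ ⟨x, hx, rfl⟩
    refine hS' ?_
    have : x ∈ Q.mk a b ⁻¹' S' := hRS ▸ (hWR hx).1
    exact this

theorem exists_lat {a b : Breve (ΓK K)} (hab : a ≤ b) : ∃ U, Lat a b U :=
  (exists_lat_of_mem_nhds hab Filter.univ_mem).imp fun _ h => h.1

theorem exists_lat_le {a b : Breve (ΓK K)} (hab : a ≤ b) {V : AddSubgroup K} (hV : IsOp a b V) :
    ∃ U, Lat a b U ∧ U ≤ V :=
  (exists_lat hab).imp' (· ⊓ V) fun _ h => ⟨h.inf hV, inf_le_right⟩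

theorem locallyCompact_Q {a b : Breve (ΓK K)} (hab : a ≤ b) : LocallyCompactSpace (Q a b) := by
  have i4 := isTopologicalAddGroup_Q hab
  obtain ⟨U, hU, -, hc⟩ := exists_lat_of_mem_nhds hab Filter.univ_mem
  exact hc.locallyCompactSpace_of_mem_nhds_of_addGroup
    (((isOpen_map_iff hU.isOp.1).2 hU.isOp).mem_nhds (zero_mem _))

/-- A lattice is covered by finitely many translates of some compact open subgroup, and it is closed
since open subgroups are closed. -/
theorem Lat.isCompact {a b : Breve (ΓK K)} (hab : a ≤ b) {U : AddSubgroup K} (hU : Lat a b U) :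
    IsCompact ((U.addSubgroupOf (O a)).map (Q.mk a b) : Set (Q a b)) := by
  have i4 := isTopologicalAddGroup_Q hab
  obtain ⟨V, hV, -, hc⟩ := exists_lat_of_mem_nhds hab Filter.univ_mem
  obtain ⟨s, hs, hsU⟩ := exists_finset_cover (hU.relIndex_ne V hV.isOp)
  have hcl := AddSubgroup.isClosed_of_isOpen _ ((isOpen_map_iff hU.isOp.1).2 hU.isOp)
  have hcov : IsCompact (⋃ c : s, (fun q => Q.mk a b ⟨c, hU.le (hs c c.2)⟩ + q) ''
      ((V.addSubgroupOf (O a)).map (Q.mk a b) : Set (Q a b))) :=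
    isCompact_iUnion fun c => hc.image (continuous_const_add _)
  refine hcov.of_isClosed_subset hcl ?_
  rintro _ ⟨x, hx, rfl⟩
  obtain ⟨c, hcs, hxc⟩ := hsU x hx
  refine Set.mem_iUnion.2 ⟨⟨c, hcs⟩, Q.mk a b (x - ⟨c, hU.le (hs c hcs)⟩), ⟨_, hxc, rfl⟩, ?_⟩
  change Q.mk a b ⟨c, hU.le (hs c hcs)⟩ + Q.mk a b (x - ⟨c, hU.le (hs c hcs)⟩) = Q.mk a b x
  rw [← map_add, add_sub_cancel]

end Lattices

/-! ### Test functions in terms of lattices. -/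

section TestFunctions

variable {K : Type*} [Field K] [TwoDimLocalField K] [PartialTopology K]

open Topology PartialTopology

/-- The criterion used to construct test functions: invariance under an open subgroup gives local
constancy, and finitely many cosets of a lattice are compact. `Test.exists_lat` is the converse. -/
theorem mem_Test_of_invariant {a b : Breve (ΓK K)} (hab : a ≤ b) {f : K → ℂ} {U V : AddSubgroup K}
    (hU : IsOp a b U) (hf : ∀ x, ∀ u ∈ U, f (x + u) = f x) (hV : Lat a b V) {s : Finset K}
    (hs : ∀ c ∈ s, c ∈ O a) (hfs : ∀ x, f x ≠ 0 → ∃ c ∈ s, x - c ∈ V) : f ∈ Test a b := by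
  have i4 := isTopologicalAddGroup_Q hab
  have hfO : ∀ x, x ∉ O a → f x = 0 := fun x hx => by
    by_contra h
    obtain ⟨c, hc, hxc⟩ := hfs x h
    have := add_mem (hV.le hxc) (hs c hc)
    rw [sub_add_cancel] at this
    exact hx this
  have hval : ∀ x : O a, f x =
      f (Function.surjInv (Q.mk_surjective a b) (Q.mk a b x) : O a) := fun x => by
    have := Q.mk_eq_mk.1 (Function.surjInv_eq (Q.mk_surjective a b) (Q.mk a b x))
    rw [← hf x _ (hU.1 this), add_sub_cancel]
  refine ⟨hfO, fun q => f (Function.surjInv (Q.mk_surjective a b) q : O a),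
    isLocallyConstant_of_invariant _ ((isOpen_map_iff hU.1).2 hU) ?_, ?_, hval⟩
  · rintro q _ ⟨u, hu, rfl⟩
    obtain ⟨x, rfl⟩ := Q.mk_surjective a b q
    rw [← map_add, ← hval, ← hval]
    exact hf x u hu
  · have hcl := AddSubgroup.isClosed_of_isOpen _ ((isOpen_map_iff hV.isOp.1).2 hV.isOp)
    have hc := hV.isCompact hab
    have e : ∀ c : s, (fun q => Q.mk a b ⟨c, hs c c.2⟩ + q) ''
        ((V.addSubgroupOf (O a)).map (Q.mk a b) : Set (Q a b)) =
        Homeomorph.addLeft (Q.mk a b ⟨c, hs c c.2⟩) ''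
          ((V.addSubgroupOf (O a)).map (Q.mk a b) : Set (Q a b)) := fun c => rfl
    refine HasCompactSupport.intro' (K := ⋃ c : s, (fun q => Q.mk a b ⟨c, hs c c.2⟩ + q) ''
        ((V.addSubgroupOf (O a)).map (Q.mk a b) : Set (Q a b)))
      (isCompact_iUnion fun c => hc.image (continuous_const_add _))
      (isClosed_iUnion_of_finite fun c => ?_) fun q hq => ?_
    · rw [e, Homeomorph.isClosed_image]
      exact hcl
    · by_contra h
      obtain ⟨c, hcs, hxc⟩ := hfs _ h
      refine hq (Set.mem_iUnion.2 ⟨⟨c, hcs⟩,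
        Q.mk a b (Function.surjInv (Q.mk_surjective a b) q - ⟨c, hs c hcs⟩), ⟨_, hxc, rfl⟩, ?_⟩)
      change Q.mk a b ⟨c, hs c hcs⟩ + Q.mk a b (_ - ⟨c, hs c hcs⟩) = q
      rw [← map_add, add_sub_cancel, Function.surjInv_eq (Q.mk_surjective a b)]

/-- On the compact support local constancy becomes uniform, and finitely many cosets of the
resulting lattice cover the support. -/
theorem Test.exists_lat {a b : Breve (ΓK K)} (hab : a ≤ b) (f : Test a b) :
    ∃ U, Lat a b U ∧ (∀ x, ∀ u ∈ U, f.1 (x + u) = f.1 x) ∧ 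
      ∃ s : Finset K, (∀ c ∈ s, c ∈ O a) ∧ ∀ x, f.1 x ≠ 0 → ∃ c ∈ s, x - c ∈ U := by
  classical
  have i4 := isTopologicalAddGroup_Q hab
  obtain ⟨f, hfO, g, hg, hgc, hgf⟩ := f
  have h1 : ∃ U, Lat a b U ∧ ∀ x : O a, Q.mk a b x ∈ tsupport g → ∀ u : O a, (u : K) ∈ U →
      g (Q.mk a b (x + u)) = g (Q.mk a b x) := by
    refine IsCompact.induction_on (p := fun S => ∃ U, Lat a b U ∧ ∀ x : O a, Q.mk a b x ∈ S →
      ∀ u : O a, (u : K) ∈ U → g (Q.mk a b (x + u)) = g (Q.mk a b x)) hgc ?_ ?_ ?_ ?_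
    · exact (TwoDim.exists_lat hab).imp fun U hU => ⟨hU, fun x hx => hx.elim⟩
    · exact fun s t hst => Exists.imp fun U hU => ⟨hU.1, fun x hx => hU.2 x (hst hx)⟩
    · rintro s t ⟨U, hU, h⟩ ⟨V, hV, h'⟩
      exact ⟨U ⊓ V, hU.inf hV.isOp, fun x hx u hu => hx.elim (fun hx => h x hx u hu.1)
        fun hx => h' x hx u hu.2⟩
    · intro q hq
      have hn : (fun y => q + y) ⁻¹' (g ⁻¹' {g q}) ∈ 𝓝 (0 : Q a b) := by
        refine ((hg.isOpen_fiber (g q)).preimage (continuous_const.add continuous_id)).mem_nhds ?_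
        change g (q + 0) = g q
        rw [add_zero]
      obtain ⟨U, hU, hUS, -⟩ := exists_lat_of_mem_nhds hab hn
      have key : ∀ y : O a, Q.mk a b y - q ∈ (U.addSubgroupOf (O a)).map (Q.mk a b) →
          g (Q.mk a b y) = g q := fun y hy => by
        have : g (q + (Q.mk a b y - q)) = g q := hUS hy
        rwa [add_sub_cancel] at this
      refine ⟨_, mem_nhdsWithin_of_mem_nhds
        (coset_mem_nhds ((isOpen_map_iff hU.isOp.1).2 hU.isOp) q), U, hU, fun x hx u hu => ?_⟩
      · rw [key x hx, key]
        have : Q.mk a b (x + u) - q = (Q.mk a b x - q) + Q.mk a b u := by rw [map_add]; abel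
        rw [this]
        exact add_mem hx ⟨u, hu, rfl⟩
  obtain ⟨U, hU, h1⟩ := h1
  have hz : ∀ x : O a, Q.mk a b x ∉ tsupport g → g (Q.mk a b x) = 0 := fun x hx =>
    image_eq_zero_of_notMem_tsupport hx
  have h2 : ∀ x, ∀ u ∈ U, f (x + u) = f x := by
    intro x u hu
    have huO := hU.le hu
    by_cases hx : x ∈ O a
    · have e1 := hgf ⟨x, hx⟩
      have e2 := hgf (⟨x, hx⟩ + ⟨u, huO⟩)
      refine e2.trans (Eq.trans ?_ e1.symm)
      by_cases h : Q.mk a b ⟨x, hx⟩ ∈ tsupport g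
      · exact h1 _ h ⟨u, huO⟩ hu
      -- If `x` is outside the support but `x + u` is inside, the invariance is applied at `x + u`
      -- with `-u`.
      · by_cases h' : Q.mk a b (⟨x, hx⟩ + ⟨u, huO⟩) ∈ tsupport g
        · have := h1 _ h' (-⟨u, huO⟩) (neg_mem hu)
          rwa [add_neg_cancel_right, eq_comm] at this
        · rw [hz _ h, hz _ h']
    · rw [hfO x hx, hfO]
      intro h
      have := sub_mem h huO
      rw [add_sub_cancel_right] at this
      exact hx this
  have h3 : ∃ s : Finset K, (∀ c ∈ s, c ∈ O a) ∧ ∀ x : O a, Q.mk a b x ∈ tsupport g →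
      ∃ c ∈ s, (x : K) - c ∈ U := by
    refine IsCompact.induction_on (p := fun S => ∃ s : Finset K, (∀ c ∈ s, c ∈ O a) ∧ ∀ x : O a,
      Q.mk a b x ∈ S → ∃ c ∈ s, (x : K) - c ∈ U) hgc ?_ ?_ ?_ ?_
    · exact ⟨∅, by simp, fun x hx => hx.elim⟩
    · exact fun s t hst => Exists.imp fun _ h => ⟨h.1, fun x hx => h.2 x (hst hx)⟩
    · rintro s t ⟨U, hU, h⟩ ⟨V, hV, h'⟩
      refine ⟨U ∪ V, fun c hc => (Finset.mem_union.1 hc).elim (hU c) (hV c), fun x hx => ?_⟩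
      rcases hx with hx | hx
      · obtain ⟨c, hc, h⟩ := h x hx
        exact ⟨c, Finset.mem_union_left _ hc, h⟩
      · obtain ⟨c, hc, h⟩ := h' x hx
        exact ⟨c, Finset.mem_union_right _ hc, h⟩
    · intro q hq
      obtain ⟨c, rfl⟩ := Q.mk_surjective a b q
      refine ⟨_, mem_nhdsWithin_of_mem_nhds
        (coset_mem_nhds ((isOpen_map_iff hU.isOp.1).2 hU.isOp) (Q.mk a b c)), {(c : K)}, ?_, ?_⟩
      · simp
      · intro x hx
        refine ⟨c, Finset.mem_singleton_self _, ?_⟩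
        have hx : Q.mk a b x - Q.mk a b c ∈ (U.addSubgroupOf (O a)).map (Q.mk a b) := hx
        rw [← map_sub, mem_map_mk_iff hU.isOp.1] at hx
        exact hx
  obtain ⟨s, hs, h3⟩ := h3
  refine ⟨U, hU, h2, s, hs, fun x hx => ?_⟩
  by_cases hxO : x ∈ O a
  · refine h3 ⟨x, hxO⟩ ?_
    by_contra h
    exact hx ((hgf ⟨x, hxO⟩).trans (hz _ h))
  · exact (hx (hfO x hxO)).elim

end TestFunctions

end

end TwoDim

namespace TwoDim

noncomputable section

open _root_.TwoDim.Ext2 (emb lev)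
open Breve

/-! ### Slices, direct images and products of measures. -/

section TestFunctions

variable {K : Type*} [Field K] [TwoDimLocalField K] [PartialTopology K]

theorem cosetFun_add {K : Type*} [Field K] (c x : K) {U : AddSubgroup K} {u : K} (hu : u ∈ U) :
    cosetFun c U (x + u) = cosetFun c U x := by
  have : x + u - c ∈ U ↔ x - c ∈ U := by
    rw [add_sub_right_comm]
    exact U.add_mem_cancel_right hu
  by_cases h : x - c ∈ U
  · rw [cosetFun_of_mem h, cosetFun_of_mem (this.2 h)]
  · rw [cosetFun_of_not_mem h, cosetFun_of_not_mem fun h' => h (this.1 h')]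

/-- The indicator function of the coset `c + U` of a lattice. -/
def Test.ind {a b : Breve (ΓK K)} (hab : a ≤ b) {U : AddSubgroup K} (hU : Lat a b U) {c : K}
    (hc : c ∈ O a) : Test a b :=
  ⟨cosetFun c U, mem_Test_of_invariant hab hU.isOp (fun x _ hu => cosetFun_add c x hu) hU
    (s := {c}) (by simpa using hc) fun x hx => ⟨c, Finset.mem_singleton_self c, by
      by_contra h
      exact hx (cosetFun_of_not_mem h)⟩⟩

theorem Test.ind_apply {a b : Breve (ΓK K)} (hab : a ≤ b) {U : AddSubgroup K} (hU : Lat a b U)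
    {c : K} (hc : c ∈ O a) (x : K) : (Test.ind hab hU hc).1 x = cosetFun c U x := rfl

theorem Test.apply_of_not_mem {a b : Breve (ΓK K)} (f : Test a b) {x : K} (hx : x ∉ O a) :
    f.1 x = 0 := f.2.1 x hx

theorem Test.apply_add {a b : Breve (ΓK K)} (hab : a ≤ b) (f : Test a b) (x : K) {u : K}
    (hu : u ∈ O b) : f.1 (x + u) = f.1 x := by
  obtain ⟨U, hU, h, -⟩ := Test.exists_lat hab f
  exact h x u (hU.isOp.1 hu)

/-- Indicators of cosets of lattices span the test functions, and the lattices can be restricted to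
any cofinal class `L`. The choice of `L` adapts this principle to balls, to sums with `𝒪'(b)` and to
intersections with it. -/
theorem Test.induction {a b : Breve (ΓK K)} (hab : a ≤ b) {L : AddSubgroup K → Prop}
    (hL : ∀ V, Lat a b V → ∃ U, L U ∧ Lat a b U ∧ U ≤ V) {P : Test a b → Prop} (h0 : P 0)
    (hadd : ∀ f g, P f → P g → P (f + g)) (hsmul : ∀ (s : ℂ) (f), P f → P (s • f))
    (hind : ∀ U c (hU : Lat a b U) (hc : c ∈ O a), L U → P (Test.ind hab hU hc)) (f : Test a b) :
    P f := by
  classical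
  obtain ⟨V, hV, hfV, s, hs, hfs⟩ := Test.exists_lat hab f
  obtain ⟨U, hLU, hU, hUV⟩ := hL V hV
  have key : ∀ s : Finset K, (∀ c ∈ s, c ∈ O a) → ∀ f : Test a b,
      (∀ x, ∀ u ∈ U, f.1 (x + u) = f.1 x) → (∀ x, f.1 x ≠ 0 → ∃ c ∈ s, x - c ∈ U) → P f := by
    intro s
    induction s using Finset.induction_on with
    | empty =>
      intro _ f _ hf
      have : f = 0 := Subtype.ext <| funext fun x => by
        by_contra h
        obtain ⟨c, hc, -⟩ := hf x h
        simp at hc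
      rw [this]
      exact h0
    | insert c s hcs ih =>
      intro hs f hfU hf
      have hc := hs c (Finset.mem_insert_self c s)
      -- The difference vanishes on the coset of `c`, so one coset fewer is needed to cover its
      -- support.
      have e : f = f.1 c • Test.ind hab hU hc + (f - f.1 c • Test.ind hab hU hc) := by abel
      rw [e]
      refine hadd _ _ (hsmul _ _ (hind U c hU hc hLU)) (ih
        (fun d hd => hs d (Finset.mem_insert_of_mem hd)) _ (fun x u hu => ?_) fun x hx => ?_)
      · change f.1 (x + u) - f.1 c * cosetFun c U (x + u) = f.1 x - f.1 c * cosetFun c U x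
        rw [hfU x u hu, cosetFun_add c x hu]
      · have hx : f.1 x - f.1 c * cosetFun c U x ≠ 0 := hx
        by_cases hxc : x - c ∈ U
        · refine (hx ?_).elim
          have := hfU c _ hxc
          rw [add_sub_cancel] at this
          rw [cosetFun_of_mem hxc, this, mul_one, sub_self]
        · rw [cosetFun_of_not_mem hxc, mul_zero, sub_zero] at hx
          obtain ⟨d, hd, hxd⟩ := hf x hx
          rcases Finset.mem_insert.1 hd with rfl | hd
          · exact (hxc hxd).elim
          · exact ⟨d, hd, hxd⟩
  -- Each of the cosets of `V` that cover the support splits into finitely many cosets of the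
  -- smaller lattice `U`.
  obtain ⟨t, ht, htV⟩ := exists_finset_cover (hV.relIndex_ne U hU.isOp)
  refine key ((s ×ˢ t).image fun p => p.1 + p.2) ?_ f (fun x u hu => hfV x u (hUV hu)) fun x hx => ?_
  · intro c hc
    obtain ⟨p, hp, rfl⟩ := Finset.mem_image.1 hc
    rw [Finset.mem_product] at hp
    exact add_mem (hs _ hp.1) (hV.le (ht _ hp.2))
  · obtain ⟨c, hc, hxc⟩ := hfs x hx
    obtain ⟨d, hd, hxd⟩ := htV _ hxc
    refine ⟨c + d, Finset.mem_image.2 ⟨(c, d), Finset.mem_product.2 ⟨hc, hd⟩, rfl⟩, ?_⟩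
    rwa [← sub_sub]

theorem Test.mul_mem {a b : Breve (ΓK K)} (hab : a ≤ b) (f : Test a b) {V : AddSubgroup K}
    (hV : IsOp a b V) {χ : K → ℂ} (hχ : ∀ x, ∀ v ∈ V, χ (x + v) = χ x) :
    (fun x => χ x * f.1 x) ∈ Test a b := by
  obtain ⟨U, hU, hfU, s, hs, hfs⟩ := Test.exists_lat hab f
  refine mem_Test_of_invariant hab (hU.isOp.inf hV) (fun x u hu => ?_) hU hs fun x hx =>
    hfs x (right_ne_zero_of_mul hx)
  rw [hχ x u hu.2, hfU x u hu.1]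

-- The slice is invariant under `U ∩ 𝒪'(b)`, where `U` is a lattice for `f`, and each coset of `U`
-- in the support of `f` contributes at most one coset of `U ∩ 𝒪'(b)`.
open Classical in
theorem slice_mem {a b c : Breve (ΓK K)} (hab : a ≤ b) (hbc : b ≤ c) (f : Test a c) (x : K) :
    (fun y => if y ∈ O b then f.1 (x + y) else 0) ∈ Test b c := by
  obtain ⟨U, hU, hfU, s, hs, hfs⟩ := Test.exists_lat (hab.trans hbc) f
  -- A representative in `𝒪'(b)` of each coset that meets `x + 𝒪'(b)`, with an arbitrary value for
  -- the other cosets.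
  have hch : ∀ d : K, ∃ y ∈ O b, (∃ y ∈ O b, x + y - d ∈ U) → x + y - d ∈ U := fun d => by
    by_cases h : ∃ y ∈ O b, x + y - d ∈ U
    · exact h.imp fun y hy => ⟨hy.1, fun _ => hy.2⟩
    · exact ⟨0, zero_mem _, fun h' => (h h').elim⟩
  choose y hy hyd using hch
  refine mem_Test_of_invariant hbc (hU.restrict hab hbc).isOp (fun z u hu => ?_)
    (hU.restrict hab hbc) (s := s.image y) (fun c hc => ?_) fun z hz => ?_
  · rw [AddSubgroup.add_mem_cancel_right _ hu.2, ← add_assoc, hfU _ u hu.1]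
  · obtain ⟨d, -, rfl⟩ := Finset.mem_image.1 hc
    exact hy d
  · have hzb : z ∈ O b := by
      by_contra h
      exact hz (if_neg h)
    rw [if_pos hzb] at hz
    obtain ⟨d, hd, hzd⟩ := hfs _ hz
    refine ⟨y d, Finset.mem_image_of_mem y hd, ?_⟩
    have h := U.sub_mem hzd (hyd d ⟨z, hzb, hzd⟩)
    have e : x + z - d - (x + y d - d) = z - y d := by ring
    rw [e] at h
    exact ⟨h, (O b).sub_mem hzb (hy d)⟩

open Classical in
/-- The function `y ↦ f(x + y)` on `𝒪'(b) / 𝒪'(c)`. -/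
def slice {a b c : Breve (ΓK K)} (hab : a ≤ b) (hbc : b ≤ c) (x : K) : Test a c →ₗ[ℂ] Test b c where
  toFun f := ⟨fun y => if y ∈ O b then f.1 (x + y) else 0, slice_mem hab hbc f x⟩
  map_add' f g := Subtype.ext <| funext fun y => by
    change (if y ∈ O b then f.1 (x + y) + g.1 (x + y) else 0) =
      (if y ∈ O b then f.1 (x + y) else 0) + (if y ∈ O b then g.1 (x + y) else 0)
    split_ifs <;> simp
  map_smul' s f := Subtype.ext <| funext fun y => by
    change (if y ∈ O b then s * f.1 (x + y) else 0) = s * (if y ∈ O b then f.1 (x + y) else 0)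
    split_ifs <;> simp

theorem slice_apply {a b c : Breve (ΓK K)} (hab : a ≤ b) (hbc : b ≤ c) (x : K) (f : Test a c) {y : K}
    (hy : y ∈ O b) : (slice hab hbc x f).1 y = f.1 (x + y) := if_pos hy

theorem Test.ext_on {a b : Breve (ΓK K)} {f g : Test a b} (h : ∀ x ∈ O a, f.1 x = g.1 x) : f = g :=
  Subtype.ext <| funext fun x => by
    by_cases hx : x ∈ O a
    · exact h x hx
    · rw [Test.apply_of_not_mem f hx, Test.apply_of_not_mem g hx]

theorem Meas.translate {a b : Breve (ΓK K)} (m : Meas a b) {x : K} (hx : x ∈ O a) {f f' : Test a b}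
    (h : ∀ y ∈ O a, f'.1 y = f.1 (y + x)) : m.1 f' = m.1 f :=
  m.2 x hx f f' fun y => by
    by_cases hy : y ∈ O a
    · exact h y hy
    · rw [Test.apply_of_not_mem f' hy, Test.apply_of_not_mem f]
      exact fun h' => hy (((O a).add_mem_cancel_right hx).1 h')

-- The integral is invariant under `U ∩ 𝒪'(a)` because `f` is, and under `𝒪'(b)` because the measure
-- is, hence under the sum, which is a lattice in `𝒪'(a) / 𝒪'(b)`.
open Classical in
theorem dirIm_mem {a' a b c : Breve (ΓK K)} (h₁ : a' ≤ a) (h₂ : a ≤ b) (h₃ : b ≤ c) (m : Meas b c)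
    (f : Test a' c) :
    (fun x => if x ∈ O a then m.1 (slice (h₁.trans h₂) h₃ x f) else 0) ∈ Test a b := by
  obtain ⟨U, hU, hfU, s, hs, hfs⟩ := Test.exists_lat (h₁.trans (h₂.trans h₃)) f
  have hL : Lat a b ((U ⊓ O a) ⊔ O b) := (hU.restrict h₁ (h₂.trans h₃)).sup h₂ h₃
  have hch : ∀ d : K, ∃ x ∈ O a, (∃ x ∈ O a, ∃ y ∈ O b, x + y - d ∈ U) →
      ∃ y ∈ O b, x + y - d ∈ U := fun d => by
    by_cases h : ∃ x ∈ O a, ∃ y ∈ O b, x + y - d ∈ U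
    · exact h.imp fun y hy => ⟨hy.1, fun _ => hy.2⟩
    · exact ⟨0, zero_mem _, fun h' => (h h').elim⟩
  choose x hx hxd using hch
  refine mem_Test_of_invariant h₂ hL.isOp (fun z w hw => ?_) hL (s := s.image x) (fun c hc => ?_)
    fun z hz => ?_
  · obtain ⟨u, hu, v, hv, rfl⟩ := AddSubgroup.mem_sup.1 hw
    rw [AddSubgroup.add_mem_cancel_right _ (hL.le hw)]
    refine if_congr Iff.rfl (Meas.translate m hv fun y hy => ?_) rfl
    rw [slice_apply _ _ _ _ hy, slice_apply _ _ _ _ (add_mem hy hv), ← hfU (z + (y + v)) u hu.1]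
    ring_nf
  · obtain ⟨d, -, rfl⟩ := Finset.mem_image.1 hc
    exact hx d
  · have hza : z ∈ O a := by
      by_contra h
      exact hz (if_neg h)
    rw [if_pos hza] at hz
    obtain ⟨y, hy, hfy⟩ : ∃ y ∈ O b, f.1 (z + y) ≠ 0 := by
      by_contra! h
      have h0 : slice (h₁.trans h₂) h₃ z f = 0 := Test.ext_on fun y hy => by
        rw [slice_apply _ _ _ _ hy, h y hy]; rfl
      rw [h0, map_zero] at hz
      exact hz rfl
    obtain ⟨d, hd, hzd⟩ := hfs _ hfy
    obtain ⟨y', hy', hyd'⟩ := hxd d ⟨z, hza, y, hy, hzd⟩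
    refine ⟨x d, Finset.mem_image_of_mem x hd, ?_⟩
    -- The first summand is in `U ∩ 𝒪'(a)` and the second in `𝒪'(b)`.
    have e : z - x d = ((z + y - d) - (x d + y' - d)) + (y' - y) := by ring
    have h := (O a).sub_mem (add_mem hza (O_anti h₂ hy)) (add_mem (hx d) (O_anti h₂ hy'))
    have e' : z + y - (x d + y') = z + y - d - (x d + y' - d) := by ring
    rw [e'] at h
    rw [e]
    exact AddSubgroup.add_mem_sup (AddSubgroup.mem_inf.2 ⟨U.sub_mem hzd hyd', h⟩)
      ((O b).sub_mem hy' hy)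

open Classical in
/-- The direct image along a measure `m` on `𝒪'(b) / 𝒪'(c)` of the restriction to `𝒪'(a) / 𝒪'(c)` of a
function on `𝒪'(a') / 𝒪'(c)`. -/
def dirIm {a' a b c : Breve (ΓK K)} (h₁ : a' ≤ a) (h₂ : a ≤ b) (h₃ : b ≤ c) (m : Meas b c) :
    Test a' c →ₗ[ℂ] Test a b where
  toFun f := ⟨_, dirIm_mem h₁ h₂ h₃ m f⟩
  map_add' f g := Subtype.ext <| funext fun x => by
    change (if x ∈ O a then m.1 (slice (h₁.trans h₂) h₃ x (f + g)) else 0) =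
      (if x ∈ O a then m.1 (slice (h₁.trans h₂) h₃ x f) else 0) +
        (if x ∈ O a then m.1 (slice (h₁.trans h₂) h₃ x g) else 0)
    rw [map_add, map_add]
    split_ifs <;> simp
  map_smul' s f := Subtype.ext <| funext fun x => by
    change (if x ∈ O a then m.1 (slice (h₁.trans h₂) h₃ x (s • f)) else 0) =
      s * (if x ∈ O a then m.1 (slice (h₁.trans h₂) h₃ x f) else 0)
    rw [map_smul, map_smul]
    split_ifs <;> simp

section DirIm

variable {a' a b c d : Breve (ΓK K)} (h₁ : a' ≤ a) (h₂ : a ≤ b) (h₃ : b ≤ c)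

theorem dirIm_apply (m : Meas b c) (f : Test a' c) {x : K} (hx : x ∈ O a) :
    (dirIm h₁ h₂ h₃ m f).1 x = m.1 (slice (h₁.trans h₂) h₃ x f) := if_pos hx

/-- The direct image, so far a relation, is the graph of a linear map. The same is done for products
of measures in `isProd_iff`. -/
theorem isDirectImage_iff {m : Meas b c} {f : Test a' c} {f' : Test a b} :
    IsDirectImage f m f' ↔ f' = dirIm h₁ h₂ h₃ m f := by
  constructor
  · intro h
    refine Test.ext_on fun x hx => ?_
    obtain ⟨φ, h1, h2⟩ := h x hx
    rw [h2, dirIm_apply h₁ h₂ h₃ m f hx]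
    refine congrArg m.1 (Test.ext_on fun y hy => ?_)
    rw [h1 y hy, slice_apply _ _ _ _ hy]
  · rintro rfl x hx
    exact ⟨_, fun y hy => slice_apply _ _ _ _ hy, dirIm_apply h₁ h₂ h₃ m f hx⟩

theorem dirIm_add (m m' : Meas b c) : dirIm h₁ h₂ h₃ (m + m') = dirIm h₁ h₂ h₃ m + dirIm h₁ h₂ h₃ m' :=
  LinearMap.ext fun f => Test.ext_on fun x hx => by
    change _ = (dirIm h₁ h₂ h₃ m f).1 x + (dirIm h₁ h₂ h₃ m' f).1 x
    rw [dirIm_apply _ _ _ _ _ hx, dirIm_apply _ _ _ _ _ hx, dirIm_apply _ _ _ _ _ hx]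
    rfl

theorem dirIm_smul (s : ℂ) (m : Meas b c) : dirIm h₁ h₂ h₃ (s • m) = s • dirIm h₁ h₂ h₃ m :=
  LinearMap.ext fun f => Test.ext_on fun x hx => by
    change _ = s * (dirIm h₁ h₂ h₃ m f).1 x
    rw [dirIm_apply _ _ _ _ _ hx, dirIm_apply _ _ _ _ _ hx]
    rfl

/-- The product of the measures on `𝒪'(a) / 𝒪'(b)` and on `𝒪'(b) / 𝒪'(c)`. -/
def Meas.prod (hab : a ≤ b) (hbc : b ≤ c) : Meas a b →ₗ[ℂ] Meas b c →ₗ[ℂ] Meas a c :=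
  LinearMap.mk₂ ℂ (fun l m => ⟨l.1 ∘ₗ dirIm le_rfl hab hbc m, fun x hx f f' h => by
      refine Meas.translate l hx fun y hy => ?_
      rw [dirIm_apply _ _ _ _ _ hy, dirIm_apply _ _ _ _ _ (add_mem hy hx)]
      refine congrArg m.1 (Test.ext_on fun z hz => ?_)
      rw [slice_apply _ _ _ _ hz, slice_apply _ _ _ _ hz, h, add_right_comm]⟩)
    (fun _ _ _ => rfl) (fun _ _ _ => rfl)
    (fun l m m' => Subtype.ext <| by
      change l.1 ∘ₗ _ = l.1 ∘ₗ _ + l.1 ∘ₗ _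
      rw [dirIm_add, LinearMap.comp_add])
    (fun s l m => Subtype.ext <| by
      change l.1 ∘ₗ _ = s • l.1 ∘ₗ _
      rw [dirIm_smul, LinearMap.comp_smul])

theorem Meas.prod_apply (hab : a ≤ b) (hbc : b ≤ c) (l : Meas a b) (m : Meas b c) (f : Test a c) :
    (Meas.prod hab hbc l m).1 f = l.1 (dirIm le_rfl hab hbc m f) := rfl

theorem isProd_iff (hab : a ≤ b) (hbc : b ≤ c) {l : Meas a b} {m : Meas b c} {n : Meas a c} :
    IsProd l m n ↔ n = Meas.prod hab hbc l m := by
  constructor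
  · refine fun h => Subtype.ext <| LinearMap.ext fun f => ?_
    obtain ⟨f', h1, h2⟩ := h f
    rw [h2, (isDirectImage_iff le_rfl hab hbc).1 h1]
    rfl
  · rintro rfl f
    exact ⟨_, (isDirectImage_iff le_rfl hab hbc).2 rfl, rfl⟩

/-- Iterated integration. It gives both the associativity of products of measures and the
transitivity of the transition maps. -/
theorem dirIm_prod {a'' : Breve (ΓK K)} (h₀ : a'' ≤ a') (h₄ : c ≤ d) (l : Meas b c) (m : Meas c d) :
    dirIm (h₀.trans h₁) h₂ (h₃.trans h₄) (Meas.prod h₃ h₄ l m) =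
      dirIm h₁ h₂ h₃ l ∘ₗ dirIm h₀ (h₁.trans (h₂.trans h₃)) h₄ m :=
  LinearMap.ext fun f => Test.ext_on fun x hx => by
    rw [LinearMap.comp_apply, dirIm_apply _ _ _ _ _ hx, dirIm_apply _ _ _ _ _ hx, Meas.prod_apply]
    refine congrArg l.1 (Test.ext_on fun y hy => ?_)
    have hxy : x + y ∈ O a' := O_anti h₁ (add_mem hx (O_anti h₂ hy))
    rw [dirIm_apply _ _ _ _ _ hy, slice_apply _ _ _ _ hy, dirIm_apply _ _ _ _ _ hxy]
    refine congrArg m.1 (Test.ext_on fun z hz => ?_)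
    rw [slice_apply _ _ _ _ hz, slice_apply _ _ _ _ (add_mem hy (O_anti h₃ hz)),
      slice_apply _ _ _ _ hz, add_assoc]

theorem Meas.prod_assoc (hab : a ≤ b) (hbc : b ≤ c) (hcd : c ≤ d) (l : Meas a b) (m : Meas b c)
    (n : Meas c d) : Meas.prod hab (hbc.trans hcd) l (Meas.prod hbc hcd m n) =
      Meas.prod (hab.trans hbc) hcd (Meas.prod hab hbc l m) n :=
  Subtype.ext <| LinearMap.ext fun f => by
    rw [Meas.prod_apply, Meas.prod_apply, Meas.prod_apply]
    exact congrArg l.1 (LinearMap.congr_fun (dirIm_prod le_rfl hab hbc le_rfl hcd m n) f)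

end DirIm

end TestFunctions

end

end TwoDim

namespace TwoDim

noncomputable section

open _root_.TwoDim.Ext2 (emb lev)
open Breve


/-! ### Invariant measures form lines. -/

section Measures

variable {K : Type*} [Field K] [TwoDimLocalField K] [PartialTopology K]

/-- The indicator function of a lattice. -/
def Test.char {a b : Breve (ΓK K)} (hab : a ≤ b) {U : AddSubgroup K} (hU : Lat a b U) : Test a b :=
  Test.ind hab hU (zero_mem (O a))

theorem Test.char_apply_of_mem {a b : Breve (ΓK K)} (hab : a ≤ b) {U : AddSubgroup K}
    (hU : Lat a b U) {x : K} (hx : x ∈ U) : (Test.char hab hU).1 x = 1 :=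
  cosetFun_of_mem (by rwa [sub_zero])

theorem Test.char_apply_of_not_mem {a b : Breve (ΓK K)} (hab : a ≤ b) {U : AddSubgroup K}
    (hU : Lat a b U) {x : K} (hx : x ∉ U) : (Test.char hab hU).1 x = 0 :=
  cosetFun_of_not_mem (by rwa [sub_zero])

theorem Test.char_apply {a b : Breve (ΓK K)} (hab : a ≤ b) {U : AddSubgroup K}
    (hU : Lat a b U) (x : K) : (Test.char hab hU).1 x = (U : Set K).indicator 1 x := by
  by_cases hx : x ∈ U
  · rw [Test.char_apply_of_mem hab hU hx, Set.indicator_of_mem (SetLike.mem_coe.2 hx), Pi.one_apply]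
  · rw [Test.char_apply_of_not_mem hab hU hx, Set.indicator_of_notMem (mt SetLike.mem_coe.1 hx)]

theorem Meas.apply_ind {a b : Breve (ΓK K)} (hab : a ≤ b) {U : AddSubgroup K} (hU : Lat a b U)
    {c : K} (hc : c ∈ O a) (m : Meas a b) : m.1 (Test.ind hab hU hc) = m.1 (Test.char hab hU) :=
  (Meas.translate m hc fun y _ => by
    rw [Test.ind_apply, Test.char, Test.ind_apply]
    by_cases h : y ∈ U
    · rw [cosetFun_of_mem (by rwa [sub_zero]), cosetFun_of_mem (by rwa [add_sub_cancel_right])]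
    · rw [cosetFun_of_not_mem (by rwa [sub_zero]),
        cosetFun_of_not_mem (by rwa [add_sub_cancel_right])]).symm

/-- `U` is the disjoint union of its cosets of `V`, which all have the same measure. -/
theorem Meas.char_eq {a b : Breve (ΓK K)} (hab : a ≤ b) {U V : AddSubgroup K} (hU : Lat a b U)
    (hV : Lat a b V) (hVU : V ≤ U) (m : Meas a b) :
    m.1 (Test.char hab hU) = V.relIndex U * m.1 (Test.char hab hV) := by
  classical
  have hfin : (V.addSubgroupOf U).FiniteIndex := ⟨hU.relIndex_ne V hV.isOp⟩
  have := Fintype.ofFinite (U ⧸ V.addSubgroupOf U)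
  have e : Test.char hab hU =
      ∑ q : U ⧸ V.addSubgroupOf U, Test.ind hab hV (c := (q.out : K)) (hU.le q.out.2) := by
    refine Test.ext_on fun x _ => ?_
    have hs : (∑ q : U ⧸ V.addSubgroupOf U, Test.ind hab hV (c := (q.out : K)) (hU.le q.out.2)).1 x =
        ∑ q : U ⧸ V.addSubgroupOf U, cosetFun (q.out : K) V x := by
      rw [AddSubmonoidClass.coe_finsetSum, Finset.sum_apply]
      rfl
    rw [hs]
    by_cases hx : x ∈ U
    · rw [Test.char_apply_of_mem hab hU hx,
        Finset.sum_eq_single (QuotientAddGroup.mk ⟨x, hx⟩ : U ⧸ V.addSubgroupOf U), cosetFun_of_mem]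
      · have := QuotientAddGroup.eq.1 (QuotientAddGroup.out_eq'
          (QuotientAddGroup.mk ⟨x, hx⟩ : U ⧸ V.addSubgroupOf U))
        rw [AddSubgroup.mem_addSubgroupOf] at this
        rw [sub_eq_neg_add]
        exact this
      · intro q _ hq
        refine cosetFun_of_not_mem fun h => hq ?_
        rw [← QuotientAddGroup.out_eq' q]
        refine QuotientAddGroup.eq.2 ?_
        rw [AddSubgroup.mem_addSubgroupOf]
        rw [sub_eq_neg_add] at h
        exact h
      · exact fun h => (h (Finset.mem_univ _)).elim
    · rw [Test.char_apply_of_not_mem hab hU hx, Finset.sum_eq_zero]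
      intro q _
      refine cosetFun_of_not_mem fun h => hx ?_
      have := U.add_mem (hVU h) q.out.2
      rwa [sub_add_cancel] at this
  rw [e, map_sum, Finset.sum_congr rfl fun q _ => Meas.apply_ind hab hV _ m, Finset.sum_const,
    Finset.card_univ, nsmul_eq_mul, ← Nat.card_eq_fintype_card]
  rfl

/-- Uniqueness of invariant measures: lattices contained in `U` are cofinal, and their measures are
determined by that of `U` through the index. -/
theorem Meas.ext_char {a b : Breve (ΓK K)} (hab : a ≤ b) {U : AddSubgroup K} (hU : Lat a b U)
    {m m' : Meas a b} (h : m.1 (Test.char hab hU) = m'.1 (Test.char hab hU)) : m = m' := by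
  refine Subtype.ext <| LinearMap.ext fun f => ?_
  refine Test.induction hab (L := fun V => V ≤ U) (P := fun f => m.1 f = m'.1 f)
    (fun V hV => ⟨V ⊓ U, inf_le_right, hV.inf hU.isOp, inf_le_left⟩) (by rw [map_zero, map_zero])
    (fun f g hf hg => by rw [map_add, map_add, hf, hg])
    (fun s f hf => by rw [map_smul, map_smul, hf]) (fun V c hV hc hVU => ?_) f
  rw [Meas.apply_ind, Meas.apply_ind]
  rw [Meas.char_eq hab hU hV hVU m, Meas.char_eq hab hU hV hVU m'] at h
  exact mul_left_cancel₀ (Nat.cast_ne_zero.2 (hU.relIndex_ne V hV.isOp)) h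

theorem Meas.char_ne_zero {a b : Breve (ΓK K)} (hab : a ≤ b) {U : AddSubgroup K} (hU : Lat a b U)
    {m : Meas a b} (hm : m ≠ 0) : m.1 (Test.char hab hU) ≠ 0 := fun h =>
  hm (Meas.ext_char hab hU (h.trans (LinearMap.zero_apply _).symm))

-- Integration against Haar measure. Test functions are integrable as they are continuous with
-- compact support, and a lattice has positive finite measure because it is open and compact.
open MeasureTheory Topology in
theorem exists_meas_ne_zero {a b : Breve (ΓK K)} (hab : a ≤ b) : ∃ m : Meas a b, m ≠ 0 := by
  have i1 := isTopologicalAddGroup_Q hab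
  have i2 := locallyCompact_Q hab
  let _ : MeasurableSpace (Q a b) := borel _
  have i3 : BorelSpace (Q a b) := ⟨rfl⟩
  let G : Test a b →ₗ[ℂ] (Q a b → ℂ) :=
    { toFun := fun f q => f.1 (Function.surjInv (Q.mk_surjective a b) q : O a)
      map_add' := fun _ _ => rfl
      map_smul' := fun _ _ => rfl }
  have hG : ∀ (f : Test a b) (x : O a), G f (Q.mk a b x) = f.1 x := fun f x => by
    have := Q.mk_eq_mk.1 (Function.surjInv_eq (Q.mk_surjective a b) (Q.mk a b x))
    change f.1 _ = _
    have h := Test.apply_add hab f (x : K) this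
    rwa [add_sub_cancel] at h
  have hint : ∀ f : Test a b, Integrable (G f) (Measure.addHaar : Measure (Q a b)) := fun f => by
    obtain ⟨g, h1, h2, h3⟩ := f.2.2
    have e : G f = g := funext fun q => by
      obtain ⟨x, rfl⟩ := Q.mk_surjective a b q
      rw [hG, h3]
    rw [e]
    exact h1.continuous.integrable_of_hasCompactSupport h2
  refine ⟨⟨⟨⟨fun f => ∫ q, G f q ∂Measure.addHaar, fun f g => ?_⟩, fun s f => ?_⟩, ?_⟩, fun h => ?_⟩
  · change ∫ q, G (f + g) q ∂Measure.addHaar = _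
    rw [map_add]
    exact integral_add (hint f) (hint g)
  · change ∫ q, G (s • f) q ∂Measure.addHaar = _
    rw [map_smul]
    exact integral_smul s _
  · intro c hc f f' h
    change ∫ q, G f' q ∂Measure.addHaar = ∫ q, G f q ∂Measure.addHaar
    rw [← integral_add_right_eq_self (G f) (Q.mk a b ⟨c, hc⟩)]
    refine integral_congr_ae (Filter.Eventually.of_forall fun q => ?_)
    obtain ⟨x, rfl⟩ := Q.mk_surjective a b q
    change G f' _ = G f _
    rw [← map_add, hG, hG, h]
    rfl
  · obtain ⟨U, hU⟩ := exists_lat hab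
    let S : Set (Q a b) := (↑((U.addSubgroupOf (O a)).map (Q.mk a b)) : Set (Q a b))
    have hSo : IsOpen S := (isOpen_map_iff hU.isOp.1).2 hU.isOp
    have hSc : IsCompact S := hU.isCompact hab
    have e : G (Test.char hab hU) = S.indicator 1 := funext fun q => by
      obtain ⟨x, rfl⟩ := Q.mk_surjective a b q
      rw [hG]
      by_cases hx : (x : K) ∈ U
      · rw [Test.char_apply_of_mem hab hU hx,
          Set.indicator_of_mem ((mem_map_mk_iff hU.isOp.1 x).2 hx), Pi.one_apply]
      · rw [Test.char_apply_of_not_mem hab hU hx,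
          Set.indicator_of_notMem (mt (mem_map_mk_iff hU.isOp.1 x).1 hx)]
    have h0 : ∫ q, G (Test.char hab hU) q ∂Measure.addHaar = 0 :=
      LinearMap.congr_fun (congrArg Subtype.val h) (Test.char hab hU)
    rw [e] at h0
    have h0 : ∫ q, S.indicator (fun _ => (1 : ℂ)) q ∂(Measure.addHaar : Measure (Q a b)) = 0 := h0
    rw [integral_indicator_const _ hSo.measurableSet, smul_eq_zero] at h0
    have h0 := h0.resolve_right one_ne_zero
    have h1 : 0 < (Measure.addHaar : Measure (Q a b)) S :=
      hSo.measure_pos _ ⟨0, AddSubgroup.zero_mem _⟩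
    exact (ENNReal.toReal_pos h1.ne' hSc.measure_lt_top.ne).ne' h0

theorem exists_meas_char_eq {a b : Breve (ΓK K)} (hab : a ≤ b) {U : AddSubgroup K} (hU : Lat a b U)
    (s : ℂ) : ∃ m : Meas a b, m.1 (Test.char hab hU) = s := by
  obtain ⟨m, hm⟩ := exists_meas_ne_zero hab
  refine ⟨(s / m.1 (Test.char hab hU)) • m, ?_⟩
  exact div_mul_cancel₀ s (Meas.char_ne_zero hab hU hm)

theorem Meas.exists_eq_smul {a b : Breve (ΓK K)} (hab : a ≤ b) {m : Meas a b} (hm : m ≠ 0)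
    (m' : Meas a b) : ∃ s : ℂ, m' = s • m := by
  obtain ⟨U, hU⟩ := exists_lat hab
  refine ⟨m'.1 (Test.char hab hU) / m.1 (Test.char hab hU), Meas.ext_char hab hU ?_⟩
  exact (div_mul_cancel₀ _ (Meas.char_ne_zero hab hU hm)).symm

/-- Over a point of `d + U + 𝒪'(b)` the slice of the coset is a coset of `U ∩ 𝒪'(b)`, and over other
points it is empty. -/
theorem dirIm_ind {a b c : Breve (ΓK K)} (hab : a ≤ b) (hbc : b ≤ c) {U : AddSubgroup K}
    (hU : Lat a c U) (m : Meas b c) {d : K} (hd : d ∈ O a) :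
    dirIm le_rfl hab hbc m (Test.ind (hab.trans hbc) hU hd) =
      m.1 (Test.char hbc (hU.restrict hab hbc)) • Test.ind hab (hU.sup hab hbc) hd := by
  refine Test.ext_on fun x hx => ?_
  change _ = _ * cosetFun d (U ⊔ O b) x
  rw [dirIm_apply _ _ _ _ _ hx]
  by_cases h : x - d ∈ U ⊔ O b
  · obtain ⟨u, hu, y, hy, e⟩ := AddSubgroup.mem_sup.1 h
    rw [cosetFun_of_mem h, mul_one, ← Meas.apply_ind hbc _ ((O b).neg_mem hy)]
    refine congrArg m.1 (Test.ext_on fun z hz => ?_)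
    rw [slice_apply _ _ _ _ hz, Test.ind_apply, Test.ind_apply]
    have e' : x + z - d = u + (z - -y) := by
      rw [sub_neg_eq_add, add_sub_right_comm, ← e]; ring
    have hz' : z - -y ∈ O b := (O b).sub_mem hz ((O b).neg_mem hy)
    by_cases hzU : z - -y ∈ U
    · rw [cosetFun_of_mem, cosetFun_of_mem (AddSubgroup.mem_inf.2 ⟨hzU, hz'⟩)]
      rw [e']
      exact U.add_mem hu hzU
    · rw [cosetFun_of_not_mem, cosetFun_of_not_mem fun h => hzU (AddSubgroup.mem_inf.1 h).1]
      rw [e']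
      exact mt (U.add_mem_cancel_left hu).1 hzU
  · rw [cosetFun_of_not_mem h, mul_zero]
    have h0 : slice (le_rfl.trans hab) hbc x (Test.ind (hab.trans hbc) hU hd) = 0 := by
      refine Test.ext_on fun z hz => ?_
      rw [slice_apply _ _ _ _ hz, Test.ind_apply, cosetFun_of_not_mem]
      · rfl
      · intro h'
        refine h ?_
        have := AddSubgroup.add_mem_sup h' ((O b).neg_mem hz)
        rwa [add_sub_right_comm, add_neg_cancel_right] at this
    rw [h0, map_zero]

/-- The formula by which products of measures are computed and seen to be nonzero: a lattice is an
extension of its image by its intersection with `𝒪'(b)`. -/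
theorem Meas.prod_char {a b c : Breve (ΓK K)} (hab : a ≤ b) (hbc : b ≤ c) {U : AddSubgroup K}
    (hU : Lat a c U) (l : Meas a b) (m : Meas b c) :
    (Meas.prod hab hbc l m).1 (Test.char (hab.trans hbc) hU) =
      m.1 (Test.char hbc (hU.restrict hab hbc)) * l.1 (Test.char hab (hU.sup hab hbc)) := by
  rw [Meas.prod_apply, Test.char, dirIm_ind, map_smul]
  rfl

theorem Meas.prod_ne_zero {a b c : Breve (ΓK K)} (hab : a ≤ b) (hbc : b ≤ c) {l : Meas a b}
    {m : Meas b c} (hl : l ≠ 0) (hm : m ≠ 0) : Meas.prod hab hbc l m ≠ 0 := by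
  obtain ⟨U, hU⟩ := exists_lat (hab.trans hbc)
  intro h
  have := Meas.prod_char hab hbc hU l m
  rw [h] at this
  exact mul_ne_zero (Meas.char_ne_zero _ _ hm) (Meas.char_ne_zero _ _ hl) this.symm

/-- The measure on the zero group for which the total measure is one. -/
def Meas.one (a : Breve (ΓK K)) : Meas a a :=
  ⟨LinearMap.proj 0 ∘ₗ (Test a a).subtype, fun c hc f f' h => by
    change f'.1 0 = f.1 0
    rw [h, Test.apply_add le_rfl f 0 hc]⟩

theorem Meas.one_apply (a : Breve (ΓK K)) (f : Test a a) : (Meas.one a).1 f = f.1 0 := rfl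

theorem Meas.one_ne_zero (a : Breve (ΓK K)) : Meas.one a ≠ 0 := by
  intro h
  obtain ⟨U, hU⟩ := exists_lat (le_refl a)
  have : (Test.char le_rfl hU).1 0 = 0 := LinearMap.congr_fun (congrArg Subtype.val h) (Test.char le_rfl hU)
  rw [Test.char_apply_of_mem _ _ (zero_mem U)] at this
  exact _root_.one_ne_zero this

theorem Meas.prod_one {a b : Breve (ΓK K)} (hab : a ≤ b) (l : Meas a b) :
    Meas.prod hab le_rfl l (Meas.one b) = l :=
  Subtype.ext <| LinearMap.ext fun f => by
    rw [Meas.prod_apply]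
    refine congrArg l.1 (Test.ext_on fun x hx => ?_)
    rw [dirIm_apply _ _ _ _ _ hx, Meas.one_apply, slice_apply _ _ _ _ (zero_mem _), add_zero]

theorem Meas.one_prod {a b : Breve (ΓK K)} (hab : a ≤ b) (m : Meas a b) :
    Meas.prod le_rfl hab (Meas.one a) m = m :=
  Subtype.ext <| LinearMap.ext fun f => by
    rw [Meas.prod_apply, Meas.one_apply, dirIm_apply _ _ _ _ _ (zero_mem _)]
    refine congrArg m.1 (Test.ext_on fun x hx => ?_)
    rw [slice_apply _ _ _ _ hx, zero_add]

theorem Meas.prod_left_injective {a b c : Breve (ΓK K)} (hab : a ≤ b) (hbc : b ≤ c) {l : Meas a b}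
    (hl : l ≠ 0) : Function.Injective (Meas.prod hab hbc l) := by
  rw [injective_iff_map_eq_zero]
  intro m h
  by_contra hm
  exact Meas.prod_ne_zero hab hbc hl hm h

theorem Meas.prod_left_surjective {a b c : Breve (ΓK K)} (hab : a ≤ b) (hbc : b ≤ c) {l : Meas a b}
    (hl : l ≠ 0) : Function.Surjective (Meas.prod hab hbc l) := fun n => by
  obtain ⟨m, hm⟩ := exists_meas_ne_zero hbc
  obtain ⟨s, rfl⟩ := Meas.exists_eq_smul (hab.trans hbc) (Meas.prod_ne_zero hab hbc hl hm) n
  exact ⟨s • m, map_smul _ _ _⟩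

end Measures

end

end TwoDim

namespace TwoDim

noncomputable section

open _root_.TwoDim.Ext2 (emb lev)
open Breve


/-! ### The numbers `jump` for sets of rays. -/

section Combinatorics

variable {Γ : Type*} [AddCommGroup Γ] [Ext2 Γ]

theorem mem_ray_iff {x γ : Γ} : γ ∈ ray x ↔ lev γ = lev x ∧ (pt x : Breve Γ) ≤ pt γ := by
  constructor
  · intro h
    exact ⟨le_pt_pt h, Or.inr h⟩
  · rintro ⟨h, h' | h'⟩
    · omega
    · exact h'

theorem mem_stdGood_iff {x γ : Γ} (h : lev γ = lev x) : γ ∈ (stdGood x).1 ↔ (pt x : Breve Γ) ≤ pt γ := by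
  rw [← and_iff_right (a := lev γ = lev x) (b := (pt x : Breve Γ) ≤ pt γ) h, ← mem_ray_iff]
  constructor
  · rintro ⟨j, hj⟩
    have h1 := (mem_ray_iff.1 hj).1
    rw [map_add, map_zsmul, lev_stdLift, smul_eq_mul, mul_one, h] at h1
    obtain rfl : j = 0 := by omega
    rwa [zero_smul, add_zero] at hj
  · intro h
    exact ⟨0, by rwa [zero_smul, add_zero]⟩

theorem lt_add_emb_one (x : Γ) : (pt x : Breve Γ) < pt (x + emb 1) := by
  refine lt_of_le_of_ne (Or.inr ⟨1, by simp⟩) fun h => ?_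
  have h : x = x + emb 1 := by injection h
  rw [left_eq_add] at h
  exact one_ne_zero (Ext2.emb_injective (h.trans (map_zero _).symm))

theorem lev_add_emb (x : Γ) (n : ℤ) : lev (x + emb n) = lev x := by rw [map_add, lev_emb, add_zero]

theorem between_lev {α β : Breve Γ} {k : ℤ} (hβ : bot k ≤ β) (hα : α ≤ bot (k + 1)) (hβα : β ≤ α) {γ : Γ}
    (h : ind (up β) γ - ind (up α) γ ≠ 0) : lev γ = k ∧ β ≤ pt γ ∧ pt γ < α := by
  have h1 : γ ∈ up β := by
    by_contra hb
    have ha : γ ∉ up α := fun ha => hb (hβα.trans ha)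
    rw [ind_not_mem hb, ind_not_mem ha] at h
    exact h (sub_self 0)
  have h2 : γ ∉ up α := fun ha => by
    rw [ind_mem h1, ind_mem ha] at h
    exact h (sub_self 1)
  have h1 : β ≤ pt γ := h1
  have h2 : pt γ < α := not_le.1 h2
  have h3 : bot k ≤ pt γ := hβ.trans h1
  have h4 : pt γ < bot (k + 1) := h2.trans_le hα
  have h3 : k ≤ lev γ := h3
  have h4 : lev γ < k + 1 := h4.le
  exact ⟨by omega, h1, h2⟩

/-- Only the fibre of `x` meets the region between `β` and `α`, and in this fibre the two rays
differ by the point `x` alone. -/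
theorem jump_stdGood_succ {α β : Breve Γ} {x : Γ} (hβ : bot (lev x) ≤ β) (hβx : β ≤ pt x)
    (hxα : pt (x + emb 1) ≤ α) (hα : α ≤ bot (lev x + 1)) :
    jump α β (stdGood (x + emb 1)) (stdGood x) = 1 := by
  have hβα : β ≤ α := hβx.trans ((lt_add_emb_one x).le.trans hxα)
  rw [jump, finsum_eq_single _ x]
  · rw [ind_mem ((mem_stdGood_iff rfl).2 le_rfl),
      ind_not_mem (mt (mem_stdGood_iff (lev_add_emb x 1).symm).1 (lt_add_emb_one x).not_ge),
      ind_mem (show x ∈ up β from hβx),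
      ind_not_mem (show x ∉ up α from ((lt_add_emb_one x).trans_le hxα).not_ge)]
    norm_num
  · intro γ hγ
    by_contra h
    obtain ⟨h1, h2, h3⟩ := between_lev hβ hα hβα (right_ne_zero_of_mul h)
    refine left_ne_zero_of_mul h ?_
    have e : γ ∈ (stdGood x).1 ↔ γ ∈ (stdGood (x + emb 1)).1 := by
      rw [mem_stdGood_iff h1, mem_stdGood_iff (h1.trans (lev_add_emb x 1).symm)]
      refine ⟨fun h => ?_, fun h => (lt_add_emb_one x).le.trans h⟩
      rcases h with h | ⟨n, rfl⟩
      · omega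
      · rcases n with _ | n
        · exact (hγ (by simp)).elim
        · exact Or.inr ⟨n, by rw [Nat.cast_succ, map_add, add_assoc, add_comm (emb (n : ℤ))]⟩
    by_cases hx : γ ∈ (stdGood x).1
    · rw [ind_mem hx, ind_mem (e.1 hx), sub_self]
    · rw [ind_not_mem hx, ind_not_mem (mt e.2 hx), sub_self]

theorem jump_stdGood_add {α β : Breve Γ} {x : Γ} (hβ : bot (lev x) ≤ β) (hβx : β ≤ pt x) (n : ℕ)
    (hxα : pt (x + emb (n : ℤ)) ≤ α) (hα : α ≤ bot (lev x + 1)) :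
    jump α β (stdGood (x + emb (n : ℤ))) (stdGood x) = n := by
  induction n with
  | zero =>
    rw [Nat.cast_zero, map_zero, add_zero, jump_same]
  | succ n ih =>
    have e : x + emb ((n + 1 : ℕ) : ℤ) = x + emb (n : ℤ) + emb 1 := by
      rw [Nat.cast_succ, map_add, add_assoc]
    have hl := lev_add_emb x n
    rw [e] at hxα
    rw [jump_trans _ _ _ (stdGood (x + emb (n : ℤ))), ih ((lt_add_emb_one _).le.trans hxα), e,
      jump_stdGood_succ (by rwa [hl]) (hβx.trans (Or.inr ⟨n, rfl⟩)) hxα (by rwa [hl])]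
    push_cast
    ring

/-- Both rays start at or above `α`, so neither meets the region. -/
theorem jump_stdGood_eq_zero {α β : Breve Γ} {k : ℤ} {x y : Γ} (hx : lev x = k) (hy : lev y = k)
    (hβ : bot k ≤ β) (hβα : β ≤ α) (hαx : α ≤ pt x) (hαy : α ≤ pt y) :
    jump α β (stdGood x) (stdGood y) = 0 := by
  refine finsum_eq_zero_of_forall_eq_zero fun γ => ?_
  by_contra h
  have hα : α ≤ bot (k + 1) := hαx.trans (pt_le_bot.2 (by omega))
  obtain ⟨h1, h2, h3⟩ := between_lev hβ hα hβα (right_ne_zero_of_mul h)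
  refine left_ne_zero_of_mul h ?_
  rw [ind_not_mem (mt (mem_stdGood_iff (h1.trans hx.symm)).1 (h3.trans_le hαx).not_ge),
    ind_not_mem (mt (mem_stdGood_iff (h1.trans hy.symm)).1 (h3.trans_le hαy).not_ge), sub_self]

end Combinatorics

/-! ### A coherent family of normalized measures. -/

section Frame

variable {K : Type*} [Field K] [TwoDimLocalField K] [PartialTopology K]

theorem char_congr {a b : Breve (ΓK K)} (hab : a ≤ b) {U V : AddSubgroup K} (hU : Lat a b U)
    (hV : Lat a b V) (h : U = V) : Test.char hab hU = Test.char hab hV := by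
  subst h; rfl

/-- `𝒪'(x)` is a lattice in `𝒪(k) / 𝒪(k + 1)`, and it contains `𝒪'(α)` and is contained in `𝒪'(β)`,
so it is its own image in the subquotient. -/
theorem lat_fibre {α β : Breve (ΓK K)} {x : ΓK K} (hβ : bot (lev x) ≤ β) (hβx : β ≤ pt x)
    (hxα : pt x ≤ α) (hα : α ≤ bot (lev x + 1)) : Lat β α (O (pt x)) := by
  have h := ((lat_O_pt (x := x) rfl).sup (hβ.trans (hβx.trans hxα)) hα).restrict hβ (hβx.trans hxα)
  rwa [sup_eq_left.2 (O_anti hxα), inf_eq_left.2 (O_anti hβx)] at h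

/-- The number that is the measure of `𝒪'(x)` for the element of `μ_q(α, β)` which takes the value one on
the standard set. -/
def weight (α β : Breve (ΓK K)) (x : ΓK K) : ℂ :=
  (qK K : ℂ) ^ jump α β (stdGood 0) (stdGood x)

theorem weight_ne_zero (α β : Breve (ΓK K)) (x : ΓK K) : weight α β x ≠ 0 :=
  zpow_ne_zero _ (qK K).ne_zero

theorem weight_mul (α β γ : Breve (ΓK K)) (x : ΓK K) :
    weight α β x * weight β γ x = weight α γ x := by
  rw [weight, weight, weight, jump_add α β γ, zpow_add₀ (qK K).ne_zero]

theorem weight_add {α β : Breve (ΓK K)} {x : ΓK K} (hβ : bot (lev x) ≤ β) (hβx : β ≤ pt x) (n : ℕ)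
    (hxα : pt (x + emb (n : ℤ)) ≤ α) (hα : α ≤ bot (lev x + 1)) :
    weight α β x = (Nat.card (LastRes K) : ℂ) ^ n * weight α β (x + emb (n : ℤ)) := by
  rw [weight, weight, jump_trans α β (stdGood 0) (stdGood (x + emb (n : ℤ))),
    jump_stdGood_add hβ hβx n hxα hα, zpow_add₀ (qK K).ne_zero, mul_comm, zpow_natCast]
  rfl

/-- The measure `m` corresponds to the element of `μ_q(α, β)` which takes the value one on the standard
set (no condition if no `x` is between `α` and `β` in one fibre). -/
def IsNorm {α β : Breve (ΓK K)} (m : Meas β α) : Prop :=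
  ∀ (x : ΓK K) (hβ : bot (lev x) ≤ β) (hβx : β ≤ pt x) (hxα : pt x ≤ α) (hα : α ≤ bot (lev x + 1)),
    m.1 (Test.char (hβx.trans hxα) (lat_fibre hβ hβx hxα hα)) = weight α β x

theorem Meas.char_add {α β : Breve (ΓK K)} {x : ΓK K} {n : ℕ} (hL : Lat β α (O (pt x)))
    (hL' : Lat β α (O (pt (x + emb (n : ℤ))))) (hab : β ≤ α) (m : Meas β α) :
    m.1 (Test.char hab hL) = (Nat.card (LastRes K) : ℂ) ^ n * m.1 (Test.char hab hL') := by
  rw [Meas.char_eq hab hL hL' (O_anti (Or.inr ⟨n, rfl⟩)), relIndex_O_add, Nat.cast_pow]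

theorem lev_eq_of_between {β : Breve (ΓK K)} {x y : ΓK K} (hβ : bot (lev x) ≤ β) (hβx : β ≤ pt x)
    (hβ' : bot (lev y) ≤ β) (hβx' : β ≤ pt y) : lev x = lev y := by
  have h1 : lev x ≤ lev y := hβ.trans hβx'
  have h2 : lev y ≤ lev x := hβ'.trans hβx
  omega

/-- Passing from one ball to another multiplies the measure and the weight by the same power of `q`,
so normalization at one point suffices. -/
theorem isNorm_of_apply {α β : Breve (ΓK K)} {x : ΓK K} (hβ : bot (lev x) ≤ β) (hβx : β ≤ pt x)
    (hxα : pt x ≤ α) (hα : α ≤ bot (lev x + 1)) {m : Meas β α}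
    (hm : m.1 (Test.char (hβx.trans hxα) (lat_fibre hβ hβx hxα hα)) = weight α β x) : IsNorm m := by
  intro y hβ' hβy hyα hα'
  have hq : (Nat.card (LastRes K) : ℂ) ≠ 0 := (qK K).ne_zero
  have hl : lev x = lev y := lev_eq_of_between hβ hβx hβ' hβy
  rcases le_or_eq_add hl with h | ⟨n, rfl⟩
  · obtain ⟨n, rfl⟩ : ∃ n : ℕ, x = y + emb (n : ℤ) := by
      rcases h with h | h
      · omega
      · exact h
    rw [Meas.char_add (lat_fibre hβ' hβy hyα hα') (lat_fibre hβ hβx hxα hα), hm, weight_add hβ' hβy n hxα hα']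
  · rw [Meas.char_add (lat_fibre hβ hβx hxα hα) (lat_fibre hβ' hβy hyα hα'), weight_add hβ hβx n hyα hα] at hm
    exact mul_left_cancel₀ (pow_ne_zero n hq) hm

theorem exists_isNorm {α β : Breve (ΓK K)} {x : ΓK K} (hβ : bot (lev x) ≤ β) (hβx : β ≤ pt x)
    (hxα : pt x ≤ α) (hα : α ≤ bot (lev x + 1)) : ∃ m : Meas β α, m ≠ 0 ∧ IsNorm m := by
  obtain ⟨m, hm⟩ := exists_meas_char_eq (hβx.trans hxα) (lat_fibre hβ hβx hxα hα) (weight α β x)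
  refine ⟨m, ?_, isNorm_of_apply hβ hβx hxα hα hm⟩
  rintro rfl
  exact weight_ne_zero α β x hm.symm

theorem exists_step (k : ℤ) : ∃ m : Meas (bot k : Breve (ΓK K)) (bot (k + 1)), m ≠ 0 ∧ IsNorm m := by
  obtain ⟨x, rfl⟩ := Ext2.lev_surjective (Γ := ΓK K) k
  exact exists_isNorm (x := x) le_rfl (bot_le_pt.2 le_rfl) (pt_le_bot.2 (lt_add_one _)) le_rfl

theorem exists_fib (y : ΓK K) : ∃ m : Meas (bot (lev y) : Breve (ΓK K)) (pt y), m ≠ 0 ∧ IsNorm m :=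
  exists_isNorm (x := y) le_rfl (bot_le_pt.2 le_rfl) le_rfl (pt_le_bot.2 (lt_add_one _))

/-- The standard measure on `𝒪(n) / 𝒪(m)`. -/
def stdMeas (n m : ℤ) : Meas (bot n : Breve (ΓK K)) (bot m) :=
  Int.inductionOn' (motive := fun m => Meas (bot n : Breve (ΓK K)) (bot m)) m n (Meas.one _)
    (fun k hk l => Meas.prod (bot_mono hk) (bot_mono (lt_add_one k).le) l (exists_step k).choose)
    -- A default value for `m < n`, about which nothing is claimed.
    fun _ _ _ => 0

theorem stdMeas_self (n : ℤ) : stdMeas (K := K) n n = Meas.one _ := Int.inductionOn'_self ..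

theorem stdMeas_succ {n k : ℤ} (hk : n ≤ k) : stdMeas (K := K) n (k + 1) =
    Meas.prod (bot_mono hk) (bot_mono (lt_add_one k).le) (stdMeas n k) (exists_step k).choose :=
  Int.inductionOn'_add_one hk

theorem stdMeas_ne_zero {n m : ℤ} (h : n ≤ m) : stdMeas (K := K) n m ≠ 0 := by
  induction m, h using Int.leInduction with
  | base =>
    rw [stdMeas_self]
    exact Meas.one_ne_zero _
  | succ k hk ih =>
    rw [stdMeas_succ hk]
    exact Meas.prod_ne_zero _ _ ih (exists_step k).choose_spec.1

theorem stdMeas_prod {n m k : ℤ} (h : n ≤ m) (h' : m ≤ k) :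
    Meas.prod (bot_mono h) (bot_mono h') (stdMeas n m) (stdMeas m k) = stdMeas (K := K) n k := by
  induction k, h' using Int.leInduction with
  | base => rw [stdMeas_self, Meas.prod_one]
  | succ k hk ih =>
    rw [stdMeas_succ hk, stdMeas_succ (h.trans hk), ← ih, Meas.prod_assoc]

/-- The standard measure on the quotient by `𝒪'(b)` of the smallest `𝒪(n)` in which it is contained. -/
def floorMeas : ∀ b : Breve (ΓK K), Meas (bot b.floor) b
  | bot n => Meas.one (bot n)
  | pt y => (exists_fib y).choose

theorem floorMeas_ne_zero (b : Breve (ΓK K)) : floorMeas b ≠ 0 := by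
  cases b with
  | bot n => exact Meas.one_ne_zero _
  | pt y => exact (exists_fib y).choose_spec.1

/-- The frame for `a ≤ b` is to be the quotient of standard measures attached to `b` and to `a`.
Division is possible since multiplication by the nonzero measure `floorMeas a` is onto. -/
theorem exists_frameMeas {a b : Breve (ΓK K)} (hab : a ≤ b) : ∃ m : Meas a b,
    Meas.prod (bot_floor_le a) hab (floorMeas a) m =
      Meas.prod (bot_mono (floor_mono hab)) (bot_floor_le b) (stdMeas a.floor b.floor) (floorMeas b) :=
  Meas.prod_left_surjective _ _ (floorMeas_ne_zero a) _

/-- A coherent family of measures. -/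
def frameMeas {a b : Breve (ΓK K)} (hab : a ≤ b) : Meas a b := (exists_frameMeas hab).choose

theorem frameMeas_spec {a b : Breve (ΓK K)} (hab : a ≤ b) :
    Meas.prod (bot_floor_le a) hab (floorMeas a) (frameMeas hab) =
      Meas.prod (bot_mono (floor_mono hab)) (bot_floor_le b) (stdMeas a.floor b.floor) (floorMeas b) :=
  (exists_frameMeas hab).choose_spec

attribute [irreducible] frameMeas

/-- Quotients of standard measures multiply: after multiplication by `floorMeas a` both sides become
the standard measure for `c`. -/
theorem frameMeas_prod {a b c : Breve (ΓK K)} (hab : a ≤ b) (hbc : b ≤ c) :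
    Meas.prod hab hbc (frameMeas hab) (frameMeas hbc) = frameMeas (hab.trans hbc) := by
  refine Meas.prod_left_injective (bot_floor_le a) (hab.trans hbc) (floorMeas_ne_zero a) ?_
  rw [Meas.prod_assoc, frameMeas_spec, ← Meas.prod_assoc, frameMeas_spec, Meas.prod_assoc,
    stdMeas_prod (floor_mono hab) (floor_mono hbc), frameMeas_spec]

theorem frameMeas_ne_zero {a b : Breve (ΓK K)} (hab : a ≤ b) : frameMeas hab ≠ 0 := by
  intro h
  refine Meas.prod_ne_zero (bot_mono (floor_mono hab)) (bot_floor_le b)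
    (stdMeas_ne_zero (floor_mono hab)) (floorMeas_ne_zero b) ?_
  rw [← frameMeas_spec hab, h, map_zero]

/-- The measure of the zero coset. When `β` is a point `y`, the rays from `x` and from `y` both
avoid the region below `y`, so `x` may replace `y` in the weight. -/
theorem floorMeas_char {β : Breve (ΓK K)} {x : ΓK K} (hβ : bot (lev x) ≤ β) (hβx : β ≤ pt x)
    (hL : Lat (bot β.floor) β (O β)) :
    (floorMeas β).1 (Test.char (bot_floor_le β) hL) = weight β (bot (lev x)) x := by
  cases β with
  | bot n =>
    obtain rfl : lev x = n := le_antisymm hβ hβx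
    refine (Meas.one_apply _ _).trans ?_
    rw [Test.char_apply_of_mem _ _ (zero_mem _), weight, jump_self, zpow_zero]
  | pt y =>
    have hl : lev x = lev y := by
      have h1 : lev x ≤ lev y := hβ
      have h2 : lev y ≤ lev x := floor_mono hβx
      omega
    refine ((exists_fib y).choose_spec.2 y le_rfl (bot_le_pt.2 le_rfl) le_rfl
      (pt_le_bot.2 (lt_add_one _))).trans ?_
    rw [weight, weight, hl, jump_trans _ _ (stdGood 0) (stdGood y) (stdGood x),
      jump_stdGood_eq_zero rfl hl le_rfl (bot_le_pt.2 le_rfl) le_rfl hβx, add_zero]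

theorem stdMeas_floorMeas_char {α : Breve (ΓK K)} {x : ΓK K} {n : ℤ} (hn : n = lev x) 
    (hxα : pt x ≤ α) (hα : α ≤ bot (lev x + 1)) (hnα : n ≤ α.floor)
    (hL : Lat (bot n) α (O (pt x))) :
    (Meas.prod (bot_mono hnα) (bot_floor_le α) (stdMeas n α.floor) (floorMeas α)).1
      (Test.char ((bot_mono hnα).trans (bot_floor_le α)) hL) = weight α (bot n) x := by
  cases α with
  | bot m =>
    subst hn
    obtain rfl : m = lev x + 1 := le_antisymm hα (Int.add_one_le_iff.2 hxα)
    have e : Meas.prod (bot_mono hnα) (bot_floor_le _) (stdMeas (lev x) (lev x + 1))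
        (floorMeas (bot (lev x + 1) : Breve (ΓK K))) = (exists_step (lev x)).choose := by
      refine (Meas.prod_one _ _).trans ?_
      rw [stdMeas_succ le_rfl, stdMeas_self, Meas.one_prod]
    refine (LinearMap.congr_fun (congrArg Subtype.val e) _).trans ?_
    exact (exists_step (lev x)).choose_spec.2 x le_rfl (bot_le_pt.2 le_rfl) hxα hα
  | pt y =>
    have hl : lev y = n := by
      have h1 : lev y < lev x + 1 := hα
      have h2 : lev x ≤ lev y := floor_mono hxα
      omega
    subst hl
    have e : Meas.prod (bot_mono hnα) (bot_floor_le _) (stdMeas (lev y) (lev y))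
        (floorMeas (pt y : Breve (ΓK K))) = (exists_fib y).choose := by
      rw [stdMeas_self]
      exact Meas.one_prod _ _
    refine (LinearMap.congr_fun (congrArg Subtype.val e) _).trans ?_
    exact (exists_fib y).choose_spec.2 x (bot_mono hn.ge) (bot_le_pt.2 hn.le) hxα hα

/-- The measure of `𝒪'(x)` in `𝒪(lev x) / 𝒪'(b)` is computed in two ways: from the standard
measures, and as the product of its measure in `𝒪'(a) / 𝒪'(b)` and of the measure of the zero coset
of `𝒪'(a)`. Weights multiply in the same way. -/
theorem frameMeas_isNorm {a b : Breve (ΓK K)} (hab : a ≤ b) : IsNorm (frameMeas hab) := by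
  intro x hβ hβx hxα hα
  have hn : a.floor = lev x := le_antisymm (floor_mono hβx) (floor_mono hβ)
  have hL : Lat (bot a.floor) b (O (pt x)) := by
    rw [hn]
    exact lat_fibre le_rfl (bot_le_pt.2 le_rfl) hxα hα
  have h := Meas.prod_char (bot_floor_le a) hab hL (floorMeas a) (frameMeas hab)
  have hLa : Lat (bot a.floor) a (O a) := by
    have := hL.sup (bot_floor_le a) hab
    rwa [sup_eq_right.2 (O_anti hβx)] at this
  rw [char_congr _ _ (lat_fibre hβ hβx hxα hα) (inf_eq_left.2 (O_anti hβx)),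
    char_congr _ _ hLa (sup_eq_right.2 (O_anti hβx)), floorMeas_char hβ hβx, frameMeas_spec,
    stdMeas_floorMeas_char hn hxα hα (floor_mono hab), hn, ← weight_mul b a] at h
  exact (mul_right_cancel₀ (weight_ne_zero a _ x) h).symm

end Frame

end

end TwoDim

namespace TwoDim

noncomputable section

open _root_.TwoDim.Ext2 (emb lev)
open Breve


/-! ### Coordinates on the lines of measures and on `μ(α, β)`. -/

section Coordinates

variable {K : Type*} [Field K] [TwoDimLocalField K] [PartialTopology K]

/-- The coordinate of a measure with respect to the coherent family of measures. -/
def Meas.coef {a b : Breve (ΓK K)} (hab : a ≤ b) : Meas a b ≃ₗ[ℂ] ℂ :=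
  (LinearEquiv.ofBijective (LinearMap.toSpanSingleton ℂ (Meas a b) (frameMeas hab))
    ⟨smul_left_injective ℂ (frameMeas_ne_zero hab), fun m =>
      (Meas.exists_eq_smul hab (frameMeas_ne_zero hab) m).imp fun _ h => h.symm⟩).symm

theorem Meas.coef_smul_frame {a b : Breve (ΓK K)} (hab : a ≤ b) (s : ℂ) :
    Meas.coef hab (s • frameMeas hab) = s :=
  (LinearEquiv.ofBijective (LinearMap.toSpanSingleton ℂ (Meas a b) (frameMeas hab)) _).symm_apply_apply s

theorem Meas.coef_frame {a b : Breve (ΓK K)} (hab : a ≤ b) :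
    Meas.coef hab (frameMeas hab) = 1 := by
  have := Meas.coef_smul_frame hab 1
  rwa [one_smul] at this

attribute [irreducible] Meas.coef

theorem Meas.eq_coef_smul {a b : Breve (ΓK K)} (hab : a ≤ b) (m : Meas a b) :
    m = Meas.coef hab m • frameMeas hab :=
  (Meas.coef hab).injective (Meas.coef_smul_frame hab _).symm

/-- This is where the multiplicativity of the frame is used: in coordinates, products of measures
are products of numbers. -/
theorem Meas.coef_prod {a b c : Breve (ΓK K)} (hab : a ≤ b) (hbc : b ≤ c) (l : Meas a b)
    (m : Meas b c) : Meas.coef (hab.trans hbc) (Meas.prod hab hbc l m) =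
      Meas.coef hab l * Meas.coef hbc m := by
  conv_lhs => rw [Meas.eq_coef_smul hab l, Meas.eq_coef_smul hbc m]
  rw [map_smul, map_smul, map_smul, LinearMap.smul_apply, map_smul, frameMeas_prod, Meas.coef_frame,
    smul_eq_mul, smul_eq_mul, mul_one, mul_comm]

/-- The pairs that span `prodGraph` already form the graph of a linear map. -/
theorem mem_prodGraph_iff {a b c : Breve (ΓK K)} (hab : a ≤ b) (hbc : b ≤ c) {l : Meas a b}
    {m : Meas b c} {n : Meas a c} : (m, n) ∈ prodGraph c l ↔ n = Meas.prod hab hbc l m := by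
  constructor
  · intro h
    have key : prodGraph c l ≤ (Meas.prod hab hbc l).graph := Submodule.span_le.2 fun p hp =>
      (LinearMap.mem_graph_iff _ _).2 ((isProd_iff hab hbc).1 hp)
    exact (LinearMap.mem_graph_iff _ _).1 (key h)
  · intro h
    exact Submodule.subset_span ((isProd_iff hab hbc).2 h)

/-- The element of `μ(α, β)` with the given coordinate. -/
def Mu.mk (α β : Breve (ΓK K)) : ℂ →ₗ[ℂ] Mu α β where
  toFun s := ⟨fun δ => s • (Meas.coef δ.2.2).toLinearMap.smulRight (frameMeas δ.2.1), by
    intro ε δ hεδ l m n h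
    rw [mem_prodGraph_iff hεδ δ.2.2] at h
    rw [mem_prodGraph_iff hεδ δ.2.1, h]
    refine (Meas.coef ε.2.1).injective ?_
    rw [Meas.coef_prod]
    change Meas.coef _ (s • Meas.coef _ _ • frameMeas _) =
      _ * Meas.coef _ (s • Meas.coef _ _ • frameMeas _)
    rw [smul_smul, smul_smul, Meas.coef_smul_frame, Meas.coef_smul_frame, Meas.coef_prod]
    ring⟩
  map_add' s t := Subtype.ext <| funext fun δ => add_smul _ _ _
  map_smul' s t := Subtype.ext <| funext fun δ => mul_smul _ _ _

theorem Mu.mk_apply (α β : Breve (ΓK K)) (s : ℂ) {δ : Breve (ΓK K)} (h : δ ≤ α ∧ δ ≤ β) (m : Meas δ β) :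
    (Mu.mk α β s).1 ⟨δ, h⟩ m = (s * Meas.coef h.2 m) • frameMeas h.1 := (smul_smul s _ _)

theorem Mu.mk_injective (α β : Breve (ΓK K)) : Function.Injective (Mu.mk α β) := fun s t h => by
  have := LinearMap.congr_fun (congrFun (congrArg Subtype.val h) ⟨min α β, min_le_left _ _, min_le_right _ _⟩)
    (frameMeas (min_le_right _ _))
  rw [Mu.mk_apply, Mu.mk_apply, Meas.coef_frame, mul_one, mul_one] at this
  exact smul_left_injective ℂ (frameMeas_ne_zero _) this

/-- The coordinate is read off at the largest admissible index, the minimum of `α` and `β`.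
Compatibility carries it to all smaller indices. -/
theorem Mu.mk_surjective (α β : Breve (ΓK K)) : Function.Surjective (Mu.mk α β) := fun φ => by
  refine ⟨Meas.coef (min_le_left α β) (φ.1 ⟨min α β, min_le_left _ _, min_le_right _ _⟩
    (frameMeas (min_le_right _ _))), Subtype.ext <| funext fun δ => LinearMap.ext fun m => ?_⟩
  have h := φ.2 δ ⟨min α β, min_le_left _ _, min_le_right _ _⟩ (le_min δ.2.1 δ.2.2)
    (frameMeas _) (frameMeas _) (frameMeas _)
    ((mem_prodGraph_iff (le_min δ.2.1 δ.2.2) (min_le_right α β)).2 (frameMeas_prod _ _).symm)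
  rw [mem_prodGraph_iff (le_min δ.2.1 δ.2.2) (min_le_left α β)] at h
  rw [Mu.mk_apply]
  conv_rhs => rw [Meas.eq_coef_smul δ.2.2 m, map_smul, h]
  refine (Meas.coef δ.2.1).injective ?_
  rw [Meas.coef_smul_frame, map_smul, Meas.coef_prod, Meas.coef_frame, smul_eq_mul, one_mul, mul_comm]

/-- The coordinate of an element of `μ(α, β)`. -/
def Mu.coord (α β : Breve (ΓK K)) : Mu α β ≃ₗ[ℂ] ℂ :=
  (LinearEquiv.ofBijective (Mu.mk α β) ⟨Mu.mk_injective α β, Mu.mk_surjective α β⟩).symm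

theorem Mu.coord_mk (α β : Breve (ΓK K)) (s : ℂ) : Mu.coord α β (Mu.mk α β s) = s :=
  (LinearEquiv.ofBijective (Mu.mk α β) _).symm_apply_apply s

attribute [irreducible] Mu.coord

theorem Mu.mk_coord {α β : Breve (ΓK K)} (x : Mu α β) : Mu.mk α β (Mu.coord α β x) = x :=
  (Mu.coord α β).injective (Mu.coord_mk α β _)

theorem Mu.apply {α β : Breve (ΓK K)} (x : Mu α β) {δ : Breve (ΓK K)} (h : δ ≤ α ∧ δ ≤ β)
    (m : Meas δ β) : x.1 ⟨δ, h⟩ m = (Mu.coord α β x * Meas.coef h.2 m) • frameMeas h.1 := by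
  conv_lhs => rw [← Mu.mk_coord x]
  exact Mu.mk_apply ..

theorem Mu.coef_apply {α β : Breve (ΓK K)} (x : Mu α β) {δ : Breve (ΓK K)} (h : δ ≤ α ∧ δ ≤ β)
    (m : Meas δ β) : Meas.coef h.1 (x.1 ⟨δ, h⟩ m) = Mu.coord α β x * Meas.coef h.2 m := by
  rw [Mu.apply, Meas.coef_smul_frame]

/-- The composition of two scalings is the scaling by the product. A common lower bound of the three
indices is enough to read this off. -/
theorem isMul_iff {α β γ : Breve (ΓK K)} {x : Mu α β} {y : Mu β γ} {z : Mu α γ} :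
    IsMul x y z ↔ Mu.coord α γ z = Mu.coord α β x * Mu.coord β γ y := by
  constructor
  · intro h
    have hα : min (min α β) γ ≤ α := (min_le_left _ _).trans (min_le_left _ _)
    have hβ : min (min α β) γ ≤ β := (min_le_left _ _).trans (min_le_right _ _)
    have := congrArg (Meas.coef hα) (h _ hα hβ (min_le_right _ _) (frameMeas (min_le_right _ _)))
    rw [Mu.coef_apply, Mu.coef_apply, Mu.coef_apply, Meas.coef_frame] at this
    simpa only [mul_one] using this
  · intro h δ hα hβ hγ m
    refine (Meas.coef hα).injective ?_
    exact (Mu.coef_apply z ⟨hα, hγ⟩ m).trans <| (congrArg (· * _) h).trans <| (mul_assoc _ _ _).trans <|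
      (congrArg (_ * ·) (Mu.coef_apply y ⟨hβ, hγ⟩ m).symm).trans (Mu.coef_apply x ⟨hα, hβ⟩ _).symm

/-- Evaluation at the index `a` on the unit measure recovers `l`. -/
theorem isMeas_iff {a b : Breve (ΓK K)} (hab : a ≤ b) {l : Meas a b} {x : Mu b a} :
    IsMeas l x ↔ Mu.coord b a x = Meas.coef hab l := by
  constructor
  · intro h
    have h' := congrArg (Meas.coef hab) ((isProd_iff le_rfl hab).1 (h a ⟨hab, le_rfl⟩ (frameMeas le_rfl)))
    rwa [Mu.coef_apply, Meas.coef_prod, Meas.coef_frame, mul_one, one_mul] at h'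
  · intro h δ hδ u
    refine (isProd_iff hδ.2 hab).2 ((Meas.coef hδ.1).injective ?_)
    rw [Mu.coef_apply, Meas.coef_prod, h, mul_comm]

theorem exists_isMul {α β γ : Breve (ΓK K)} (x : Mu α β) (y : Mu β γ) : ∃ z : Mu α γ, IsMul x y z :=
  ⟨Mu.mk α γ _, isMul_iff.2 (Mu.coord_mk ..)⟩

end Coordinates

/-! ### The action of `Kˣ` in coordinates, and the map `Θ`. -/

section Translation

variable {K : Type*} [Field K] [TwoDimLocalField K] [PartialTopology K]

/-- A transitive relation which contains the pairs in one fibre contains all pairs `a ≤ b`. -/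
theorem le_induction_fibre {Γ : Type*} [AddCommGroup Γ] [Ext2 Γ] {P : Breve Γ → Breve Γ → Prop}
    (hrefl : ∀ a, P a a)
    (htrans : ∀ a b c, a ≤ b → b ≤ c → P a b → P b c → P a c)
    (hfib : ∀ (a b : Breve Γ) (x : Γ), bot (lev x) ≤ a → a ≤ pt x → pt x ≤ b → b ≤ bot (lev x + 1) → P a b)
    {a b : Breve Γ} (hab : a ≤ b) : P a b := by
  -- Induction on the number of levels between `a` and `b`: the first step goes from `a` up to the
  -- bottom of the next level and stays inside one fibre.
  obtain ⟨n, hn⟩ := Int.le.dest (floor_mono hab)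
  induction n generalizing a with
  | zero =>
    rw [Nat.cast_zero, add_zero] at hn
    rcases a with y | k
    · refine hfib _ _ y (bot_floor_le (pt y)) le_rfl hab ((le_bot_ceil b).trans ?_)
      rcases b with z | m
      · exact le_of_eq (congrArg (fun i : ℤ => (bot (i + 1) : Breve Γ)) hn.symm)
      · have hn : lev y = m := hn
        have : lev y < m := hab
        omega
    · rcases b with z | m
      · obtain rfl : k = lev z := hn
        exact hfib _ _ z le_rfl (bot_le_pt.2 le_rfl) le_rfl (pt_le_bot.2 (lt_add_one _))
      · obtain rfl : k = m := hn
        exact hrefl _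
  | succ n ih =>
    have hb : bot (a.floor + 1) ≤ b := by
      refine le_trans ?_ (bot_floor_le b)
      rw [bot_le_bot]
      push_cast at hn
      omega
    have ha : ∃ x : Γ, lev x = a.floor ∧ a ≤ pt x := by
      rcases a with y | k
      · exact ⟨y, rfl, le_rfl⟩
      · obtain ⟨x, hx⟩ := Ext2.lev_surjective (Γ := Γ) k
        exact ⟨x, hx, bot_le_pt.2 hx.ge⟩
    obtain ⟨x, hx, hax⟩ := ha
    have hxb : pt x ≤ bot (a.floor + 1) := pt_le_bot.2 (by omega)
    refine htrans _ _ _ (hax.trans hxb) hb (hfib a _ x ?_ hax hxb (by rw [hx])) (ih hb ?_)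
    · rw [hx]
      exact bot_floor_le a
    · change a.floor + 1 + (n : ℤ) = b.floor
      push_cast at hn
      omega

theorem Meas.mul_prod (g : Kˣ) {a b c a' b' c' : Breve (ΓK K)} (hab : a ≤ b) (hbc : b ≤ c)
    (hab' : a' ≤ b') (hbc' : b' ≤ c') (ha : a' = ν g +ᵥ a) (hb : b' = ν g +ᵥ b) (hc : c' = ν g +ᵥ c)
    (l : Meas a b) (m : Meas b c) :
    Meas.mul g (hab.trans hbc) ha hc (Meas.prod hab hbc l m) =
      Meas.prod hab' hbc' (Meas.mul g hab ha hb l) (Meas.mul g hbc hb hc m) :=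
  (isProd_iff hab' hbc').1 (IsProd.mul g (hab.trans hbc) hbc hab ha hb hc ((isProd_iff hab hbc).2 rfl))

/-- The factor by which the translation by `γ` changes the standard measures. -/
def modulus (γ : ΓK K) (α β : Breve (ΓK K)) : ℂ :=
  (qK K : ℂ) ^ jump α β (stdGood 0) ((stdGood 0).shift (-γ))

theorem modulus_ne_zero (γ : ΓK K) (α β : Breve (ΓK K)) : modulus γ α β ≠ 0 :=
  zpow_ne_zero _ (qK K).ne_zero

theorem modulus_self (γ : ΓK K) (α : Breve (ΓK K)) : modulus γ α α = 1 := by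
  rw [modulus, jump_self, zpow_zero]

theorem modulus_mul (γ : ΓK K) (α β δ : Breve (ΓK K)) :
    modulus γ α β * modulus γ β δ = modulus γ α δ := by
  rw [modulus, modulus, modulus, jump_add α β δ, zpow_add₀ (qK K).ne_zero]

/-- `jump` is invariant under simultaneous translation, so the two weights differ only by the change
of the standard set to its translate. -/
theorem modulus_mul_weight (γ : ΓK K) (α β : Breve (ΓK K)) (x : ΓK K) :
    modulus γ α β * weight (γ +ᵥ α) (γ +ᵥ β) (γ + x) = weight α β x := by
  have h := jump_shift γ α β ((stdGood 0).shift (-γ)) (stdGood x)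
  rw [← Good.shift_add, add_neg_cancel, Good.shift_zero, stdGood_shift] at h
  rw [modulus, weight, weight, h, ← zpow_add₀ (qK K).ne_zero, ← jump_trans]

/-- By coherence this measure is idempotent, and it is nonzero. -/
theorem frameMeas_self (a : Breve (ΓK K)) : frameMeas (le_refl a) = Meas.one a := by
  refine Meas.prod_left_injective le_rfl le_rfl (frameMeas_ne_zero (le_refl a)) ?_
  rw [frameMeas_prod, Meas.prod_one]

theorem Test.mul_char (g : Kˣ) {a b a' b' : Breve (ΓK K)} (hab : a ≤ b) (hab' : a' ≤ b')
    (ha : a' = ν g +ᵥ a) (hb : b' = ν g +ᵥ b) {x y : Breve (ΓK K)} (hx : y = ν g +ᵥ x) 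
    (hU : Lat a b (O x)) (hV : Lat a' b' (O y)) :
    Test.mul g hab ha hb (Test.char hab hU) = Test.char hab' hV :=
  Test.ext_on fun z hz => by
    rw [Test.mul_apply]
    by_cases h : z ∈ O y
    · rw [Test.char_apply_of_mem hab' hV h, Test.char_apply_of_mem]
      exact (inv_mul_mem_O_iff g hx).2 h
    · rw [Test.char_apply_of_not_mem hab' hV h, Test.char_apply_of_not_mem]
      exact mt (inv_mul_mem_O_iff g hx).1 h

/-- Both sides are multiplicative in `a ≤ b`, so it suffices to treat one fibre. There the measures
are compared on a ball `𝒪'(x)` and its translate, whose measures are known weights. -/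
theorem Meas.mul_frame (g : Kˣ) {a b : Breve (ΓK K)} (hab : a ≤ b) :
    Meas.mul g hab rfl rfl (frameMeas hab) =
      modulus (ν g) b a • frameMeas (vadd_mono (ν g) hab) := by
  refine le_induction_fibre (P := fun a b => ∀ hab : a ≤ b, Meas.mul g hab rfl rfl (frameMeas hab) =
      modulus (ν g) b a • frameMeas (vadd_mono (ν g) hab)) ?_ ?_ ?_ hab hab
  · intro a _
    rw [modulus_self, one_smul, frameMeas_self, frameMeas_self]
    refine Subtype.ext <| LinearMap.ext fun f => ?_
    change f.1 _ = f.1 0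
    rw [mul_zero]
  · intro a b c hab hbc h1 h2 hac
    have h := Meas.mul_prod g hab hbc (vadd_mono (ν g) hab) (vadd_mono (ν g) hbc) rfl rfl rfl
      (frameMeas hab) (frameMeas hbc)
    rw [frameMeas_prod, h1, h2, map_smul, map_smul, LinearMap.smul_apply, frameMeas_prod, smul_smul,
      modulus_mul] at h
    exact h
  · intro β α x hβ hβx hxα hα hab
    have hβ' : bot (lev (ν g + x)) ≤ ν g +ᵥ β := by
      rw [map_add, ← vadd_bot]
      exact vadd_mono _ hβ
    have hα' : ν g +ᵥ α ≤ bot (lev (ν g + x) + 1) := by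
      rw [map_add, add_assoc, ← vadd_bot]
      exact vadd_mono _ hα
    have hβx' : ν g +ᵥ β ≤ pt (ν g + x) := vadd_mono (ν g) hβx
    have hxα' : pt (ν g + x) ≤ ν g +ᵥ α := vadd_mono (ν g) hxα
    have hL := lat_fibre hβ' hβx' hxα' hα'
    refine Meas.ext_char (vadd_mono _ hab) hL ?_
    have e := Test.mul_char g hab (vadd_mono _ hab) rfl rfl (vadd_pt (ν g) x).symm
      (lat_fibre hβ hβx hxα hα) hL
    rw [← e, Meas.mul_apply, e]
    change _ = _ * (frameMeas _).1 _
    rw [frameMeas_isNorm hab x hβ hβx hxα hα,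
      frameMeas_isNorm (vadd_mono (ν g) hab) _ hβ' hβx' hxα' hα', modulus_mul_weight]

theorem Meas.coef_mul (g : Kˣ) {a b a' b' : Breve (ΓK K)} (hab : a ≤ b) (hab' : a' ≤ b')
    (ha : a' = ν g +ᵥ a) (hb : b' = ν g +ᵥ b) (m : Meas a b) :
    Meas.coef hab' (Meas.mul g hab ha hb m) = modulus (ν g) b a * Meas.coef hab m := by
  subst ha hb
  conv_lhs => rw [Meas.eq_coef_smul hab m]
  rw [map_smul, Meas.mul_frame, smul_smul, Meas.coef_smul_frame, mul_comm]

/-- Computed at the minimum of the two indices, where the factors for source and target are both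
known. Their ratio is the modulus by the cocycle property. -/
theorem Mu.coord_mul (g : Kˣ) {α β α' β' : Breve (ΓK K)} (hα : α' = ν g +ᵥ α) (hβ : β' = ν g +ᵥ β)
    (x : Mu α β) : Mu.coord α' β' (Mu.mul g hα hβ x) = modulus (ν g) α β * Mu.coord α β x := by
  have h : min α' β' ≤ α' ∧ min α' β' ≤ β' := ⟨min_le_left _ _, min_le_right _ _⟩
  have h0 : min α β ≤ α ∧ min α β ≤ β := ⟨min_le_left _ _, min_le_right _ _⟩
  have hδ : min α' β' = ν g +ᵥ min α β := by rw [vadd_min, hα, hβ]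
  have key := Mu.mul_apply g hα hβ x h h0 hδ (Meas.mul g h0.2 hδ hβ (frameMeas h0.2))
  rw [Meas.inv_mul_mul] at key
  have e1 := Mu.coef_apply (Mu.mul g hα hβ x) h (Meas.mul g h0.2 hδ hβ (frameMeas h0.2))
  have e2 := Meas.coef_mul g h0.2 h.2 hδ hβ (frameMeas h0.2)
  have e3 := Meas.coef_mul g h0.1 h.1 hδ hα (x.1 ⟨min α β, h0⟩ (frameMeas h0.2))
  have e4 := Mu.coef_apply x h0 (frameMeas h0.2)
  rw [Meas.coef_frame, mul_one] at e2 e4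
  have h1 := (congrArg (_ * ·) e2).symm.trans (e1.symm.trans
    ((congrArg (Meas.coef h.1) key).trans (e3.trans (congrArg (_ * ·) e4))))
  refine mul_right_cancel₀ (modulus_ne_zero (ν g) β (min α β)) (h1.trans ?_)
  rw [← modulus_mul (ν g) α β, mul_right_comm]

theorem modulus_zero (α β : Breve (ΓK K)) : modulus 0 α β = 1 := by
  rw [modulus, neg_zero, Good.shift_zero, jump_same, zpow_zero]

/-- The canonical isomorphisms `μ_q(α, β) → μ(α, β)`. -/
def thetaK (α β : Breve (ΓK K)) : muR (qK K) α β ≃ₗ[ℂ] Mu α β :=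
  (evalR (qK K) α β (stdGood 0)).trans (Mu.coord α β).symm

theorem coord_thetaK {α β : Breve (ΓK K)} (m : muR (qK K) α β) :
    Mu.coord α β (thetaK α β m) = m.1 (stdGood 0) := (Mu.coord α β).apply_symm_apply _

attribute [irreducible] thetaK

theorem isMul_thetaK {α β γ : Breve (ΓK K)} (m : muR (qK K) α β) (n : muR (qK K) β γ) :
    IsMul (thetaK α β m) (thetaK β γ n) (thetaK α γ (mulR (qK K) α β γ m n)) := by
  rw [isMul_iff, coord_thetaK, coord_thetaK, coord_thetaK, mulR_apply]

theorem thetaK_apply_char {α β : Breve (ΓK K)} (hβα : β ≤ α) {x : ΓK K} (hβ : bot (lev x) ≤ β)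
    (hβx : β ≤ pt x) (hxα : pt x ≤ α) (hα : α ≤ bot (lev x + 1)) (m : muR (qK K) α β) :
    (m.1 (stdGood 0) • frameMeas hβα).1 (Test.char hβα (lat_fibre hβ hβx hxα hα)) =
      m.1 (stdGood x) := by
  change _ * (frameMeas hβα).1 _ = _
  rw [frameMeas_isNorm hβα x hβ hβx hxα hα, muR_prop m (stdGood 0) (stdGood x), weight, mul_comm]

/-- Compatibility with products is immediate in coordinates, and the normalization on balls is the
one built into the frame. -/
theorem isTheta_thetaK : IsTheta fun α β : Breve (ΓK K) => (thetaK α β).toLinearMap where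
  mul α β γ x y := isMul_thetaK x y
  norm α β x hβ hβx hxα hα m := by
    refine ⟨m.1 (stdGood 0) • frameMeas (hβx.trans hxα), Test.char _ (lat_fibre hβ hβx hxα hα),
      Test.char_apply _ _, ?_, thetaK_apply_char _ hβ hβx hxα hα m⟩
    rw [isMeas_iff (hβx.trans hxα), Meas.coef_smul_frame]
    exact coord_thetaK m

end Translation

end

end TwoDim

namespace TwoDim

noncomputable section

open _root_.TwoDim.Ext2 (emb lev)
open Breve


/-! ### The space `𝒟₊(π⁻¹(k))` and its functionals. -/

section FibreFunctions

variable {Γ : Type*} [AddCommGroup Γ] [Ext2 Γ]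

open Classical in
theorem deltaGe_mem {k : ℤ} {x : Γ} (hx : lev x = k) :
    (fun y => if lev y = k ∧ (pt x : Breve Γ) ≤ pt y then (1 : ℂ) else 0) ∈ DPlusT Γ k := by
  refine ⟨fun y hy => if_neg fun h => hy h.1, ⟨x - emb 1, ?_, fun y hy hyx => if_neg fun h => ?_⟩,
    ⟨x, hx, fun y hy hyx => ?_⟩⟩
  · rw [map_sub, lev_emb, sub_zero, hx]
  · have := lt_add_emb_one (x - emb 1)
    rw [sub_add_cancel] at this
    exact ((h.2.trans hyx).trans_lt this).false
  · exact (if_pos ⟨hy, hyx⟩).trans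
      (if_pos ⟨(lev_add_emb y 1).trans hy, hyx.trans (lt_add_emb_one y).le⟩).symm

open Classical in
/-- The indicator function of the ray from `x`. -/
def deltaGe {k : ℤ} {x : Γ} (hx : lev x = k) : DPlusT Γ k := ⟨_, deltaGe_mem hx⟩

theorem deltaGe_of_le {k : ℤ} {x y : Γ} (hx : lev x = k) (hy : lev y = k) (h : (pt x : Breve Γ) ≤ pt y) :
    (deltaGe hx).1 y = 1 := if_pos ⟨hy, h⟩

theorem deltaGe_of_not_le {k : ℤ} {x y : Γ} (hx : lev x = k) (h : ¬ (pt x : Breve Γ) ≤ pt y) :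
    (deltaGe hx).1 y = 0 := if_neg fun h' => h h'.2

theorem deltaGe_of_lev_ne {k : ℤ} {x y : Γ} (hx : lev x = k) (h : lev y ≠ k) :
    (deltaGe hx).1 y = 0 := if_neg fun h' => h h'.1

theorem add_emb_one_le {x y : Γ} (h : lev x = lev y) :
    (pt (x + emb 1) : Breve Γ) ≤ pt y ↔ (pt x : Breve Γ) < pt y := by
  constructor
  · exact fun h => (lt_add_emb_one x).trans_le h
  · intro h'
    rcases h'.le with h0 | ⟨n, rfl⟩
    · omega
    · rcases n with _ | n
      · exact (h'.ne (by simp)).elim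
      · exact Or.inr ⟨n, by rw [Nat.cast_succ, map_add, add_assoc, add_comm (emb (n : ℤ))]⟩

theorem deltaGe_sub {k : ℤ} {x : Γ} (hx : lev x = k) (hx' : lev (x + emb 1) = k) (y : Γ) [Decidable (y = x)] :
    (deltaGe hx - deltaGe hx').1 y = if y = x then 1 else 0 := by
  change (deltaGe hx).1 y - (deltaGe hx').1 y = _
  by_cases hy : lev y = k
  · rcases lt_trichotomy (pt x : Breve Γ) (pt y) with h | h | h
    · rw [deltaGe_of_le hx hy h.le, deltaGe_of_le hx' hy ((add_emb_one_le (hx.trans hy.symm)).2 h),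
        sub_self, if_neg]
      rintro rfl
      exact h.false
    · rw [deltaGe_of_le hx hy h.le, deltaGe_of_not_le hx', sub_zero, if_pos]
      · injection h with h
        exact h.symm
      · rw [add_emb_one_le (hx.trans hy.symm)]
        exact h.ge.not_gt
    · rw [deltaGe_of_not_le hx h.not_ge, deltaGe_of_not_le hx', sub_zero, if_neg]
      · rintro rfl
        exact h.false
      · rw [add_emb_one_le (hx.trans hy.symm)]
        exact h.le.not_gt
  · rw [deltaGe_of_lev_ne hx hy, deltaGe_of_lev_ne hx' hy, sub_zero, if_neg]
    rintro rfl
    exact hy hx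

/-- The difference function of the indicator of the ray is the indicator of the point `x`, so one
summand remains. -/
theorem ofVals_deltaGe {k : ℤ} (a : Γ → ℂ) {x : Γ} (hx : lev x = k) : ofVals k a (deltaGe hx) = a x := by
  classical
  have hx' : lev (x + emb 1) = k := (lev_add_emb x 1).trans hx
  have key : ∀ y, (deltaGe hx).1 y - (deltaGe hx).1 (y - emb 1) = if y = x then 1 else 0 := fun y => by
    rw [← deltaGe_sub hx hx']
    have hl : lev (y - emb 1) = lev y := by rw [map_sub, lev_emb, sub_zero]
    have : (deltaGe hx).1 (y - emb 1) = (deltaGe hx').1 y := by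
      refine if_congr (and_congr (by rw [hl]) ?_) rfl rfl
      rw [← vadd_le_vadd (emb 1), vadd_pt, vadd_pt, add_sub_cancel, add_comm]
    rw [this]; rfl
  rw [ofVals_apply, finsum_eq_single _ x]
  · rw [key, if_pos rfl, one_mul]
  · intro y hy
    rw [key, if_neg hy, zero_mul]

theorem deltaInf_deltaGe {k : ℤ} {x : Γ} (hx : lev x = k) : deltaInf Γ k (deltaGe hx) = 1 :=
  ofVals_deltaGe _ hx

theorem embR_deltaGe {r : ℂˣ} {k : ℤ} (η : muR (Γ := Γ) r (bot (k + 1)) (bot k)) {x : Γ} (hx : lev x = k) :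
    embR r k η (deltaGe hx) = η.1 (stdGood x) := ofVals_deltaGe _ hx

/-- The indicators of rays span. The induction is on the distance `m` from a point up to which `f`
vanishes to one from which it is constant. At distance zero the function is zero. -/
theorem DPlusT.induction {k : ℤ} {P : DPlusT Γ k → Prop} (h0 : P 0) (hadd : ∀ f g, P f → P g → P (f + g))
    (hsmul : ∀ (s : ℂ) f, P f → P (s • f)) (hδ : ∀ (x : Γ) (hx : lev x = k), P (deltaGe hx))
    (f : DPlusT Γ k) : P f := by
  obtain ⟨a, ha, h2⟩ := f.2.2.1
  obtain ⟨b, hb, h3⟩ := f.2.2.2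
  obtain ⟨m, hm⟩ : ∃ m : ℕ, ∀ y, lev y = k → (pt (a + emb (m : ℤ)) : Breve Γ) ≤ pt y →
      f.1 y = f.1 (y + emb 1) := by
    rcases le_total (pt a) (pt b) with h | h
    · rcases h with h | ⟨m, rfl⟩
      · omega
      · exact ⟨m, h3⟩
    · exact ⟨0, fun y hy hy' => h3 y hy (h.trans (by simpa using hy'))⟩
  clear h3
  induction m generalizing f with
  | zero =>
    have key : ∀ n : ℕ, f.1 (a + emb (n : ℤ)) = 0 := fun n => by
      induction n with
      | zero =>
        rw [Nat.cast_zero, map_zero, add_zero]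
        exact h2 a ha le_rfl
      | succ n ih =>
        rw [Nat.cast_succ, map_add, ← add_assoc, ← hm _ ((lev_add_emb a n).trans ha), ih]
        rw [Nat.cast_zero, map_zero, add_zero]
        exact Or.inr ⟨n, rfl⟩
    have : f = 0 := Subtype.ext <| funext fun y => by
      by_cases hy : lev y = k
      · rcases le_total (pt y) (pt a) with h | h
        · exact h2 y hy h
        · rcases h with h | ⟨n, rfl⟩
          · omega
          · exact key n
      · exact f.2.1 y hy
    rw [this]
    exact h0
  | succ m ih =>
    set x := a + emb ((m + 1 : ℕ) : ℤ) with hx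
    have hxl : lev x = k := (lev_add_emb a _).trans ha
    have hx0 : a + emb (m : ℤ) + emb 1 = x := by rw [hx, Nat.cast_succ, map_add, add_assoc]
    have hl : lev (a + emb (m : ℤ)) = k := (lev_add_emb a _).trans ha
    have hlt := lt_add_emb_one (a + emb (m : ℤ))
    rw [hx0] at hlt
    -- The last possible jump of `f`. After subtraction of `s` times the indicator of the ray from
    -- `x` the function is constant one step earlier.
    set s := f.1 x - f.1 (a + emb (m : ℤ)) with hs
    have e : f = s • deltaGe hxl + (f - s • deltaGe hxl) := by abel
    rw [e]
    refine hadd _ _ (hsmul _ _ (hδ x hxl)) (ih _ (fun y hy hya => ?_) fun y hy hya => ?_)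
    · change f.1 y - s * (deltaGe hxl).1 y = 0
      rw [h2 y hy hya, deltaGe_of_not_le, mul_zero, sub_zero]
      exact ((hya.trans (Or.inr ⟨m, rfl⟩)).trans_lt hlt).not_ge
    · change f.1 y - s * (deltaGe hxl).1 y = f.1 (y + emb 1) - s * (deltaGe hxl).1 (y + emb 1)
      have hy' : lev (y + emb 1) = k := (lev_add_emb y 1).trans hy
      rcases hya.lt_or_eq with h | h
      · have hxy : pt x ≤ pt y := by
          rw [← hx0]
          exact (add_emb_one_le (hl.trans hy.symm)).2 h
        rw [deltaGe_of_le hxl hy hxy, deltaGe_of_le hxl hy' (hxy.trans (lt_add_emb_one y).le), hm y hy hxy]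
      · obtain rfl : a + emb (m : ℤ) = y := by injection h
        rw [hx0, deltaGe_of_le hxl hxl le_rfl, deltaGe_of_not_le hxl hlt.not_ge, hs]
        ring

end FibreFunctions

/-! ### Mean values on the spheres `{y : ν(y) = x}`. -/

section Average

variable {K : Type*} [Field K] [TwoDimLocalField K] [PartialTopology K]

theorem mem_OStar_iff {x : ΓK K} {y : K} :
    y ∈ OStar x ↔ y ∈ O (pt x) ∧ y ∉ O (pt (x + emb 1)) := by
  constructor
  · rintro ⟨a, rfl, rfl⟩
    rw [units_mem_O_iff, units_mem_O_iff]
    exact ⟨le_rfl, (lt_add_emb_one _).not_ge⟩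
  · rintro ⟨h1, h2⟩
    have hy : y ≠ 0 := by
      rintro rfl
      exact h2 (zero_mem _)
    obtain ⟨a, rfl⟩ : ∃ a : Kˣ, (a : K) = y := ⟨Units.mk0 y hy, rfl⟩
    rw [units_mem_O_iff] at h1 h2
    refine ⟨a, rfl, ?_⟩
    have hl : lev x = lev (ν a) := by
      rcases h1 with h | h
      · exact (h2 (Or.inl (by rwa [lev_add_emb]))).elim
      · exact (le_pt_pt h).symm
    rw [add_emb_one_le hl] at h2
    have := le_antisymm h1 (not_lt.1 h2)
    injection this with h
    exact h.symm

theorem bot_le_bot_succ (k : ℤ) : (bot k : Breve (ΓK K)) ≤ bot (k + 1) := bot_mono (lt_add_one k).le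

theorem cut_mem {k : ℤ} {x : ΓK K} (hx : lev x = k) (f : Test (bot k : Breve (ΓK K)) (bot (k + 1))) :
    (OStar x).indicator f.1 ∈ Test (bot k : Breve (ΓK K)) (bot (k + 1)) := by
  have h := Test.mul_mem (bot_le_bot_succ k) f
    (lat_O_pt ((lev_add_emb x 1).trans hx)).isOp (χ := (OStar x).indicator 1) (fun z v hv => by
      have : z + v ∈ OStar x ↔ z ∈ OStar x := by
        rw [mem_OStar_iff, mem_OStar_iff, AddSubgroup.add_mem_cancel_right _ hv,
          AddSubgroup.add_mem_cancel_right _ (O_succ_le x hv)]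
      by_cases hz : z ∈ OStar x
      · rw [Set.indicator_of_mem hz, Set.indicator_of_mem (this.2 hz)]; rfl
      · rw [Set.indicator_of_notMem hz, Set.indicator_of_notMem (mt this.1 hz)])
  convert h using 1
  funext z
  by_cases hz : z ∈ OStar x
  · rw [Set.indicator_of_mem hz, Set.indicator_of_mem hz, Pi.one_apply, one_mul]
  · rw [Set.indicator_of_notMem hz, Set.indicator_of_notMem hz, zero_mul]

/-- The product of a function and of the indicator function of `{y : ν(y) = x}`. -/
def cut {k : ℤ} {x : ΓK K} (hx : lev x = k) :
    Test (bot k : Breve (ΓK K)) (bot (k + 1)) →ₗ[ℂ] Test (bot k : Breve (ΓK K)) (bot (k + 1)) where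
  toFun f := ⟨_, cut_mem hx f⟩
  map_add' f g := Subtype.ext (Set.indicator_add _ _ _)
  map_smul' s f := Subtype.ext (Set.indicator_const_smul _ s f.1)

theorem cut_apply {k : ℤ} {x : ΓK K} (hx : lev x = k) (f : Test (bot k : Breve (ΓK K)) (bot (k + 1))) (y : K) :
    (cut hx f).1 y = (OStar x).indicator f.1 y := rfl

/-- The indicator function of `{y : ν(y) = x}`. -/
def starChar {k : ℤ} {x : ΓK K} (hx : lev x = k) : Test (bot k : Breve (ΓK K)) (bot (k + 1)) :=
  Test.char (bot_le_bot_succ k) (lat_O_pt hx) -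
    Test.char (bot_le_bot_succ k) (lat_O_pt ((lev_add_emb x 1).trans hx))

theorem starChar_apply {k : ℤ} {x : ΓK K} (hx : lev x = k) (y : K) :
    (starChar hx).1 y = (OStar x).indicator 1 y := by
  change (Test.char _ _).1 y - (Test.char _ _).1 y = _
  by_cases h : y ∈ O (pt (x + emb 1))
  · rw [Test.char_apply_of_mem _ _ h, Test.char_apply_of_mem _ _ (O_succ_le x h), sub_self,
      Set.indicator_of_notMem fun h' => (mem_OStar_iff.1 h').2 h]
  · by_cases h' : y ∈ O (pt x)
    · rw [Test.char_apply_of_mem _ _ h', Test.char_apply_of_not_mem _ _ h, sub_zero,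
        Set.indicator_of_mem (mem_OStar_iff.2 ⟨h', h⟩), Pi.one_apply]
    · rw [Test.char_apply_of_not_mem _ _ h', Test.char_apply_of_not_mem _ _ h, sub_zero,
        Set.indicator_of_notMem fun h0 => h' (mem_OStar_iff.1 h0).1]

theorem frameMeas_char {k : ℤ} {x : ΓK K} (hx : lev x = k) :
    (frameMeas (bot_le_bot_succ k)).1 (Test.char (bot_le_bot_succ k) (lat_O_pt hx)) =
      weight (bot (k + 1)) (bot k) x := by
  subst hx
  exact frameMeas_isNorm _ x le_rfl (bot_le_pt.2 le_rfl) (pt_le_bot.2 (lt_add_one _)) le_rfl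

theorem frameMeas_starChar {k : ℤ} {x : ΓK K} (hx : lev x = k) :
    (frameMeas (bot_le_bot_succ k)).1 (starChar hx) =
      weight (bot (k + 1)) (bot k) x - weight (bot (k + 1)) (bot k) (x + emb 1) := by
  rw [starChar, map_sub, frameMeas_char hx, frameMeas_char ((lev_add_emb x 1).trans hx)]

/-- The sphere is the ball of `x` without the next smaller ball, so its measure is `q - 1` times
that of the smaller ball, and `q ≠ 1`. -/
theorem frameMeas_starChar_ne_zero {k : ℤ} {x : ΓK K} (hx : lev x = k) :
    (frameMeas (bot_le_bot_succ k)).1 (starChar hx) ≠ 0 := by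
  subst hx
  have h := weight_add (α := bot (lev x + 1)) (β := bot (lev x)) le_rfl (bot_le_pt.2 (le_refl (lev x))) 1
    (pt_le_bot.2 (by rw [lev_add_emb]; exact lt_add_one _)) le_rfl
  rw [Nat.cast_one, pow_one] at h
  rw [frameMeas_starChar, h, ← sub_one_mul]
  refine mul_ne_zero ?_ (weight_ne_zero _ _ _)
  have : Nat.card (LastRes K) ≠ 1 := (Finite.one_lt_card (α := LastRes K)).ne'
  rw [sub_ne_zero]
  exact_mod_cast this

open Classical in
/-- The function of the mean values of `f`. -/
def avgFun (k : ℤ) : Test (bot k : Breve (ΓK K)) (bot (k + 1)) →ₗ[ℂ] (ΓK K → ℂ) where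
  toFun f x := if hx : lev x = k then (frameMeas (bot_le_bot_succ k)).1 (cut hx f) /
    (frameMeas (bot_le_bot_succ k)).1 (starChar hx) else 0
  map_add' f g := funext fun x => by
    rw [Pi.add_apply]
    split_ifs with hx
    · rw [map_add, map_add, add_div]
    · rw [add_zero]
  map_smul' s f := funext fun x => by
    rw [Pi.smul_apply]
    split_ifs with hx
    · rw [map_smul, map_smul, smul_eq_mul, mul_div_assoc]; rfl
    · rw [smul_zero]

theorem avgFun_apply {k : ℤ} (f : Test (bot k : Breve (ΓK K)) (bot (k + 1))) {x : ΓK K} (hx : lev x = k) :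
    avgFun k f x = (frameMeas (bot_le_bot_succ k)).1 (cut hx f) /
      (frameMeas (bot_le_bot_succ k)).1 (starChar hx) := dif_pos hx

theorem avgFun_of_ne {k : ℤ} (f : Test (bot k : Breve (ΓK K)) (bot (k + 1))) {x : ΓK K} (hx : lev x ≠ k) :
    avgFun k f x = 0 := dif_neg hx

/-- A sphere of the same level is either contained in the ball or disjoint from it. -/
theorem avgFun_char {k : ℤ} {y : ΓK K} (hy : lev y = k) :
    avgFun k (Test.char (bot_le_bot_succ k) (lat_O_pt hy)) = (deltaGe hy).1 := by
  funext x
  by_cases hx : lev x = k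
  · rw [avgFun_apply _ hx]
    by_cases h : (pt y : Breve (ΓK K)) ≤ pt x
    · have e : cut hx (Test.char (bot_le_bot_succ k) (lat_O_pt hy)) = starChar hx :=
        Subtype.ext <| funext fun z => by
          rw [cut_apply, starChar_apply]
          by_cases hz : z ∈ OStar x
          · rw [Set.indicator_of_mem hz, Set.indicator_of_mem hz, Pi.one_apply,
              Test.char_apply_of_mem _ _ (O_anti h (mem_OStar_iff.1 hz).1)]
          · rw [Set.indicator_of_notMem hz, Set.indicator_of_notMem hz]
      rw [e, div_self (frameMeas_starChar_ne_zero hx), deltaGe_of_le hy hx h]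
    · have e : cut hx (Test.char (bot_le_bot_succ k) (lat_O_pt hy)) = 0 :=
        Subtype.ext <| funext fun z => by
          rw [cut_apply]
          by_cases hz : z ∈ OStar x
          · rw [Set.indicator_of_mem hz, Test.char_apply_of_not_mem]
            · rfl
            · exact fun hz' => (mem_OStar_iff.1 hz).2
                (O_anti ((add_emb_one_le (hx.trans hy.symm)).2 (not_le.1 h)) hz')
          · rw [Set.indicator_of_notMem hz]; rfl
      rw [e, map_zero, zero_div, deltaGe_of_not_le hy h]
  · rw [avgFun_of_ne _ hx, deltaGe_of_lev_ne hy hx]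

/-- By the ultrametric inequality a coset of a ball that does not contain zero lies in a single
sphere, that of `a`. So only one mean value is nonzero, and it is the ratio of the measures of the
coset and of the sphere. -/
theorem avgFun_ind {k : ℤ} {y : ΓK K} (hy : lev y = k) {a : Kˣ} (ha : (a : K) ∈ O (bot k))
    (hay : (a : K) ∉ O (pt y)) (hz : lev (ν a) = k) (hz' : lev (ν a + emb 1) = k) :
    avgFun k (Test.ind (bot_le_bot_succ k) (lat_O_pt hy) ha) =
      ((frameMeas (bot_le_bot_succ k)).1 (Test.char (bot_le_bot_succ k) (lat_O_pt hy)) /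
        (frameMeas (bot_le_bot_succ k)).1 (starChar hz)) • (deltaGe hz - deltaGe hz').1 := by
  classical
  have hlt : O (pt y) ≤ O (pt (ν a + emb 1)) := by
    refine O_anti ((add_emb_one_le (hz.trans hy.symm)).2 ?_)
    rw [units_mem_O_iff] at hay
    exact not_le.1 hay
  have hsub : ∀ z : K, z - (a : K) ∈ O (pt y) → z ∈ OStar (ν a) := fun z h => by
    have ha' := mem_OStar_iff.1 ⟨a, rfl, rfl⟩
    rw [mem_OStar_iff]
    have h1 := hlt h
    constructor
    · have := (O (pt (ν a))).add_mem (O_succ_le _ h1) ha'.1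
      rwa [sub_add_cancel] at this
    · intro h2
      have := (O (pt (ν a + emb 1))).sub_mem h2 h1
      rw [sub_sub_cancel] at this
      exact ha'.2 this
  funext x
  rw [Pi.smul_apply, deltaGe_sub]
  by_cases hxz : x = ν a
  · subst hxz
    rw [if_pos rfl, smul_eq_mul, mul_one, avgFun_apply _ hz, ← Meas.apply_ind _ _ ha]
    congr 2
    refine Subtype.ext <| funext fun z => ?_
    rw [cut_apply]
    by_cases h : z - a ∈ O (pt y)
    · rw [Set.indicator_of_mem (hsub z h)]
    · rw [Test.ind_apply, cosetFun_of_not_mem h, Set.indicator_apply_eq_zero]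
      exact fun _ => cosetFun_of_not_mem h
  · rw [if_neg hxz, smul_zero]
    by_cases hx : lev x = k
    · rw [avgFun_apply _ hx]
      have e : cut hx (Test.ind (bot_le_bot_succ k) (lat_O_pt hy) ha) = 0 :=
        Subtype.ext <| funext fun z => by
          rw [cut_apply]
          refine Set.indicator_apply_eq_zero.2 fun h => ?_
          rw [Test.ind_apply]
          refine cosetFun_of_not_mem fun h' => hxz ?_
          obtain ⟨b, hb, hbx⟩ := h
          obtain ⟨c, hc, hca⟩ := hsub z h'
          rw [← hbx, ← hca, Units.ext (hb.trans hc.symm)]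
      rw [e, map_zero, zero_div]
    · exact avgFun_of_ne _ hx

/-- Balls are cofinal among lattices here, and a coset of a ball is either the ball itself or avoids
zero. For these two kinds of indicators the mean values are known explicitly. -/
theorem Test.fibre_induction {k : ℤ} {P : Test (bot k : Breve (ΓK K)) (bot (k + 1)) → Prop} (h0 : P 0)
    (hadd : ∀ f g, P f → P g → P (f + g)) (hsmul : ∀ (s : ℂ) (f), P f → P (s • f))
    (hchar : ∀ (y : ΓK K) (hy : lev y = k), P (Test.char (bot_le_bot_succ k) (lat_O_pt hy)))
    (hind : ∀ (y : ΓK K) (hy : lev y = k) (a : Kˣ) (ha : (a : K) ∈ O (bot k)), (a : K) ∉ O (pt y) →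
      lev (ν a) = k → P (Test.ind (bot_le_bot_succ k) (lat_O_pt hy) ha)) (f) : P f := by
  refine Test.induction (bot_le_bot_succ k) (L := fun U => ∃ y : ΓK K, lev y = k ∧ U = O (pt y))
    (fun V hV => ?_) h0 hadd hsmul (fun U c hU hc hy => ?_) f
  · obtain ⟨y, hy, h⟩ := hV.isOp.exists_O_pt
    exact ⟨_, ⟨y, hy, rfl⟩, lat_O_pt hy, h⟩
  · obtain ⟨y, hy, rfl⟩ := hy
    by_cases h : c ∈ O (pt y)
    · convert hchar y hy using 1
      refine Subtype.ext <| funext fun z => ?_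
      rw [Test.ind_apply]
      have : z - c ∈ O (pt y) ↔ z ∈ O (pt y) := ⟨fun hz => by
        have := (O (pt y)).add_mem hz h
        rwa [sub_add_cancel] at this, fun hz => (O (pt y)).sub_mem hz h⟩
      by_cases hz : z ∈ O (pt y)
      · rw [cosetFun_of_mem (this.2 hz), Test.char_apply_of_mem _ _ hz]
      · rw [cosetFun_of_not_mem (mt this.1 hz), Test.char_apply_of_not_mem _ _ hz]
    · have hc0 : c ≠ 0 := by
        rintro rfl
        exact h (zero_mem _)
      obtain ⟨a, rfl⟩ : ∃ a : Kˣ, (a : K) = c := ⟨Units.mk0 c hc0, rfl⟩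
      refine hind y hy a hc h (le_antisymm ?_ ((units_mem_O_iff a).1 hc))
      by_contra hl
      exact h ((units_mem_O_iff a).2 (Or.inl (by omega)))

theorem avgFun_mem {k : ℤ} (f : Test (bot k : Breve (ΓK K)) (bot (k + 1))) :
    avgFun k f ∈ DPlusT (ΓK K) k := by
  refine Test.fibre_induction (P := fun f => avgFun k f ∈ DPlusT (ΓK K) k) ?_ (fun f g hf hg => ?_)
    (fun s f hf => ?_) (fun y hy => ?_) (fun y hy a ha hay hz => ?_) f
  · rw [map_zero]
    exact zero_mem _
  · rw [map_add]
    exact add_mem hf hg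
  · rw [map_smul]
    exact Submodule.smul_mem _ s hf
  · rw [avgFun_char hy]
    exact Subtype.property _
  · rw [avgFun_ind hy ha hay hz ((lev_add_emb _ 1).trans hz)]
    exact Submodule.smul_mem _ _ (Subtype.property _)

/-- The map that takes a function on `𝒪(k) / 𝒪(k + 1)` to the function of its mean values. -/
def avg (k : ℤ) : Test (bot k : Breve (ΓK K)) (bot (k + 1)) →ₗ[ℂ] DPlusT (ΓK K) k :=
  (avgFun k).codRestrict _ avgFun_mem

theorem avg_char {k : ℤ} {y : ΓK K} (hy : lev y = k) :
    avg k (Test.char (bot_le_bot_succ k) (lat_O_pt hy)) = deltaGe hy := Subtype.ext (avgFun_char hy)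

theorem avg_ind {k : ℤ} {y : ΓK K} (hy : lev y = k) {a : Kˣ} (ha : (a : K) ∈ O (bot k))
    (hay : (a : K) ∉ O (pt y)) (hz : lev (ν a) = k) (hz' : lev (ν a + emb 1) = k) :
    avg k (Test.ind (bot_le_bot_succ k) (lat_O_pt hy) ha) =
      ((frameMeas (bot_le_bot_succ k)).1 (Test.char (bot_le_bot_succ k) (lat_O_pt hy)) /
        (frameMeas (bot_le_bot_succ k)).1 (starChar hz)) • (deltaGe hz - deltaGe hz') :=
  Subtype.ext (avgFun_ind hy ha hay hz hz')

theorem avg_surjective (k : ℤ) : Function.Surjective (avg (K := K) k) := fun c => by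
  refine DPlusT.induction (P := fun c => ∃ f, avg k f = c) ⟨0, map_zero _⟩ ?_ ?_
    (fun y hy => ⟨_, avg_char hy⟩) c
  · rintro _ _ ⟨f, rfl⟩ ⟨g, rfl⟩
    exact ⟨f + g, map_add _ _ _⟩
  · rintro s _ ⟨f, rfl⟩
    exact ⟨s • f, map_smul _ _ _⟩

/-- Far to the right the spheres shrink to zero, where `f` is constant. Formally the identity is
checked on the generators. -/
theorem deltaInf_avg {k : ℤ} (f : Test (bot k : Breve (ΓK K)) (bot (k + 1))) :
    deltaInf (ΓK K) k (avg k f) = f.1 0 := by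
  refine Test.fibre_induction (P := fun f => deltaInf (ΓK K) k (avg k f) = f.1 0) ?_ (fun f g hf hg => ?_)
    (fun s f hf => ?_) (fun y hy => ?_) (fun y hy a ha hay hz => ?_) f
  · rw [map_zero, map_zero]; rfl
  · rw [map_add, map_add, hf, hg]; rfl
  · rw [map_smul, map_smul, hf]; rfl
  · rw [avg_char hy, deltaInf_deltaGe, Test.char_apply_of_mem _ _ (zero_mem _)]
  · rw [avg_ind hy ha hay hz ((lev_add_emb _ 1).trans hz), map_smul, map_sub, deltaInf_deltaGe, deltaInf_deltaGe, sub_self,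
      smul_zero, Test.ind_apply, cosetFun_of_not_mem]
    rw [zero_sub]
    exact mt (AddSubgroup.neg_mem_iff _).1 hay

/-- The integral of `f` is recovered from its mean values on spheres: on the generators, the values
of `η` on rays are multiples of the measures of the balls. -/
theorem embR_avg {k : ℤ} (η : muR (qK K) (bot (k + 1)) (bot k))
    (f : Test (bot k : Breve (ΓK K)) (bot (k + 1))) :
    embR (qK K) k η (avg k f) = η.1 (stdGood 0) * (frameMeas (bot_le_bot_succ k)).1 f := by
  have key : ∀ {x : ΓK K}, lev x = k →
      η.1 (stdGood x) = η.1 (stdGood 0) * weight (bot (k + 1)) (bot k) x := fun {x} _ => by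
    rw [muR_prop η (stdGood 0) (stdGood x), weight, mul_comm]
  refine Test.fibre_induction (P := fun f => embR (qK K) k η (avg k f) =
    η.1 (stdGood 0) * (frameMeas (bot_le_bot_succ k)).1 f) ?_ (fun f g hf hg => ?_)
    (fun s f hf => ?_) (fun y hy => ?_) (fun y hy a ha hay hz => ?_) f
  · rw [map_zero, map_zero, map_zero, mul_zero]
  · rw [map_add, map_add, map_add, hf, hg, mul_add]
  · rw [map_smul, map_smul, map_smul, hf, smul_eq_mul, smul_eq_mul, mul_left_comm]
  · rw [avg_char hy, embR_deltaGe, frameMeas_char hy, key hy]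
  · have hz' := (lev_add_emb (ν a) 1).trans hz
    rw [avg_ind hy ha hay hz hz', map_smul, map_sub, embR_deltaGe, embR_deltaGe, key hz, key hz',
      ← mul_sub, ← frameMeas_starChar hz, Meas.apply_ind, smul_eq_mul, mul_left_comm,
      div_mul_cancel₀ _ (frameMeas_starChar_ne_zero hz)]

theorem isAvg_avg {k : ℤ} (f : Test (bot k : Breve (ΓK K)) (bot (k + 1))) : IsAvg f (avg k f) := by
  intro x hx m
  refine ⟨starChar hx, cut hx f, starChar_apply hx, cut_apply hx f, ?_⟩
  obtain ⟨s, rfl⟩ := Meas.exists_eq_smul (bot_le_bot_succ k) (frameMeas_ne_zero (bot_le_bot_succ k)) m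
  change s * _ = _ * (s * _)
  rw [mul_left_comm]
  congr 1
  change _ = avgFun k f x * _
  rw [avgFun_apply f hx, div_mul_cancel₀ _ (frameMeas_starChar_ne_zero hx)]

/-- Since spheres have nonzero measure for the frame, the relation determines the mean values, and
it can be used to prove equalities. -/
theorem isAvg_iff {k : ℤ} {f : Test (bot k : Breve (ΓK K)) (bot (k + 1))} {c : DPlusT (ΓK K) k} :
    IsAvg f c ↔ c = avg k f := by
  refine ⟨fun h => Subtype.ext <| funext fun x => ?_, fun h => h ▸ isAvg_avg f⟩
  by_cases hx : lev x = k
  · obtain ⟨u, φ, hu, hφ, e⟩ := h x hx (frameMeas (bot_le_bot_succ k))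
    obtain rfl : u = starChar hx := Subtype.ext <| funext fun y => (hu y).trans (starChar_apply hx y).symm
    obtain rfl : φ = cut hx f := Subtype.ext <| funext fun y => (hφ y).trans (cut_apply hx f y).symm
    change _ = avgFun k f x
    rw [avgFun_apply f hx, e, mul_div_cancel_right₀ _ (frameMeas_starChar_ne_zero hx)]
  · rw [c.2.1 x hx, (avg k f).2.1 x hx]

theorem mul_mem_OStar_iff (g : Kˣ) {x : ΓK K} {y : K} :
    (g⁻¹ : Kˣ) * y ∈ OStar (x - ν g) ↔ y ∈ OStar x := by
  have e : ∀ z : ΓK K, (pt z : Breve (ΓK K)) = ν g +ᵥ pt (z - ν g) := fun z => by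
    rw [vadd_pt, add_sub_cancel]
  rw [mem_OStar_iff, mem_OStar_iff, inv_mul_mem_O_iff g (e x)]
  have := inv_mul_mem_O_iff (x := y) g (e (x + emb 1))
  rw [add_sub_right_comm] at this
  rw [this]

/-- Multiplication by `g` carries spheres to spheres and invariant measures to invariant measures,
so the shifted mean values satisfy the characterization for the translated function. -/
theorem avg_mul (g : Kˣ) {k k' : ℤ} (hk : k' = lev (ν g) + k)
    (h₀ : (bot k' : Breve (ΓK K)) = ν g +ᵥ bot k) (h₁ : (bot (k' + 1) : Breve (ΓK K)) = ν g +ᵥ bot (k + 1))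
    (f : Test (bot k : Breve (ΓK K)) (bot (k + 1))) :
    avg k' (Test.mul g (bot_le_bot_succ k) h₀ h₁ f) = shiftT (ν g) hk (avg k f) := by
  symm
  rw [← isAvg_iff]
  intro x hx m
  have hx0 : lev (x - ν g) = k := by rw [map_sub, hx, hk]; ring
  obtain ⟨u, φ, hu, hφ, e⟩ := isAvg_avg f (x - ν g) hx0
    (Meas.mul g⁻¹ (bot_le_bot_succ k') (eq_vadd_inv h₀) (eq_vadd_inv h₁) m)
  refine ⟨Test.mul g (bot_le_bot_succ k) h₀ h₁ u, Test.mul g (bot_le_bot_succ k) h₀ h₁ φ, fun y => ?_,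
    fun y => ?_, ?_⟩
  · rw [Test.mul_apply, hu]
    by_cases hy : y ∈ OStar x
    · rw [Set.indicator_of_mem hy, Set.indicator_of_mem ((mul_mem_OStar_iff g).2 hy)]; rfl
    · rw [Set.indicator_of_notMem hy, Set.indicator_of_notMem (mt (mul_mem_OStar_iff g).1 hy)]
  · rw [Test.mul_apply, hφ]
    by_cases hy : y ∈ OStar x
    · rw [Set.indicator_of_mem hy, Set.indicator_of_mem ((mul_mem_OStar_iff g).2 hy)]; rfl
    · rw [Set.indicator_of_notMem hy, Set.indicator_of_notMem (mt (mul_mem_OStar_iff g).1 hy)]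
  · have key : ∀ f, (Meas.mul g⁻¹ (bot_le_bot_succ k') (eq_vadd_inv h₀) (eq_vadd_inv h₁) m).1 f =
        m.1 (Test.mul g (bot_le_bot_succ k) h₀ h₁ f) := fun f =>
      congrArg m.1 <| Subtype.ext <| funext fun y => by
        rw [Test.mul_apply, Test.mul_apply, inv_inv]
    rw [key, key] at e
    exact e

end Average

end

end TwoDim

namespace TwoDim

noncomputable section

open _root_.TwoDim.Ext2 (emb lev)
open Breve


/-! ### Gluing test functions into compatible families. -/

section Limit

variable {K : Type*} [Field K] [TwoDimLocalField K] [PartialTopology K]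

/-- Intersections `V ∩ 𝒪'(b)` are cofinal among the lattices of the subspace, and the indicator of a
coset of such an intersection extends to that of a coset of `V`. -/
theorem slice_surjective {a b c : Breve (ΓK K)} (hab : a ≤ b) (hbc : b ≤ c) :
    Function.Surjective (slice hab hbc (0 : K)) := fun f => by
  refine Test.induction hbc (L := fun U => ∃ V, Lat a c V ∧ U = V ⊓ O b)
    (P := fun f => ∃ G, slice hab hbc (0 : K) G = f) (fun U hU => ?_) ⟨0, map_zero _⟩ ?_ ?_ ?_ f
  · obtain ⟨V', hV', h⟩ := hU.isOp.extend hab hbc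
    obtain ⟨V, hV, hVV⟩ := exists_lat_le (hab.trans hbc) hV'
    exact ⟨V ⊓ O b, ⟨V, hV, rfl⟩, hV.restrict hab hbc, (inf_le_inf_right _ hVV).trans h⟩
  · rintro _ _ ⟨F, rfl⟩ ⟨G, rfl⟩
    exact ⟨F + G, map_add _ _ _⟩
  · rintro s _ ⟨F, rfl⟩
    exact ⟨s • F, map_smul _ _ _⟩
  · rintro U d hU hd ⟨V, hV, rfl⟩
    refine ⟨Test.ind (hab.trans hbc) hV (O_anti hab hd), Test.ext_on fun x hx => ?_⟩
    rw [slice_apply _ _ _ _ hx, zero_add, Test.ind_apply, Test.ind_apply]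
    have h := (O b).sub_mem hx hd
    by_cases hxV : x - d ∈ V
    · rw [cosetFun_of_mem hxV, cosetFun_of_mem (AddSubgroup.mem_inf.2 ⟨hxV, h⟩)]
    · rw [cosetFun_of_not_mem hxV, cosetFun_of_not_mem fun h => hxV (AddSubgroup.mem_inf.1 h).1]

/-- Sums `V + 𝒪'(b)` are cofinal among the lattices of the quotient, and the indicator of a coset of
such a sum is, up to a nonzero factor, the direct image of that of a coset of `V`. -/
theorem dirIm_surjective {a b c : Breve (ΓK K)} (hab : a ≤ b) (hbc : b ≤ c) {m : Meas b c} (hm : m ≠ 0) :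
    Function.Surjective (dirIm le_rfl hab hbc m) := fun f => by
  refine Test.induction hab (L := fun U => ∃ V, Lat a c V ∧ U = V ⊔ O b)
    (P := fun f => ∃ G, dirIm le_rfl hab hbc m G = f) (fun U hU => ?_) ⟨0, map_zero _⟩ ?_ ?_ ?_ f
  · obtain ⟨V, hV, hVU⟩ := exists_lat_le (hab.trans hbc) (hU.isOp.of_quotient hab hbc)
    exact ⟨V ⊔ O b, ⟨V, hV, rfl⟩, hV.sup hab hbc, sup_le hVU hU.isOp.le⟩
  · rintro _ _ ⟨F, rfl⟩ ⟨G, rfl⟩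
    exact ⟨F + G, map_add _ _ _⟩
  · rintro s _ ⟨F, rfl⟩
    exact ⟨s • F, map_smul _ _ _⟩
  · rintro U d hU hd ⟨V, hV, rfl⟩
    refine ⟨(m.1 (Test.char hbc (hV.restrict hab hbc)))⁻¹ • Test.ind (hab.trans hbc) hV hd, ?_⟩
    rw [map_smul, dirIm_ind, smul_smul, inv_mul_cancel₀ (Meas.char_ne_zero _ _ hm), one_smul]

/-- The gluing lemma. Any extension `G₁` of `f` has a direct image with the right value at zero, so
the error vanishes near zero. It can then be corrected by a function that vanishes on all of
`𝒪'(b)`. -/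
theorem exists_extension {a b c : Breve (ΓK K)} (hab : a ≤ b) (hbc : b ≤ c) {m : Meas b c} (hm : m ≠ 0)
    (F : Test a b) (f : Test b c) (h : m.1 f = F.1 0) :
    ∃ G : Test a c, slice hab hbc (0 : K) G = f ∧ dirIm le_rfl hab hbc m G = F := by
  classical
  obtain ⟨G₁, hG₁⟩ := slice_surjective hab hbc f
  obtain ⟨H, hH⟩ := dirIm_surjective hab hbc hm (F - dirIm le_rfl hab hbc m G₁)
  have h0 : (F - dirIm le_rfl hab hbc m G₁).1 0 = 0 := by
    change F.1 0 - (dirIm le_rfl hab hbc m G₁).1 0 = 0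
    rw [dirIm_apply _ _ _ _ _ (zero_mem _), hG₁, h, sub_self]
  obtain ⟨U, hU, hFU, -⟩ := Test.exists_lat hab (F - dirIm le_rfl hab hbc m G₁)
  have hχ : ∀ x, ∀ v ∈ U, (if x + v ∈ U then (0 : ℂ) else 1) = if x ∈ U then 0 else 1 :=
    fun x v hv => if_congr (U.add_mem_cancel_right hv) rfl rfl
  -- A lift `H` of the error, cut off on the open subgroup `U` on which the error is zero. As `𝒪'(b)
  -- ⊆ U`, each slice of `H` is either kept or killed as a whole, so the direct image does not
  -- change.
  let H' : Test a c := ⟨_, Test.mul_mem (hab.trans hbc) H (hU.isOp.of_quotient hab hbc)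
    (χ := fun x => if x ∈ U then 0 else 1) hχ⟩
  have hH' : ∀ x, H'.1 x = (if x ∈ U then 0 else 1) * H.1 x := fun _ => rfl
  refine ⟨G₁ + H', ?_, ?_⟩
  · have : slice hab hbc (0 : K) H' = 0 := Test.ext_on fun x hx => by
      rw [slice_apply _ _ _ _ hx, hH', zero_add, if_pos (hU.isOp.1 hx), zero_mul]; rfl
    rw [map_add, this, add_zero, hG₁]
  · have : dirIm le_rfl hab hbc m H' = F - dirIm le_rfl hab hbc m G₁ := Test.ext_on fun x hx => by
      rw [dirIm_apply _ _ _ _ _ hx]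
      by_cases hxU : x ∈ U
      · have e : slice (le_rfl.trans hab) hbc x H' = 0 := Test.ext_on fun y hy => by
          rw [slice_apply _ _ _ _ hy, hH', if_pos (U.add_mem hxU (hU.isOp.1 hy)), zero_mul]; rfl
        have hx0 := hFU 0 x hxU
        rw [zero_add] at hx0
        rw [e, map_zero, hx0, h0]
      · have e : slice (le_rfl.trans hab) hbc x H' = slice (le_rfl.trans hab) hbc x H :=
          Test.ext_on fun y hy => by
            rw [slice_apply _ _ _ _ hy, slice_apply _ _ _ _ hy, hH', if_neg, one_mul]
            exact mt (U.add_mem_cancel_right (hU.isOp.1 hy)).1 hxU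
        rw [e, ← dirIm_apply le_rfl hab hbc m H hx, hH]
    rw [map_add, this, add_sub_cancel]

/-- The transition maps for the coherent family of measures. -/
def tr {a' a b c : Breve (ΓK K)} (h₁ : a' ≤ a) (h₂ : a ≤ b) (h₃ : b ≤ c) : Test a' c →ₗ[ℂ] Test a b :=
  dirIm h₁ h₂ h₃ (frameMeas h₃)

theorem tr_tr {a'' a' a b c d : Breve (ΓK K)} (h₀ : a'' ≤ a') (h₁ : a' ≤ a) (h₂ : a ≤ b) (h₃ : b ≤ c)
    (h₄ : c ≤ d) (f : Test a'' d) : tr h₁ h₂ h₃ (tr h₀ (h₁.trans (h₂.trans h₃)) h₄ f) =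
      tr (h₀.trans h₁) h₂ (h₃.trans h₄) f := by
  have := LinearMap.congr_fun (dirIm_prod h₁ h₂ h₃ h₀ h₄ (frameMeas h₃) (frameMeas h₄)) f
  rw [frameMeas_prod] at this
  exact this.symm

theorem tr_restrict {a b c : Breve (ΓK K)} (hab : a ≤ b) (hbc : b ≤ c) (f : Test a c) :
    tr hab hbc le_rfl f = slice hab hbc (0 : K) f := Test.ext_on fun x hx => by
  rw [tr, dirIm_apply _ _ _ _ _ hx, frameMeas_self, Meas.one_apply, slice_apply _ _ _ _ (zero_mem _),
    slice_apply _ _ _ _ hx, add_zero, zero_add]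

theorem frameMeas_tr {a b c : Breve (ΓK K)} (hab : a ≤ b) (hbc : b ≤ c) (f : Test a c) :
    (frameMeas hab).1 (tr le_rfl hab hbc f) = (frameMeas (hab.trans hbc)).1 f := by
  rw [← frameMeas_prod hab hbc]
  rfl

/-- Integrating along `𝒪'(b)` at zero is integrating the restriction to `𝒪'(b)`. This is the
necessary condition for gluing. -/
theorem tr_apply_zero {a b c : Breve (ΓK K)} (hab : a ≤ b) (hbc : b ≤ c) (f : Test a c) :
    (tr le_rfl hab hbc f).1 0 = (frameMeas hbc).1 (tr hab hbc le_rfl f) := by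
  rw [tr_restrict, tr, dirIm_apply _ _ _ _ _ (zero_mem _)]

theorem tr_self {a b : Breve (ΓK K)} (hab : a ≤ b) (f : Test a b) : tr le_rfl hab le_rfl f = f := by
  rw [tr_restrict]
  exact Test.ext_on fun x hx => by rw [slice_apply _ _ _ _ hx, zero_add]

theorem exists_tr_eq {a b c : Breve (ΓK K)} (hab : a ≤ b) (hbc : b ≤ c) (F : Test a b) (f : Test b c)
    (h : (frameMeas hbc).1 f = F.1 0) : ∃ G : Test a c, tr hab hbc le_rfl G = f ∧ tr le_rfl hab hbc G = F := by
  obtain ⟨G, h1, h2⟩ := exists_extension hab hbc (frameMeas_ne_zero hbc) F f h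
  exact ⟨G, (tr_restrict _ _ _).trans h1, h2⟩

/-- The function `F` on `𝒪(n) / 𝒪(m)` induces the given functions on the quotients `𝒪(k) / 𝒪(k + 1)`. -/
def Induces (f : ∀ k : ℤ, Test (bot k : Breve (ΓK K)) (bot (k + 1))) {n m : ℤ}
    (F : Test (bot n : Breve (ΓK K)) (bot m)) : Prop :=
  ∀ (k : ℤ) (h₁ : n ≤ k) (h₂ : k + 1 ≤ m),
    tr (bot_mono h₁) (bot_le_bot_succ k) (bot_mono h₂) F = f k

variable {f : ∀ k : ℤ, Test (bot k : Breve (ΓK K)) (bot (k + 1))}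

/-- `F` is glued with `f (k + 1)`. The gluing condition holds because `F` and `f k` have the same
value at zero. -/
theorem Induces.exists_right (hf : ∀ k, (f k).1 0 = (frameMeas (bot_le_bot_succ (k + 1))).1 (f (k + 1)))
    {n k : ℤ} (hn : n ≤ k) {F : Test (bot n : Breve (ΓK K)) (bot (k + 1))} (hF : Induces f F) :
    ∃ G : Test (bot n : Breve (ΓK K)) (bot (k + 1 + 1)), Induces f G ∧
      tr le_rfl (bot_mono (hn.trans (lt_add_one k).le)) (bot_le_bot_succ _) G = F := by
  have h1 := congrArg (fun f => f.1 0) (hF k hn le_rfl)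
  change (tr _ _ _ F).1 0 = _ at h1
  rw [tr_restrict, slice_apply _ _ _ _ (zero_mem _), zero_add, hf k] at h1
  obtain ⟨G, h2, h3⟩ := exists_tr_eq (bot_mono (hn.trans (lt_add_one k).le)) (bot_le_bot_succ (k + 1)) F
    (f (k + 1)) h1.symm
  refine ⟨G, fun j hj hjk => ?_, h3⟩
  rcases hjk.lt_or_eq with h | h
  · rw [← hF j hj (by omega), ← h3, tr_tr]
  · obtain rfl : j = k + 1 := by omega
    exact h2

/-- `f n` is glued with `F`. The gluing condition holds because `F` and `f (n + 1)` have the same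
integral. -/
theorem Induces.exists_left (hf : ∀ k, (f k).1 0 = (frameMeas (bot_le_bot_succ (k + 1))).1 (f (k + 1)))
    {n m : ℤ} (hn : n + 1 + 1 ≤ m) {F : Test (bot (n + 1) : Breve (ΓK K)) (bot m)} (hF : Induces f F) :
    ∃ G : Test (bot n : Breve (ΓK K)) (bot m), Induces f G ∧
      tr (bot_le_bot_succ n) (bot_mono (by omega)) le_rfl G = F := by
  have h1 := hf n
  rw [← hF (n + 1) le_rfl hn, frameMeas_tr] at h1
  obtain ⟨G, h2, h3⟩ := exists_tr_eq (bot_le_bot_succ n) (bot_mono (by omega)) (f n) F h1.symm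
  refine ⟨G, fun j hj hjk => ?_, h2⟩
  rcases hj.lt_or_eq with h | rfl
  · rw [← hF j (by omega) hjk, ← h2, tr_tr]
  · exact h3

theorem Induces.exists_succ (hf : ∀ k, (f k).1 0 = (frameMeas (bot_le_bot_succ (k + 1))).1 (f (k + 1)))
    {n m n' m' : ℤ} (hn : n = n' + 1) (hm : m' = m + 1) (hnm : n < m) (h₁ : n' ≤ n) (h₂ : m ≤ m')
    {F : Test (bot n : Breve (ΓK K)) (bot m)} (hF : Induces f F) :
    ∃ G : Test (bot n' : Breve (ΓK K)) (bot m'), Induces f G ∧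
      tr (bot_mono h₁) (bot_mono hnm.le) (bot_mono h₂) G = F := by
  subst hn hm
  obtain ⟨k, rfl⟩ : ∃ k, m = k + 1 := ⟨m - 1, by ring⟩
  obtain ⟨G₁, h3, h4⟩ := hF.exists_right hf (by omega)
  obtain ⟨G, h5, h6⟩ := h3.exists_left hf (by omega)
  refine ⟨G, h5, ?_⟩
  rw [← h4, ← h6, tr_tr]

theorem induces_self : Induces f (f 0 : Test (bot (-(0 : ℕ))) (bot ((0 : ℕ) + 1))) := fun k h₁ h₂ => by
  obtain rfl : k = 0 := by
    push_cast at h₁ h₂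
    omega
  exact tr_self _ _

/-- A sequence of functions on `𝒪(-j) / 𝒪(j + 1)` each of which extends the preceding one. -/
def towerSeq (hf : ∀ k, (f k).1 0 = (frameMeas (bot_le_bot_succ (k + 1))).1 (f (k + 1))) :
    ∀ j : ℕ, {F : Test (bot (-(j : ℤ)) : Breve (ΓK K)) (bot ((j : ℤ) + 1)) // Induces f F}
  | 0 => ⟨f 0, induces_self⟩
  | j + 1 => ⟨_, ((towerSeq hf j).2.exists_succ hf (n' := -((j + 1 : ℕ) : ℤ)) (m' := ((j + 1 : ℕ) : ℤ) + 1)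
      (by push_cast; ring) (by push_cast; ring) (by omega) (by omega) (by omega)).choose_spec.1⟩

theorem towerSeq_succ (hf : ∀ k, (f k).1 0 = (frameMeas (bot_le_bot_succ (k + 1))).1 (f (k + 1))) (j : ℕ) :
    tr (bot_mono (by omega)) (bot_mono (by omega)) (bot_mono (by omega)) (towerSeq hf (j + 1)).1 =
      (towerSeq hf j).1 :=
  ((towerSeq hf j).2.exists_succ hf (n' := -((j + 1 : ℕ) : ℤ)) (m' := ((j + 1 : ℕ) : ℤ) + 1)
      (by push_cast; ring) (by push_cast; ring) (by omega) (by omega) (by omega)).choose_spec.2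

theorem tr_towerSeq (hf : ∀ k, (f k).1 0 = (frameMeas (bot_le_bot_succ (k + 1))).1 (f (k + 1)))
    {i j : ℕ} (h : i ≤ j) :
    tr (bot_mono (by omega)) (bot_mono (by omega)) (bot_mono (by omega)) (towerSeq hf j).1 =
      (towerSeq hf i).1 := by
  induction j, h using Nat.le_induction with
  | base => exact tr_self _ _
  | succ j hj ih => rw [← ih, ← towerSeq_succ hf j, tr_tr]

variable (K) in
/-- The families of functions on the quotients `𝒪(n) / 𝒪(m)` which are compatible with the transition maps. -/
def Lim : Submodule ℂ (∀ p : Idx, TestI K p) where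
  carrier := {G | ∀ (p' p : Idx) (h₁ : p'.1.1 ≤ p.1.1) (h₂ : p.1.2 ≤ p'.1.2),
    G p = tr (bot_mono h₁) (bot_mono p.2) (bot_mono h₂) (G p')}
  add_mem' h h' p' p h₁ h₂ := by rw [Pi.add_apply, Pi.add_apply, map_add, h p' p h₁ h₂, h' p' p h₁ h₂]
  zero_mem' _ _ _ _ := (map_zero _).symm
  smul_mem' c _ h p' p h₁ h₂ := by rw [Pi.smul_apply, Pi.smul_apply, map_smul, h p' p h₁ h₂]

theorem exists_lim (hf : ∀ k, (f k).1 0 = (frameMeas (bot_le_bot_succ (k + 1))).1 (f (k + 1))) :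
    ∃ G : Lim K, ∀ k, G.1 (succIdx k) = f k := by
  have hp : ∀ p : Idx, -((p.1.1.natAbs + p.1.2.natAbs : ℕ) : ℤ) ≤ p.1.1 ∧
      p.1.2 ≤ ((p.1.1.natAbs + p.1.2.natAbs : ℕ) : ℤ) + 1 := fun p => by omega
  -- The quotients `𝒪(-j) / 𝒪(j + 1)` are cofinal, and any stage of the tower that is large enough
  -- for `p` gives the same function on `p`.
  have key : ∀ (p : Idx) (j : ℕ) (h₁ : -(j : ℤ) ≤ p.1.1) (h₂ : p.1.2 ≤ (j : ℤ) + 1),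
      tr (bot_mono (hp p).1) (bot_mono p.2) (bot_mono (hp p).2) (towerSeq hf _).1 =
        tr (bot_mono h₁) (bot_mono p.2) (bot_mono h₂) (towerSeq hf j).1 := fun p j h₁ h₂ => by
    rw [← tr_towerSeq hf (le_max_left _ j), tr_tr, ← tr_towerSeq hf (le_max_right _ j), tr_tr]
  refine ⟨⟨fun p => tr (bot_mono (hp p).1) (bot_mono p.2) (bot_mono (hp p).2) (towerSeq hf _).1,
    fun p' p h₁ h₂ => ?_⟩, fun k => ?_⟩
  · change tr _ _ _ _ = tr _ _ _ (tr _ _ _ _)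
    rw [key p _ ((hp p').1.trans h₁) (h₂.trans (hp p').2), tr_tr]
  · exact (towerSeq hf _).2 k (hp (succIdx k)).1 (hp (succIdx k)).2

end Limit

end

end TwoDim

namespace TwoDim

noncomputable section

open _root_.TwoDim.Ext2 (emb lev)
open Breve


/-! ### The action of the Heisenberg group on compatible families. -/

section Operators

variable {K : Type*} [Field K] [TwoDimLocalField K] [PartialTopology K] {α : Breve (ΓK K)}

/-- The factor `h⁻¹ γ(μ) / μ`, where `μ` is the standard element of `μ(β, α)`. -/
def scal (w : Heis α) (β : Breve (ΓK K)) : ℂ := modulus w.pt β α * (qK K : ℂ) ^ (-w.tor.1 (stdGood 0))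

theorem modulus_mul_scal (w : Heis α) (β γ : Breve (ΓK K)) : modulus w.pt β γ * scal w γ = scal w β := by
  rw [scal, scal, ← mul_assoc, modulus_mul]

/-- The passage from the standard set to its translate is made in two steps, and `jump` is invariant
under translation. -/
theorem modulus_add (γ δ : ΓK K) (β β' : Breve (ΓK K)) :
    modulus (γ + δ) β β' = modulus γ (δ +ᵥ β) (δ +ᵥ β') * modulus δ β β' := by
  have h := jump_shift δ β β' ((stdGood 0).shift (-δ)) (((stdGood 0).shift (-γ)).shift (-δ))
  rw [← Good.shift_add, add_neg_cancel, Good.shift_zero, ← Good.shift_add, add_neg_cancel,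
    Good.shift_zero] at h
  rw [modulus, modulus, modulus, ← zpow_add₀ (qK K).ne_zero, h, add_comm (jump _ _ _ _), ← jump_trans,
    ← Good.shift_add, neg_add_rev]

/-- The group law evaluates the torsor element of `y` at a translate of the standard set. Moving
back to the standard set costs `modulus x.pt α (y.pt +ᵥ α)`, which is the factor by which
`modulus_add` alone would fail to give the result. -/
theorem scal_mul (x y : Heis α) (β : Breve (ΓK K)) : scal (x * y) β = scal x (y.pt +ᵥ β) * scal y β := by
  have h1 : (x * y).tor.1 (stdGood 0) =
      x.tor.1 (stdGood 0) + y.tor.1 ((stdGood 0).shift (-x.pt)) := rfl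
  have h2 := y.tor.2 (stdGood 0) ((stdGood 0).shift (-x.pt))
  have h3 : modulus x.pt (y.pt +ᵥ α) α * modulus x.pt α (y.pt +ᵥ α) = 1 := by
    rw [modulus_mul, modulus_self]
  have h4 := modulus_mul x.pt (y.pt +ᵥ β) α (y.pt +ᵥ α)
  have h5 : scal (x * y) β = modulus (x.pt + y.pt) β α * (qK K : ℂ) ^ (-(x * y).tor.1 (stdGood 0)) := rfl
  rw [h5, scal, scal, modulus_add, ← h4, h1, h2, neg_add, neg_add, zpow_add₀ (qK K).ne_zero,
    zpow_add₀ (qK K).ne_zero, zpow_neg _ (jump _ _ _ _), ← modulus]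
  field_simp [modulus_ne_zero]

theorem scal_one (β : Breve (ΓK K)) : scal (1 : Heis α) β = 1 := by
  change modulus 0 β α * (qK K : ℂ) ^ (-0 : ℤ) = 1
  rw [modulus_zero, neg_zero, zpow_zero, mul_one]

/-- `tr` integrates against the frame on `𝒪'(b) / 𝒪'(c)`, which `g` multiplies by the modulus. -/
theorem tr_mul (g : Kˣ) {a' a b c e' e d i : Breve (ΓK K)} (h₁ : a' ≤ a) (h₂ : a ≤ b) (h₃ : b ≤ c)
    (h₁' : e' ≤ e) (h₂' : e ≤ d) (h₃' : d ≤ i)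
    (ha' : e' = ν g +ᵥ a') (ha : e = ν g +ᵥ a) (hb : d = ν g +ᵥ b) (hc : i = ν g +ᵥ c) (f : Test a' c) :
    modulus (ν g) c b • tr h₁' h₂' h₃' (Test.mul g (h₁.trans (h₂.trans h₃)) ha' hc f) =
      Test.mul g h₂ ha hb (tr h₁ h₂ h₃ f) := by
  subst ha' ha hb hc
  have := (isDirectImage_iff h₁' h₂' h₃').1 (IsDirectImage.mul g (h₁.trans (h₂.trans h₃)) h₃ h₂ rfl rfl
    rfl rfl ((isDirectImage_iff h₁ h₂ h₃).2 (rfl : tr h₁ h₂ h₃ f = _)))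
  rw [this, Meas.mul_frame, dirIm_smul]
  rfl

/-- The pair `(n - d, m - d)`. -/
def subIdx (d : ℤ) (p : Idx) : Idx := ⟨(p.1.1 - d, p.1.2 - d), sub_le_sub_right p.2 d⟩

theorem bot_eq_vadd (γ : ΓK K) (n : ℤ) : (bot n : Breve (ΓK K)) = γ +ᵥ bot (n - lev γ) := by
  rw [vadd_bot, add_sub_cancel]

theorem eq_subIdx {γ : ΓK K} {p p' : Idx} (hn : (bot p'.1.1 : Breve (ΓK K)) = γ +ᵥ bot p.1.1)
    (hm : (bot p'.1.2 : Breve (ΓK K)) = γ +ᵥ bot p.1.2) : p = subIdx (lev γ) p' := by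
  rw [vadd_bot] at hn hm
  injection hn with hn
  injection hm with hm
  exact Subtype.ext (Prod.ext (eq_sub_of_add_eq' hn.symm) (eq_sub_of_add_eq' hm.symm))

/-- The action of an element of the Heisenberg group on all families of functions. -/
def opPi (g : Kˣ) (w : Heis α) : (∀ p : Idx, TestI K p) →ₗ[ℂ] ∀ p : Idx, TestI K p :=
  LinearMap.pi fun p => scal w (bot (p.1.2 - lev (ν g))) • Test.mul g
    (bot_mono (subIdx (lev (ν g)) p).2) (bot_eq_vadd (ν g) p.1.1) (bot_eq_vadd (ν g) p.1.2) ∘ₗ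
      LinearMap.proj (subIdx (lev (ν g)) p)

theorem opPi_apply (g : Kˣ) (w : Heis α) (G : ∀ p : Idx, TestI K p) {p p' : Idx}
    (hn : (bot p'.1.1 : Breve (ΓK K)) = ν g +ᵥ bot p.1.1)
    (hm : (bot p'.1.2 : Breve (ΓK K)) = ν g +ᵥ bot p.1.2) :
    opPi g w G p' = scal w (bot p.1.2) • Test.mul g (bot_mono p.2) hn hm (G p) := by
  obtain rfl := eq_subIdx hn hm
  rfl

/-- The modulus that appears when `g` passes a transition map is the quotient of the scalars at the
two lower ends. -/
theorem opPi_mem {g : Kˣ} {w : Heis α} (hw : ν g = w.pt) {G : ∀ p : Idx, TestI K p} (hG : G ∈ Lim K) :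
    opPi g w G ∈ Lim K := fun p' p h₁ h₂ => by
  have e := tr_mul g (bot_mono (sub_le_sub_right h₁ (lev (ν g)))) (bot_mono (subIdx (lev (ν g)) p).2)
    (bot_mono (sub_le_sub_right h₂ (lev (ν g)))) (bot_mono h₁) (bot_mono p.2) (bot_mono h₂)
    (bot_eq_vadd _ _) (bot_eq_vadd _ _) (bot_eq_vadd _ _) (bot_eq_vadd _ _) (G (subIdx (lev (ν g)) p'))
  rw [opPi_apply g w G (p := subIdx _ p) (bot_eq_vadd (ν g) p.1.1) (bot_eq_vadd (ν g) p.1.2),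
    opPi_apply g w G (p := subIdx _ p') (bot_eq_vadd (ν g) p'.1.1) (bot_eq_vadd (ν g) p'.1.2),
    hG (subIdx _ p') (subIdx _ p) (sub_le_sub_right h₁ _) (sub_le_sub_right h₂ _), map_smul]
  refine (congrArg (_ • ·) e.symm).trans ?_
  rw [smul_smul]
  refine congrArg (· • _) ?_
  rw [hw, mul_comm]
  exact modulus_mul_scal w _ _

/-- The action of an element of the Heisenberg group on the compatible families of functions. -/
def opLim {g : Kˣ} {w : Heis α} (hw : ν g = w.pt) : Lim K →ₗ[ℂ] Lim K :=
  (opPi g w).restrict fun _ => opPi_mem hw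

theorem opLim_apply {g : Kˣ} {w : Heis α} (hw : ν g = w.pt) (G : Lim K) {p p' : Idx}
    (hn : (bot p'.1.1 : Breve (ΓK K)) = ν g +ᵥ bot p.1.1)
    (hm : (bot p'.1.2 : Breve (ΓK K)) = ν g +ᵥ bot p.1.2) :
    (opLim hw G).1 p' = scal w (bot p.1.2) • Test.mul g (bot_mono p.2) hn hm (G.1 p) :=
  opPi_apply g w G.1 hn hm

theorem opLim_mul {g g' g'' : Kˣ} {w w' w'' : Heis α} (hw : ν g = w.pt) (hw' : ν g' = w'.pt)
    (hw'' : ν g'' = w''.pt) (hg : g'' = g * g') (h : w'' = w * w') (G : Lim K) :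
    opLim hw'' G = opLim hw (opLim hw' G) := Subtype.ext <| funext fun p => by
  subst hg h
  have e : ∀ n : ℤ, (bot n : Breve (ΓK K)) = ν (g * g') +ᵥ bot (n - lev (ν g) - lev (ν g')) := fun n => by
    rw [ν_mul, add_vadd, ← bot_eq_vadd, ← bot_eq_vadd]
  rw [opLim_apply hw _ (p := subIdx (lev (ν g)) p) (bot_eq_vadd _ _) (bot_eq_vadd _ _),
    opLim_apply hw' _ (p := subIdx (lev (ν g')) (subIdx (lev (ν g)) p)) (bot_eq_vadd _ _) (bot_eq_vadd _ _),
    opLim_apply hw'' _ (p := subIdx (lev (ν g')) (subIdx (lev (ν g)) p)) (e _) (e _), map_smul, smul_smul]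
  refine congrArg₂ (· • ·) ((scal_mul w w' _).trans (congrArg (scal w · * _) ?_))
    (LinearMap.congr_fun (Test.mul_mul' g g' _ (bot_mono (subIdx _ p).2) _ _ (bot_eq_vadd _ _)
      (bot_eq_vadd _ _) _ _) _)
  rw [← hw']
  exact (bot_eq_vadd (ν g') _).symm

end Operators

/-! ### The space `𝒟_α(K)` in coordinates, and the action on coinvariants. -/

section Coordinates

variable {K : Type*} [Field K] [TwoDimLocalField K] [PartialTopology K] {α : Breve (ΓK K)}

/-- The identification of `𝒟(𝒪(n) / 𝒪(m)) ⊗ μ(m, α)` with `𝒟(𝒪(n) / 𝒪(m))`. -/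
def triv (α : Breve (ΓK K)) (p : Idx) : XK α p ≃ₗ[ℂ] TestI K p :=
  ((Mu.coord (bot p.1.2) α).lTensor (TestI K p)).trans (TensorProduct.rid ℂ _)

theorem triv_tmul {p : Idx} (f : TestI K p) (m : Mu (bot p.1.2) α) :
    triv α p (XK.tmul f m) = Mu.coord (bot p.1.2) α m • f := rfl

theorem eq_tmul_triv {p : Idx} (x : XK α p) : x = XK.tmul (triv α p x) (Mu.mk _ _ 1) :=
  (triv α p).injective (by rw [triv_tmul, Mu.coord_mk, one_smul])

theorem dirIm_eq_smul_tr {a' a b c : Breve (ΓK K)} (h₁ : a' ≤ a) (h₂ : a ≤ b) (h₃ : b ≤ c) (m : Meas b c)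
    (f : Test a' c) : dirIm h₁ h₂ h₃ m f = Meas.coef h₃ m • tr h₁ h₂ h₃ f := by
  conv_lhs => rw [Meas.eq_coef_smul h₃ m, dirIm_smul]
  rfl

/-- In coordinates the scalars of `s` and `μ` move from one tensor factor to the other, and the
transition map becomes `tr`. -/
theorem mem_transGraph_iff {p' p : Idx} (h₁ : p'.1.1 ≤ p.1.1) (h₂ : p.1.2 ≤ p'.1.2) {x : XK α p'}
    {y : XK α p} : (x, y) ∈ transGraph α p' p ↔
      triv α p y = tr (bot_mono h₁) (bot_mono p.2) (bot_mono h₂) (triv α p' x) := by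
  constructor
  · let φ : XK α p' × XK α p →ₗ[ℂ] TestI K p := (triv α p).toLinearMap ∘ₗ LinearMap.snd ℂ _ _ -
      tr (bot_mono h₁) (bot_mono p.2) (bot_mono h₂) ∘ₗ (triv α p').toLinearMap ∘ₗ LinearMap.fst ℂ _ _
    suffices transGraph α p' p ≤ LinearMap.ker φ from fun h => sub_eq_zero.1 (this h)
    refine Submodule.span_le.2 ?_
    rintro _ ⟨f, f', s, z, m, m', hf, hs, hm, rfl⟩
    have e1 := (isMul_iff.1 hm).trans (congrArg (· * _) ((isMeas_iff (bot_mono h₂)).1 hs))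
    have e2 := (isDirectImage_iff (bot_mono h₁) (bot_mono p.2) (bot_mono h₂)).1 hf
    refine sub_eq_zero.2 ?_
    change Mu.coord (bot p.1.2) α m • f' =
      tr (bot_mono h₁) (bot_mono p.2) (bot_mono h₂) (Mu.coord (bot p'.1.2) α m' • f)
    rw [e1, e2, map_smul, dirIm_eq_smul_tr]
    generalize Mu.coord (bot p.1.2) α m = t
    generalize Meas.coef (bot_mono h₂) s = t'
    exact (smul_smul t t' _).trans (congrArg (· • _) (mul_comm t t'))
  · intro h
    rw [eq_tmul_triv x, eq_tmul_triv y]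
    refine Submodule.subset_span ⟨_, _, frameMeas (bot_mono h₂), Mu.mk _ _ 1, _, _,
      (isDirectImage_iff (bot_mono h₁) (bot_mono p.2) (bot_mono h₂)).2 h, ?_, ?_, rfl⟩
    · exact (isMeas_iff (bot_mono h₂)).2 ((Mu.coord_mk _ _ 1).trans (Meas.coef_frame (bot_mono h₂)).symm)
    · exact isMul_iff.2 ((Mu.coord_mk _ _ 1).trans ((mul_one (1 : ℂ)).symm.trans
        (congrArg₂ (· * ·) (Mu.coord_mk _ _ 1).symm (Mu.coord_mk _ _ 1).symm)))

/-- The identification of `𝒟_α(K)` with a space of families of functions. -/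
def trivD (α : Breve (ΓK K)) : DK α ≃ₗ[ℂ] Lim K where
  toFun F := ⟨fun p => triv α p (F.1 p), fun p' p h₁ h₂ => (mem_transGraph_iff h₁ h₂).1 (F.2 p' p h₁ h₂)⟩
  map_add' F G := Subtype.ext <| funext fun p => map_add (triv α p) _ _
  map_smul' s F := Subtype.ext <| funext fun p => map_smul (triv α p) _ _
  invFun G := ⟨fun p => (triv α p).symm (G.1 p), fun p' p h₁ h₂ => (mem_transGraph_iff h₁ h₂).2 (by
    rw [LinearEquiv.apply_symm_apply, LinearEquiv.apply_symm_apply]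
    exact G.2 p' p h₁ h₂)⟩
  left_inv F := Subtype.ext <| funext fun p => (triv α p).symm_apply_apply _
  right_inv G := Subtype.ext <| funext fun p => (triv α p).apply_symm_apply _

/-- The action of an element of the Heisenberg group on `𝒟_α(K)`, for a lift `g` of the element of `Γ`. -/
def opD {g : Kˣ} {w : Heis α} (hw : ν g = w.pt) : DK α →ₗ[ℂ] DK α :=
  (trivD α).symm.toLinearMap ∘ₗ opLim hw ∘ₗ (trivD α).toLinearMap

theorem trivD_opD {g : Kˣ} {w : Heis α} (hw : ν g = w.pt) (F : DK α) :
    trivD α (opD hw F) = opLim hw (trivD α F) := (trivD α).apply_symm_apply _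

theorem opD_mul {g g' g'' : Kˣ} {w w' w'' : Heis α} (hw : ν g = w.pt) (hw' : ν g' = w'.pt)
    (hw'' : ν g'' = w''.pt) (hg : g'' = g * g') (h : w'' = w * w') (F : DK α) :
    opD hw'' F = opD hw (opD hw' F) := (trivD α).injective <| by
  rw [trivD_opD, trivD_opD, trivD_opD, opLim_mul hw hw' hw'' hg h]

theorem triv_actX (u : OUnits K) (p : Idx) (x : XK α p) : triv α p (actX α u p x) =
    Test.mul (u : Kˣ) (bot_mono p.2) (eq_unit_vadd u _) (eq_unit_vadd u _) (triv α p x) := by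
  rw [eq_tmul_triv x, actX_tmul, triv_tmul, triv_tmul, Mu.coord_mul, Mu.coord_mk, mul_one, one_smul,
    ν_eq_zero.2 u.2, modulus_zero, one_smul]

theorem opD_unit (u : OUnits K) (hu : ν (u : Kˣ) = (1 : Heis α).pt) (F : DK α) :
    opD hu F = repD α u F := (trivD α).injective <| Subtype.ext <| funext fun p => by
  rw [trivD_opD, opLim_apply hu _ (eq_unit_vadd u _) (eq_unit_vadd u _), scal_one, one_smul]
  exact (triv_actX u p (F.1 p)).symm

/-- A single tensor with coordinate one represents `F p`. Its image has coordinate `scal`, the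
product of the modulus of `g` and of the coordinate of `h⁻¹`. -/
theorem isHeisAct_opD {g : Kˣ} (h : Torsor α (ν g +ᵥ α)) :
    IsHeisAct (fun α β => (thetaK α β).toLinearMap) g h (opD (w := ⟨ν g, h⟩) rfl) := fun F p p' hn hm => by
  have e : triv α p' ((opD (w := ⟨ν g, h⟩) rfl F).1 p') = _ :=
    (congrArg (fun G : Lim K => G.1 p') (trivD_opD (g := g) (w := ⟨ν g, h⟩) rfl F)).trans
      (opLim_apply _ _ hn hm)
  have e1 : Mu.coord (bot p'.1.2) (ν g +ᵥ α) (Mu.mul g hm (rfl : ν g +ᵥ α = _) (Mu.mk (bot p.1.2) α 1)) =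
      modulus (ν g) (bot p.1.2) α :=
    (Mu.coord_mul g hm rfl _).trans ((congrArg (_ * ·) (Mu.coord_mk _ _ 1)).trans (mul_one _))
  have e2 : Mu.coord (ν g +ᵥ α) α (thetaK (ν g +ᵥ α) α (theta (qK K) h.inv)) =
      (qK K : ℂ) ^ (-h.1 (stdGood 0)) := coord_thetaK _
  refine Submodule.subset_span ⟨triv α p (F.1 p), Mu.mk _ _ 1, Mu.mk _ _ (scal ⟨ν g, h⟩ (bot p.1.2)),
    isMul_iff.2 ((Mu.coord_mk _ _ _).trans (congrArg₂ (· * ·) e1 e2).symm), ?_⟩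
  refine Prod.ext (eq_tmul_triv _) ((triv α p').injective (e.trans ?_))
  exact (congrArg (· • _) (Mu.coord_mk (bot p'.1.2) α _)).symm.trans (triv_tmul _ _).symm

/-- A lift of an element of `Γ`. -/
def lift (γ : ΓK K) : Kˣ := (ν_surjective γ).choose

theorem ν_lift (γ : ΓK K) : ν (lift γ) = γ := (ν_surjective γ).choose_spec

/-- Two lifts of the same element differ by a unit, whose operator is the given action of the units
and disappears in the coinvariants. -/
theorem mk_opD_congr {g g' : Kˣ} {w : Heis α} (hw : ν g = w.pt) (hw' : ν g' = w.pt) (F : DK α) :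
    Representation.Coinvariants.mk (repD α) (opD hw F) =
      Representation.Coinvariants.mk (repD α) (opD hw' F) := by
  have hu : g * g'⁻¹ ∈ OUnits K := ν_eq_zero.1 (by rw [ν_mul, ν_inv, hw, hw', add_neg_cancel])
  have h1 : ν ((⟨_, hu⟩ : OUnits K) : Kˣ) = (1 : Heis α).pt := ν_eq_zero.2 hu
  rw [opD_mul h1 hw' hw (inv_mul_cancel_right g g').symm (one_mul w).symm, opD_unit,
    Representation.Coinvariants.mk_self_apply]

theorem opD_repD {g : Kˣ} {w : Heis α} (hw : ν g = w.pt) (u : OUnits K) (F : DK α) :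
    opD hw (repD α u F) = repD α u (opD hw F) := by
  have h1 : ν (u : Kˣ) = (1 : Heis α).pt := ν_eq_zero.2 u.2
  have h2 : ν (g * (u : Kˣ)) = w.pt := by rw [ν_mul, hw, ν_eq_zero.2 u.2, add_zero]
  rw [← opD_unit u h1, ← opD_unit u h1, ← opD_mul hw h1 h2 rfl (mul_one w).symm,
    opD_mul h1 hw h2 (mul_comm _ _) (one_mul w).symm]

/-- The action of the Heisenberg group on the coinvariants of `𝒟_α(K)`. -/
def repCo (α : Breve (ΓK K)) : Representation ℂ (Heis α) (repD α).Coinvariants where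
  toFun w := Representation.Coinvariants.lift (repD α)
    (Representation.Coinvariants.mk (repD α) ∘ₗ opD (ν_lift w.pt)) fun u => LinearMap.ext fun F => by
      change Representation.Coinvariants.mk (repD α) (opD _ (repD α u F)) = _
      rw [opD_repD, Representation.Coinvariants.mk_self_apply]
      rfl
  map_one' := Representation.Coinvariants.hom_ext <| LinearMap.ext fun F => by
    change Representation.Coinvariants.mk (repD α) (opD (ν_lift (1 : Heis α).pt) F) = _
    have h : ν ((1 : OUnits K) : Kˣ) = (1 : Heis α).pt := ν_eq_zero.2 (1 : OUnits K).2
    refine (mk_opD_congr _ h F).trans ?_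
    rw [opD_unit, map_one]
    rfl
  map_mul' x y := Representation.Coinvariants.hom_ext <| LinearMap.ext fun F => by
    have h : ν (lift x.pt * lift y.pt) = (x * y).pt := by
      rw [ν_mul, ν_lift, ν_lift]
      rfl
    refine (mk_opD_congr (ν_lift _) h F).trans ?_
    rw [opD_mul (ν_lift x.pt) (ν_lift y.pt) h rfl rfl]
    rfl

theorem repCo_mk {g : Kˣ} {w : Heis α} (hw : ν g = w.pt) (F : DK α) :
    repCo α w (Representation.Coinvariants.mk (repD α) F) =
      Representation.Coinvariants.mk (repD α) (opD hw F) := mk_opD_congr _ _ _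

theorem isHeisRep_repCo : IsHeisRep (fun α β => (thetaK α β).toLinearMap) (repCo α) := fun _ h =>
  ⟨_, isHeisAct_opD h, repCo_mk (w := ⟨_, h⟩) rfl⟩

end Coordinates

end

end TwoDim

namespace TwoDim

noncomputable section

open _root_.TwoDim.Ext2 (emb lev)
open Breve


/-! ### Coordinates on the spaces on `Γ`. -/

section GammaCoordinates

variable {Γ : Type*} [AddCommGroup Γ] [Ext2 Γ] (r : ℂˣ) (α : Breve Γ)

/-- The element of `μ_r(α, β)` with value `1` on the standard set. -/
def oneR (α β : Breve Γ) : muR r α β := (evalR r α β (stdGood 0)).symm 1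

theorem oneR_apply (α β : Breve Γ) : (oneR r α β).1 (stdGood 0) = 1 :=
  (evalR r α β (stdGood 0)).apply_symm_apply 1

theorem eq_smul_oneR {α β : Breve Γ} (m : muR r α β) : m = m.1 (stdGood 0) • oneR r α β :=
  (evalR r α β (stdGood 0)).injective (by
    rw [map_smul]
    change m.1 _ = _ * (oneR r α β).1 (stdGood 0)
    rw [oneR_apply, mul_one])

theorem mulR_oneR (α β γ : Breve Γ) : mulR r α β γ (oneR r α β) (oneR r β γ) = oneR r α γ :=
  (evalR r α γ (stdGood 0)).injective (by
    change (oneR r α β).1 (stdGood 0) * (oneR r β γ).1 (stdGood 0) = (oneR r α γ).1 (stdGood 0)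
    rw [oneR_apply, oneR_apply, oneR_apply, mul_one])

/-- The standard element of `μ_r(k + 1, k)` as a functional. -/
def stdE (k : ℤ) : Module.Dual ℂ (DPlusT Γ k) := embR r k (oneR r (bot (k + 1)) (bot k))

/-- The identification of `𝒟₊(π⁻¹(k)) ⊗ μ_r(k + 1, α)` with `𝒟₊(π⁻¹(k))`. -/
def trivR (k : ℤ) : DPlusT Γ k ⊗[ℂ] muR r (bot (k + 1)) α ≃ₗ[ℂ] DPlusT Γ k :=
  ((evalR r (bot (k + 1)) α (stdGood 0)).lTensor (DPlusT Γ k)).trans (TensorProduct.rid ℂ _)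

variable {α}

theorem trivR_tmul {k : ℤ} (f : DPlusT Γ k) (m : muR r (bot (k + 1)) α) :
    trivR r α k (f ⊗ₜ m) = m.1 (stdGood 0) • f := rfl

theorem eq_tmul_trivR {k : ℤ} (z : DPlusT Γ k ⊗[ℂ] muR r (bot (k + 1)) α) :
    z = trivR r α k z ⊗ₜ oneR r _ _ :=
  (trivR r α k).injective (by rw [trivR_tmul, oneR_apply, one_smul])

theorem istar_apply {k : ℤ} (z : DPlusT Γ k ⊗[ℂ] muR r (bot (k + 1)) α) :
    istar r α k z = deltaInf Γ k (trivR r α k z) • oneR r _ _ := by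
  conv_lhs => rw [eq_tmul_trivR r z, istar_tmul]

theorem pistar_apply {k : ℤ} (z : DPlusT Γ k ⊗[ℂ] muR r (bot (k + 1)) α) :
    pistar r α k z = stdE r k (trivR r α k z) • oneR r _ _ := by
  conv_lhs => rw [eq_tmul_trivR r z, ← mulR_oneR r _ (bot k), pistar_tmul]
  rfl

/-- With the standard elements as bases, the condition that defines the space becomes an equation
between two numbers in each degree. -/
theorem mem_DPlus_iff {F : PreD r α} : F ∈ DPlus r α ↔
    ∀ k, deltaInf Γ k (trivR r α k (F k)) = stdE r (k + 1) (trivR r α (k + 1) (F (k + 1))) := by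
  refine forall_congr' fun k => ?_
  rw [istar_apply, pistar_apply]
  refine ⟨fun h => ?_, fun h => by rw [h]⟩
  have := congrFun (congrArg Subtype.val h) (stdGood 0)
  change _ * (oneR r _ α).1 _ = _ * (oneR r _ α).1 _ at this
  rwa [oneR_apply, mul_one, mul_one] at this

theorem shiftT_congr {β β' : Γ} (h : β = β') {k k' : ℤ} (hk : k' = lev β + k) (hk' : k' = lev β' + k) :
    shiftT β hk = shiftT β' hk' := by
  subst h
  rfl

instance : AddCommGroup (DPlus r α) := Module.addCommMonoidToAddCommGroup ℂ

end GammaCoordinates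

/-! ### The map `Φ`. -/

section Surjection

variable {K : Type*} [Field K] [TwoDimLocalField K] [PartialTopology K] {α : Breve (ΓK K)}

theorem stdE_avg {k : ℤ} (f : Test (bot k : Breve (ΓK K)) (bot (k + 1))) :
    stdE (qK K) k (avg k f) = (frameMeas (bot_le_bot_succ k)).1 f := by
  rw [stdE, embR_avg, oneR_apply, one_mul]

/-- The translated standard element contributes the modulus and `h⁻¹` contributes a power of `q`.
The result is the scalar of `opLim`, which is the reason for equivariance. -/
theorem trivR_actAt (w : Heis α) {k k' : ℤ} (hk : k' = lev w.pt + k)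
    (z : DPlusT (ΓK K) k ⊗[ℂ] muR (qK K) (bot (k + 1)) α) :
    trivR (qK K) α k' (actAt (qK K) w hk z) =
      scal w (bot (k + 1)) • shiftT w.pt hk (trivR (qK K) α k z) := by
  conv_lhs => rw [eq_tmul_trivR (qK K) z, actAt_tmul, trivR_tmul]
  refine congrArg (· • _) ?_
  change (oneR (qK K) (bot (k + 1)) α).1 ((stdGood 0).shift (-w.pt)) *
    (qK K : ℂ) ^ (-w.tor.1 (stdGood 0)) = _
  rw [muR_prop _ (stdGood 0), oneR_apply, mul_one]
  rfl

/-- The component in `𝒟(𝒪(k) / 𝒪(k + 1))`. -/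
def succ (k : ℤ) : Lim K →ₗ[ℂ] Test (bot k : Breve (ΓK K)) (bot (k + 1)) where
  toFun G := G.1 (succIdx k)
  map_add' _ _ := rfl
  map_smul' _ _ := rfl

/-- Both components come from the component on `𝒪(k) / 𝒪(k + 2)`, one by integration and the other
by restriction. -/
theorem succ_apply_zero (G : Lim K) (k : ℤ) : (succ k G).1 0 =
    (frameMeas (bot_le_bot_succ (k + 1))).1 (succ (k + 1) G) := by
  let p : Idx := ⟨(k, k + 1 + 1), (by omega : k ≤ k + 1 + 1)⟩
  have e1 := G.2 p (succIdx k) le_rfl (lt_add_one (k + 1)).le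
  have e2 := G.2 p (succIdx (k + 1)) (lt_add_one k).le le_rfl
  exact (congrArg (fun f : TestI K _ => f.1 0) e1).trans
    ((tr_apply_zero _ _ _).trans (congrArg (frameMeas (bot_le_bot_succ (k + 1))).1 e2.symm))

/-- The mean values of an element of `𝒟_α(K)`. -/
def surD (α : Breve (ΓK K)) : DK α →ₗ[ℂ] DPlus (qK K) α :=
  LinearMap.codRestrict _ (LinearMap.pi fun k => (trivR (qK K) α k).symm.toLinearMap ∘ₗ avg k ∘ₗ
    succ k ∘ₗ (trivD α).toLinearMap) fun F => (mem_DPlus_iff _).2 fun k => by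
      change deltaInf _ k (trivR (qK K) α k ((trivR (qK K) α k).symm (avg k (succ k (trivD α F))))) =
        stdE (qK K) (k + 1) (trivR (qK K) α (k + 1)
          ((trivR (qK K) α (k + 1)).symm (avg (k + 1) (succ (k + 1) (trivD α F)))))
      rw [LinearEquiv.apply_symm_apply, LinearEquiv.apply_symm_apply, deltaInf_avg, stdE_avg,
        succ_apply_zero]

theorem trivR_surD (F : DK α) (k : ℤ) :
    trivR (qK K) α k ((surD α F).1 k) = avg k (succ k (trivD α F)) :=
  (trivR (qK K) α k).apply_symm_apply _

theorem DPlus.ext {x y : DPlus (qK K) α} (h : ∀ k, trivR (qK K) α k (x.1 k) = trivR (qK K) α k (y.1 k)) :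
    x = y := Subtype.ext <| funext fun k => (trivR (qK K) α k).injective (h k)

theorem exists_lim_avg {c : ∀ k : ℤ, DPlusT (ΓK K) k}
    (hc : ∀ k, deltaInf _ k (c k) = stdE (qK K) (k + 1) (c (k + 1))) :
    ∃ G : Lim K, ∀ k, avg k (succ k G) = c k := by
  choose f hf using fun k => avg_surjective (K := K) k (c k)
  -- Under the mean value map the condition on `c` turns into the gluing condition, for any choice
  -- of the preimages.
  obtain ⟨G, hG⟩ := exists_lim (f := f) fun k => by rw [← stdE_avg, hf, ← hc, ← hf, deltaInf_avg]
  exact ⟨G, fun k => (congrArg (avg k) (hG k)).trans (hf k)⟩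

theorem surD_surjective : Function.Surjective (surD α) := fun x => by
  obtain ⟨G, hG⟩ := exists_lim_avg ((mem_DPlus_iff _).1 x.2)
  refine ⟨(trivD α).symm G, DPlus.ext fun k => ?_⟩
  rw [trivR_surD, LinearEquiv.apply_symm_apply, hG]

theorem surD_opD {g : Kˣ} {w : Heis α} (hw : ν g = w.pt) (F : DK α) :
    surD α (opD hw F) = repPlus (qK K) α w (surD α F) := DPlus.ext fun k' => by
  obtain ⟨k, hk⟩ : ∃ k, k' = lev (ν g) + k := ⟨k' - lev (ν g), by ring⟩
  have h₀ : (bot k' : Breve (ΓK K)) = ν g +ᵥ bot k := by rw [vadd_bot, hk]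
  have h₁ : (bot (k' + 1) : Breve (ΓK K)) = ν g +ᵥ bot (k + 1) := by rw [vadd_bot, hk, add_assoc]
  have hk' : k' = lev w.pt + k := by rw [← hw, hk]
  have e : (repPlus (qK K) α w (surD α F)).1 k' = actAt (qK K) w hk' ((surD α F).1 k) :=
    actPre_apply (qK K) w (surD α F).1 hk'
  have e' : succ k' (opLim hw (trivD α F)) =
      scal w (bot (k + 1)) • Test.mul g (bot_le_bot_succ k) h₀ h₁ (succ k (trivD α F)) :=
    opLim_apply hw _ (p := succIdx k) (p' := succIdx k') h₀ h₁
  rw [e, trivR_actAt, trivR_surD, trivR_surD, trivD_opD, e', map_smul, avg_mul g hk, shiftT_congr hw hk hk']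

/-- A unit is a lift of the identity of the Heisenberg group, so this is a case of equivariance. -/
theorem surD_repD (u : OUnits K) (F : DK α) : surD α (repD α u F) = surD α F := by
  rw [← opD_unit u (ν_eq_zero.2 u.2), surD_opD, map_one]
  rfl

/-- The natural surjection `Φ`. -/
def sur (α : Breve (ΓK K)) : (repD α).Coinvariants →ₗ[ℂ] DPlus (qK K) α :=
  Representation.Coinvariants.lift (W := DPlus (qK K) α) (repD α) (surD α) fun u => LinearMap.ext fun F => surD_repD u F

theorem sur_surjective : Function.Surjective (sur α) := fun x =>
  (surD_surjective x).imp' (Representation.Coinvariants.mk (repD α)) fun _ h => h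

theorem sur_repCo (w : Heis α) (x : (repD α).Coinvariants) :
    sur α (repCo α w x) = repPlus (qK K) α w (sur α x) := by
  obtain ⟨F, rfl⟩ := Representation.Coinvariants.mk_surjective (repD α) x
  exact surD_opD (ν_lift w.pt) F

theorem isSur_sur : IsSur (fun α β => (thetaK α β).toLinearMap) (sur α) := fun F k => by
  have e : Mu.coord (bot (k + 1)) α (thetaK (bot (k + 1)) α (oneR (qK K) _ _)) = 1 :=
    (coord_thetaK _).trans (oneR_apply _ _ _)
  have e1 : F.1 (succIdx k) =
      XK.tmul (p := succIdx k) (succ k (trivD α F)) (thetaK (bot (k + 1)) α (oneR (qK K) _ _)) :=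
    (triv α (succIdx k)).injective ((one_smul ℂ (succ k (trivD α F))).symm.trans
      ((congrArg (· • succ k (trivD α F)) e.symm).trans
        (triv_tmul (p := succIdx k) (succ k (trivD α F)) (thetaK (bot (k + 1)) α _)).symm))
  have e2 : (surD α F).1 k = avg k (succ k (trivD α F)) ⊗ₜ oneR (qK K) _ _ := by
    rw [← trivR_surD, ← eq_tmul_trivR]
  exact Submodule.subset_span ⟨_, _, oneR (qK K) _ _, isAvg_avg _, Prod.ext e1 e2⟩

end Surjection

end

end TwoDim

namespace TwoDim

noncomputable section

open _root_.TwoDim.Ext2 (emb lev)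
open Breve


/-! ### The space `𝒟'_α(K)` in coordinates, and the action on invariants. -/

section DualCoordinates

open scoped DirectSum

variable {K : Type*} [Field K] [TwoDimLocalField K] [PartialTopology K] {α : Breve (ΓK K)}

/-- The identification of `𝒟'(𝒪(n) / 𝒪(m)) ⊗ μ(α, m)` with `𝒟'(𝒪(n) / 𝒪(m))`. -/
def triv' (α : Breve (ΓK K)) (p : Idx) : XK' α p ≃ₗ[ℂ] Module.Dual ℂ (TestI K p) :=
  ((Mu.coord α (bot p.1.2)).lTensor (Module.Dual ℂ (TestI K p))).trans (TensorProduct.rid ℂ _)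

theorem triv'_tmul {p : Idx} (v : Module.Dual ℂ (TestI K p)) (l : Mu α (bot p.1.2)) :
    triv' α p (XK'.tmul v l) = Mu.coord α (bot p.1.2) l • v := rfl

theorem triv'_tmul_mk {p : Idx} (v : Module.Dual ℂ (TestI K p)) :
    triv' α p (XK'.tmul v (Mu.mk _ _ 1)) = v :=
  (triv'_tmul v _).trans ((congrArg (· • v) (Mu.coord_mk _ _ 1)).trans (one_smul ℂ v))

/-- The map from the distributions on `𝒪(n) / 𝒪(m)` to `𝒟'_α(K)`. -/
def ι (α : Breve (ΓK K)) (p : Idx) : Module.Dual ℂ (TestI K p) →ₗ[ℂ] DK' α :=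
  toDK' α p ∘ₗ (triv' α p).symm.toLinearMap

theorem ι_triv' {p : Idx} (x : XK' α p) : ι α p (triv' α p x) = toDK' α p x :=
  congrArg (toDK' α p) ((triv' α p).symm_apply_apply x)

theorem ι_eq {p : Idx} (v : Module.Dual ℂ (TestI K p)) :
    ι α p v = toDK' α p (XK'.tmul v (Mu.mk _ _ 1)) := by
  rw [← ι_triv', triv'_tmul_mk]

theorem toDK'_tmul {p : Idx} (v : Module.Dual ℂ (TestI K p)) (l : Mu α (bot p.1.2)) :
    toDK' α p (XK'.tmul v l) = Mu.coord α (bot p.1.2) l • ι α p v :=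
  (ι_triv' _).symm.trans ((congrArg (ι α p) (triv'_tmul v l)).trans (map_smul _ _ _))

theorem ι_tr {p' p : Idx} (h₁ : p'.1.1 ≤ p.1.1) (h₂ : p.1.2 ≤ p'.1.2) (v : Module.Dual ℂ (TestI K p)) :
    ι α p v = ι α p' (v ∘ₗ tr (bot_mono h₁) (bot_mono p.2) (bot_mono h₂)) := by
  rw [ι_eq, ι_eq]
  refine (Submodule.Quotient.eq _).2 (relDK'_mem h₁ h₂ (s := frameMeas (bot_mono h₂)) (x := Mu.mk _ _ 1)
    (fun f => ⟨_, (isDirectImage_iff (bot_mono h₁) (bot_mono p.2) (bot_mono h₂)).2 rfl, rfl⟩) ?_ ?_)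
  · exact (isMeas_iff (bot_mono h₂)).2 ((Mu.coord_mk _ _ 1).trans (Meas.coef_frame (bot_mono h₂)).symm)
  · exact isMul_iff.2 ((Mu.coord_mk _ _ 1).trans ((mul_one (1 : ℂ)).symm.trans
        (congrArg₂ (· * ·) (Mu.coord_mk _ _ 1).symm (Mu.coord_mk _ _ 1).symm)))

theorem DK'.hom_ext {V : Type*} [AddCommGroup V] [Module ℂ V] {A B : DK' α →ₗ[ℂ] V}
    (h : ∀ p v, A (ι α p v) = B (ι α p v)) : A = B :=
  Submodule.linearMap_qext _ <| DirectSum.linearMap_ext _ fun p => LinearMap.ext fun x =>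
    ((congrArg A (ι_triv' x)).symm.trans (h p _)).trans (congrArg B (ι_triv' x))

/-- The generating relations of the inductive limit become composition with `tr`. This lets maps out
of the limit be defined by families compatible with `tr`. -/
theorem triv'_eq_comp_tr {p' p : Idx} (h₁ : p'.1.1 ≤ p.1.1) (h₂ : p.1.2 ≤ p'.1.2)
    {v : Module.Dual ℂ (TestI K p)} {v' : Module.Dual ℂ (TestI K p')}
    {s : Meas (bot p.1.2 : Breve (ΓK K)) (bot p'.1.2)} {x : Mu (bot p'.1.2) (bot p.1.2)}
    {l : Mu α (bot p.1.2)} {l' : Mu α (bot p'.1.2)} (hv : IsDualImage s v v') (hs : IsMeas s x)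
    (hl : IsMul l' x l) : triv' α p' (XK'.tmul v' l') =
      triv' α p (XK'.tmul v l) ∘ₗ tr (bot_mono h₁) (bot_mono p.2) (bot_mono h₂) := by
  have e1 := (isMul_iff.1 hl).trans (congrArg (_ * ·) ((isMeas_iff (bot_mono h₂)).1 hs))
  have e2 : v' = Meas.coef (bot_mono h₂) s • v ∘ₗ tr (bot_mono h₁) (bot_mono p.2) (bot_mono h₂) :=
    LinearMap.ext fun f => by
      obtain ⟨f', hf, e⟩ := hv f
      have h := (isDirectImage_iff (bot_mono h₁) (bot_mono p.2) (bot_mono h₂)).1 hf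
      rw [e, h, dirIm_eq_smul_tr, map_smul]
      rfl
  exact (triv'_tmul v' l').trans ((congrArg (Mu.coord α (bot p'.1.2) l' • ·) e2).trans
    ((smul_smul _ _ _).trans (congrArg (· • v ∘ₗ tr _ _ _) e1.symm)))

/-- A linear map on `𝒟'_α(K)` is given by a compatible family of maps. -/
def liftDK' (α : Breve (ΓK K)) {V : Type*} [AddCommGroup V] [Module ℂ V]
    (φ : ∀ p : Idx, Module.Dual ℂ (TestI K p) →ₗ[ℂ] V)
    (hφ : ∀ (p' p : Idx) (h₁ : p'.1.1 ≤ p.1.1) (h₂ : p.1.2 ≤ p'.1.2) (v : Module.Dual ℂ (TestI K p)),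
      φ p v = φ p' (v ∘ₗ tr (bot_mono h₁) (bot_mono p.2) (bot_mono h₂))) : DK' α →ₗ[ℂ] V :=
  (relDK' α).liftQ (DirectSum.toModule ℂ Idx V fun p => φ p ∘ₗ (triv' α p).toLinearMap) <| by
    refine Submodule.span_le.2 ?_
    rintro _ ⟨p', p, h₁, h₂, v, v', s, x, l, l', hv, hs, hl, rfl⟩
    refine LinearMap.mem_ker.2 ((map_sub _ _ _).trans (sub_eq_zero.2 ?_))
    refine (DirectSum.toModule_lof ..).trans (Eq.trans ?_ (DirectSum.toModule_lof ..).symm)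
    exact (hφ p' p h₁ h₂ _).trans (congrArg (φ p') (triv'_eq_comp_tr h₁ h₂ hv hs hl).symm)

theorem liftDK'_ι {V : Type*} [AddCommGroup V] [Module ℂ V]
    (φ : ∀ p : Idx, Module.Dual ℂ (TestI K p) →ₗ[ℂ] V) (hφ) (p : Idx) (v : Module.Dual ℂ (TestI K p)) :
    liftDK' α φ hφ (ι α p v) = φ p v :=
  (DirectSum.toModule_lof ℂ (φ := fun p => φ p ∘ₗ (triv' α p).toLinearMap) p ((triv' α p).symm v)).trans
    (congrArg (φ p) ((triv' α p).apply_symm_apply v))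

/-- The pair `(d + n, d + m)`. -/
def addIdx (d : ℤ) (p : Idx) : Idx := ⟨(d + p.1.1, d + p.1.2), add_le_add_right p.2 d⟩

theorem addIdx_fst_le {p' p : Idx} (h : p'.1.1 ≤ p.1.1) (d : ℤ) : (addIdx d p').1.1 ≤ (addIdx d p).1.1 :=
  add_le_add_right h d

theorem addIdx_snd_le {p' p : Idx} (h : p.1.2 ≤ p'.1.2) (d : ℤ) : (addIdx d p).1.2 ≤ (addIdx d p').1.2 :=
  add_le_add_right h d

theorem eq_addIdx {γ : ΓK K} {p p' : Idx} (hn : (bot p'.1.1 : Breve (ΓK K)) = γ +ᵥ bot p.1.1)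
    (hm : (bot p'.1.2 : Breve (ΓK K)) = γ +ᵥ bot p.1.2) : p' = addIdx (lev γ) p := by
  rw [vadd_bot] at hn hm
  injection hn with hn
  injection hm with hm
  exact Subtype.ext (Prod.ext hn hm)

/-- The transpose of `tr_mul`. -/
theorem dualMul_tr (g : Kˣ) {a' a b c e' e d i : Breve (ΓK K)} (h₁ : a' ≤ a) (h₂ : a ≤ b) (h₃ : b ≤ c)
    (h₁' : e' ≤ e) (h₂' : e ≤ d) (h₃' : d ≤ i)
    (ha' : e' = ν g +ᵥ a') (ha : e = ν g +ᵥ a) (hb : d = ν g +ᵥ b) (hc : i = ν g +ᵥ c)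
    (v : Module.Dual ℂ (Test a b)) :
    dualMul g (h₁.trans (h₂.trans h₃)) ha' hc (v ∘ₗ tr h₁ h₂ h₃) =
      modulus (ν g) c b • dualMul g h₂ ha hb v ∘ₗ tr h₁' h₂' h₃' := LinearMap.ext fun f => by
  have e := tr_mul g h₁ h₂ h₃ h₁' h₂' h₃' ha' ha hb hc (Test.mul g⁻¹ (h₁'.trans (h₂'.trans h₃'))
    (eq_vadd_inv ha') (eq_vadd_inv hc) f)
  rw [Test.mul_mul_inv] at e
  have e' := congrArg (Test.mul g⁻¹ h₂' (eq_vadd_inv ha) (eq_vadd_inv hb)) e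
  rw [Test.inv_mul_mul, map_smul] at e'
  exact (congrArg v e'.symm).trans (map_smul v _ _)

/-- The action of `g` on distributions, with values in the distributions on the translated quotient. -/
def dualIdx (g : Kˣ) (p : Idx) :
    Module.Dual ℂ (TestI K p) →ₗ[ℂ] Module.Dual ℂ (TestI K (addIdx (lev (ν g)) p)) :=
  dualMul g (bot_mono p.2) (vadd_bot _ _).symm (vadd_bot _ _).symm

theorem dualIdx_tr (g : Kˣ) {p' p : Idx} (h₁ : p'.1.1 ≤ p.1.1) (h₂ : p.1.2 ≤ p'.1.2)
    (v : Module.Dual ℂ (TestI K p)) :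
    dualIdx g p' (v ∘ₗ tr (bot_mono h₁) (bot_mono p.2) (bot_mono h₂)) =
      modulus (ν g) (bot p'.1.2) (bot p.1.2) • (dualIdx g p v ∘ₗ tr (bot_mono (addIdx_fst_le h₁ _))
        (bot_mono (addIdx (lev (ν g)) p).2) (bot_mono (addIdx_snd_le h₂ _))) :=
  dualMul_tr g _ _ _ _ _ _ _ _ _ _ v

/-- The action of an element of the Heisenberg group on `𝒟'_α(K)`, for a lift `g` of the element of `Γ`. -/
def opD' {g : Kˣ} {w : Heis α} (hw : ν g = w.pt) : DK' α →ₗ[ℂ] DK' α :=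
  liftDK' α (fun p => (scal w (bot p.1.2))⁻¹ • ι α (addIdx (lev (ν g)) p) ∘ₗ dualIdx g p)
    fun p' p h₁ h₂ v => by
      change (scal w (bot p.1.2))⁻¹ • ι α (addIdx (lev (ν g)) p) (dualIdx g p v) =
        (scal w (bot p'.1.2))⁻¹ • ι α (addIdx (lev (ν g)) p') (dualIdx g p' _)
      -- The distributions carry the inverse scalar, so the modulus of the transition map cancels
      -- against the quotient of two values of `scal`.
      rw [ι_tr (p' := addIdx (lev (ν g)) p') (addIdx_fst_le h₁ _) (addIdx_snd_le h₂ _),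
        dualIdx_tr g h₁ h₂, map_smul, smul_smul, ← modulus_mul_scal w (bot p'.1.2) (bot p.1.2), ← hw, mul_inv,
        mul_comm, mul_inv_cancel_left₀ (modulus_ne_zero _ _ _)]

theorem opD'_ι {g : Kˣ} {w : Heis α} (hw : ν g = w.pt) {p p' : Idx}
    (hn : (bot p'.1.1 : Breve (ΓK K)) = ν g +ᵥ bot p.1.1)
    (hm : (bot p'.1.2 : Breve (ΓK K)) = ν g +ᵥ bot p.1.2) (v : Module.Dual ℂ (TestI K p)) :
    opD' hw (ι α p v) = (scal w (bot p.1.2))⁻¹ • ι α p' (dualMul g (bot_mono p.2) hn hm v) := by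
  obtain rfl := eq_addIdx hn hm
  exact liftDK'_ι _ _ _ _

theorem opD'_mul {g g' g'' : Kˣ} {w w' w'' : Heis α} (hw : ν g = w.pt) (hw' : ν g' = w'.pt)
    (hw'' : ν g'' = w''.pt) (hg : g'' = g * g') (h : w'' = w * w') (x : DK' α) :
    opD' hw'' x = opD' hw (opD' hw' x) := by
  subst hg h
  have e : ∀ n : ℤ, (bot (lev (ν g) + (lev (ν g') + n)) : Breve (ΓK K)) = ν (g * g') +ᵥ bot n := fun n => by
    rw [ν_mul, add_vadd, vadd_bot, vadd_bot]
  refine LinearMap.congr_fun (DK'.hom_ext (A := opD' hw'') (B := opD' hw ∘ₗ opD' hw') fun p v => ?_) x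
  rw [LinearMap.comp_apply, opD'_ι hw' (p' := addIdx (lev (ν g')) p) (vadd_bot _ _).symm (vadd_bot _ _).symm,
    map_smul, opD'_ι hw (p' := addIdx (lev (ν g)) (addIdx (lev (ν g')) p)) (vadd_bot _ _).symm
      (vadd_bot _ _).symm, opD'_ι hw'' (p' := addIdx (lev (ν g)) (addIdx (lev (ν g')) p)) (e _) (e _),
    smul_smul]
  refine congrArg₂ (· • ·) ?_ (congrArg (ι α _) (LinearMap.ext fun f => congrArg v ?_))
  · rw [scal_mul, mul_inv, mul_comm, ← hw', vadd_bot]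
    rfl
  · refine Subtype.ext <| funext fun x => ?_
    rw [Test.mul_apply, Test.mul_apply, Test.mul_apply, inv_inv, inv_inv, inv_inv, Units.val_mul, mul_assoc]

theorem triv'_actX' (u : OUnits K) (p : Idx) (v : Module.Dual ℂ (TestI K p)) :
    triv' α p (actX' α u p (XK'.tmul v (Mu.mk _ _ 1))) =
    dualMul (u : Kˣ) (bot_mono p.2) (eq_unit_vadd u _) (eq_unit_vadd u _) v := by
  rw [actX'_tmul, triv'_tmul, Mu.coord_mul, Mu.coord_mk, mul_one, ν_eq_zero.2 u.2, modulus_zero, one_smul]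

theorem opD'_unit (u : OUnits K) (hu : ν (u : Kˣ) = (1 : Heis α).pt) (x : DK' α) :
    opD' hu x = repD' α u x := by
  refine LinearMap.congr_fun (DK'.hom_ext (A := opD' hu) (B := repD' α u) fun p v => ?_) x
  rw [opD'_ι hu (eq_unit_vadd u _) (eq_unit_vadd u _), scal_one, inv_one, one_smul, ι_eq v, ← triv'_actX' (α := α),
    ι_triv']
  exact congrArg (relDK' α).mkQ (actPreDK'_of α u p _).symm

theorem isHeisAct'_opD' {g : Kˣ} (h : Torsor α (ν g +ᵥ α)) :
    IsHeisAct' (fun α β => (thetaK α β).toLinearMap) g h (opD' (w := ⟨ν g, h⟩) rfl) := fun p p' hn hm v l => by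
  have e1 : Mu.coord (ν g +ᵥ α) (bot p'.1.2) (Mu.mul g rfl hm l) =
      modulus (ν g) α (bot p.1.2) * Mu.coord α (bot p.1.2) l := Mu.coord_mul g rfl hm _
  have e2 : Mu.coord α (ν g +ᵥ α) (thetaK α (ν g +ᵥ α) (theta (qK K) h)) =
      (qK K : ℂ) ^ h.1 (stdGood 0) := coord_thetaK _
  -- Here `h` itself acts and the line is `μ(α, m)` in place of `μ(m, α)`; both changes invert the
  -- scalar.
  have e3 : (scal ⟨ν g, h⟩ (bot p.1.2))⁻¹ = (qK K : ℂ) ^ h.1 (stdGood 0) * modulus (ν g) α (bot p.1.2) := by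
    refine inv_eq_of_mul_eq_one_left ?_
    have h1 : modulus (ν g) α (bot p.1.2) * modulus (ν g) (bot p.1.2) α = 1 := by
      rw [modulus_mul, modulus_self]
    change _ * (modulus (ν g) (bot p.1.2) α * (qK K : ℂ) ^ (-h.1 (stdGood 0))) = 1
    rw [mul_assoc, ← mul_assoc (modulus _ _ _), h1, one_mul, ← zpow_add₀ (qK K).ne_zero, add_neg_cancel,
      zpow_zero]
  obtain ⟨τ, hτ⟩ := exists_isMul (thetaK α (ν g +ᵥ α) (theta (qK K) h)) (Mu.mul g rfl hm l)
  refine ⟨τ, hτ, ?_⟩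
  have e4 := (isMul_iff.1 hτ).trans (congrArg₂ (· * ·) e2 e1)
  have e7 : Mu.coord α (bot p.1.2) l * (scal ⟨ν g, h⟩ (bot p.1.2))⁻¹ = Mu.coord α (bot p'.1.2) τ :=
    (congrArg (_ * ·) e3).trans
      (((by intros; ring : ∀ a b c : ℂ, c * (a * b) = a * (b * c)) _ _ _).trans e4.symm)
  exact (congrArg (opD' (w := ⟨ν g, h⟩) rfl) (toDK'_tmul v l)).trans ((map_smul _ _ _).trans
    ((congrArg (_ • ·) (opD'_ι _ hn hm v)).trans ((smul_smul _ _ _).trans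
      ((congrArg (· • ι α p' _) e7).trans (toDK'_tmul _ τ).symm))))

theorem opD'_repD' {g : Kˣ} {w : Heis α} (hw : ν g = w.pt) (u : OUnits K) (x : DK' α) :
    opD' hw (repD' α u x) = repD' α u (opD' hw x) := by
  have h1 : ν (u : Kˣ) = (1 : Heis α).pt := ν_eq_zero.2 u.2
  have h2 : ν (g * (u : Kˣ)) = w.pt := by rw [ν_mul, hw, ν_eq_zero.2 u.2, add_zero]
  rw [← opD'_unit u h1, ← opD'_unit u h1, ← opD'_mul hw h1 h2 rfl (mul_one w).symm,
    opD'_mul h1 hw h2 (mul_comm _ _) (one_mul w).symm]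

theorem opD'_mem {g : Kˣ} {w : Heis α} (hw : ν g = w.pt) {x : DK' α} (hx : x ∈ (repD' α).invariants) :
    opD' hw x ∈ (repD' α).invariants := fun u => by
  rw [← opD'_repD', hx u]

/-- Two lifts differ by a unit, which fixes the invariant vectors, and the operators preserve
invariance. -/
theorem opD'_congr {g g' : Kˣ} {w : Heis α} (hw : ν g = w.pt) (hw' : ν g' = w.pt) {x : DK' α}
    (hx : x ∈ (repD' α).invariants) : opD' hw x = opD' hw' x := by
  have hu : g * g'⁻¹ ∈ OUnits K := ν_eq_zero.1 (by rw [ν_mul, ν_inv, hw, hw', add_neg_cancel])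
  have h1 : ν ((⟨_, hu⟩ : OUnits K) : Kˣ) = (1 : Heis α).pt := ν_eq_zero.2 hu
  rw [opD'_mul h1 hw' hw (inv_mul_cancel_right g g').symm (one_mul w).symm, opD'_unit, opD'_mem hw' hx]

/-- The action of the Heisenberg group on the invariants of `𝒟'_α(K)`. -/
def repInv (α : Breve (ΓK K)) : Representation ℂ (Heis α) (repD' α).invariants where
  toFun w := (opD' (ν_lift w.pt)).restrict fun _ => opD'_mem _
  map_one' := LinearMap.ext fun x => Subtype.ext <| by
    have h : ν ((1 : OUnits K) : Kˣ) = (1 : Heis α).pt := ν_eq_zero.2 (1 : OUnits K).2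
    refine (opD'_congr (ν_lift _) h x.2).trans ?_
    rw [opD'_unit, map_one]
    rfl
  map_mul' x y := LinearMap.ext fun z => Subtype.ext <| by
    have h : ν (lift x.pt * lift y.pt) = (x * y).pt := by
      rw [ν_mul, ν_lift, ν_lift]
      rfl
    refine (opD'_congr (ν_lift _) h z.2).trans ?_
    rw [opD'_mul (ν_lift x.pt) (ν_lift y.pt) h rfl rfl]
    rfl

theorem repInv_apply {g : Kˣ} {w : Heis α} (hw : ν g = w.pt) (x : (repD' α).invariants) :
    (repInv α w x : DK' α) = opD' hw x := opD'_congr (ν_lift w.pt) hw x.2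

theorem isHeisRep'_repInv : IsHeisRep' (fun α β => (thetaK α β).toLinearMap) (repInv α) := fun _ h =>
  ⟨_, isHeisAct'_opD' h, repInv_apply (w := ⟨_, h⟩) rfl⟩

end DualCoordinates

end

end TwoDim

namespace TwoDim

noncomputable section

open _root_.TwoDim.Ext2 (emb lev)
open Breve


/-! ### The map `Φ'`. -/

section Injection

open scoped DirectSum

variable {K : Type*} [Field K] [TwoDimLocalField K] [PartialTopology K] {α : Breve (ΓK K)}

/-- The map from the distributions on `π⁻¹(k)` to `𝒟'_{+, α, q}(Γ_K)`. -/
def ιR (α : Breve (ΓK K)) (k : ℤ) : Module.Dual ℂ (DPlusT (ΓK K) k) →ₗ[ℂ] DPlus' (qK K) α :=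
  (relD' (qK K) α).mkQ ∘ₗ ofDeg (qK K) α k ∘ₗ
    (TensorProduct.mk ℂ _ (muR (qK K) α (bot (k + 1)))).flip (oneR (qK K) _ _)

theorem mkQ_ofDeg_tmul (k : ℤ) (h : Module.Dual ℂ (DPlusT (ΓK K) k)) (l : muR (qK K) α (bot (k + 1))) :
    (relD' (qK K) α).mkQ (ofDeg (qK K) α k (h ⊗ₜ l)) = l.1 (stdGood 0) • ιR α k h := by
  conv_lhs => rw [eq_smul_oneR (qK K) l, TensorProduct.tmul_smul, map_smul, map_smul]
  rfl

theorem ιR_deltaInf (k : ℤ) : ιR α k (deltaInf _ k) = ιR α (k + 1) (stdE (qK K) (k + 1)) :=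
  (Submodule.Quotient.eq _).2 (Submodule.subset_span ⟨k, oneR _ _ _, oneR _ _ _, by rw [mulR_oneR]; rfl⟩)

theorem DPlus'.hom_ext {V : Type*} [AddCommGroup V] [Module ℂ V] {A B : DPlus' (qK K) α →ₗ[ℂ] V}
    (h : ∀ k v, A (ιR α k v) = B (ιR α k v)) : A = B :=
  Submodule.linearMap_qext _ <| DirectSum.linearMap_ext _ fun k => TensorProduct.ext' fun v l => by
    have e := mkQ_ofDeg_tmul (α := α) k v l
    refine (congrArg A e).trans (Eq.trans ?_ (congrArg B e).symm)
    rw [map_smul, map_smul, h]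

/-- A linear map on `𝒟'_{+, α, q}(Γ_K)` is given by a compatible family of maps. -/
def liftDPlus' (α : Breve (ΓK K)) {V : Type*} [AddCommGroup V] [Module ℂ V]
    (φ : ∀ k : ℤ, Module.Dual ℂ (DPlusT (ΓK K) k) →ₗ[ℂ] V)
    (hφ : ∀ k, φ k (deltaInf _ k) = φ (k + 1) (stdE (qK K) (k + 1))) : DPlus' (qK K) α →ₗ[ℂ] V :=
  (relD' (qK K) α).liftQ (DirectSum.toModule ℂ ℤ V fun k => φ k ∘ₗ (TensorProduct.rid ℂ _).toLinearMap ∘ₗ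
    (evalR (qK K) α (bot (k + 1)) (stdGood 0)).toLinearMap.lTensor _) <| by
    refine Submodule.span_le.2 ?_
    rintro _ ⟨k, l, η, rfl⟩
    refine LinearMap.mem_ker.2 ((map_sub _ _ _).trans (sub_eq_zero.2 ?_))
    refine (DirectSum.toModule_lof ..).trans (Eq.trans ?_ (DirectSum.toModule_lof ..).symm)
    change φ k ((l.1 (stdGood 0) * η.1 (stdGood 0)) • deltaInf _ k) =
      φ (k + 1) (l.1 (stdGood 0) • embR (qK K) (k + 1) η)
    have e : embR (qK K) (k + 1) η = η.1 (stdGood 0) • stdE (qK K) (k + 1) := by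
      conv_lhs => rw [eq_smul_oneR (qK K) η, map_smul]
      rfl
    rw [e, map_smul, map_smul, map_smul, hφ, smul_smul]

theorem liftDPlus'_ιR {V : Type*} [AddCommGroup V] [Module ℂ V]
    (φ : ∀ k : ℤ, Module.Dual ℂ (DPlusT (ΓK K) k) →ₗ[ℂ] V) (hφ) (k : ℤ)
    (h : Module.Dual ℂ (DPlusT (ΓK K) k)) : liftDPlus' α φ hφ (ιR α k h) = φ k h := by
  refine (DirectSum.toModule_lof ℂ (φ := fun k => φ k ∘ₗ (TensorProduct.rid ℂ _).toLinearMap ∘ₗ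
    (evalR (qK K) α (bot (k + 1)) (stdGood 0)).toLinearMap.lTensor (Module.Dual ℂ (DPlusT (ΓK K) k))) k
      (h ⊗ₜ oneR (qK K) _ _)).trans (congrArg (φ k) ?_)
  change (oneR (qK K) α (bot (k + 1))).1 (stdGood 0) • h = h
  rw [oneR_apply, one_smul]

/-- Dual to `succ_apply_zero`: on `𝒪(k) / 𝒪(k + 2)` both distributions are the integral over `𝒪(k +
1) / 𝒪(k + 2)`. -/
theorem ι_deltaInf (k : ℤ) : ι α (succIdx k) (deltaInf _ k ∘ₗ avg k) =
    ι α (succIdx (k + 1)) (stdE (qK K) (k + 1) ∘ₗ avg (k + 1)) := by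
  let p : Idx := ⟨(k, k + 1 + 1), (by omega : k ≤ k + 1 + 1)⟩
  have e1 := ι_tr (α := α) (p' := p) (p := succIdx k) le_rfl (lt_add_one (k + 1)).le (deltaInf _ k ∘ₗ avg k)
  have e2 := ι_tr (α := α) (p' := p) (p := succIdx (k + 1)) (lt_add_one k).le le_rfl
    (stdE (qK K) (k + 1) ∘ₗ avg (k + 1))
  refine e1.trans (Eq.trans (congrArg (ι α p) (LinearMap.ext fun f => ?_)) e2.symm)
  exact (deltaInf_avg _).trans ((tr_apply_zero _ _ _).trans (stdE_avg _).symm)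

/-- The map `Φ'` with values in `𝒟'_α(K)`. -/
def injD (α : Breve (ΓK K)) : DPlus' (qK K) α →ₗ[ℂ] DK' α :=
  liftDPlus' α (fun k => ι α (succIdx k) ∘ₗ (avg k).dualMap) ι_deltaInf

theorem injD_ιR (k : ℤ) (h : Module.Dual ℂ (DPlusT (ΓK K) k)) :
    injD α (ιR α k h) = ι α (succIdx k) (h ∘ₗ avg k) := liftDPlus'_ιR _ _ _ _

theorem repPlus'_ιR (w : Heis α) {k k' : ℤ} (hk : k' = lev w.pt + k)
    (h : Module.Dual ℂ (DPlusT (ΓK K) k)) : repPlus' (qK K) α w (ιR α k h) =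
      (scal w (bot (k + 1)))⁻¹ • ιR α k' (h ∘ₗ shiftT' w.pt hk) := by
  refine (congrArg (relD' (qK K) α).mkQ (actPre'_ofDeg (qK K) w hk _)).trans ?_
  refine (congrArg (fun z => (relD' (qK K) α).mkQ (ofDeg (qK K) α k' z))
    (actAt'_tmul (qK K) w hk h (oneR (qK K) α (bot (k + 1))))).trans ((mkQ_ofDeg_tmul _ _ _).trans ?_)
  refine congrArg (· • _) ?_
  change (qK K : ℂ) ^ w.tor.1 (stdGood 0) * (oneR (qK K) α (bot (k + 1))).1 ((stdGood 0).shift (-w.pt)) = _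
  rw [muR_prop _ (stdGood 0), oneR_apply, mul_one]
  change _ * modulus w.pt α (bot (k + 1)) = _
  refine (inv_eq_of_mul_eq_one_left ?_).symm
  have h1 : modulus w.pt α (bot (k + 1)) * modulus w.pt (bot (k + 1)) α = 1 := by
    rw [modulus_mul, modulus_self]
  rw [scal, mul_assoc, ← mul_assoc (modulus _ _ _), h1, one_mul, ← zpow_add₀ (qK K).ne_zero,
    add_neg_cancel, zpow_zero]

/-- The scalars on the two sides are the same, and the remaining identity is the equivariance of
mean values under `g⁻¹`. -/
theorem injD_repPlus' {g : Kˣ} {w : Heis α} (hw : ν g = w.pt) (x : DPlus' (qK K) α) :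
    injD α (repPlus' (qK K) α w x) = opD' hw (injD α x) := by
  refine LinearMap.congr_fun (DPlus'.hom_ext (A := injD α ∘ₗ repPlus' (qK K) α w)
    (B := opD' hw ∘ₗ injD α) fun k h => ?_) x
  have hk : lev (ν g) + k = lev w.pt + k := by rw [hw]
  have h₀ : (bot (lev (ν g) + k) : Breve (ΓK K)) = ν g +ᵥ bot k := (vadd_bot _ _).symm
  have h₁ : (bot (lev (ν g) + k + 1) : Breve (ΓK K)) = ν g +ᵥ bot (k + 1) := by rw [vadd_bot, add_assoc]
  rw [LinearMap.comp_apply, LinearMap.comp_apply, repPlus'_ιR w hk, map_smul, injD_ιR, injD_ιR,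
    opD'_ι hw (p := succIdx k) (p' := succIdx (lev (ν g) + k)) h₀ h₁]
  refine congrArg (_ • ·) (congrArg (ι α _) (LinearMap.ext fun f => congrArg h ?_))
  have hk' : k = lev (ν g⁻¹) + (lev (ν g) + k) := by rw [ν_inv, map_neg]; ring
  refine Eq.trans ?_ (avg_mul g⁻¹ hk' (eq_vadd_inv h₀) (eq_vadd_inv h₁) f).symm
  rw [shiftT_congr (show ν g⁻¹ = -w.pt by rw [ν_inv, hw]) hk' (by rw [map_neg]; omega)]
  rfl

/-- Units are lifts of the identity of the Heisenberg group, so equivariance forces invariance. -/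
theorem injD_mem (x : DPlus' (qK K) α) : injD α x ∈ (repD' α).invariants := fun u => by
  rw [← opD'_unit u (ν_eq_zero.2 u.2), ← injD_repPlus', map_one]
  rfl

/-- The natural injection `Φ'`. -/
def inj (α : Breve (ΓK K)) : DPlus' (qK K) α →ₗ[ℂ] (repD' α).invariants :=
  LinearMap.codRestrict _ (injD α) injD_mem

theorem inj_repPlus' (w : Heis α) (x : DPlus' (qK K) α) :
    inj α (repPlus' (qK K) α w x) = repInv α w (inj α x) :=
  Subtype.ext (injD_repPlus' (ν_lift w.pt) x)

theorem isInj_inj : IsInj (fun α β => (thetaK α β).toLinearMap) (inj α) := fun k h l => by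
  refine ⟨h ∘ₗ avg k, fun f => ⟨_, isAvg_avg f, rfl⟩, ?_⟩
  refine (congrArg (injD α) (mkQ_ofDeg_tmul k h l)).trans ((map_smul _ _ _).trans
    ((congrArg (_ • ·) (injD_ιR k h)).trans (Eq.trans ?_ (toDK'_tmul _ _).symm)))
  exact congrArg (· • _) (coord_thetaK l).symm

end Injection

end

end TwoDim

namespace TwoDim

noncomputable section

open _root_.TwoDim.Ext2 (emb lev)
open Breve


/-! ### Injectivity of `Φ'` by duality. -/

section Injectivity

variable {K : Type*} [Field K] [TwoDimLocalField K] [PartialTopology K] {α : Breve (ΓK K)}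

variable (K) in
/-- The families of functions on the fibres of `π` which satisfy the conditions in `𝒟_{+, α, q}(Γ_K)`. -/
def Fam : Submodule ℂ (∀ k, DPlusT (ΓK K) k) where
  carrier := {c | ∀ k, deltaInf _ k (c k) = stdE (qK K) (k + 1) (c (k + 1))}
  add_mem' h h' k := by rw [Pi.add_apply, Pi.add_apply, map_add, map_add, h k, h' k]
  zero_mem' _ := by rw [Pi.zero_apply, Pi.zero_apply, map_zero, map_zero]
  smul_mem' s _ h k := by rw [Pi.smul_apply, Pi.smul_apply, map_smul, map_smul, h k]

/-- The mean values of the indicator of a sphere are killed by `δ_{+∞}` but not by the integral. A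
multiple of them adjusts the second value of the indicator of a ray without changing the first. -/
theorem exists_deltaInf_stdE_eq_one (k : ℤ) :
    ∃ u : DPlusT (ΓK K) k, deltaInf _ k u = 1 ∧ stdE (qK K) k u = 1 := by
  obtain ⟨x, hx⟩ := Ext2.lev_surjective (Γ := ΓK K) k
  have h0 : (starChar hx).1 0 = 0 := by
    rw [starChar_apply]
    exact Set.indicator_of_notMem (fun h => h.elim fun a ha => a.ne_zero ha.1) _
  refine ⟨deltaGe hx + ((1 - stdE (qK K) k (deltaGe hx)) *
    ((frameMeas (bot_le_bot_succ k)).1 (starChar hx))⁻¹) • avg k (starChar hx), ?_, ?_⟩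
  · rw [map_add, map_smul, deltaInf_avg, h0, smul_zero, add_zero, deltaInf_deltaGe]
  · rw [map_add, map_smul, stdE_avg, smul_eq_mul, mul_assoc, inv_mul_cancel₀ (frameMeas_starChar_ne_zero hx),
      mul_one, add_sub_cancel]

/-- All other degrees are filled with multiples of functions on which both functionals are one, so
the conditions only ask that the multiple be constant on each side of `b`. -/
theorem Fam.exists_extension {b : ℤ} (c : DPlusT (ΓK K) b) :
    ∃ F : Fam K, F.1 b = c ∧ (stdE (qK K) b c = 0 → ∀ j < b, F.1 j = 0) := by
  choose u hu hu' using exists_deltaInf_stdE_eq_one (K := K)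
  let F : ∀ k, DPlusT (ΓK K) k :=
    Function.update (fun j => (if j < b then stdE (qK K) b c else deltaInf _ b c) • u j) b c
  have h1 : F b = c := Function.update_self ..
  have h2 : ∀ {j}, j ≠ b → F j = (if j < b then stdE (qK K) b c else deltaInf _ b c) • u j := fun hj =>
    Function.update_of_ne hj ..
  refine ⟨⟨F, fun k => ?_⟩, h1, fun h j hj => ?_⟩
  · rcases eq_or_ne k b with rfl | hk
    · rw [h1, h2 (lt_add_one k).ne', if_neg (lt_add_one k).not_gt, map_smul, hu', smul_eq_mul, mul_one]
    rw [h2 hk, map_smul, hu, smul_eq_mul, mul_one]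
    rcases eq_or_ne (k + 1) b with rfl | hk'
    · rw [h1, if_pos (lt_add_one k)]
    · rw [h2 hk', map_smul, hu', smul_eq_mul, mul_one]
      exact if_congr ⟨fun h => by omega, fun h => by omega⟩ rfl rfl
  · exact (h2 hj.ne).trans (by rw [if_pos hj, h, zero_smul])

/-- The pairing of `𝒟'_{+, α, q}(Γ_K)` with the families of functions. -/
def evFam (α : Breve (ΓK K)) : DPlus' (qK K) α →ₗ[ℂ] Module.Dual ℂ (Fam K) :=
  liftDPlus' α (fun k => (LinearMap.proj k ∘ₗ (Fam K).subtype).dualMap) fun k =>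
    LinearMap.ext fun c => c.2 k

theorem evFam_ιR (k : ℤ) (h : Module.Dual ℂ (DPlusT (ΓK K) k)) (c : Fam K) :
    evFam α (ιR α k h) c = h (c.1 k) := LinearMap.congr_fun (liftDPlus'_ιR _ _ _ _) c

/-- The subspace of the elements supported in the degrees between `a` and `b`. -/
def between (α : Breve (ΓK K)) (a b : ℤ) : Submodule ℂ (DPlus' (qK K) α) :=
  ⨆ k : Set.Icc a b, LinearMap.range (ιR α k)

theorem ιR_mem_between {a b k : ℤ} (h₁ : a ≤ k) (h₂ : k ≤ b) (h : Module.Dual ℂ (DPlusT (ΓK K) k)) :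
    ιR α k h ∈ between α a b :=
  Submodule.mem_iSup_of_mem (⟨k, h₁, h₂⟩ : Set.Icc a b) ⟨h, rfl⟩

theorem between_le {a b : ℤ} {L : Submodule ℂ (DPlus' (qK K) α)}
    (h : ∀ k, a ≤ k → k ≤ b → ∀ v, ιR α k v ∈ L) : between α a b ≤ L :=
  iSup_le fun k => by
    rintro _ ⟨v, rfl⟩
    exact h k k.2.1 k.2.2 v

theorem between_mono {a b a' b' : ℤ} (h₁ : a' ≤ a) (h₂ : b ≤ b') : between α a b ≤ between α a' b' :=
  between_le fun _ h h' => ιR_mem_between (h₁.trans h) (h'.trans h₂)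

theorem exists_mem_between (x : DPlus' (qK K) α) : ∃ a b : ℤ, a ≤ b ∧ x ∈ between α a b := by
  obtain ⟨z, rfl⟩ := (relD' (qK K) α).mkQ_surjective x
  have hadd : ∀ x y : DPlus' (qK K) α, (∃ a b : ℤ, a ≤ b ∧ x ∈ between α a b) →
      (∃ a b : ℤ, a ≤ b ∧ y ∈ between α a b) → ∃ a b : ℤ, a ≤ b ∧ x + y ∈ between α a b := by
    rintro x y ⟨a, b, hab, hx⟩ ⟨a', b', -, hy⟩
    exact ⟨min a a', max b b', (min_le_left _ _).trans (hab.trans (le_max_left _ _)),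
      add_mem (between_mono (min_le_left _ _) (le_max_left _ _) hx)
        (between_mono (min_le_right _ _) (le_max_right _ _) hy)⟩
  induction z using DirectSum.induction_on with
  | zero => exact ⟨0, 0, le_rfl, zero_mem _⟩
  | add x y hx hy => exact hadd _ _ hx hy
  | of k t =>
    refine ⟨k, k, le_rfl, ?_⟩
    induction t with
    | zero =>
      rw [map_zero]
      exact zero_mem _
    | add x y hx hy =>
      rw [map_add]
      exact add_mem hx hy
    | tmul h l =>
      exact (mkQ_ofDeg_tmul k h l).symm ▸ Submodule.smul_mem _ _ (ιR_mem_between le_rfl le_rfl h)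

/-- Descent on the top degree: the component there is shown to be a multiple of `stdE`, which the
relation turns into a multiple of `δ_{+∞}` one degree lower. In a single degree every function is a
component of some family. -/
theorem evFam_eq_zero {a b : ℤ} (hab : a ≤ b) {x : DPlus' (qK K) α} (hx : x ∈ between α a b)
    (h0 : evFam α x = 0) : x = 0 := by
  induction b, hab using Int.leInduction generalizing x with
  | base =>
    obtain ⟨h, rfl⟩ : ∃ h, ιR α a h = x := by
      have : between α a a ≤ LinearMap.range (ιR α a) := between_le fun k h₁ h₂ v => by
        obtain rfl := le_antisymm h₂ h₁
        exact ⟨v, rfl⟩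
      exact this hx
    have : h = 0 := LinearMap.ext fun c => by
      obtain ⟨F, rfl, -⟩ := Fam.exists_extension c
      rw [← evFam_ιR (α := α), h0]
      rfl
    rw [this, map_zero]
  | succ b hab ih =>
    obtain ⟨y, hy, z, ⟨h, rfl⟩, rfl⟩ : ∃ y ∈ between α a b, ∃ z ∈ LinearMap.range (ιR α (b + 1)),
        y + z = x := Submodule.mem_sup.1 <| (between_le fun k h₁ h₂ v => by
      rcases h₂.lt_or_eq with h | rfl
      · exact Submodule.mem_sup_left (ιR_mem_between h₁ (by omega) v)
      · exact Submodule.mem_sup_right ⟨v, rfl⟩ :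
        between α a (b + 1) ≤ between α a b ⊔ LinearMap.range (ιR α (b + 1))) hx
    -- Such a `c` extends to a family that is zero in all lower degrees, so the pairing only sees
    -- the top component.
    have hker : ∀ c, stdE (qK K) (b + 1) c = 0 → h c = 0 := fun c hc => by
      obtain ⟨F, rfl, hF⟩ := Fam.exists_extension c
      have hyF : between α a b ≤ LinearMap.ker ((LinearMap.applyₗ F) ∘ₗ evFam α) :=
        between_le fun k _ h₂ v => by
          change evFam α (ιR α k v) F = 0
          rw [evFam_ιR, hF hc k (by omega), map_zero]
      have e := LinearMap.congr_fun h0 F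
      rw [map_add, LinearMap.add_apply, evFam_ιR, show evFam α y F = 0 from hyF hy, zero_add] at e
      exact e
    obtain ⟨u, -, hu⟩ := exists_deltaInf_stdE_eq_one (K := K) (b + 1)
    have hh : h = h u • stdE (qK K) (b + 1) := LinearMap.ext fun c => by
      have := hker (c - stdE (qK K) (b + 1) c • u) (by
        rw [map_sub, map_smul, hu, smul_eq_mul, mul_one, sub_self])
      rw [map_sub, map_smul, sub_eq_zero] at this
      rw [this, smul_eq_mul, mul_comm]
      rfl
    refine ih (add_mem hy ?_) h0
    -- The top component is moved to degree `b`.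
    rw [hh, map_smul, ← ιR_deltaInf]
    exact Submodule.smul_mem _ _ (ιR_mem_between hab le_rfl _)

theorem evFam_injective : Function.Injective (evFam α) :=
  (injective_iff_map_eq_zero _).2 fun x hx => by
    obtain ⟨a, b, hab, h⟩ := exists_mem_between x
    exact evFam_eq_zero hab h hx

/-- The pairing of `𝒟'_α(K)` with the compatible families of functions. -/
def evLim (α : Breve (ΓK K)) : DK' α →ₗ[ℂ] Module.Dual ℂ (Lim K) :=
  liftDK' α (fun p => (LinearMap.proj p ∘ₗ (Lim K).subtype).dualMap) fun p' p h₁ h₂ v =>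
    LinearMap.ext fun G => congrArg v (G.2 p' p h₁ h₂)

/-- `Φ'` is the transpose of the mean value map. Since every family in `Fam` lifts to `Lim`, the
kernel of `Φ'` pairs to zero with all of them. -/
theorem evLim_injD (x : DPlus' (qK K) α) {G : Lim K} {c : Fam K} (h : ∀ k, avg k (succ k G) = c.1 k) :
    evLim α (injD α x) G = evFam α x c := by
  refine LinearMap.congr_fun (DPlus'.hom_ext (A := LinearMap.applyₗ G ∘ₗ evLim α ∘ₗ injD α)
    (B := LinearMap.applyₗ c ∘ₗ evFam α) fun k v => ?_) x
  change evLim α (injD α (ιR α k v)) G = evFam α (ιR α k v) c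
  rw [injD_ιR, evFam_ιR, ← h]
  exact LinearMap.congr_fun (liftDK'_ι _ _ _ _) G

theorem inj_injective : Function.Injective (inj α) := fun x y h => evFam_injective <|
  LinearMap.ext fun c => by
    obtain ⟨G, hG⟩ := exists_lim_avg c.2
    rw [← evLim_injD x hG, ← evLim_injD y hG]
    exact congrArg (fun z : (repD' α).invariants => evLim α z G) h

end Injectivity

end

end TwoDim

/-- For a two-dimensional local field `K` with a partial topology and with finite last residue field, the
natural surjection `Φ : 𝒟_α(K)_{(𝒪'_K)^*} → 𝒟_{+, α, q}(Γ_K)` and the natural injection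
`Φ' : 𝒟'_{+, α, q}(Γ_K) → 𝒟'_α(K)^{(𝒪'_K)^*}` are equivariant for the discrete Heisenberg group. -/
theorem mainTheorem11 (K : Type*) [Field K] [TwoDimLocalField K] [PartialTopology K]
    (α : Breve (ΓK K)) :
    ∃ Θ : ∀ β γ : Breve (ΓK K), muR (qK K) β γ →ₗ[ℂ] Mu β γ, IsTheta Θ ∧
      ∃ (ρ : Representation ℂ (Heis α) (repD α).Coinvariants)
        (ρ' : Representation ℂ (Heis α) (repD' α).invariants)
        (Φ : (repD α).Coinvariants →ₗ[ℂ] DPlus (qK K) α)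
        (Φ' : DPlus' (qK K) α →ₗ[ℂ] (repD' α).invariants),
        IsHeisRep Θ ρ ∧ IsHeisRep' Θ ρ' ∧ IsSur Θ Φ ∧ IsInj Θ Φ' ∧
          Function.Surjective Φ ∧ Function.Injective Φ' ∧
          (∀ (w : Heis α) (x : (repD α).Coinvariants), Φ (ρ w x) = repPlus (qK K) α w (Φ x)) ∧
          ∀ (w : Heis α) (x : DPlus' (qK K) α), Φ' (repPlus' (qK K) α w x) = ρ' w (Φ' x) := by
  exact ⟨fun α β => (thetaK α β).toLinearMap, isTheta_thetaK, repCo α, repInv α, sur α, inj α,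
    isHeisRep_repCo, isHeisRep'_repInv, isSur_sur, isInj_inj, sur_surjective, inj_injective, sur_repCo,
    inj_repPlus'⟩
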